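/- **Setting.** Let $\mathbb T=\mathbb R/2\pi\mathbb Z$, let $m>0$, $\kappa\ge 0$, $\sigma>0$, and let $g:\mathbb R\to[0,\infty)$ be measurable with $\int_{\mathbb R} g\,d\nu=1$ and $\|g\|_\nu^2:=\int_{\mathbb R}(1+\nu^2)g(\nu)\,d\nu<\infty$. Put $$M(\omega,\nu)=\frac1{2\pi}\sqrt{\frac{m}{2\pi\sigma}}\;e^{-\frac{m}{2\sigma}(\omega-\nu)^2}g(\nu),\qquad \mathcal S[h](\theta)=\int_{\mathbb T\times\mathbb R^2}\sin(\theta_*-\theta)\,h(\theta_*,\omega_*,\nu_*)\,d\theta_*d\omega_*d\nu_* ,$$ and consider the Cauchy problem for $f=f(\theta,\omega,\nu,t)$, $$\partial_t f+\omega\,\partial_\theta f=\mathcal L_0f+\mathcal L_1f+\mathcal N(f,f),\qquad f|_{t=0}=f^{in}:=\frac{F^{in}-M}{\sqrt M}\quad(f^{in}:=0\text{ where }M=0),\tag{1}$$ $$\mathcal L_0f=\frac{\sigma}{m^2}\frac1{\sqrt M}\,\partial_\omega\Big[M\,\partial_\omega\Big(\frac f{\sqrt M}\Big)\Big]=\frac{\sigma}{m^2}\partial_\omega^2f+\frac1{2m}\Big(1-\frac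 m{2\sigma}(\omega-\nu)^2\Big)f,$$ $$\mathcal L_1f=\frac\kappa\sigma(\omega-\nu)\sqrt M\,\mathcal S[\sqrt Mf],\qquad \mathcal N(f,f)=\frac{\kappa}{2\sigma}\mathcal S[\sqrt Mf](\omega-\nu)f-\frac\kappa m\,\mathcal S[\sqrt Mf]\,\partial_\omega f$$ (the second expression for $\mathcal L_0$ is used where $g(\nu)=0$), where $F^{in}\ge0$ is integrable on $\mathbb T\times\mathbb R^2$ with $\int_{\mathbb T\times\mathbb R}F^{in}\,d\theta\,d\omega=g(\nu)$ for a.e. $\nu$. For an integer $s\ge1$ let $H^s$ be the space of $u\in L^2(\mathbb T\times\mathbb R^2)$ whose weak derivatives $\partial_\theta^i\partial_\omega^ju$, $i+j\le s$, lie in $L^2$, with $\|u\|_{H^s}^2=\sum_{i+j\le s}\|\partial_\theta^i\partial_\omega^ju\|_{L^2}^2$. A solution $f\in\mathcal C([0,T];H^s)$ satisfies the equation on $[0,T]$ in the sense of distributions. **Proposition 5.2.** For every integer $s\ge1$ there is a constant $C>0$, depending only on $s$, and for every $m>0$ there are constants $c,K,\lambda>0$, depending only on $s$ and $m$, such that the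 following holds. Let $\kappa$, $\sigma$, $g$ be as above with $$\sigma>C\max\{m\kappa^2,\ \kappa,\ m^{-1},\ m\|g\|_\nu^2\}.$$ Then there are functionals $\mathcal E_s$ and $\mathcal D_s$ of the state, depending only on $s,m,\kappa,\sigma,g$, such that for every $T>0$, every $F^{in}$ as above and every solution $f\in\mathcal C([0,T];H^s)$ of (1), with $\mathcal E_s(t)=\mathcal E_s(f(t))$ and $\mathcal D_s(t)=\mathcal D_s(f(t))$: the function $t\mapsto\mathcal E_s(t)$ is absolutely continuous on $[0,T]$, $$\frac{d}{dt}\mathcal E_s(t)+\mathcal D_s(t)\le0\quad\text{for a.e. }t\in[0,T],$$ $$c^{-1}\|f(t)\|_{H^s}^2\le\mathcal E_s(t)\le c\,\|f(t)\|_{H^s}^2,\qquad \mathcal E_s(t)\le c\,\mathcal D_s(t)\quad\text{for all }t\in[0,T],$$ and consequently $\|f(t)\|_{H^s}\le K e^{-\lambda t}\|f^{in}\|_{H^s}$ for all $t\in[0,T]$. -/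

import Mathlib

open MeasureTheory Set

noncomputable section

namespace KuramotoSakaguchi

instance factTwoPiPos : Fact ((0 : ℝ) < 2 * Real.pi) := ⟨Real.two_pi_pos⟩

/-- The phase circle `𝕋 = ℝ / 2πℤ`, of total length `2π`. -/
abbrev Circ : Type := AddCircle (2 * Real.pi)

/-- Phase space `𝕋 × ℝ × ℝ`; a point is `(θ, ω, ν)`. -/
abbrev Phase : Type := Circ × ℝ × ℝ

/-- The Hilbert space `L²(𝕋 × ℝ²)`. -/
abbrev L2 : Type := Lp ℝ 2 (volume : Measure Phase)

/-- The sine function on the circle. -/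
def sinC (θ : Circ) : ℝ := Real.sin_periodic.lift θ

/-! ### Classical derivatives, test functions, weak derivatives -/

/-- `∂_θ φ`. -/
def dTheta (φ : Phase → ℝ) : Phase → ℝ :=
  fun z => deriv (fun h : ℝ => φ (z.1 + (h : Circ), z.2.1, z.2.2)) 0

/-- `∂_ω φ`. -/
def dOmega (φ : Phase → ℝ) : Phase → ℝ :=
  fun z => deriv (fun w : ℝ => φ (z.1, w, z.2.2)) z.2.1

/-- Test functions on `𝕋 × ℝ²`: smooth with compact support. -/
structure IsTest (φ : Phase → ℝ) : Prop where
  smooth : ContDiff ℝ ((⊤ : ℕ∞) : WithTop ℕ∞)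
    (fun x : ℝ × ℝ × ℝ => φ ((x.1 : Circ), x.2.1, x.2.2))
  compact : HasCompactSupport φ

/-- `w = ∂_θ^i ∂_ω^j u` in the sense of distributions. -/
def IsWeakDeriv (i j : ℕ) (u w : L2) : Prop :=
  ∀ φ : Phase → ℝ, IsTest φ →
    ∫ z, u z * (dTheta^[i] (dOmega^[j] φ)) z = (-1 : ℝ) ^ (i + j) * ∫ z, w z * φ z

open Classical in
/-- The weak derivative `∂_θ^i ∂_ω^j u` when it exists in `L²` (and `0` otherwise). -/
def weakDeriv (i j : ℕ) (u : L2) : L2 :=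
  if h : ∃ w : L2, IsWeakDeriv i j u w then h.choose else 0

/-- `u ∈ H^s`: the derivatives `∂_θ^i ∂_ω^j u` with `i + j ≤ s` are in `L²`. -/
def MemH (s : ℕ) (u : L2) : Prop :=
  ∀ i j : ℕ, i + j ≤ s → ∃ w : L2, IsWeakDeriv i j u w

/-- `‖u‖_{H^s}² = ∑_{i + j ≤ s} ‖∂_θ^i ∂_ω^j u‖²`. -/
def hNormSq (s : ℕ) (u : L2) : ℝ :=
  ∑ i ∈ Finset.range (s + 1), ∑ j ∈ Finset.range (s + 1 - i), ‖weakDeriv i j u‖ ^ 2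

/-- `‖u‖_{H^s}`. -/
def hNorm (s : ℕ) (u : L2) : ℝ := Real.sqrt (hNormSq s u)

/-- `f ∈ C([0,T]; H^s)`. -/
def ContInH (s : ℕ) (T : ℝ) (f : ℝ → L2) : Prop :=
  (∀ t ∈ Icc 0 T, MemH s (f t)) ∧
  ∀ i j : ℕ, i + j ≤ s → ContinuousOn (fun t => weakDeriv i j (f t)) (Icc 0 T)

/-! ### The equation -/

/-- `‖g‖_ν² = ∫ (1 + ν²) g(ν) dν`. -/
def gNormSq (g : ℝ → ℝ) : ℝ := ∫ ν, (1 + ν ^ 2) * g ν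

/-- The unnormalized Gaussian factor `exp(-(m / 2σ) (ω - ν)²)` of the Maxwellian. -/
def gaussFactor (m σ : ℝ) (z : Phase) : ℝ :=
  Real.exp (-(m / (2 * σ)) * (z.2.1 - z.2.2) ^ 2)

/-- The Maxwellian
`M = (1 / 2π) √(m / 2πσ) exp(-(m / 2σ) (ω - ν)²) g(ν)`. -/
def maxwellian (m σ : ℝ) (g : ℝ → ℝ) (z : Phase) : ℝ :=
  1 / (2 * Real.pi) * Real.sqrt (m / (2 * Real.pi * σ)) * gaussFactor m σ z * g z.2.2

/-- `S[√M u](θ) = ∫ sin(θ_* - θ) √M(ω_*, ν_*) u(θ_*, ω_*, ν_*) dθ_* dω_* dν_*`. -/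
def order (m σ : ℝ) (g : ℝ → ℝ) (u : L2) (θ : Circ) : ℝ :=
  ∫ z : Phase, sinC (z.1 - θ) * (Real.sqrt (maxwellian m σ g z) * u z)

/-- `L₀ φ = (σ / m²) μ^{-1/2} ∂_ω [μ ∂_ω (φ / μ^{1/2})]` for a weight `μ` on phase space. -/
def weightedL0 (m σ : ℝ) (μ φ : Phase → ℝ) : Phase → ℝ :=
  fun z => σ / m ^ 2 * (1 / Real.sqrt (μ z)) *
    dOmega (fun y => μ y * dOmega (fun x => φ x / Real.sqrt (μ x)) y) z

/-- The operator `L₀` on test functions. The factor of `M` that depends on `ν` alone cancels in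
`(σ / m²) M^{-1/2} ∂_ω [M ∂_ω (φ / M^{1/2})]` (see `opL0_eq`), so the Gaussian factor is used as
the weight; this also gives `L₀` its meaning at those `ν` where `g(ν) = 0`. -/
def opL0 (m σ : ℝ) (φ : Phase → ℝ) : Phase → ℝ :=
  weightedL0 m σ (gaussFactor m σ) φ

theorem opL0_eq {m σ : ℝ} (hm : 0 < m) (hσ : 0 < σ) (g : ℝ → ℝ) (φ : Phase → ℝ) (z : Phase)
    (hg : 0 < g z.2.2) :
    opL0 m σ φ z = weightedL0 m σ (maxwellian m σ g) φ z := by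
  obtain ⟨θ, ω, ν⟩ := z
  simp only at hg
  set a : ℝ := 1 / (2 * Real.pi) * Real.sqrt (m / (2 * Real.pi * σ)) * g ν with ha
  have hapos : 0 < a := by positivity
  have hsa : Real.sqrt a ≠ 0 := (Real.sqrt_pos.mpr hapos).ne'
  have hM : ∀ w : ℝ, maxwellian m σ g (θ, w, ν) = a * gaussFactor m σ (θ, w, ν) := by
    intro w; simp only [maxwellian, ha]; ring
  have h1 : ∀ w : ℝ, dOmega (fun x => φ x / Real.sqrt (maxwellian m σ g x)) (θ, w, ν)
      = (Real.sqrt a)⁻¹ * dOmega (fun x => φ x / Real.sqrt (gaussFactor m σ x)) (θ, w, ν) := by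
    intro w
    simp only [dOmega, hM, Real.sqrt_mul hapos.le]
    rw [← deriv_const_mul_field]
    congr 1
    funext v
    rw [div_mul_eq_div_div, div_eq_mul_inv (φ _) (Real.sqrt a)]
    ring
  have h2 : dOmega (fun y => maxwellian m σ g y *
        dOmega (fun x => φ x / Real.sqrt (maxwellian m σ g x)) y) (θ, ω, ν)
      = Real.sqrt a * dOmega (fun y => gaussFactor m σ y *
        dOmega (fun x => φ x / Real.sqrt (gaussFactor m σ x)) y) (θ, ω, ν) := by
    rw [dOmega, dOmega]
    simp only [h1, hM]
    rw [← deriv_const_mul_field]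
    congr 1
    funext v
    have h3 : a * (Real.sqrt a)⁻¹ = Real.sqrt a := by
      rw [← div_eq_mul_inv, Real.div_sqrt]
    calc _ = (a * (Real.sqrt a)⁻¹) * (gaussFactor m σ (θ, v, ν) *
          dOmega (fun x => φ x / Real.sqrt (gaussFactor m σ x)) (θ, v, ν)) := by ring
      _ = _ := by rw [h3]
  simp only [opL0, weightedL0]
  rw [h2, hM, Real.sqrt_mul hapos.le]
  field_simp

/-- `L₁ u = (κ / σ) (ω - ν) √M S[√M u]`. -/
def opL1 (m κ σ : ℝ) (g : ℝ → ℝ) (u : L2) (z : Phase) : ℝ :=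
  κ / σ * (z.2.1 - z.2.2) * Real.sqrt (maxwellian m σ g z) * order m σ g u z.1

/-- `N(u, u) = (κ / 2σ) S[√M u] (ω - ν) u - (κ / m) S[√M u] ∂_ω u`. -/
def opN (m κ σ : ℝ) (g : ℝ → ℝ) (u : L2) (z : Phase) : ℝ :=
  κ / (2 * σ) * order m σ g u z.1 * (z.2.1 - z.2.2) * u z
    - κ / m * order m σ g u z.1 * weakDeriv 0 1 u z

/-- `∂_t f + ω ∂_θ f = L₀ f + L₁ f + N(f, f)` on `[0,T]`, tested against smooth compactly supported
functions of `(θ, ω, ν)`. Only `L₀`, which is symmetric and of second order, is moved to the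
test function. -/
def SolvesEq (m κ σ : ℝ) (g : ℝ → ℝ) (T : ℝ) (f : ℝ → L2) : Prop :=
  ∀ φ : Phase → ℝ, IsTest φ → ∀ t ∈ Icc 0 T,
    HasDerivWithinAt (fun τ => ∫ z, f τ z * φ z)
      (-(∫ z : Phase, z.2.1 * weakDeriv 1 0 (f t) z * φ z)
        + (∫ z, f t z * opL0 m σ φ z)
        + (∫ z, opL1 m κ σ g (f t) z * φ z)
        + ∫ z, opN m κ σ g (f t) z * φ z)
      (Icc 0 T) t

/-- Initial densities: `F ≥ 0` integrable with `∫ F dθ dω = g(ν)`. -/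
structure IsInitialDensity (g : ℝ → ℝ) (F : Phase → ℝ) : Prop where
  integrable : Integrable F
  nonneg : ∀ᵐ z, 0 ≤ F z
  marginal : ∀ᵐ ν : ℝ, ∫ p : Circ × ℝ, F (p.1, p.2, ν) = g ν

/-- `f ∈ C([0,T]; H^s)` solves the Cauchy problem for the perturbation equation with initial datum
`(F - M) / √M` (which is `0` where `M = 0`). -/
structure IsSolution (m κ σ : ℝ) (g : ℝ → ℝ) (F : Phase → ℝ) (s : ℕ) (T : ℝ) (f : ℝ → L2) :
    Prop where
  cont : ContInH s T f
  eqn : SolvesEq m κ σ g T f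
  init : ∀ᵐ z, f 0 z = (F z - maxwellian m σ g z) / Real.sqrt (maxwellian m σ g z)

end KuramotoSakaguchi

end

open KuramotoSakaguchi

/-! ### Hermite polynomials and Hermite functions of scale `b` on the line. -/

noncomputable section
namespace KuramotoSakaguchi

/-! Put b = √(σ/m), so that σ = m b². Expanding in Fourier modes in θ and Hermite functions in (ω −
ν)/b writes L² of phase space as a Hilbert sum of copies of L² in the natural frequency, with
coefficients u_{k,n}(ν). Let a and a* be the annihilation and creation operators in n. Then L₀ is
−(1/m) a*a, the derivative ∂_ω is (a − a*)/(2b), transport is multiplication by ik(ν + b(a + a*)),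
and L₁ + N collapse to the single term (κ/(mb)) a*(S·(u + √M)). Here S is the mean field, fixed by
one complex number Z, the pairing of √g with u_{−1,0}.

No smallness of the data is needed, because the nonlinearity is bounded a priori. With S given, h =
u + √M = F/√M solves a linear equation, so its negative part satisfies a Grönwall inequality and h
stays nonnegative (`negLp_density_eq_zero`). The mass at each frequency is conserved, that is
u_{0,0} = 0 (`coef_zero_zero`). A nonnegative density of mass one has |Z| ≤ 1
(`norm_orderZ_le_one`). Since also |Z| ≤ ‖∂_θ^s u‖, the product S·(u + √M) is bounded linearly in u
(`MemH.norm_forcingDeriv_sq_le`), with a factor κ/b that the threshold on σ makes small.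

For ∂_t v + ω∂_θ v = −(1/m)a*a v − d v + p + a*q, the energy estimate (`ModeEq.energy`) bounds the
derivative of ‖v‖² by −(1/m)∑ n‖v_{k,n}‖² − 2d‖v‖² + 2‖p‖‖v‖ + m‖q‖². Commuting ∂_ω^j through the
equation creates the damping d = j/m, and all new sources carry fewer velocity derivatives
(`modeEq_deriv`). Hence a level j ≥ 1 decays up to lower levels and a small multiple of itself.
Level 0, the pure phase derivatives, is not damped at n = 0. There a hypocoercive cross term pairs
the n = 1 layer of ∂_θ^{s−1}u with the n = 0 layer of ∂_θ^s u, and its time derivative contains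
−(b/2)‖∂_θ^s u‖² (`ModeEq.cross`). As u_{0,0} = 0, a Poincaré argument then controls every ∂_θ^i u
(`MemH.norm_sq_le_dissip_add`). Adding the levels with rapidly decreasing weights α^j gives a
functional equivalent to the square of the H^s norm whose derivative is at most a negative multiple
of itself; that multiple serves as the dissipation.

The solution has no regularity beyond H^s and no moments in ν, so these computations are justified
by truncation to finitely many modes, with a cutoff in ν and weights that decay slowly in n. The
commutator of the weights with transport is of order 1/r (`norm_transportError_le`). The
inequalities are kept in integrated form (`IntBound`), which survives the limit; bounds for the
functional and for its negative together yield absolute continuity. -/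

open Polynomial in
/-- The function `v ↦ p(v / b) ψ₀(v)`, where `ψ₀` is the normalized square root of the centred
Gaussian density of variance `b²`. -/
def polyGauss (b : ℝ) (p : ℝ[X]) (v : ℝ) : ℝ :=
  p.eval (v / b) * ((Real.sqrt (Real.sqrt (2 * Real.pi) * b))⁻¹ * Real.exp (-(v ^ 2 / (4 * b ^ 2))))

open Polynomial in
/-- The normalized Hermite polynomials, generated by the raising operator. -/
def hermitePoly : ℕ → ℝ[X]
  | 0 => 1
  | n + 1 => C (Real.sqrt (n + 1))⁻¹ * (X * hermitePoly n - derivative (hermitePoly n))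

/-- The orthonormal Hermite functions of scale `b`. -/
def hermiteFun (b : ℝ) (n : ℕ) : ℝ → ℝ := polyGauss b (hermitePoly n)

section Hermite
open Polynomial

lemma hermitePoly_raise (n : ℕ) :
    X * hermitePoly n - derivative (hermitePoly n) = C (Real.sqrt (n + 1)) * hermitePoly (n + 1) := by
  have : Real.sqrt ((n : ℝ) + 1) ≠ 0 := (Real.sqrt_pos.2 (by positivity)).ne'
  rw [hermitePoly, ← mul_assoc, ← C_mul, mul_inv_cancel₀ this, C_1, one_mul]

/-- The derivative is the lowering operator. Induction works because its commutator with the raising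
operator X − d/dx is 1. At n = 0 the index n − 1 is truncated to 0, which is harmless since the
factor √0 vanishes; the same convention recurs throughout. -/
lemma derivative_hermitePoly (n : ℕ) :
    derivative (hermitePoly n) = C (Real.sqrt n) * hermitePoly (n - 1) := by
  induction n with
  | zero => simp [hermitePoly]
  | succ n ih =>
    have h0 : Real.sqrt ((n : ℝ) + 1) ≠ 0 := (Real.sqrt_pos.2 (by positivity)).ne'
    have h2 : derivative (X * hermitePoly n - derivative (hermitePoly n))
        = C ((n : ℝ) + 1) * hermitePoly n := by
      rcases n with _ | n
      · simp [hermitePoly]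
      · rw [derivative_sub, derivative_mul, derivative_X, one_mul]
        conv_lhs => rw [ih]
        rw [derivative_C_mul]
        have := hermitePoly_raise n
        simp only [Nat.add_sub_cancel, Nat.cast_add, Nat.cast_one] at *
        have h3 : (C (Real.sqrt ((n : ℝ) + 1)) : ℝ[X]) * C (Real.sqrt ((n : ℝ) + 1))
            = C ((n : ℝ) + 1) := by
          rw [← C_mul, Real.mul_self_sqrt (by positivity)]
        calc _ = hermitePoly (n + 1) + C (Real.sqrt ((n : ℝ) + 1)) *
              (X * hermitePoly n - derivative (hermitePoly n)) := by ring
          _ = hermitePoly (n + 1) + (C (Real.sqrt ((n : ℝ) + 1)) * C (Real.sqrt ((n : ℝ) + 1)))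
              * hermitePoly (n + 1) := by rw [this]; ring
          _ = _ := by rw [h3]; simp only [C_add, C_1]; ring
    rw [hermitePoly, derivative_C_mul, h2, ← mul_assoc, ← C_mul]
    simp only [Nat.add_sub_cancel, Nat.cast_add, Nat.cast_one]
    congr 2
    rw [inv_mul_eq_iff_eq_mul₀ h0, Real.mul_self_sqrt (by positivity)]

lemma X_mul_hermitePoly (n : ℕ) : X * hermitePoly n =
    C (Real.sqrt (n + 1)) * hermitePoly (n + 1) + C (Real.sqrt n) * hermitePoly (n - 1) := by
  rw [← hermitePoly_raise, ← derivative_hermitePoly]; ring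

/-- By the three-term recurrence the span is stable under multiplication by X, and it contains 1,
hence every monomial. -/
lemma span_hermitePoly : Submodule.span ℝ (range hermitePoly) = ⊤ := by
  have hX : ∀ p ∈ Submodule.span ℝ (range hermitePoly),
      X * p ∈ Submodule.span ℝ (range hermitePoly) := by
    intro p hp
    induction hp using Submodule.span_induction with
    | mem x hx =>
      obtain ⟨n, rfl⟩ := hx
      rw [X_mul_hermitePoly, ← smul_eq_C_mul, ← smul_eq_C_mul]
      exact Submodule.add_mem _ (Submodule.smul_mem _ _ (Submodule.subset_span ⟨_, rfl⟩))
        (Submodule.smul_mem _ _ (Submodule.subset_span ⟨_, rfl⟩))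
    | zero => simp
    | add x y _ _ hx hy => rw [mul_add]; exact Submodule.add_mem _ hx hy
    | smul a x _ hx => rw [mul_smul_comm]; exact Submodule.smul_mem _ _ hx
  have hXn : ∀ n : ℕ, (X : ℝ[X]) ^ n ∈ Submodule.span ℝ (range hermitePoly) := by
    intro n
    induction n with
    | zero => exact Submodule.subset_span ⟨0, by simp [hermitePoly]⟩
    | succ n ih => rw [pow_succ']; exact hX _ ih
  rw [eq_top_iff]
  rintro p -
  induction p using Polynomial.induction_on' with
  | add p q hp hq => exact Submodule.add_mem _ hp hq
  | monomial n a =>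
    rw [← C_mul_X_pow_eq_monomial, ← smul_eq_C_mul]
    exact Submodule.smul_mem _ _ (hXn n)

lemma polyGauss_add (b : ℝ) (p q : ℝ[X]) (v : ℝ) :
    polyGauss b (p + q) v = polyGauss b p v + polyGauss b q v := by
  simp [polyGauss, add_mul]

lemma polyGauss_C_mul (b c : ℝ) (p : ℝ[X]) (v : ℝ) :
    polyGauss b (C c * p) v = c * polyGauss b p v := by
  simp [polyGauss, mul_assoc]

variable {b : ℝ}

lemma mul_polyGauss (hb : 0 < b) (p : ℝ[X]) (v : ℝ) :
    v * polyGauss b p v = polyGauss b (C b * (X * p)) v := by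
  simp only [polyGauss, eval_mul, eval_C, eval_X]
  field_simp

lemma hasDerivAt_polyGauss (hb : 0 < b) (p : ℝ[X]) (v : ℝ) :
    HasDerivAt (polyGauss b p)
      (polyGauss b (C b⁻¹ * (derivative p - C (1 / 2) * (X * p))) v) v := by
  have h1 : HasDerivAt (fun v => p.eval (v / b)) (p.derivative.eval (v / b) * (1 / b)) v :=
    HasDerivAt.comp (h₂ := fun x => p.eval x) v (p.hasDerivAt (v / b))
      ((hasDerivAt_id v).div_const b)
  have h2 : HasDerivAt (fun v : ℝ => Real.exp (-(v ^ 2 / (4 * b ^ 2))))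
      (Real.exp (-(v ^ 2 / (4 * b ^ 2))) * (-(2 * v / (4 * b ^ 2)))) v := by
    have : HasDerivAt (fun v : ℝ => -(v ^ 2 / (4 * b ^ 2))) (-(2 * v / (4 * b ^ 2))) v := by
      have h := ((hasDerivAt_pow 2 v).div_const (4 * b ^ 2)).fun_neg
      simpa using h
    exact this.exp
  have h3 := h1.mul (h2.const_mul ((Real.sqrt (Real.sqrt (2 * Real.pi) * b))⁻¹))
  refine h3.congr_deriv ?_
  simp only [polyGauss, eval_mul, eval_C, eval_sub, eval_X]
  field_simp
  ring

lemma contDiff_polyGauss (b : ℝ) (p : ℝ[X]) {n : WithTop ℕ∞} : ContDiff ℝ n (polyGauss b p) := by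
  unfold polyGauss
  refine ContDiff.mul ?_ ?_
  · have : ContDiff ℝ n (fun x : ℝ => p.eval x) := by
      simpa using p.contDiff_aeval (𝕜 := ℝ) n
    exact this.comp (contDiff_id.div_const b)
  · fun_prop

lemma continuous_polyGauss (b : ℝ) (p : ℝ[X]) : Continuous (polyGauss b p) :=
  (contDiff_polyGauss b p (n := 0)).continuous

lemma integrable_eval_mul_exp {c : ℝ} (hc : 0 < c) (p : ℝ[X]) :
    Integrable (fun v : ℝ => p.eval v * Real.exp (-c * v ^ 2)) := by
  induction p using Polynomial.induction_on' with
  | add p q hp hq => simpa [add_mul] using hp.fun_add hq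
  | monomial n a =>
    have h := integrable_rpow_mul_exp_neg_mul_sq hc (s := (n : ℝ))
      (by have : (0 : ℝ) ≤ n := by positivity
          linarith)
    simp only [Real.rpow_natCast] at h
    simpa [mul_assoc] using h.const_mul a

lemma polyGauss_mul_eq (hb : 0 < b) (p q : ℝ[X]) (v : ℝ) :
    polyGauss b p v * polyGauss b q v = (Real.sqrt (2 * Real.pi) * b)⁻¹ *
      (((p * q).comp (C b⁻¹ * X)).eval v * Real.exp (-(1 / (2 * b ^ 2)) * v ^ 2)) := by
  have h1 : Real.exp (-(1 / (2 * b ^ 2)) * v ^ 2) =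
      Real.exp (-(v ^ 2 / (4 * b ^ 2))) * Real.exp (-(v ^ 2 / (4 * b ^ 2))) := by
    rw [← Real.exp_add]; congr 1; field_simp; ring
  have h2 : (Real.sqrt (2 * Real.pi) * b)⁻¹ = (Real.sqrt (Real.sqrt (2 * Real.pi) * b))⁻¹ *
      (Real.sqrt (Real.sqrt (2 * Real.pi) * b))⁻¹ := by
    rw [← mul_inv, Real.mul_self_sqrt (by positivity)]
  rw [h1, h2]
  simp only [polyGauss, eval_comp, eval_mul, eval_C, eval_X]
  rw [show b⁻¹ * v = v / b by field_simp]
  ring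

lemma integrable_polyGauss_mul (hb : 0 < b) (p q : ℝ[X]) :
    Integrable (fun v => polyGauss b p v * polyGauss b q v) := by
  simp_rw [polyGauss_mul_eq hb]
  exact (integrable_eval_mul_exp (by positivity) _).const_mul _

lemma memLp_polyGauss (hb : 0 < b) (p : ℝ[X]) : MemLp (polyGauss b p) 2 := by
  rw [memLp_two_iff_integrable_sq (continuous_polyGauss b p).aestronglyMeasurable]
  simpa [pow_two] using integrable_polyGauss_mul hb p p

lemma integral_polyGauss_one (hb : 0 < b) :
    ∫ v, polyGauss b 1 v * polyGauss b 1 v = 1 := by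
  simp_rw [polyGauss_mul_eq hb]
  rw [integral_const_mul]
  simp only [mul_one, one_comp, eval_one, one_mul]
  rw [integral_gaussian, show Real.pi / (1 / (2 * b ^ 2)) = (2 * Real.pi) * b ^ 2 by field_simp,
    Real.sqrt_mul (x := 2 * Real.pi) (by positivity) (b ^ 2), Real.sqrt_sq hb.le]
  exact inv_mul_cancel₀ (by positivity)

/-- Against the Gaussian weight, raising is the adjoint of differentiation: the integral of the
derivative of a product of two such functions vanishes. -/
lemma integral_raise (hb : 0 < b) (p q : ℝ[X]) :
    ∫ v, polyGauss b (X * p - derivative p) v * polyGauss b q v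
      = ∫ v, polyGauss b p v * polyGauss b (derivative q) v := by
  have h := integral_eq_zero_of_hasDerivAt_of_integrable
    (f := fun v => polyGauss b p v * polyGauss b q v)
    (fun v => (hasDerivAt_polyGauss hb p v).mul (hasDerivAt_polyGauss hb q v))
    ((integrable_polyGauss_mul hb _ _).add (integrable_polyGauss_mul hb _ _))
    (integrable_polyGauss_mul hb p q)
  have h2 : ∀ v, polyGauss b (X * p - derivative p) v * polyGauss b q v
      = polyGauss b p v * polyGauss b (derivative q) v - b *
      (polyGauss b (C b⁻¹ * (derivative p - C (1 / 2) * (X * p))) v * polyGauss b q v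
        + polyGauss b p v * polyGauss b (C b⁻¹ * (derivative q - C (1 / 2) * (X * q))) v) := by
    intro v
    simp only [polyGauss, eval_mul, eval_C, eval_sub, eval_X]
    field_simp
    ring
  simp_rw [h2]
  rw [integral_sub (integrable_polyGauss_mul hb _ _)
    (((integrable_polyGauss_mul hb _ _).fun_add (integrable_polyGauss_mul hb _ _)).const_mul b),
    integral_const_mul, h, mul_zero, sub_zero]

/-- Moving the raising operator to the other factor lowers both indices, so the claim reduces to the
Gaussian integral and to the fact that lowering annihilates the ground state. -/
lemma integral_hermiteFun_mul (hb : 0 < b) (n k : ℕ) :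
    ∫ v, hermiteFun b n v * hermiteFun b k v = if n = k then 1 else 0 := by
  have step : ∀ n k : ℕ, Real.sqrt (n + 1) * ∫ v, hermiteFun b (n + 1) v * hermiteFun b k v
      = Real.sqrt k * ∫ v, hermiteFun b n v * hermiteFun b (k - 1) v := by
    intro n k
    have := integral_raise hb (hermitePoly n) (hermitePoly k)
    rw [hermitePoly_raise, derivative_hermitePoly] at this
    simp_rw [polyGauss_C_mul] at this
    rw [← integral_const_mul, ← integral_const_mul]
    simp only [hermiteFun]
    convert this using 1
    · congr 1; ext v; ring
    · congr 1; ext v; ring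
  induction n generalizing k with
  | zero =>
    rcases k with _ | k
    · simpa [hermiteFun, hermitePoly] using integral_polyGauss_one hb
    · have h := step k 0
      have h0 : Real.sqrt ((k : ℝ) + 1) ≠ 0 := (Real.sqrt_pos.2 (by positivity)).ne'
      simp only [Nat.cast_zero, Real.sqrt_zero, zero_mul, mul_eq_zero, h0, false_or] at h
      simp only [show (0 : ℕ) ≠ k + 1 by omega, if_false]
      rw [← h]; congr 1; ext v; ring
  | succ n ih =>
    have h := step n k
    have h0 : Real.sqrt ((n : ℝ) + 1) ≠ 0 := (Real.sqrt_pos.2 (by positivity)).ne'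
    rcases k with _ | k
    · simp only [Nat.cast_zero, Real.sqrt_zero, zero_mul, mul_eq_zero, h0, false_or] at h
      simp [h]
    · rw [Nat.add_sub_cancel, ih k] at h
      by_cases hnk : n = k
      · subst hnk
        simp only [if_true, mul_one, Nat.cast_add, Nat.cast_one] at h
        simpa [h0] using h
      · simp only [hnk, if_false, mul_zero, mul_eq_zero, h0, false_or] at h
        simp [h, hnk]

/-! ### Totality of the Hermite functions -/

/-- The positive and negative parts of u are densities of two finite measures with the same
characteristic function. The measures agree, so both parts agree almost everywhere, and then both
vanish. -/
lemma ae_eq_zero_of_fourier_eq_zero {u : ℝ → ℝ} (hu : Integrable u)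
    (h : ∀ t : ℝ, ∫ v : ℝ, Complex.exp (t * v * Complex.I) * (u v : ℂ) = 0) : u =ᵐ[volume] 0 := by
  have hfin : ∀ w : ℝ → ℝ, Integrable w →
      IsFiniteMeasure (volume.withDensity fun v => ENNReal.ofReal (w v)) := fun w hw =>
    isFiniteMeasure_withDensity_ofReal hw.2
  have := hfin u hu
  have := hfin (fun v => -u v) hu.neg
  have hchar : ∀ w : ℝ → ℝ, Integrable w → ∀ t,
      charFun (volume.withDensity fun v => ENNReal.ofReal (w v)) t
        = ∫ v : ℝ, Complex.exp (t * v * Complex.I) * ((max (w v) 0 : ℝ) : ℂ) := by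
    intro w hw t
    rw [charFun_apply_real, integral_withDensity_eq_integral_toReal_smul₀
      hw.1.aemeasurable.ennreal_ofReal (by simp)]
    congr 1; ext v
    rw [ENNReal.toReal_ofReal', Complex.real_smul, mul_comm]
  have hint : ∀ w : ℝ → ℝ, Integrable w → ∀ t : ℝ,
      Integrable (fun v : ℝ => Complex.exp (t * v * Complex.I) * (w v : ℂ)) := by
    intro w hw t
    refine (hw.ofReal (𝕜 := ℂ)).bdd_mul (c := 1) (by fun_prop) (.of_forall fun v => ?_)
    rw [← Complex.ofReal_mul, Complex.norm_exp_ofReal_mul_I]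
  have heq := Measure.ext_of_charFun (μ := volume.withDensity fun v => ENNReal.ofReal (u v))
    (ν := volume.withDensity fun v => ENNReal.ofReal (-u v)) (by
      ext t
      rw [hchar u hu, hchar _ hu.fun_neg, ← sub_eq_zero, ← integral_sub (hint _ hu.pos_part t)
        (hint _ hu.fun_neg.pos_part t), ← h t]
      congr 1; ext v
      rw [← mul_sub, ← Complex.ofReal_sub]
      congr 2
      rcases le_total (u v) 0 with h0 | h0
      · rw [max_eq_right h0, max_eq_left (by simpa using h0)]; simp
      · rw [max_eq_left h0, max_eq_right (by simpa using h0)]; simp)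
  rw [withDensity_eq_iff hu.1.aemeasurable.ennreal_ofReal hu.fun_neg.1.aemeasurable.ennreal_ofReal
    (by have := measure_lt_top (volume.withDensity fun v => ENNReal.ofReal (u v)) univ
        rw [withDensity_apply _ MeasurableSet.univ, Measure.restrict_univ] at this
        exact this.ne)] at heq
  filter_upwards [heq] with v hv
  rcases lt_trichotomy (u v) 0 with h0 | h0 | h0
  · rw [ENNReal.ofReal_of_nonpos h0.le] at hv
    have := (ENNReal.ofReal_pos.2 (neg_pos.2 h0)); rw [← hv] at this; simp at this
  · simpa using h0
  · rw [ENNReal.ofReal_of_nonpos (p := -u v) (by linarith)] at hv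
    have := (ENNReal.ofReal_pos.2 h0); rw [hv] at this; simp at this

/-- Half of the Gaussian in the squared weight absorbs the exponential, by 2|t||v| ≤ 4b²t² +
v²/(4b²). This domination permits termwise integration of the Fourier exponential. -/
lemma integrable_exp_mul_polyGauss_one (hb : 0 < b) (t : ℝ) {u : ℝ → ℝ} (hu : MemLp u 2) :
    Integrable (fun v => Real.exp (|t * v|) * (polyGauss b 1 v * u v)) := by
  have hm : MemLp (fun v => Real.exp (|t * v|) * polyGauss b 1 v) 2 := by
    have hcont : Continuous (fun v => Real.exp (|t * v|) * polyGauss b 1 v) := by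
      have := continuous_polyGauss b 1
      fun_prop
    rw [memLp_two_iff_integrable_sq hcont.aestronglyMeasurable]
    have hg := ((integrable_exp_neg_mul_sq (b := 1 / (4 * b ^ 2)) (by positivity)).const_mul
      ((Real.sqrt (Real.sqrt (2 * Real.pi) * b))⁻¹ ^ 2 * Real.exp (4 * b ^ 2 * t ^ 2)))
    refine hg.mono' (hcont.pow 2).aestronglyMeasurable (.of_forall fun v => ?_)
    rw [Real.norm_of_nonneg (by positivity)]
    simp only [polyGauss, eval_one, one_mul]
    rw [mul_pow, mul_pow, ← Real.exp_nat_mul, ← Real.exp_nat_mul, mul_comm, mul_assoc, mul_assoc,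
      ← Real.exp_add, ← Real.exp_add]
    refine mul_le_mul_of_nonneg_left (Real.exp_le_exp.2 ?_) (by positivity)
    push_cast
    rw [abs_mul]
    have h1 : 2 * (|t| * |v|) ≤ 4 * b ^ 2 * t ^ 2 + v ^ 2 / (4 * b ^ 2) := by
      have h2 := sq_nonneg (2 * b * |t| - |v| / (2 * b))
      have h3 : (2 * b * |t| - |v| / (2 * b)) ^ 2
          = 4 * b ^ 2 * t ^ 2 + v ^ 2 / (4 * b ^ 2) - 2 * (|t| * |v|) := by
        rw [← sq_abs t, ← sq_abs v]; field_simp; ring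
      linarith
    have h4 : 2 * -(v ^ 2 / (4 * b ^ 2)) = - (v ^ 2 / (4 * b ^ 2)) + -(1 / (4 * b ^ 2)) * v ^ 2 := by
      field_simp; ring
    linarith
  exact (hm.integrable_mul hu).congr (.of_forall fun v => by simp [mul_assoc])

/-- All moments of ψ₀u vanish. Expanding e^{itv} in its power series shows that the Fourier
transform of ψ₀u vanishes, and ψ₀ has no zeros. -/
lemma ae_eq_zero_of_integral_polyGauss_real (hb : 0 < b) {u : ℝ → ℝ} (hu : MemLp u 2)
    (h : ∀ p : ℝ[X], ∫ v, polyGauss b p v * u v = 0) : u =ᵐ[volume] 0 := by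
  have hE := fun t => integrable_exp_mul_polyGauss_one hb t hu
  have h0 : Integrable (fun v => polyGauss b 1 v * u v) := by simpa using hE 0
  have key := ae_eq_zero_of_fourier_eq_zero h0 (by
    intro t
    have hmom : ∀ (n : ℕ) (v : ℝ), ((t * v * Complex.I) ^ n / (n.factorial : ℂ)) *
          ((polyGauss b 1 v * u v : ℝ) : ℂ)
          = ((t * b * Complex.I) ^ n / (n.factorial : ℂ)) *
            ((polyGauss b (X ^ n) v * u v : ℝ) : ℂ) := by
      intro n v
      have hb' : (b : ℂ) ≠ 0 := by exact_mod_cast hb.ne'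
      have e : (t * v * Complex.I : ℂ) ^ n = (t * b * Complex.I) ^ n * ((v / b : ℝ) : ℂ) ^ n := by
        rw [← mul_pow]; congr 1; push_cast; field_simp
      simp only [polyGauss, eval_pow, eval_X, eval_one]
      rw [e]
      push_cast
      ring
    have hs := hasSum_integral_of_summable_integral_norm (μ := volume)
      (F := fun (n : ℕ) (v : ℝ) => ((t * v * Complex.I) ^ n / (n.factorial : ℂ)) *
        ((polyGauss b 1 v * u v : ℝ) : ℂ))
      (fun n => by
        have hi : Integrable (fun v => polyGauss b (X ^ n) v * u v) :=
          (memLp_polyGauss hb (X ^ n)).integrable_mul hu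
        convert (hi.ofReal (𝕜 := ℂ)).const_mul ((t * b * Complex.I) ^ n / (n.factorial : ℂ))
          using 2 with v
        exact hmom n v)
      (by
        have hnn : ∀ (n : ℕ) (v : ℝ), ‖((t * v * Complex.I) ^ n / (n.factorial : ℂ)) *
            ((polyGauss b 1 v * u v : ℝ) : ℂ)‖
            = |t * v| ^ n / n.factorial * ‖polyGauss b 1 v * u v‖ := by
          intro n v
          rw [norm_mul, norm_div, norm_pow, norm_mul, Complex.norm_I, mul_one, ← Complex.ofReal_mul,
            Complex.norm_real, Complex.norm_natCast, Complex.norm_real, Real.norm_eq_abs]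
        simp_rw [hnn]
        -- The partial sums of the norms stay below the integral with e^{|tv|}, which is finite.
        refine summable_of_sum_range_le (c := ∫ v, ‖Real.exp (|t * v|) * (polyGauss b 1 v * u v)‖)
          (fun n => integral_nonneg fun v => by positivity) (fun N => ?_)
        have hin : ∀ n : ℕ, Integrable (fun v : ℝ => |t * v| ^ n / n.factorial *
            ‖polyGauss b 1 v * u v‖) := by
          intro n
          refine (hE t).norm.mono' ?_ (.of_forall fun v => ?_)
          · exact ((by fun_prop : Continuous fun v : ℝ => |t * v| ^ n / n.factorial)
              |>.aestronglyMeasurable).mul h0.1.norm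
          · rw [Real.norm_of_nonneg (by positivity), norm_mul _ (polyGauss b 1 v * u v),
              Real.norm_of_nonneg (Real.exp_pos _).le]
            gcongr
            exact Real.pow_div_factorial_le_exp _ (abs_nonneg _) n
        rw [← integral_finsetSum _ fun n _ => hin n]
        refine integral_mono (integrable_finsetSum _ fun n _ => hin n) (hE t).norm fun v => ?_
        simp only
        rw [← Finset.sum_mul, norm_mul _ (polyGauss b 1 v * u v),
          Real.norm_of_nonneg (Real.exp_pos _).le]
        gcongr
        exact Real.sum_le_exp_of_nonneg (abs_nonneg _) N)
    have hz : ∀ n : ℕ, ∫ v : ℝ, ((t * v * Complex.I) ^ n / (n.factorial : ℂ)) *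
        ((polyGauss b 1 v * u v : ℝ) : ℂ) = 0 := by
      intro n

      simp_rw [hmom]
      rw [integral_const_mul, integral_complex_ofReal, h]
      simp
    simp_rw [hz] at hs
    have := hs.unique hasSum_zero
    rw [← this]
    congr 1; ext v
    rw [tsum_mul_right, Complex.exp_eq_exp_ℂ, NormedSpace.exp_eq_tsum_div])
  filter_upwards [key] with v hv
  have h1 : polyGauss b 1 v ≠ 0 := by
    simp only [polyGauss, eval_one, one_mul]
    positivity
  simpa [h1] using hv

lemma ae_eq_zero_of_integral_hermiteFun (hb : 0 < b) {u : ℝ → ℂ} (hu : MemLp u 2)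
    (h : ∀ n, ∫ v, (hermiteFun b n v : ℂ) * u v = 0) : u =ᵐ[volume] 0 := by
  have hint : ∀ p : ℝ[X], Integrable (fun v => (polyGauss b p v : ℂ) * u v) := fun p =>
    ((memLp_polyGauss hb p).ofReal (K := ℂ)).integrable_mul hu
  have hp : ∀ p : ℝ[X], ∫ v, (polyGauss b p v : ℂ) * u v = 0 := by
    intro p
    have hmem : p ∈ Submodule.span ℝ (range hermitePoly) := by rw [span_hermitePoly]; trivial
    induction hmem using Submodule.span_induction with
    | mem x hx => obtain ⟨n, rfl⟩ := hx; exact h n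
    | zero => simp [polyGauss]
    | add x y _ _ hx hy =>
      simp_rw [polyGauss_add, Complex.ofReal_add, add_mul]
      rw [integral_add (hint x) (hint y), hx, hy, add_zero]
    | smul a x _ hx =>
      simp_rw [smul_eq_C_mul, polyGauss_C_mul, Complex.ofReal_mul, mul_assoc]
      rw [integral_const_mul, hx, mul_zero]
  have hre := ae_eq_zero_of_integral_polyGauss_real hb hu.re (fun p => by
    have := congrArg Complex.re (hp p)
    rw [← Complex.reCLM_apply, ← ContinuousLinearMap.integral_comp_comm _ (hint p)] at this
    simpa using this)
  have him := ae_eq_zero_of_integral_polyGauss_real hb hu.im (fun p => by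
    have := congrArg Complex.im (hp p)
    rw [← Complex.imCLM_apply, ← ContinuousLinearMap.integral_comp_comm _ (hint p)] at this
    simpa using this)
  filter_upwards [hre, him] with v h1 h2
  exact Complex.ext (by simpa using h1) (by simpa using h2)

end Hermite
end KuramotoSakaguchi
end

/-! ### The Fourier–Hermite decomposition of L² of phase space. -/

noncomputable section
namespace KuramotoSakaguchi

/-- The space `L²(ℝ; ℂ)` of coefficient functions of the natural frequency. -/
abbrev FreqL2 : Type := Lp ℂ 2 (volume : Measure ℝ)

/-- The complexification of `L2`. -/
abbrev L2C : Type := Lp ℂ 2 (volume : Measure Phase)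

/-! ### Generalities on `L²` -/

section Generalities
variable {X Y : Type*} [MeasurableSpace X] [MeasurableSpace Y] {μ : Measure X} {ν : Measure Y}

lemma norm_toLp_sq {f : X → ℂ} (hf : MemLp f 2 μ) : ‖hf.toLp f‖ ^ 2 = ∫ x, ‖f x‖ ^ 2 ∂μ := by
  rw [← inner_self_eq_norm_sq (𝕜 := ℂ), L2.inner_def]
  rw [integral_congr_ae (g := fun x => ((‖f x‖ ^ 2 : ℝ) : ℂ))]
  · rw [integral_complex_ofReal]; simp
  · filter_upwards [hf.coeFn_toLp] with x hx
    rw [hx, inner_self_eq_norm_sq_to_K]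
    norm_cast

lemma inner_toLp {f g : X → ℂ} (hf : MemLp f 2 μ) (hg : MemLp g 2 μ) :
    inner ℂ (hf.toLp f) (hg.toLp g) = ∫ x, (starRingEnd ℂ) (f x) * g x ∂μ := by
  rw [L2.inner_def]
  refine integral_congr_ae ?_
  filter_upwards [hf.coeFn_toLp, hg.coeFn_toLp] with x h1 h2
  rw [h1, h2, RCLike.inner_apply, mul_comm]

lemma norm_integral_mul_sq_le {f g : X → ℂ} (hf : MemLp f 2 μ) (hg : MemLp g 2 μ) :
    ‖∫ x, f x * g x ∂μ‖ ^ 2 ≤ (∫ x, ‖f x‖ ^ 2 ∂μ) * ∫ x, ‖g x‖ ^ 2 ∂μ := by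
  have hf' : MemLp (fun x => (starRingEnd ℂ) (f x)) 2 μ := by
    exact hf.star
  have h := norm_inner_le_norm (𝕜 := ℂ) (hf'.toLp _) (hg.toLp _)
  rw [inner_toLp] at h
  simp only [Complex.conj_conj] at h
  calc _ ≤ (‖hf'.toLp _‖ * ‖hg.toLp _‖) ^ 2 := by gcongr
    _ = _ := by rw [mul_pow, norm_toLp_sq, norm_toLp_sq]; simp

lemma memLp_slice_ae [SFinite μ] [SFinite ν] {u : X × Y → ℂ} (hm : StronglyMeasurable u)
    (hu : MemLp u 2 (μ.prod ν)) : ∀ᵐ y ∂ν, MemLp (fun x => u (x, y)) 2 μ := by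
  have h := ((memLp_two_iff_integrable_sq_norm hm.aestronglyMeasurable).1 hu).prod_left_ae
  filter_upwards [h] with y hy
  exact (memLp_two_iff_integrable_sq_norm
    (hm.comp_measurable measurable_prodMk_right).aestronglyMeasurable).2 hy

lemma memLp_partial_integral [SFinite μ] [SFinite ν] {e : X → ℂ} (he : MemLp e 2 μ)
    (hem : StronglyMeasurable e)
    {u : X × Y → ℂ} (hm : StronglyMeasurable u) (hu : MemLp u 2 (μ.prod ν)) :
    StronglyMeasurable (fun y => ∫ x, e x * u (x, y) ∂μ) ∧
      MemLp (fun y => ∫ x, e x * u (x, y) ∂μ) 2 ν := by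
  have hsm : StronglyMeasurable (fun y => ∫ x, e x * u (x, y) ∂μ) :=
    StronglyMeasurable.integral_prod_left' (f := fun z : X × Y => e z.1 * u z)
      ((hem.comp_measurable measurable_fst).mul hm)
  refine ⟨hsm, ?_⟩
  rw [memLp_two_iff_integrable_sq_norm hsm.aestronglyMeasurable]
  have hi := ((memLp_two_iff_integrable_sq_norm hm.aestronglyMeasurable).1 hu).integral_prod_right
  refine (hi.const_mul (∫ x, ‖e x‖ ^ 2 ∂μ)).mono' (hsm.norm.pow 2).aestronglyMeasurable ?_
  filter_upwards [memLp_slice_ae hm hu] with y hy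
  rw [Real.norm_of_nonneg (by positivity)]
  exact norm_integral_mul_sq_le he hy

/-- Countability of the family lets one null set of y serve all members. Totality kills almost every
slice, and Fubini finishes. It peels off one variable at a time. -/
lemma ae_eq_zero_of_partial_integrals [SFinite μ] [SFinite ν] {ι : Type*} [Countable ι]
    {e : ι → X → ℂ} (htot : ∀ v : X → ℂ, MemLp v 2 μ → (∀ i, ∫ x, e i x * v x ∂μ = 0) → v =ᵐ[μ] 0)
    {u : X × Y → ℂ} (hm : StronglyMeasurable u) (hu : MemLp u 2 (μ.prod ν))
    (h : ∀ i, ∀ᵐ y ∂ν, ∫ x, e i x * u (x, y) ∂μ = 0) : u =ᵐ[μ.prod ν] 0 := by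
  have h1 : ∀ᵐ y ∂ν, ∀ᵐ x ∂μ, u (x, y) = 0 := by
    filter_upwards [memLp_slice_ae hm hu, ae_all_iff.2 h] with y h1 h2
    exact htot _ h1 h2
  have hms : MeasurableSet {z : X × Y | u z = 0} := hm.measurable (measurableSet_singleton 0)
  have := (Measure.ae_ae_comm (p := fun x y => u (x, y) = 0) hms).2 h1
  exact (Measure.ae_prod_iff_ae_ae hms).2 this

end Generalities

/-! ### The Fourier modes on the circle -/

/-- The normalized Fourier mode `e^{ikθ} / √(2π)`. -/
def circMode (k : ℤ) (θ : Circ) : ℂ := ((Real.sqrt (2 * Real.pi))⁻¹ : ℝ) * fourier k θ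

lemma continuous_circMode (k : ℤ) : Continuous (circMode k) := by
  unfold circMode; fun_prop

lemma conj_circMode (k : ℤ) (θ : Circ) : (starRingEnd ℂ) (circMode k θ) = circMode (-k) θ := by
  rw [circMode, circMode, map_mul, Complex.conj_ofReal, fourier_neg]

lemma memLp_circMode (k : ℤ) : MemLp (circMode k) 2 :=
  (continuous_circMode k).memLp_of_hasCompactSupport
    (HasCompactSupport.of_compactSpace _)

lemma integral_circ_eq (F : Circ → ℂ) :
    ∫ θ, F θ = (2 * Real.pi : ℝ) * ∫ θ, F θ ∂AddCircle.haarAddCircle := by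
  rw [AddCircle.volume_eq_smul_haarAddCircle, integral_smul_measure,
    ENNReal.toReal_ofReal Real.two_pi_pos.le, Complex.real_smul]

lemma integral_circMode_mul (k l : ℤ) :
    ∫ θ, (starRingEnd ℂ) (circMode k θ) * circMode l θ = if k = l then 1 else 0 := by
  have h := orthonormal_iff_ite.1 (orthonormal_fourier (T := 2 * Real.pi)) k l
  rw [fourierLp, fourierLp, ContinuousMap.inner_toLp] at h
  rw [← h, integral_circ_eq]
  have h2 : ((2 * Real.pi : ℝ) : ℂ) * ((((Real.sqrt (2 * Real.pi))⁻¹ : ℝ) : ℂ) *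
      (((Real.sqrt (2 * Real.pi))⁻¹ : ℝ) : ℂ)) = 1 := by
    rw [← Complex.ofReal_mul, ← Complex.ofReal_mul, ← mul_inv,
      Real.mul_self_sqrt Real.two_pi_pos.le, mul_inv_cancel₀ Real.two_pi_pos.ne', Complex.ofReal_one]
  simp only [circMode, map_mul, Complex.conj_ofReal]
  rw [← integral_const_mul]
  congr 1; ext θ
  calc _ = (((2 * Real.pi : ℝ) : ℂ) * ((((Real.sqrt (2 * Real.pi))⁻¹ : ℝ) : ℂ) *
      (((Real.sqrt (2 * Real.pi))⁻¹ : ℝ) : ℂ))) * (fourier l θ * (starRingEnd ℂ) (fourier k θ)) := by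
        ring
    _ = _ := by rw [h2, one_mul]

lemma circMode_total (v : Circ → ℂ) (hv : MemLp v 2)
    (h : ∀ k : ℤ, ∫ θ, circMode k θ * v θ = 0) : v =ᵐ[volume] 0 := by
  have hvol := AddCircle.volume_eq_smul_haarAddCircle (T := 2 * Real.pi)
  have h2 : ENNReal.ofReal (2 * Real.pi) ≠ 0 := by
    simp [Real.pi_pos]
  have hv' : MemLp v 2 (AddCircle.haarAddCircle (T := 2 * Real.pi)) := by
    have := hv.smul_measure (c := (ENNReal.ofReal (2 * Real.pi))⁻¹) (ENNReal.inv_ne_top.2 h2)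
    rwa [hvol, smul_smul, ENNReal.inv_mul_cancel h2 ENNReal.ofReal_ne_top, one_smul] at this
  have h0 : hv'.toLp v = 0 := by
    apply (fourierBasis (T := 2 * Real.pi)).repr.injective
    rw [map_zero]
    ext k
    rw [fourierBasis_repr, fourierCoeff_congr_ae hv'.coeFn_toLp, fourierCoeff]
    -- The k-th Fourier coefficient integrates against the mode of index −k.
    have h3 := h (-k)
    rw [integral_circ_eq] at h3
    simp only [circMode, mul_assoc] at h3
    rw [integral_const_mul] at h3
    have hc : ((2 * Real.pi : ℝ) : ℂ) ≠ 0 := by exact_mod_cast Real.two_pi_pos.ne'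
    have hd : (((Real.sqrt (2 * Real.pi))⁻¹ : ℝ) : ℂ) ≠ 0 := by
      exact_mod_cast (inv_pos.2 (Real.sqrt_pos.2 Real.two_pi_pos)).ne'
    change _ = (0 : ℂ)
    simpa only [mul_eq_zero, hc, hd, false_or, smul_eq_mul] using h3
  have h4 : v =ᵐ[AddCircle.haarAddCircle] 0 := by
    have := hv'.coeFn_toLp
    rw [h0] at this
    exact this.symm.trans (Lp.coeFn_zero _ _ _)
  rw [hvol]
  exact Measure.ae_smul_measure h4 _

/-! ### The shear `(θ, ω, ν) ↦ (θ, ω - ν, ν)` -/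

/-- The change of variables `(θ, ω, ν) ↦ (θ, ω - ν, ν)`. -/
def shear : Phase ≃ᵐ Phase where
  toFun z := (z.1, z.2.1 - z.2.2, z.2.2)
  invFun z := (z.1, z.2.1 + z.2.2, z.2.2)
  left_inv z := by simp
  right_inv z := by simp
  measurable_toFun := by simp only [Equiv.coe_fn_mk]; fun_prop
  measurable_invFun := by simp only [Equiv.coe_fn_symm_mk]; fun_prop

lemma measurePreserving_shear : MeasurePreserving shear volume volume :=
  (MeasurePreserving.id (volume : Measure Circ)).prod
    (measurePreserving_sub_prod (volume : Measure ℝ) (volume : Measure ℝ))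

lemma shear_apply (z : Phase) : shear z = (z.1, z.2.1 - z.2.2, z.2.2) := rfl

lemma ae_shear {p : Phase → Prop} (h : ∀ᵐ z, p z) : ∀ᵐ z, p (shear z) :=
  measurePreserving_shear.quasiMeasurePreserving.ae h

lemma ae_velocity {p : ℝ → Prop} (h : ∀ᵐ v, p v) : ∀ᵐ z : Phase, p (z.2.1 - z.2.2) :=
  ae_shear (p := fun z => p z.2.1)
    ((Measure.quasiMeasurePreserving_fst.comp Measure.quasiMeasurePreserving_snd).ae h)

lemma ae_frequency {p : ℝ → Prop} (h : ∀ᵐ v, p v) : ∀ᵐ z : Phase, p z.2.2 :=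
  (Measure.quasiMeasurePreserving_snd.comp Measure.quasiMeasurePreserving_snd).ae h

/-! ### Separated functions -/

/-- The separated function `A(θ) H(ω - ν) η(ν)`. -/
def sepFun (A : Circ → ℂ) (H η : ℝ → ℂ) (z : Phase) : ℂ :=
  A z.1 * (H (z.2.1 - z.2.2) * η z.2.2)

lemma integral_sepFun (A : Circ → ℂ) (H η : ℝ → ℂ) :
    ∫ z, sepFun A H η z = (∫ θ, A θ) * ((∫ v, H v) * ∫ ν, η ν) := by
  have h := measurePreserving_shear.integral_comp shear.measurableEmbedding
    (fun z : Phase => A z.1 * (H z.2.1 * η z.2.2))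
  simp only [shear_apply] at h
  unfold sepFun
  rw [h]
  erw [integral_prod_mul A (fun p : ℝ × ℝ => H p.1 * η p.2)]
  rw [← integral_prod_mul H η]
  rfl

lemma memLp_sepFun {A : Circ → ℂ} {H η : ℝ → ℂ} (hA : MemLp A 2) (hH : MemLp H 2)
    (hη : MemLp η 2) : MemLp (sepFun A H η) 2 := by
  have hm : AEStronglyMeasurable (fun z : Phase => A z.1 * (H z.2.1 * η z.2.2)) volume :=
    hA.1.comp_fst.mul (hH.1.comp_fst.mul hη.1.comp_snd).comp_snd
  have hms : AEStronglyMeasurable (sepFun A H η) volume :=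
    hm.comp_quasiMeasurePreserving measurePreserving_shear.quasiMeasurePreserving
  rw [memLp_two_iff_integrable_sq_norm hms]
  rw [memLp_two_iff_integrable_sq_norm hA.1] at hA
  rw [memLp_two_iff_integrable_sq_norm hH.1] at hH
  rw [memLp_two_iff_integrable_sq_norm hη.1] at hη
  refine (measurePreserving_shear.integrable_comp_of_integrable
    (hA.mul_prod (hH.mul_prod hη))).congr (.of_forall fun z => ?_)
  simp [sepFun, shear_apply, mul_pow]

/-- The separated element `e^{ikθ} H(ω - ν) η(ν) / √(2π)` of `L²`, bilinear in `(H, η)`. -/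
def sep (k : ℤ) (H η : FreqL2) : L2C :=
  (memLp_sepFun (memLp_circMode k) (Lp.memLp H) (Lp.memLp η)).toLp _

lemma coeFn_sep (k : ℤ) (H η : FreqL2) : sep k H η =ᵐ[volume] sepFun (circMode k) H η :=
  MemLp.coeFn_toLp _

lemma inner_sep_sep (k l : ℤ) (H η H' η' : FreqL2) :
    inner ℂ (sep k H η) (sep l H' η') = (if k = l then 1 else 0) * (inner ℂ H H' * inner ℂ η η') := by
  rw [sep, sep, inner_toLp, ← integral_circMode_mul, L2.inner_def, L2.inner_def]
  rw [← integral_sepFun]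
  congr 1; ext z
  simp only [sepFun, map_mul, RCLike.inner_apply]
  ring

lemma norm_sep (k : ℤ) (H η : FreqL2) : ‖sep k H η‖ = ‖H‖ * ‖η‖ := by
  have h := inner_sep_sep k k H η H η
  simp only [if_true, one_mul, inner_self_eq_norm_sq_to_K] at h
  have h2 : ‖sep k H η‖ ^ 2 = (‖H‖ * ‖η‖) ^ 2 := by rw [mul_pow]; exact_mod_cast h
  exact (pow_left_inj₀ (norm_nonneg _) (by positivity) two_ne_zero).1 h2

/-- `sep k` as a continuous bilinear map. -/
def sepCLM (k : ℤ) : FreqL2 →L[ℂ] FreqL2 →L[ℂ] L2C :=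
  LinearMap.mkContinuous₂
    (LinearMap.mk₂ ℂ (sep k)
      (by
        intro H H' η
        apply Lp.ext
        filter_upwards [coeFn_sep k (H + H') η, Lp.coeFn_add (sep k H η) (sep k H' η),
          coeFn_sep k H η, coeFn_sep k H' η, ae_velocity (Lp.coeFn_add H H')] with z h1 h2 h3 h4 h5
        rw [h1, h2, Pi.add_apply, h3, h4]
        simp only [sepFun, h5, Pi.add_apply]; ring)
      (by
        intro c H η
        apply Lp.ext
        filter_upwards [coeFn_sep k (c • H) η, Lp.coeFn_smul c (sep k H η),
          coeFn_sep k H η, ae_velocity (Lp.coeFn_smul c H)] with z h1 h2 h3 h5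
        rw [h1, h2, Pi.smul_apply, h3]
        simp only [sepFun, h5, Pi.smul_apply, smul_eq_mul]; ring)
      (by
        intro H η η'
        apply Lp.ext
        filter_upwards [coeFn_sep k H (η + η'), Lp.coeFn_add (sep k H η) (sep k H η'),
          coeFn_sep k H η, coeFn_sep k H η', ae_frequency (Lp.coeFn_add η η')] with z h1 h2 h3 h4 h5
        rw [h1, h2, Pi.add_apply, h3, h4]
        simp only [sepFun, h5, Pi.add_apply]; ring)
      (by
        intro c H η
        apply Lp.ext
        filter_upwards [coeFn_sep k H (c • η), Lp.coeFn_smul c (sep k H η),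
          coeFn_sep k H η, ae_frequency (Lp.coeFn_smul c η)] with z h1 h2 h3 h5
        rw [h1, h2, Pi.smul_apply, h3]
        simp only [sepFun, h5, Pi.smul_apply, smul_eq_mul]; ring))
    1 (fun H η => by simp [norm_sep])

lemma sepCLM_apply (k : ℤ) (H η : FreqL2) : sepCLM k H η = sep k H η := rfl

/-! ### The Hilbert sum decomposition -/

variable {b : ℝ} [hb : Fact (0 < b)]

variable (b) in
/-- The Hermite function of scale `b` as an element of `L²(ℝ; ℂ)`. -/
def hermiteLp (n : ℕ) : FreqL2 := (((memLp_polyGauss hb.out (hermitePoly n)).ofReal (K := ℂ))).toLp _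

lemma coeFn_hermiteLp (n : ℕ) : hermiteLp b n =ᵐ[volume] fun v => (hermiteFun b n v : ℂ) :=
  MemLp.coeFn_toLp _

lemma inner_hermiteLp (n k : ℕ) :
    inner ℂ (hermiteLp b n) (hermiteLp b k) = if n = k then (1 : ℂ) else 0 := by
  rw [hermiteLp, hermiteLp, inner_toLp]
  have h := congrArg (fun x : ℝ => (x : ℂ)) (integral_hermiteFun_mul hb.out n k)
  simp only [← integral_complex_ofReal] at h
  simp only [RCLike.ofReal_eq_complex_ofReal, Complex.conj_ofReal]
  rw [show (if n = k then (1 : ℂ) else 0) = ((if n = k then (1 : ℝ) else 0 : ℝ) : ℂ) by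
    split_ifs <;> simp, ← h]
  congr 1; ext v
  simp [hermiteFun]

variable (b) in
/-- The isometric embedding of the `(k, n)` mode. -/
def modeEmb (i : ℤ × ℕ) : FreqL2 →ₗᵢ[ℂ] L2C where
  toLinearMap := (sepCLM i.1 (hermiteLp b i.2)).toLinearMap
  norm_map' η := by
    have h : ‖hermiteLp b i.2‖ = 1 := by
      have h2 : ‖hermiteLp b i.2‖ ^ 2 = 1 := by
        rw [← inner_self_eq_norm_sq (𝕜 := ℂ), inner_hermiteLp]; simp
      exact (pow_eq_one_iff_of_nonneg (norm_nonneg _) two_ne_zero).1 h2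
    change ‖sep i.1 (hermiteLp b i.2) η‖ = ‖η‖
    rw [norm_sep, h, one_mul]

lemma modeEmb_apply (i : ℤ × ℕ) (η : FreqL2) : modeEmb b i η = sep i.1 (hermiteLp b i.2) η := rfl

lemma orthogonalFamily_modeEmb : OrthogonalFamily ℂ (fun _ : ℤ × ℕ => FreqL2) (modeEmb b) := by
  rintro ⟨k, n⟩ ⟨l, j⟩ hij η η'
  rw [modeEmb_apply, modeEmb_apply, inner_sep_sep, inner_hermiteLp]
  by_cases h1 : k = l
  · by_cases h2 : n = j
    · exact absurd (by rw [h1, h2]) hij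
    · simp [h2]
  · simp [h1]

/-- After the shear the function is integrated against the modes in θ, then in the relative
velocity. What remains is a function W of ν alone, and choosing η = W in the hypothesis gives ‖W‖ =
0. Totality of the Hermite functions and of the Fourier modes then goes back up to u. -/
lemma eq_zero_of_inner_modeEmb (u : L2C) (h : ∀ i η, inner ℂ (modeEmb b i η) u = 0) : u = 0 := by
  set u' : Circ × (ℝ × ℝ) → ℂ := fun z => u (shear.symm z) with hu'
  have hm : StronglyMeasurable u' := (Lp.stronglyMeasurable u).comp_measurable shear.symm.measurable
  have hmp : MeasurePreserving shear.symm volume volume := measurePreserving_shear.symm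
  have hL : MemLp u' 2 (volume : Measure Phase) := (Lp.memLp u).comp_measurePreserving hmp
  have hH : ∀ n, StronglyMeasurable (fun v => (hermiteFun b n v : ℂ)) := fun n =>
    (Complex.continuous_ofReal.comp (continuous_polyGauss b _)).stronglyMeasurable
  have hHL : ∀ n, MemLp (fun v => (hermiteFun b n v : ℂ)) 2 := fun n =>
    (memLp_polyGauss hb.out (hermitePoly n)).ofReal (K := ℂ)
  have key : u' =ᵐ[(volume : Measure Circ).prod volume] 0 := by
    refine ae_eq_zero_of_partial_integrals (e := circMode) circMode_total hm hL (fun k => ?_)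
    obtain ⟨hUm, hUL⟩ := memLp_partial_integral (memLp_circMode k)
      (continuous_circMode k).stronglyMeasurable hm hL
    refine ae_eq_zero_of_partial_integrals (μ := (volume : Measure ℝ)) (ν := (volume : Measure ℝ))
      (e := fun n v => (hermiteFun b n v : ℂ))
      (fun v hv h => ae_eq_zero_of_integral_hermiteFun hb.out hv h) hUm hUL (fun n => ?_)
    obtain ⟨hWm, hWL⟩ := memLp_partial_integral (hHL n) (hH n) hUm hUL
    set W := fun y => ∫ x, (hermiteFun b n x : ℂ) * ∫ θ, circMode k θ * u' (θ, x, y) with hW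
    have hzero : hWL.toLp W = 0 := by
      rw [← inner_self_eq_zero (𝕜 := ℂ)]
      -- The index is −k because the inner product conjugates the Fourier mode.
      have h1 := h (-k, n) (hWL.toLp W)
      rw [modeEmb_apply, L2.inner_def] at h1
      rw [L2.inner_def, ← h1]
      have e1 : ∫ a, inner ℂ ((sep (-k) (hermiteLp b n) (hWL.toLp W)) a) (u a)
          = ∫ z : Phase, circMode k z.1 *
            ((hermiteFun b n z.2.1 : ℂ) * (starRingEnd ℂ) (W z.2.2)) * u' z := by
        rw [← measurePreserving_shear.integral_comp shear.measurableEmbedding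
          (fun z : Phase => circMode k z.1 *
            ((hermiteFun b n z.2.1 : ℂ) * (starRingEnd ℂ) (W z.2.2)) * u' z)]
        refine integral_congr_ae ?_
        filter_upwards [coeFn_sep (-k) (hermiteLp b n) (hWL.toLp W),
          ae_velocity (coeFn_hermiteLp (b := b) n), ae_frequency hWL.coeFn_toLp] with z h1 h2 h3
        rw [h1]
        simp only [sepFun, h2, h3, RCLike.inner_apply, map_mul, Complex.conj_ofReal,
          conj_circMode, neg_neg, hu', shear_apply]
        rw [← shear_apply, MeasurableEquiv.symm_apply_apply]
        ring
      have hint : Integrable (fun z : Phase => circMode k z.1 *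
            ((hermiteFun b n z.2.1 : ℂ) * (starRingEnd ℂ) (W z.2.2)) * u' z) volume := by
        have h5 : MemLp (fun z : Phase => circMode k z.1 *
            ((hermiteFun b n z.2.1 : ℂ) * (starRingEnd ℂ) (W z.2.2))) 2 volume := by
          have := (memLp_sepFun (memLp_circMode k) (hHL n) hWL.star).comp_measurePreserving hmp
          refine this.ae_eq (.of_forall fun z => ?_)
          simp [sepFun, shear]
        exact h5.integrable_mul hL
      rw [e1]
      have e2 : ∫ z : Phase, circMode k z.1 *
            ((hermiteFun b n z.2.1 : ℂ) * (starRingEnd ℂ) (W z.2.2)) * u' z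
          = ∫ p : ℝ × ℝ, ((hermiteFun b n p.1 : ℂ) * (starRingEnd ℂ) (W p.2)) *
            ∫ θ, circMode k θ * u' (θ, p.1, p.2) := by
        rw [Measure.volume_eq_prod, integral_prod_symm _ hint]
        congr 1; ext p
        rw [← integral_const_mul]
        congr 1; ext θ
        ring
      have hint2 : Integrable (fun p : ℝ × ℝ => ((hermiteFun b n p.1 : ℂ) *
          (starRingEnd ℂ) (W p.2)) * ∫ θ, circMode k θ * u' (θ, p.1, p.2)) volume := by
        have := hint
        rw [Measure.volume_eq_prod] at this
        refine this.integral_prod_right.congr (.of_forall fun p => ?_)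
        simp only
        rw [← integral_const_mul]
        congr 1; ext θ
        ring
      rw [e2, Measure.volume_eq_prod, integral_prod_symm _ hint2]
      refine integral_congr_ae ?_
      filter_upwards [hWL.coeFn_toLp] with y hy
      rw [hy, RCLike.inner_apply, mul_comm]
      simp only [hW]
      rw [← integral_const_mul]
      congr 1; ext v
      ring
    have h6 := hWL.coeFn_toLp
    rw [hzero] at h6
    exact h6.symm.trans (Lp.coeFn_zero _ _ _)
  apply Lp.ext
  refine Filter.EventuallyEq.trans ?_ (Lp.coeFn_zero _ _ _).symm
  have := ae_shear key
  filter_upwards [this] with z hz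
  simpa [hu'] using hz

lemma isHilbertSum_modeEmb : IsHilbertSum ℂ (fun _ : ℤ × ℕ => FreqL2) (modeEmb b) := by
  refine IsHilbertSum.mk orthogonalFamily_modeEmb (top_le_iff.2 ?_)
  rw [Submodule.topologicalClosure_eq_top_iff, Submodule.eq_bot_iff]
  intro u hu
  refine eq_zero_of_inner_modeEmb (b := b) u fun i η => ?_
  exact (Submodule.mem_orthogonal _ _).1 hu _
    (Submodule.mem_iSup_of_mem i (LinearMap.mem_range.2 ⟨η, rfl⟩))

variable (b) in
/-- The coefficient of the `(k, n)` mode. -/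
def coef (i : ℤ × ℕ) : L2C →L[ℂ] FreqL2 :=
  ContinuousLinearMap.adjoint (modeEmb b i).toContinuousLinearMap

lemma inner_coef (i : ℤ × ℕ) (η : FreqL2) (u : L2C) :
    inner ℂ η (coef b i u) = inner ℂ (modeEmb b i η) u := by
  rw [coef, ContinuousLinearMap.adjoint_inner_right]; rfl

lemma coef_modeEmb (i j : ℤ × ℕ) (η : FreqL2) :
    coef b i (modeEmb b j η) = if i = j then η else 0 := by
  refine ext_inner_left ℂ fun ξ => ?_
  rw [inner_coef]
  split_ifs with h
  · subst h; exact (modeEmb b i).inner_map_map ξ η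
  · rw [inner_zero_right]; exact orthogonalFamily_modeEmb h ξ η

/-- Parseval's identity for the mode decomposition; every norm below is computed through it. -/
lemma hasSum_coef (u : L2C) : HasSum (fun i => ‖coef b i u‖ ^ 2) (‖u‖ ^ 2) := by
  have h := lp.hasSum_norm (p := 2) (by simp)
    ((isHilbertSum_modeEmb (b := b)).linearIsometryEquiv u)
  have hc : ∀ i, ((isHilbertSum_modeEmb (b := b)).linearIsometryEquiv u) i = coef b i u := by
    intro i
    refine ext_inner_left ℂ fun ξ => ?_
    classical
    rw [inner_coef, ← lp.inner_single_left (𝕜 := ℂ) (G := fun _ : ℤ × ℕ => FreqL2),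
      ← (isHilbertSum_modeEmb (b := b)).linearIsometryEquiv_symm_apply_single (i := i) ξ,
      ← LinearIsometryEquiv.inner_map_map (isHilbertSum_modeEmb (b := b)).linearIsometryEquiv,
      LinearIsometryEquiv.apply_symm_apply]
  simpa [hc] using h

lemma eq_of_coef_eq {u w : L2C} (h : ∀ i, coef b i u = coef b i w) : u = w := by
  have h1 := hasSum_coef (b := b) (u - w)
  simp only [map_sub, h, sub_self, norm_zero] at h1
  have h2 := h1.unique (a₂ := 0) (by simp [hasSum_zero])
  rw [← sub_eq_zero, ← norm_eq_zero]
  simpa using h2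

end KuramotoSakaguchi
end

/-! ### Multipliers on L², complexification, and separated test functions. -/

noncomputable section
namespace KuramotoSakaguchi
open Filter Topology BoundedContinuousFunction

/-! ### Multiplication operators and complexification -/

section Mul
variable {X : Type*} [TopologicalSpace X] [MeasurableSpace X] [BorelSpace X] {μ : Measure X}

lemma memLp_bcf_mul (φ : X →ᵇ ℂ) (u : Lp ℂ 2 μ) : MemLp (fun x => φ x * u x) 2 μ := by
  refine MemLp.of_le_mul (c := ‖φ‖) (Lp.memLp u)
    (φ.continuous.measurable.aestronglyMeasurable.mul (Lp.aestronglyMeasurable u))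
    (.of_forall fun x => ?_)
  rw [norm_mul]
  gcongr
  exact φ.norm_coe_le_norm x

/-- Multiplication by a bounded continuous function on `L²`. -/
def mulCLM (φ : X →ᵇ ℂ) : Lp ℂ 2 μ →L[ℂ] Lp ℂ 2 μ :=
  LinearMap.mkContinuous
    { toFun := fun u => (memLp_bcf_mul φ u).toLp _
      map_add' := fun u w => by
        apply Lp.ext
        filter_upwards [(memLp_bcf_mul φ (u + w)).coeFn_toLp, (memLp_bcf_mul φ u).coeFn_toLp,
          (memLp_bcf_mul φ w).coeFn_toLp, Lp.coeFn_add u w,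
          Lp.coeFn_add ((memLp_bcf_mul φ u).toLp _) ((memLp_bcf_mul φ w).toLp _)] with x h1 h2 h3 h4 h5
        rw [h1, h5, Pi.add_apply, h2, h3, h4, Pi.add_apply, mul_add]
      map_smul' := fun c u => by
        apply Lp.ext
        filter_upwards [(memLp_bcf_mul φ (c • u)).coeFn_toLp, (memLp_bcf_mul φ u).coeFn_toLp,
          Lp.coeFn_smul c u, Lp.coeFn_smul c ((memLp_bcf_mul φ u).toLp _)] with x h1 h2 h3 h4
        rw [h1, RingHom.id_apply, h4, Pi.smul_apply, h2, h3, Pi.smul_apply, smul_eq_mul, smul_eq_mul]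
        ring } ‖φ‖
    (fun u => by
      refine Lp.norm_le_mul_norm_of_ae_le_mul ?_
      filter_upwards [(memLp_bcf_mul φ u).coeFn_toLp] with x hx
      change ‖((memLp_bcf_mul φ u).toLp _) x‖ ≤ _
      rw [hx, norm_mul]
      gcongr
      exact φ.norm_coe_le_norm x)

lemma coeFn_mulCLM (φ : X →ᵇ ℂ) (u : Lp ℂ 2 μ) : mulCLM φ u =ᵐ[μ] fun x => φ x * u x :=
  (memLp_bcf_mul φ u).coeFn_toLp

lemma norm_mulCLM_le (φ : X →ᵇ ℂ) (u : Lp ℂ 2 μ) {c : ℝ} (hc : ∀ x, ‖φ x‖ ≤ c) :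
    ‖mulCLM φ u‖ ≤ c * ‖u‖ := by
  refine Lp.norm_le_mul_norm_of_ae_le_mul ?_
  filter_upwards [coeFn_mulCLM φ u] with x hx
  rw [hx, norm_mul]
  gcongr
  exact hc x

lemma inner_mulCLM_mulCLM (φ ψ : X →ᵇ ℂ) (u w : Lp ℂ 2 μ) :
    inner ℂ (mulCLM φ u) (mulCLM ψ w)
      = ∫ x, (starRingEnd ℂ) (φ x * u x) * (ψ x * w x) ∂μ := by
  rw [L2.inner_def]
  refine integral_congr_ae ?_
  filter_upwards [coeFn_mulCLM φ u, coeFn_mulCLM ψ w] with x h1 h2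
  rw [h1, h2, RCLike.inner_apply, mul_comm]

/-- A uniformly bounded sequence of multipliers converging pointwise to `1` converges strongly. -/
lemma tendsto_mulCLM {φ : ℕ → X →ᵇ ℂ} {c : ℝ} (hc : ∀ n x, ‖φ n x‖ ≤ c)
    (hφ : ∀ x, Tendsto (fun n => φ n x) atTop (𝓝 1)) (u : Lp ℂ 2 μ) :
    Tendsto (fun n => mulCLM (φ n) u) atTop (𝓝 u) := by
  rw [tendsto_iff_norm_sub_tendsto_zero]
  have hsq : Tendsto (fun n => ‖mulCLM (φ n) u - u‖ ^ 2) atTop (𝓝 0) := by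
    have heq : ∀ n, ‖mulCLM (φ n) u - u‖ ^ 2 = ∫ x, ‖(φ n x - 1) * u x‖ ^ 2 ∂μ := by
      intro n
      rw [← inner_self_eq_norm_sq (𝕜 := ℂ), L2.inner_def]
      rw [integral_congr_ae (g := fun x => ((‖(φ n x - 1) * u x‖ ^ 2 : ℝ) : ℂ))]
      · rw [integral_complex_ofReal]; simp
      · filter_upwards [coeFn_mulCLM (φ n) u, Lp.coeFn_sub (mulCLM (φ n) u) u] with x h1 h2
        rw [h2, Pi.sub_apply, h1, inner_self_eq_norm_sq_to_K, ← sub_one_mul]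
        norm_cast
    simp_rw [heq]
    have hint : Integrable (fun x => ‖u x‖ ^ 2) μ :=
      (memLp_two_iff_integrable_sq_norm (Lp.aestronglyMeasurable u)).1 (Lp.memLp u)
    have := tendsto_integral_of_dominated_convergence (μ := μ)
      (F := fun n x => ‖(φ n x - 1) * u x‖ ^ 2) (f := fun _ => (0 : ℝ))
      (fun x => (c + 1) ^ 2 * ‖u x‖ ^ 2)
      (fun n => ((((φ n).continuous.sub continuous_const).measurable.aestronglyMeasurable.mul
        (Lp.aestronglyMeasurable u)).norm.pow 2)) (hint.const_mul _)
      (fun n => .of_forall fun x => by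
        rw [Real.norm_of_nonneg (by positivity), norm_mul, mul_pow]
        gcongr
        calc ‖φ n x - 1‖ ≤ ‖φ n x‖ + ‖(1 : ℂ)‖ := norm_sub_le _ _
          _ ≤ c + 1 := by simpa using hc n x)
      (.of_forall fun x => by
        have h1 : Tendsto (fun n => ‖(φ n x - 1) * u x‖ ^ 2) atTop (𝓝 (‖((1 : ℂ) - 1) * u x‖ ^ 2)) :=
          ((((hφ x).sub_const 1).mul_const _).norm.pow 2)
        simpa using h1)
    simpa using this
  have := hsq.sqrt
  simpa [Real.sqrt_sq (norm_nonneg _)] using this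

end Mul

/-- The inclusion of `L2` in its complexification. -/
def toC : L2 →L[ℝ] L2C := Complex.ofRealCLM.compLpL 2 volume

lemma coeFn_toC (u : L2) : toC u =ᵐ[volume] fun z => (u z : ℂ) :=
  Complex.ofRealCLM.coeFn_compLpL u

lemma norm_toC (u : L2) : ‖toC u‖ = ‖u‖ := by
  rw [Lp.norm_def, Lp.norm_def]
  congr 1
  refine eLpNorm_congr_norm_ae ?_
  filter_upwards [coeFn_toC u] with z hz
  rw [hz, Complex.norm_real]

/-- A real square integrable function as an element of `L²(ℝ; ℂ)`. -/
def realLp (B : ℝ → ℝ) (h : MemLp B 2) : FreqL2 := (h.ofReal (K := ℂ)).toLp _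

lemma coeFn_realLp (B : ℝ → ℝ) (h : MemLp B 2) : realLp B h =ᵐ[volume] fun v => (B v : ℂ) :=
  MemLp.coeFn_toLp _

lemma realLp_add {B B' : ℝ → ℝ} (h : MemLp B 2) (h' : MemLp B' 2)
    (h'' : MemLp (fun v => B v + B' v) 2) :
    realLp (fun v => B v + B' v) h'' = realLp B h + realLp B' h' := by
  apply Lp.ext
  filter_upwards [coeFn_realLp B h, coeFn_realLp B' h', coeFn_realLp _ h'',
    Lp.coeFn_add (realLp B h) (realLp B' h')] with v h1 h2 h3 h4
  rw [h3, h4, Pi.add_apply, h1, h2]; push_cast; rfl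

lemma realLp_const_mul {B : ℝ → ℝ} (c : ℝ) (h : MemLp B 2) (h' : MemLp (fun v => c * B v) 2) :
    realLp (fun v => c * B v) h' = (c : ℂ) • realLp B h := by
  apply Lp.ext
  filter_upwards [coeFn_realLp B h, coeFn_realLp _ h', Lp.coeFn_smul (c : ℂ) (realLp B h)]
    with v h1 h2 h3
  rw [h2, h3, Pi.smul_apply, h1]; push_cast; rfl

/-- Dominated convergence; it is applied to cutoffs and to their derivatives multiplied by Hermite
functions. -/
lemma tendsto_realLp {g : ℝ → ℝ} (hg : MemLp g 2) {x : ℕ → ℝ → ℝ} {c l : ℝ}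
    (hx : ∀ n v, |x n v| ≤ c) (hl : ∀ v, Tendsto (fun n => x n v) atTop (𝓝 l))
    (hm : ∀ n, MemLp (fun v => x n v * g v) 2) (hlg : MemLp (fun v => l * g v) 2) :
    Tendsto (fun n => realLp (fun v => x n v * g v) (hm n)) atTop (𝓝 (realLp _ hlg)) := by
  rw [tendsto_iff_norm_sub_tendsto_zero]
  have heq : ∀ n, ‖realLp (fun v => x n v * g v) (hm n) - realLp _ hlg‖ ^ 2
      = ∫ v, ((x n v - l) * g v) ^ 2 := by
    intro n
    rw [realLp, realLp, ← MemLp.toLp_sub, norm_toLp_sq]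
    congr 1; ext v
    simp only [Pi.sub_apply, RCLike.ofReal_eq_complex_ofReal]
    rw [← Complex.ofReal_sub, Complex.norm_real, Real.norm_eq_abs, sq_abs, sub_mul]
  have hint : Integrable (fun v => g v ^ 2) := (memLp_two_iff_integrable_sq hg.1).1 hg
  have hsq : Tendsto (fun n => ‖realLp (fun v => x n v * g v) (hm n) - realLp _ hlg‖ ^ 2) atTop
      (𝓝 0) := by
    simp_rw [heq]
    have := tendsto_integral_of_dominated_convergence (μ := (volume : Measure ℝ))
      (F := fun n v => ((x n v - l) * g v) ^ 2) (f := fun _ => (0 : ℝ))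
      (fun v => (c + |l|) ^ 2 * g v ^ 2)
      (fun n => by
        have h := (((hm n).sub hlg).1.pow 2)
        refine h.congr (.of_forall fun v => ?_)
        simp [sub_mul]) (hint.const_mul _)
      (fun n => .of_forall fun v => by
        rw [Real.norm_of_nonneg (by positivity), mul_pow]
        refine mul_le_mul_of_nonneg_right ?_ (sq_nonneg _)
        rw [← sq_abs]
        gcongr
        calc |x n v - l| ≤ |x n v| + |l| := abs_sub _ _
          _ ≤ c + |l| := by gcongr; exact hx n v)
      (.of_forall fun v => by
        have h1 : Tendsto (fun n => ((x n v - l) * g v) ^ 2) atTop (𝓝 (((l - l) * g v) ^ 2)) :=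
          (((hl v).sub_const l).mul_const _).pow 2
        simpa using h1)
    simpa using this
  have := hsq.sqrt
  simpa [Real.sqrt_sq (norm_nonneg _)] using this

/-! ### Separated test functions -/

/-- The real separated function `A(θ) B(ω - ν) e(ν)`. -/
def sepTest (A : Circ → ℝ) (B e : ℝ → ℝ) (z : Phase) : ℝ :=
  A z.1 * (B (z.2.1 - z.2.2) * e z.2.2)

/-- The derivative of a function on the circle. -/
def dCirc (A : Circ → ℝ) (θ : Circ) : ℝ := deriv (fun h : ℝ => A (θ + (h : Circ))) 0

lemma dTheta_sepTest (A : Circ → ℝ) (B e : ℝ → ℝ) :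
    dTheta (sepTest A B e) = sepTest (dCirc A) B e := by
  ext z
  simp only [dTheta, sepTest, dCirc]
  rw [deriv_mul_const_field]

lemma dOmega_sepTest (A : Circ → ℝ) (B e : ℝ → ℝ) :
    dOmega (sepTest A B e) = sepTest A (deriv B) e := by
  ext z
  simp only [dOmega, sepTest]
  rw [deriv_const_mul_field, deriv_mul_const_field, deriv_comp_sub_const]

lemma iterate_dOmega_sepTest (A : Circ → ℝ) (B e : ℝ → ℝ) (j : ℕ) :
    dOmega^[j] (sepTest A B e) = sepTest A (deriv^[j] B) e := by
  induction j generalizing B with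
  | zero => rfl
  | succ j ih => rw [Function.iterate_succ_apply, Function.iterate_succ_apply, dOmega_sepTest, ih]

/-- Smooth compactly supported functions on the line. -/
def IsBump (B : ℝ → ℝ) : Prop := ContDiff ℝ ((⊤ : ℕ∞) : WithTop ℕ∞) B ∧ HasCompactSupport B

lemma IsBump.deriv {B : ℝ → ℝ} (h : IsBump B) : IsBump (deriv B) :=
  ⟨((contDiff_infty_iff_deriv).1 h.1).2, h.2.deriv⟩

lemma IsBump.mul_left {B x : ℝ → ℝ} (h : IsBump B) (hx : ContDiff ℝ ((⊤ : ℕ∞) : WithTop ℕ∞) x) :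
    IsBump (fun v => x v * B v) := ⟨hx.mul h.1, h.2.mul_left⟩

lemma IsBump.memLp {B : ℝ → ℝ} (h : IsBump B) : MemLp B 2 :=
  h.1.continuous.memLp_of_hasCompactSupport h.2

open scoped Pointwise in
lemma isTest_sepTest {A : Circ → ℝ} {B e : ℝ → ℝ}
    (hA : ContDiff ℝ ((⊤ : ℕ∞) : WithTop ℕ∞) (fun x : ℝ => A x)) (hB : IsBump B) (he : IsBump e) :
    IsTest (sepTest A B e) where
  smooth := by
    have hB1 := hB.1
    have he1 := he.1
    unfold sepTest
    exact (hA.comp contDiff_fst).mul ((hB1.comp (by fun_prop)).mul (he1.comp (by fun_prop)))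
  compact := by
    -- Since ω = (ω − ν) + ν, the support in ω lies in the sum of the two compact supports.
    refine HasCompactSupport.intro (K := univ ×ˢ ((tsupport B + tsupport e) ×ˢ tsupport e))
      (isCompact_univ.prod ((hB.2.isCompact.add he.2.isCompact).prod he.2.isCompact)) ?_
    rintro ⟨θ, ω, ν⟩ hz
    simp only [mem_prod, mem_univ, true_and, not_and_or] at hz
    simp only [sepTest]
    by_cases hν : ν ∈ tsupport e
    · have : ω - ν ∉ tsupport B := fun h => by
        rcases hz with h1 | h1
        · exact h1 ⟨ω - ν, h, ν, hν, by simp⟩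
        · exact h1 hν
      rw [image_eq_zero_of_notMem_tsupport this]; simp
    · rw [image_eq_zero_of_notMem_tsupport hν]; simp

/-- The real part of the Fourier mode. -/
def cosMode (k : ℤ) (θ : Circ) : ℝ := (circMode k θ).re

/-- The imaginary part of the Fourier mode. -/
def sinMode (k : ℤ) (θ : Circ) : ℝ := (circMode k θ).im

lemma circMode_coe (k : ℤ) (x : ℝ) : circMode k (x : Circ)
    = ((Real.sqrt (2 * Real.pi))⁻¹ : ℝ) * Complex.exp ((k * x : ℝ) * Complex.I) := by
  rw [circMode, fourier_coe_apply]
  congr 2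
  have : (Real.pi : ℂ) ≠ 0 := by exact_mod_cast Real.pi_pos.ne'
  push_cast
  field_simp

lemma cosMode_coe (k : ℤ) (x : ℝ) :
    cosMode k (x : Circ) = (Real.sqrt (2 * Real.pi))⁻¹ * Real.cos (k * x) := by
  rw [cosMode, circMode_coe, Complex.re_ofReal_mul, Complex.exp_ofReal_mul_I_re]

lemma sinMode_coe (k : ℤ) (x : ℝ) :
    sinMode k (x : Circ) = (Real.sqrt (2 * Real.pi))⁻¹ * Real.sin (k * x) := by
  rw [sinMode, circMode_coe, Complex.im_ofReal_mul, Complex.exp_ofReal_mul_I_im]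

lemma contDiff_cosMode (k : ℤ) : ContDiff ℝ ((⊤ : ℕ∞) : WithTop ℕ∞) (fun x : ℝ => cosMode k x) := by
  simp_rw [cosMode_coe]; fun_prop

lemma contDiff_sinMode (k : ℤ) : ContDiff ℝ ((⊤ : ℕ∞) : WithTop ℕ∞) (fun x : ℝ => sinMode k x) := by
  simp_rw [sinMode_coe]; fun_prop

lemma dCirc_cosMode (k : ℤ) : dCirc (cosMode k) = fun θ => -(k : ℝ) * sinMode k θ := by
  ext θ
  induction θ using QuotientAddGroup.induction_on with
  | H x =>
    simp only [dCirc]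
    have : ∀ h : ℝ, cosMode k ((x : Circ) + (h : Circ))
        = (Real.sqrt (2 * Real.pi))⁻¹ * Real.cos (k * (x + h)) := fun h => by
      rw [← AddCircle.coe_add, cosMode_coe]
    rw [show (fun h : ℝ => cosMode k ((QuotientAddGroup.mk x : Circ) + (h : Circ))) = _ from
      funext this]
    have hd : HasDerivAt (fun h : ℝ => (Real.sqrt (2 * Real.pi))⁻¹ * Real.cos (k * (x + h)))
        ((Real.sqrt (2 * Real.pi))⁻¹ * (-Real.sin (k * (x + 0)) * (k * (0 + 1)))) 0 := by
      have h1 : HasDerivAt (fun h : ℝ => (k : ℝ) * (x + h)) (k * (0 + 1)) 0 := by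
        simpa using ((hasDerivAt_id (0 : ℝ)).const_add x).const_mul (k : ℝ)
      exact (h1.cos).const_mul _
    rw [hd.deriv]
    change _ = -(k : ℝ) * sinMode k (x : Circ)
    rw [sinMode_coe]; simp; ring

lemma dCirc_sinMode (k : ℤ) : dCirc (sinMode k) = fun θ => (k : ℝ) * cosMode k θ := by
  ext θ
  induction θ using QuotientAddGroup.induction_on with
  | H x =>
    simp only [dCirc]
    have : ∀ h : ℝ, sinMode k ((x : Circ) + (h : Circ))
        = (Real.sqrt (2 * Real.pi))⁻¹ * Real.sin (k * (x + h)) := fun h => by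
      rw [← AddCircle.coe_add, sinMode_coe]
    rw [show (fun h : ℝ => sinMode k ((QuotientAddGroup.mk x : Circ) + (h : Circ))) = _ from
      funext this]
    have hd : HasDerivAt (fun h : ℝ => (Real.sqrt (2 * Real.pi))⁻¹ * Real.sin (k * (x + h)))
        ((Real.sqrt (2 * Real.pi))⁻¹ * (Real.cos (k * (x + 0)) * (k * (0 + 1)))) 0 := by
      have h1 : HasDerivAt (fun h : ℝ => (k : ℝ) * (x + h)) (k * (0 + 1)) 0 := by
        simpa using ((hasDerivAt_id (0 : ℝ)).const_add x).const_mul (k : ℝ)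
      exact (h1.sin).const_mul _
    rw [hd.deriv]
    change _ = (k : ℝ) * cosMode k (x : Circ)
    rw [cosMode_coe]; simp; ring

lemma sepTest_eq_re (k : ℤ) (B e : ℝ → ℝ) (z : Phase) : sepTest (cosMode k) B e z
    = (sepFun (circMode k) (fun v => (B v : ℂ)) (fun v => (e v : ℂ)) z).re := by
  simp only [sepTest, sepFun, cosMode]
  rw [← Complex.ofReal_mul, Complex.re_mul_ofReal]

lemma sepTest_eq_im (k : ℤ) (B e : ℝ → ℝ) (z : Phase) : sepTest (sinMode k) B e z
    = (sepFun (circMode k) (fun v => (B v : ℂ)) (fun v => (e v : ℂ)) z).im := by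
  simp only [sepTest, sepFun, sinMode]
  rw [← Complex.ofReal_mul, Complex.im_mul_ofReal]

lemma memLp_sepFun_real (k : ℤ) {B e : ℝ → ℝ} (hB : MemLp B 2) (he : MemLp e 2) :
    MemLp (sepFun (circMode k) (fun v => (B v : ℂ)) (fun v => (e v : ℂ))) 2 :=
  memLp_sepFun (memLp_circMode k) (hB.ofReal (K := ℂ)) (he.ofReal (K := ℂ))

lemma memLp_sepTest_cos (k : ℤ) {B e : ℝ → ℝ} (hB : MemLp B 2) (he : MemLp e 2) :
    MemLp (sepTest (cosMode k) B e) 2 := by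
  simp_rw [funext (sepTest_eq_re k B e)]
  exact (memLp_sepFun_real k hB he).re

lemma memLp_sepTest_sin (k : ℤ) {B e : ℝ → ℝ} (hB : MemLp B 2) (he : MemLp e 2) :
    MemLp (sepTest (sinMode k) B e) 2 := by
  simp_rw [funext (sepTest_eq_im k B e)]
  exact (memLp_sepFun_real k hB he).im

/-- The pairing of a real function with a complex separated function. -/
lemma integral_mul_conj_sepFun {Y : Phase → ℝ} (k : ℤ) (B e : ℝ → ℝ)
    (hc : Integrable (fun z => Y z * sepTest (cosMode k) B e z))
    (hs : Integrable (fun z => Y z * sepTest (sinMode k) B e z)) :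
    ∫ z, (Y z : ℂ) * (starRingEnd ℂ)
        (sepFun (circMode k) (fun v => (B v : ℂ)) (fun v => (e v : ℂ)) z)
      = ((∫ z, Y z * sepTest (cosMode k) B e z : ℝ) : ℂ)
        - Complex.I * ((∫ z, Y z * sepTest (sinMode k) B e z : ℝ) : ℂ) := by
  rw [← integral_complex_ofReal, ← integral_complex_ofReal, ← integral_const_mul,
    ← integral_sub hc.ofReal (hs.ofReal.const_mul _)]
  congr 1; ext z
  rw [sepTest_eq_re, sepTest_eq_im]
  apply Complex.ext <;> simp

lemma inner_sep_toC (k : ℤ) {B e : ℝ → ℝ} (hB : MemLp B 2) (he : MemLp e 2) (u : L2) :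
    inner ℂ (sep k (realLp B hB) (realLp e he)) (toC u)
      = ∫ z, (u z : ℂ) * (starRingEnd ℂ)
        (sepFun (circMode k) (fun v => (B v : ℂ)) (fun v => (e v : ℂ)) z) := by
  rw [L2.inner_def]
  refine integral_congr_ae ?_
  filter_upwards [coeFn_sep k (realLp B hB) (realLp e he), coeFn_toC u,
    ae_velocity (coeFn_realLp B hB), ae_frequency (coeFn_realLp e he)] with z h1 h2 h3 h4
  rw [h1, h2, RCLike.inner_apply]
  simp only [sepFun, h3, h4]

/-- The weak formulation only speaks of real test functions. A complex coefficient is recovered from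
the pairings with the cosine and the sine mode. -/
lemma inner_sep_toC_eq (k : ℤ) {B e : ℝ → ℝ} (hB : MemLp B 2) (he : MemLp e 2) (u : L2) :
    inner ℂ (sep k (realLp B hB) (realLp e he)) (toC u)
      = ((∫ z, u z * sepTest (cosMode k) B e z : ℝ) : ℂ)
        - Complex.I * ((∫ z, u z * sepTest (sinMode k) B e z : ℝ) : ℂ) := by
  rw [inner_sep_toC, integral_mul_conj_sepFun]
  · exact (Lp.memLp u).integrable_mul (memLp_sepTest_cos k hB he)
  · exact (Lp.memLp u).integrable_mul (memLp_sepTest_sin k hB he)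

/-! ### Weak derivatives tested against separated functions -/

/-- Testing the derivative of order i with A′ and that of order i + 1 with A produces the same
integral of u, so the two right-hand sides agree up to sign. No integration by parts for the L²
functions is involved. -/
lemma IsWeakDeriv.sep_theta {i j : ℕ} {u w w' : L2} (h : IsWeakDeriv i j u w)
    (h' : IsWeakDeriv (i + 1) j u w') (k : ℤ) {B e : ℝ → ℝ} (hB : IsBump B) (he : IsBump e) :
    inner ℂ (sep k (realLp B hB.memLp) (realLp e he.memLp)) (toC w')
      = (k * Complex.I) * inner ℂ (sep k (realLp B hB.memLp) (realLp e he.memLp)) (toC w) := by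
  have key : ∀ A : Circ → ℝ, ContDiff ℝ ((⊤ : ℕ∞) : WithTop ℕ∞) (fun x : ℝ => A x) →
      ContDiff ℝ ((⊤ : ℕ∞) : WithTop ℕ∞) (fun x : ℝ => dCirc A x) →
      ∫ z, w' z * sepTest A B e z = -∫ z, w z * sepTest (dCirc A) B e z := by
    intro A hA hA'
    have h1 := h _ (isTest_sepTest hA' hB he)
    have h2 := h' _ (isTest_sepTest hA hB he)
    rw [Function.iterate_succ_apply, iterate_dOmega_sepTest, dTheta_sepTest] at h2
    rw [iterate_dOmega_sepTest, h2] at h1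
    have h3 : ((-1 : ℝ) ^ (i + 1 + j)) = -(-1) ^ (i + j) := by ring
    rw [h3] at h1
    have h4 : ((-1 : ℝ) ^ (i + j)) ≠ 0 := pow_ne_zero _ (by norm_num)
    refine mul_left_cancel₀ h4 ?_
    rw [mul_neg, ← h1]; ring
  rw [inner_sep_toC_eq, inner_sep_toC_eq, key _ (contDiff_cosMode k) (by
      rw [dCirc_cosMode]; exact contDiff_const.mul (contDiff_sinMode k)),
    key _ (contDiff_sinMode k) (by
      rw [dCirc_sinMode]; exact contDiff_const.mul (contDiff_cosMode k)),
    dCirc_cosMode, dCirc_sinMode]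
  have e1 : ∀ z, w z * sepTest (fun θ => -(k : ℝ) * sinMode k θ) B e z
      = -k * (w z * sepTest (sinMode k) B e z) := fun z => by simp only [sepTest]; ring
  have e2 : ∀ z, w z * sepTest (fun θ => (k : ℝ) * cosMode k θ) B e z
      = k * (w z * sepTest (cosMode k) B e z) := fun z => by simp only [sepTest]; ring
  simp_rw [e1, e2]
  rw [integral_const_mul, integral_const_mul]
  push_cast
  linear_combination ((k : ℂ) * ((∫ z, w z * sepTest (sinMode k) B e z : ℝ) : ℂ)) * Complex.I_sq

lemma IsWeakDeriv.sep_omega {i j : ℕ} {u w w' : L2} (h : IsWeakDeriv i j u w)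
    (h' : IsWeakDeriv i (j + 1) u w') (k : ℤ) {B e : ℝ → ℝ} (hB : IsBump B) (he : IsBump e) :
    inner ℂ (sep k (realLp B hB.memLp) (realLp e he.memLp)) (toC w')
      = -inner ℂ (sep k (realLp _ hB.deriv.memLp) (realLp e he.memLp)) (toC w) := by
  have key : ∀ A : Circ → ℝ, ContDiff ℝ ((⊤ : ℕ∞) : WithTop ℕ∞) (fun x : ℝ => A x) →
      ∫ z, w' z * sepTest A B e z = -∫ z, w z * sepTest A (deriv B) e z := by
    intro A hA
    have h1 := h _ (isTest_sepTest hA hB.deriv he)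
    have h2 := h' _ (isTest_sepTest hA hB he)
    rw [Function.iterate_succ_apply, dOmega_sepTest] at h2
    rw [h2] at h1
    have h3 : ((-1 : ℝ) ^ (i + (j + 1))) = -(-1) ^ (i + j) := by ring
    rw [h3] at h1
    have h4 : ((-1 : ℝ) ^ (i + j)) ≠ 0 := pow_ne_zero _ (by norm_num)
    refine mul_left_cancel₀ h4 ?_
    rw [mul_neg, ← h1]; ring
  rw [inner_sep_toC_eq, inner_sep_toC_eq, key _ (contDiff_cosMode k), key _ (contDiff_sinMode k)]
  push_cast
  ring

lemma IsWeakDeriv.sep_zero {u w : L2} (h : IsWeakDeriv 0 0 u w) (k : ℤ) {B e : ℝ → ℝ}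
    (hB : IsBump B) (he : IsBump e) :
    inner ℂ (sep k (realLp B hB.memLp) (realLp e he.memLp)) (toC w)
      = inner ℂ (sep k (realLp B hB.memLp) (realLp e he.memLp)) (toC u) := by
  rw [inner_sep_toC_eq, inner_sep_toC_eq]
  have h1 := h _ (isTest_sepTest (contDiff_cosMode k) hB he)
  have h2 := h _ (isTest_sepTest (contDiff_sinMode k) hB he)
  simp only [Function.iterate_zero, id, add_zero, pow_zero, one_mul] at h1 h2
  rw [h1, h2]

end KuramotoSakaguchi
end

/-! ### Calculus in time, cutoffs, and the action of weak derivatives on coefficients. -/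

noncomputable section
namespace KuramotoSakaguchi
open Filter Topology
open scoped BoundedContinuousFunction

/-! ### Calculus on a compact time interval -/

section Calculus
variable {E : Type*} [NormedAddCommGroup E] [NormedSpace ℝ E] [CompleteSpace E] {T : ℝ}

lemma integral_eq_sub_of_hasDerivWithinAt_Icc {Φ D : ℝ → E} (hD : ContinuousOn D (Icc 0 T))
    (h : ∀ t ∈ Icc 0 T, HasDerivWithinAt Φ (D t) (Icc 0 T) t) {s t : ℝ} (hs : 0 ≤ s) (hst : s ≤ t)
    (ht : t ≤ T) : ∫ τ in s..t, D τ = Φ t - Φ s := by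
  have hsub : Icc s t ⊆ Icc 0 T := Icc_subset_Icc hs ht
  refine intervalIntegral.integral_eq_sub_of_hasDeriv_right_of_le hst
    (fun x hx => (h x (hsub hx)).continuousWithinAt.mono hsub) (fun x hx => ?_) ?_
  · have hx' : x ∈ Ioo 0 T := ⟨hs.trans_lt hx.1, hx.2.trans_le ht⟩
    exact ((h x (Ioo_subset_Icc_self hx')).hasDerivAt (Icc_mem_nhds hx'.1 hx'.2)).hasDerivWithinAt
  · exact ((hD.mono hsub).mono (by rw [uIcc_of_le hst])).intervalIntegrable

lemma hasDerivWithinAt_Icc_of_eq_integral {Φ D : ℝ → E} (hD : ContinuousOn D (Icc 0 T))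
    (h : ∀ t ∈ Icc 0 T, Φ t = Φ 0 + ∫ τ in (0 : ℝ)..t, D τ) :
    ∀ t ∈ Icc 0 T, HasDerivWithinAt Φ (D t) (Icc 0 T) t := by
  intro t ht
  have hT : 0 ≤ T := ht.1.trans ht.2
  set D' : ℝ → E := IccExtend hT ((Icc 0 T).domRestrict D) with hD'
  have hc : Continuous D' := (continuousOn_iff_continuous_domRestrict.1 hD).Icc_extend'
  have heq : ∀ τ ∈ Icc 0 T, D' τ = D τ := fun τ hτ => by
    rw [hD', IccExtend_of_mem hT _ hτ]; rfl
  have h1 : HasDerivAt (fun t => Φ 0 + ∫ τ in (0 : ℝ)..t, D' τ) (D' t) t :=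
    (intervalIntegral.integral_hasDerivAt_right (hc.intervalIntegrable _ _)
      (hc.stronglyMeasurableAtFilter _ _) hc.continuousAt).const_add _
  rw [← heq t ht]
  refine h1.hasDerivWithinAt.congr_of_mem (fun x hx => ?_) ht
  rw [h x hx]
  congr 1
  refine intervalIntegral.integral_congr fun τ hτ => (heq τ ?_).symm
  rw [uIcc_of_le hx.1] at hτ
  exact ⟨hτ.1, hτ.2.trans hx.2⟩

/-- The derivatives are jointly continuous in parameter and time, so on the compact interval they
converge uniformly along the sequence. The integrated identity then passes to the limit and is
differentiated again. It replaces compactly supported test functions by Hermite functions. -/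
lemma hasDerivWithinAt_Icc_of_tendsto {P : Type*} [TopologicalSpace P] {Φ D : P → ℝ → E}
    {x : ℕ → P} {y : P} (hx : Tendsto x atTop (𝓝 y))
    (hD : ContinuousOn (Function.uncurry D) (univ ×ˢ Icc 0 T))
    (hΦ : ∀ t ∈ Icc 0 T, Tendsto (fun n => Φ (x n) t) atTop (𝓝 (Φ y t)))
    (h : ∀ n, ∀ t ∈ Icc 0 T, HasDerivWithinAt (Φ (x n)) (D (x n) t) (Icc 0 T) t) :
    ∀ t ∈ Icc 0 T, HasDerivWithinAt (Φ y) (D y t) (Icc 0 T) t := by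
  have hDc : ∀ p, ContinuousOn (D p) (Icc 0 T) := fun p =>
    hD.comp (f := fun t => (p, t)) (by fun_prop) (fun t ht => ⟨mem_univ _, ht⟩)
  refine hasDerivWithinAt_Icc_of_eq_integral (hDc y) fun t ht => ?_
  have h1 : Tendsto (fun n => Φ (x n) t - Φ (x n) 0) atTop (𝓝 (Φ y t - Φ y 0)) :=
    (hΦ t ht).sub (hΦ 0 ⟨le_rfl, ht.1.trans ht.2⟩)
  have h2 : Tendsto (fun n => ∫ τ in (0 : ℝ)..t, D (x n) τ) atTop
      (𝓝 (∫ τ in (0 : ℝ)..t, D y τ)) := by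
    rw [Metric.tendsto_nhds]
    intro ε hε
    have hpos : 0 < ε / (t + 1) := div_pos hε (by linarith [ht.1])
    -- A tube-lemma argument: one neighbourhood of y makes D uniformly close to `D y` on all of
    -- [0,T]. The tolerance ε/(t + 1) also covers t = 0.
    obtain ⟨v, hv, hv'⟩ := isCompact_Icc.mem_uniformity_of_prod hD (mem_univ y)
      (Metric.dist_mem_uniformity hpos)
    rw [nhdsWithin_univ] at hv
    filter_upwards [hx hv] with n hn
    have hi : ∀ p, IntervalIntegrable (D p) volume 0 t := fun p =>
      ((hDc p).mono (by rw [uIcc_of_le ht.1]; exact Icc_subset_Icc_right ht.2)).intervalIntegrable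
    rw [dist_eq_norm, ← intervalIntegral.integral_sub (hi _) (hi _)]
    refine (intervalIntegral.norm_integral_le_of_norm_le_const (C := ε / (t + 1))
      fun τ hτ => ?_).trans_lt ?_
    · rw [uIoc_of_le ht.1] at hτ
      have := hv' _ hn τ ⟨hτ.1.le, hτ.2.trans ht.2⟩
      rw [← dist_eq_norm]
      exact (le_of_lt this)
    · rw [sub_zero, abs_of_nonneg ht.1, div_mul_eq_mul_div, div_lt_iff₀ (by linarith [ht.1])]
      nlinarith [ht.1]
  have h3 : ∀ n, ∫ τ in (0 : ℝ)..t, D (x n) τ = Φ (x n) t - Φ (x n) 0 := fun n =>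
    integral_eq_sub_of_hasDerivWithinAt_Icc (hDc _) (h n) le_rfl ht.1 ht.2
  simp_rw [h3] at h2
  rw [tendsto_nhds_unique h2 h1]
  abel

end Calculus

/-! ### Cutoffs -/

/-- A fixed bump function on the line. -/
def bumpZero : ContDiffBump (0 : ℝ) := ⟨1, 2, one_pos, one_lt_two⟩

/-- The cutoff at scale `R + 1`. -/
def cutoff (R : ℕ) (v : ℝ) : ℝ := bumpZero (v / (R + 1))

lemma cutoff_mem (R : ℕ) (v : ℝ) : 0 ≤ cutoff R v ∧ cutoff R v ≤ 1 :=
  ⟨bumpZero.nonneg, bumpZero.le_one⟩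

lemma abs_cutoff_le (R : ℕ) (v : ℝ) : |cutoff R v| ≤ 1 := by
  rw [abs_of_nonneg (cutoff_mem R v).1]; exact (cutoff_mem R v).2

lemma isBump_bumpZero : IsBump bumpZero := ⟨bumpZero.contDiff, bumpZero.hasCompactSupport⟩

lemma isBump_comp_div {B : ℝ → ℝ} (h : IsBump B) (R : ℕ) :
    IsBump (fun v => B (v / ((R : ℝ) + 1))) := by
  refine ⟨h.1.comp (contDiff_id.div_const _), ?_⟩
  have hR : (R : ℝ) + 1 ≠ 0 := by positivity
  have := h.2.comp_homeomorph (Homeomorph.mulRight₀ ((R : ℝ) + 1)⁻¹ (inv_ne_zero hR))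
  exact this

lemma isBump_cutoff (R : ℕ) : IsBump (cutoff R) := isBump_comp_div isBump_bumpZero R

lemma tendsto_cutoff (v : ℝ) : Tendsto (fun R => cutoff R v) atTop (𝓝 1) := by
  refine tendsto_const_nhds.congr' ?_
  obtain ⟨N, hN⟩ := exists_nat_ge |v|
  filter_upwards [eventually_ge_atTop N] with R hR
  refine (bumpZero.one_of_mem_closedBall ?_).symm
  rw [mem_closedBall_zero_iff, Real.norm_eq_abs, abs_div, abs_of_pos (by positivity : (0 : ℝ) < R + 1)]
  change _ ≤ (1 : ℝ)
  rw [div_le_one (by positivity)]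
  have : (N : ℝ) ≤ R := by exact_mod_cast hR
  linarith

lemma hasDerivAt_comp_div {B : ℝ → ℝ} (h : IsBump B) (R : ℕ) (v : ℝ) :
    HasDerivAt (fun v => B (v / ((R : ℝ) + 1)))
      (((R : ℝ) + 1)⁻¹ * deriv B (v / ((R : ℝ) + 1))) v := by
  have h1 : HasDerivAt B (deriv B (v / ((R : ℝ) + 1))) (v / ((R : ℝ) + 1)) :=
    (h.1.differentiable (by simp)).differentiableAt.hasDerivAt
  have h2 := HasDerivAt.comp (h₂ := B) v h1 ((hasDerivAt_id v).div_const ((R : ℝ) + 1))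
  refine h2.congr_deriv ?_
  rw [mul_comm, one_div]

/-- The derivative of the cutoff. -/
def cutoffD (R : ℕ) (v : ℝ) : ℝ := ((R : ℝ) + 1)⁻¹ * deriv bumpZero (v / ((R : ℝ) + 1))

/-- The second derivative of the cutoff. -/
def cutoffDD (R : ℕ) (v : ℝ) : ℝ :=
  ((R : ℝ) + 1)⁻¹ * (((R : ℝ) + 1)⁻¹ * deriv (deriv bumpZero) (v / ((R : ℝ) + 1)))

lemma hasDerivAt_cutoff (R : ℕ) (v : ℝ) : HasDerivAt (cutoff R) (cutoffD R v) v :=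
  hasDerivAt_comp_div isBump_bumpZero R v

lemma hasDerivAt_cutoffD (R : ℕ) (v : ℝ) : HasDerivAt (cutoffD R) (cutoffDD R v) v :=
  (hasDerivAt_comp_div isBump_bumpZero.deriv R v).const_mul _

lemma tendsto_inv_nat_add_one : Tendsto (fun R : ℕ => ((R : ℝ) + 1)⁻¹) atTop (𝓝 0) :=
  tendsto_inv_atTop_zero.comp (tendsto_atTop_add_const_right _ _ tendsto_natCast_atTop_atTop)

lemma inv_nat_add_one_le (R : ℕ) : ((R : ℝ) + 1)⁻¹ ≤ 1 := by
  refine inv_le_one_of_one_le₀ ?_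
  have : (0 : ℝ) ≤ R := by positivity
  linarith

lemma IsBump.exists_bound {B : ℝ → ℝ} (h : IsBump B) : ∃ C, ∀ v, |B v| ≤ C :=
  h.2.exists_bound_of_continuous h.1.continuous

/-- Each derivative of the cutoff at scale R + 1 gains a factor 1/(R + 1), so the terms in which the
cutoff is differentiated disappear in the limit. -/
lemma exists_bound_cutoffD : ∃ C, (∀ R v, |cutoffD R v| ≤ C) ∧
    (∀ v, Tendsto (fun R => cutoffD R v) atTop (𝓝 0)) := by
  obtain ⟨C, hC⟩ := isBump_bumpZero.deriv.exists_bound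
  have hb : ∀ R v, |cutoffD R v| ≤ ((R : ℝ) + 1)⁻¹ * C := fun R v => by
    rw [cutoffD, abs_mul, abs_of_nonneg (by positivity : (0 : ℝ) ≤ ((R : ℝ) + 1)⁻¹)]
    gcongr; exact hC _
  have hC0 : 0 ≤ C := (abs_nonneg _).trans (hC 0)
  refine ⟨C, fun R v => (hb R v).trans ?_, fun v => ?_⟩
  · exact mul_le_of_le_one_left hC0 (inv_nat_add_one_le R)
  · refine squeeze_zero_norm (fun R => hb R v) ?_
    simpa using tendsto_inv_nat_add_one.mul_const C

lemma exists_bound_cutoffDD : ∃ C, (∀ R v, |cutoffDD R v| ≤ C) ∧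
    (∀ v, Tendsto (fun R => cutoffDD R v) atTop (𝓝 0)) := by
  obtain ⟨C, hC⟩ := isBump_bumpZero.deriv.deriv.exists_bound
  have hC0 : 0 ≤ C := (abs_nonneg _).trans (hC 0)
  have hb : ∀ R v, |cutoffDD R v| ≤ ((R : ℝ) + 1)⁻¹ * C := fun R v => by
    have h0 : (0 : ℝ) ≤ ((R : ℝ) + 1)⁻¹ := by positivity
    rw [cutoffDD, abs_mul, abs_mul, abs_of_nonneg h0]
    refine mul_le_mul_of_nonneg_left ?_ h0
    exact (mul_le_of_le_one_left (abs_nonneg _) (inv_nat_add_one_le R)).trans (hC _)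
  refine ⟨C, fun R v => (hb R v).trans ?_, fun v => ?_⟩
  · exact mul_le_of_le_one_left hC0 (inv_nat_add_one_le R)
  · refine squeeze_zero_norm (fun R => hb R v) ?_
    simpa using tendsto_inv_nat_add_one.mul_const C

section PolyGaussLp
open Polynomial
variable {b : ℝ} [hb : Fact (0 < b)]

variable (b) in
/-- Differentiation of `polyGauss` on the level of polynomials. -/
def derivPoly (p : ℝ[X]) : ℝ[X] := C b⁻¹ * (derivative p - C (1 / 2) * (X * p))

variable (b) in
/-- `polyGauss b p` as an element of `L²(ℝ; ℂ)`. -/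
def polyLp (p : ℝ[X]) : FreqL2 := realLp (polyGauss b p) (memLp_polyGauss hb.out p)

lemma hermiteLp_eq (n : ℕ) : hermiteLp b n = polyLp b (hermitePoly n) := rfl

lemma polyLp_add (p q : ℝ[X]) : polyLp b (p + q) = polyLp b p + polyLp b q := by
  rw [polyLp, polyLp, polyLp, ← realLp_add (memLp_polyGauss hb.out p) (memLp_polyGauss hb.out q)
    ((memLp_polyGauss hb.out p).add (memLp_polyGauss hb.out q))]
  congr 1; ext v; exact polyGauss_add b p q v

lemma polyLp_C_mul (c : ℝ) (p : ℝ[X]) : polyLp b (C c * p) = (c : ℂ) • polyLp b p := by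
  rw [polyLp, polyLp, ← realLp_const_mul c (memLp_polyGauss hb.out p)
    ((memLp_polyGauss hb.out p).const_mul c)]
  congr 1; ext v; exact polyGauss_C_mul b c p v

/-- The truncation of `polyGauss`. -/
def cutPoly (b : ℝ) (R : ℕ) (p : ℝ[X]) (v : ℝ) : ℝ := cutoff R v * polyGauss b p v

lemma isBump_cutPoly (b : ℝ) (R : ℕ) (p : ℝ[X]) : IsBump (cutPoly b R p) :=
  ⟨(isBump_cutoff R).1.mul (contDiff_polyGauss b p), (isBump_cutoff R).2.mul_right⟩

lemma deriv_cutPoly (R : ℕ) (p : ℝ[X]) : deriv (cutPoly b R p) =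
    fun v => cutoffD R v * polyGauss b p v + cutoff R v * polyGauss b (derivPoly b p) v := by
  ext v
  exact ((hasDerivAt_cutoff R v).fun_mul (hasDerivAt_polyGauss hb.out p v)).deriv

lemma deriv_deriv_cutPoly (R : ℕ) (p : ℝ[X]) : deriv (deriv (cutPoly b R p)) =
    fun v => (cutoffDD R v * polyGauss b p v + cutoffD R v * polyGauss b (derivPoly b p) v) +
      (cutoffD R v * polyGauss b (derivPoly b p) v +
        cutoff R v * polyGauss b (derivPoly b (derivPoly b p)) v) := by
  rw [deriv_cutPoly]
  ext v
  exact (((hasDerivAt_cutoffD R v).fun_mul (hasDerivAt_polyGauss hb.out p v)).fun_add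
    ((hasDerivAt_cutoff R v).fun_mul (hasDerivAt_polyGauss hb.out (derivPoly b p) v))).deriv

lemma memLp_bdd_mul_polyGauss {x : ℝ → ℝ} (hx : Continuous x) {c : ℝ} (hc : ∀ v, |x v| ≤ c)
    (p : ℝ[X]) : MemLp (fun v => x v * polyGauss b p v) 2 := by
  refine MemLp.of_le_mul (c := c) (memLp_polyGauss hb.out p)
    (hx.mul (continuous_polyGauss b p)).aestronglyMeasurable (.of_forall fun v => ?_)
  rw [norm_mul]; gcongr; exact hc v

lemma continuous_cutoff (R : ℕ) : Continuous (cutoff R) := (isBump_cutoff R).1.continuous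

lemma continuous_cutoffD (R : ℕ) : Continuous (cutoffD R) :=
  continuous_const.mul (isBump_comp_div isBump_bumpZero.deriv R).1.continuous

lemma continuous_cutoffDD (R : ℕ) : Continuous (cutoffDD R) :=
  continuous_const.mul (continuous_const.mul
    (isBump_comp_div isBump_bumpZero.deriv.deriv R).1.continuous)

lemma tendsto_cutPoly (p : ℝ[X]) :
    Tendsto (fun R => realLp (cutPoly b R p) (isBump_cutPoly b R p).memLp) atTop
      (𝓝 (polyLp b p)) := by
  have := tendsto_realLp (memLp_polyGauss hb.out p) abs_cutoff_le tendsto_cutoff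
    (fun R => memLp_bdd_mul_polyGauss (continuous_cutoff R) (abs_cutoff_le R) p)
    (by simpa using memLp_polyGauss hb.out p)
  simp only [one_mul] at this
  exact this

lemma tendsto_mul_polyGauss_zero {x : ℕ → ℝ → ℝ} {c : ℝ} (hc : ∀ R v, |x R v| ≤ c)
    (h0 : ∀ v, Tendsto (fun R => x R v) atTop (𝓝 0)) (hx : ∀ R, Continuous (x R)) (p : ℝ[X]) :
    Tendsto (fun R => realLp (fun v => x R v * polyGauss b p v)
      (memLp_bdd_mul_polyGauss (hx R) (hc R) p)) atTop (𝓝 0) := by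
  have := tendsto_realLp (memLp_polyGauss hb.out p) hc h0
    (fun R => memLp_bdd_mul_polyGauss (hx R) (hc R) p) (by simp)
  have e : realLp (fun v => (0 : ℝ) * polyGauss b p v) (by simp) = 0 := by
    rw [realLp_const_mul 0 (memLp_polyGauss hb.out p)]; simp
  rwa [e] at this

/-- Hermite functions are not compactly supported. Their truncations are admissible, and together
with their derivatives they converge in L² to the untruncated functions. -/
lemma tendsto_deriv_cutPoly (p : ℝ[X]) :
    Tendsto (fun R => realLp (deriv (cutPoly b R p)) (isBump_cutPoly b R p).deriv.memLp) atTop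
      (𝓝 (polyLp b (derivPoly b p))) := by
  obtain ⟨C, hC, h0⟩ := exists_bound_cutoffD
  have h1 := (tendsto_mul_polyGauss_zero (b := b) hC h0 continuous_cutoffD p).add
    (tendsto_cutPoly (b := b) (derivPoly b p))
  rw [zero_add] at h1
  refine h1.congr fun R => ?_
  rw [← realLp_add _ _ (by
    have := (isBump_cutPoly b R p).deriv.memLp
    rwa [deriv_cutPoly] at this)]
  congr 1
  rw [deriv_cutPoly]; rfl

lemma tendsto_deriv_deriv_cutPoly (p : ℝ[X]) :
    Tendsto (fun R => realLp (deriv (deriv (cutPoly b R p))) (isBump_cutPoly b R p).deriv.deriv.memLp)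
      atTop (𝓝 (polyLp b (derivPoly b (derivPoly b p)))) := by
  obtain ⟨C, hC, h0⟩ := exists_bound_cutoffD
  obtain ⟨C', hC', h0'⟩ := exists_bound_cutoffDD
  have h1 := ((tendsto_mul_polyGauss_zero (b := b) hC' h0' continuous_cutoffDD p).add
    (tendsto_mul_polyGauss_zero (b := b) hC h0 continuous_cutoffD (derivPoly b p))).add
    ((tendsto_mul_polyGauss_zero (b := b) hC h0 continuous_cutoffD (derivPoly b p)).add
    (tendsto_cutPoly (b := b) (derivPoly b (derivPoly b p))))
  simp only [zero_add] at h1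
  refine h1.congr fun R => ?_
  have m1 := memLp_bdd_mul_polyGauss (b := b) (continuous_cutoffDD R) (hC' R) p
  have m2 := memLp_bdd_mul_polyGauss (b := b) (continuous_cutoffD R) (hC R) (derivPoly b p)
  have m3 := memLp_bdd_mul_polyGauss (b := b) (continuous_cutoff R) (abs_cutoff_le R)
    (derivPoly b (derivPoly b p))
  change realLp _ m1 + realLp _ m2 + (realLp _ m2 + realLp (fun v => cutoff R v *
    polyGauss b (derivPoly b (derivPoly b p)) v) m3) = _
  have m4 : MemLp (fun v => cutoffDD R v * polyGauss b p v +
    cutoffD R v * polyGauss b (derivPoly b p) v) 2 := m1.add m2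
  have m5 : MemLp (fun v => cutoffD R v * polyGauss b (derivPoly b p) v +
    cutoff R v * polyGauss b (derivPoly b (derivPoly b p)) v) 2 := m2.add m3
  rw [← realLp_add _ _ m4, ← realLp_add _ _ m5, ← realLp_add m4 m5 (m4.add m5)]
  congr 1
  rw [deriv_deriv_cutPoly]

/-! ### Relations between the coefficients of weak derivatives -/

lemma tendsto_inner_sep {x : ℕ → FreqL2} {y : FreqL2} (h : Tendsto x atTop (𝓝 y)) (k : ℤ)
    (η : FreqL2) (u : L2C) :
    Tendsto (fun n => inner ℂ (sep k (x n) η) u) atTop (𝓝 (inner ℂ (sep k y η) u)) := by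
  have hc : Continuous (fun x => inner ℂ (sepCLM k x η) u) := by fun_prop
  exact (hc.tendsto y).comp h

/-- Complex test functions are dense in L², and their real and imaginary parts are real test
functions. -/
lemma freqL2_ext_bump {x y : FreqL2}
    (h : ∀ (e : ℝ → ℝ) (he : IsBump e), inner ℂ (realLp e he.memLp) x = inner ℂ (realLp e he.memLp) y) :
    x = y := by
  refine ext_inner_left ℂ fun η => ?_
  have hd := Lp.dense_hasCompactSupport_contDiff (E := ℝ) (F := ℂ) (μ := volume) (p := 2) (by simp)
  refine hd.induction (P := fun η : FreqL2 => inner ℂ η x = inner ℂ η y) ?_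
    (isClosed_eq (by fun_prop) (by fun_prop)) η
  rintro η ⟨e, he, hec, hes⟩
  have hre : IsBump (fun v => (e v).re) :=
    ⟨Complex.reCLM.contDiff.comp hes, hec.comp_left (g := Complex.re) (by simp)⟩
  have him : IsBump (fun v => (e v).im) :=
    ⟨Complex.imCLM.contDiff.comp hes, hec.comp_left (g := Complex.im) (by simp)⟩
  have hη : η = realLp _ hre.memLp + Complex.I • realLp _ him.memLp := by
    apply Lp.ext
    filter_upwards [he, coeFn_realLp _ hre.memLp, coeFn_realLp _ him.memLp,
      Lp.coeFn_add (realLp _ hre.memLp) (Complex.I • realLp _ him.memLp),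
      Lp.coeFn_smul Complex.I (realLp _ him.memLp)] with v h1 h2 h3 h4 h5
    rw [h1, h4, Pi.add_apply, h2, h5, Pi.smul_apply, h3, smul_eq_mul, mul_comm]
    exact (Complex.re_add_im _).symm
  rw [hη, inner_add_left, inner_add_left, inner_smul_left, inner_smul_left, h _ hre, h _ him]

/-- The identity holds for truncated Hermite functions; both sides are continuous in the L² velocity
profile. -/
lemma IsWeakDeriv.coef_theta {i j : ℕ} {u w w' : L2} (h : IsWeakDeriv i j u w)
    (h' : IsWeakDeriv (i + 1) j u w') (k : ℤ) (n : ℕ) :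
    coef b (k, n) (toC w') = (k * Complex.I) • coef b (k, n) (toC w) := by
  refine freqL2_ext_bump fun e he => ?_
  rw [inner_smul_right, inner_coef, inner_coef, modeEmb_apply, hermiteLp_eq]
  refine tendsto_nhds_unique (tendsto_inner_sep (tendsto_cutPoly (hermitePoly n)) k _ _) ?_
  simp_rw [fun R => h.sep_theta h' k (isBump_cutPoly b R (hermitePoly n)) he]
  exact (tendsto_inner_sep (tendsto_cutPoly (hermitePoly n)) k _ _).const_mul _

lemma IsWeakDeriv.coef_zero {u w : L2} (h : IsWeakDeriv 0 0 u w) : w = u := by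
  have h1 : toC w = toC u := by
    -- The statement does not involve b; any scale gives a total family of modes.
    have : Fact ((0 : ℝ) < 1) := ⟨one_pos⟩
    refine eq_of_coef_eq (b := 1) ?_
    rintro ⟨k, n⟩
    refine freqL2_ext_bump fun e he => ?_
    rw [inner_coef, inner_coef, modeEmb_apply, hermiteLp_eq]
    refine tendsto_nhds_unique (tendsto_inner_sep (tendsto_cutPoly (hermitePoly n)) k _ _) ?_
    simp_rw [fun R => h.sep_zero k (isBump_cutPoly 1 R (hermitePoly n)) he]
    exact (tendsto_inner_sep (tendsto_cutPoly (hermitePoly n)) k _ _)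
  have h2 := norm_toC (w - u)
  rw [map_sub, h1, sub_self, norm_zero] at h2
  exact sub_eq_zero.1 (norm_eq_zero.1 h2.symm)

/-- This is ∂_v = (a − a*)/(2b): half of the lowering operator is cancelled by the derivative of the
Gaussian factor. -/
lemma derivPoly_hermitePoly (n : ℕ) : derivPoly b (hermitePoly n) =
    C (-(Real.sqrt (n + 1) / (2 * b))) * hermitePoly (n + 1) +
      C (Real.sqrt n / (2 * b)) * hermitePoly (n - 1) := by
  have hb0 : b ≠ 0 := hb.out.ne'
  rw [derivPoly, X_mul_hermitePoly, derivative_hermitePoly]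
  have e1 : (C (-(Real.sqrt (n + 1) / (2 * b))) : ℝ[X])
      = -(C b⁻¹ * C (1 / 2) * C (Real.sqrt (n + 1))) := by
    rw [← C_mul, ← C_mul, ← C_neg]; congr 1; field_simp
  have e2 : (C (Real.sqrt n / (2 * b)) : ℝ[X]) = C b⁻¹ * C (Real.sqrt n)
      - C b⁻¹ * C (1 / 2) * C (Real.sqrt n) := by
    rw [← C_mul, ← C_mul, ← C_mul, ← C_sub]; congr 1; field_simp; ring
  rw [e1, e2]; ring

lemma sep_add_left (k : ℤ) (x y η : FreqL2) : sep k (x + y) η = sep k x η + sep k y η := by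
  simp only [← sepCLM_apply, map_add, add_apply]

lemma sep_smul_left (k : ℤ) (c : ℂ) (x η : FreqL2) : sep k (c • x) η = c • sep k x η := by
  simp only [← sepCLM_apply, map_smul, smul_apply]

lemma inner_sep_derivPoly (k : ℤ) (n : ℕ) (η : FreqL2) (u : L2C) :
    inner ℂ (sep k (polyLp b (derivPoly b (hermitePoly n))) η) u =
      inner ℂ η (-((1 / (2 * b) : ℝ) : ℂ) • (((Real.sqrt (n + 1) : ℝ) : ℂ) • coef b (k, n + 1) u
        - ((Real.sqrt n : ℝ) : ℂ) • coef b (k, n - 1) u)) := by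
  rw [derivPoly_hermitePoly, polyLp_add, polyLp_C_mul, polyLp_C_mul, sep_add_left, sep_smul_left,
    sep_smul_left, inner_add_left, inner_smul_left, inner_smul_left, ← hermiteLp_eq,
    ← hermiteLp_eq, ← modeEmb_apply (b := b) (k, n + 1), ← modeEmb_apply (b := b) (k, n - 1),
    ← inner_coef, ← inner_coef]
  simp only [inner_smul_right, inner_sub_right, Complex.conj_ofReal]
  push_cast
  ring

/-- Integration by parts turns −∂_v of the n-th Hermite function into its two neighbours, which are
then read as coefficients of w. -/
lemma IsWeakDeriv.coef_omega {i j : ℕ} {u w w' : L2} (h : IsWeakDeriv i j u w)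
    (h' : IsWeakDeriv i (j + 1) u w') (k : ℤ) (n : ℕ) :
    coef b (k, n) (toC w') = ((1 / (2 * b) : ℝ) : ℂ) •
      (((Real.sqrt (n + 1) : ℝ) : ℂ) • coef b (k, n + 1) (toC w)
        - ((Real.sqrt n : ℝ) : ℂ) • coef b (k, n - 1) (toC w)) := by
  refine freqL2_ext_bump fun e he => ?_
  rw [inner_coef, modeEmb_apply, hermiteLp_eq]
  refine tendsto_nhds_unique (tendsto_inner_sep (tendsto_cutPoly (hermitePoly n)) k _ _) ?_
  simp_rw [fun R => h.sep_omega h' k (isBump_cutPoly b R (hermitePoly n)) he]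
  have := (tendsto_inner_sep (tendsto_deriv_cutPoly (b := b) (hermitePoly n)) k (realLp e he.memLp)
    (toC w)).neg
  rw [inner_sep_derivPoly, ← inner_neg_right, ← neg_smul, neg_neg] at this
  exact this

end PolyGaussLp

end KuramotoSakaguchi
end

/-! ### The mean field, the Maxwellian, and L₀ on separated functions. -/

noncomputable section
namespace KuramotoSakaguchi
open Filter Topology
open scoped BoundedContinuousFunction

/-! ### Multiplication by Fourier modes and by the order function -/

/-- `e^{ilθ}` as a bounded function on phase space. -/
def fourierBCF (l : ℤ) : Phase →ᵇ ℂ :=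
  BoundedContinuousFunction.ofNormedAddCommGroup (fun z => fourier l z.1)
    ((fourier l).continuous.comp continuous_fst) 1 (fun z => by
      rw [fourier_apply, Circle.norm_coe])

/-- Multiplication by `e^{ilθ}`. -/
def shiftC (l : ℤ) : L2C →L[ℂ] L2C := mulCLM (fourierBCF l)

lemma coeFn_shiftC (l : ℤ) (u : L2C) : shiftC l u =ᵐ[volume] fun z => fourier l z.1 * u z :=
  coeFn_mulCLM _ _

lemma norm_shiftC_le (l : ℤ) (u : L2C) : ‖shiftC l u‖ ≤ ‖u‖ := by
  rw [← one_mul ‖u‖]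
  refine norm_mulCLM_le (fourierBCF l) u fun z => ?_
  change ‖(fourier l z.1 : ℂ)‖ ≤ 1
  rw [fourier_apply, Circle.norm_coe]

lemma circMode_mul_fourier (k l : ℤ) (θ : Circ) : (starRingEnd ℂ) (circMode k θ) * fourier l θ
    = (starRingEnd ℂ) (circMode (k - l) θ) := by
  rw [conj_circMode, conj_circMode, circMode, circMode, mul_assoc, ← fourier_add,
    show -(k - l) = -k + l by ring]

lemma inner_sep_shiftC (k l : ℤ) (H η : FreqL2) (u : L2C) :
    inner ℂ (sep k H η) (shiftC l u) = inner ℂ (sep (k - l) H η) u := by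
  rw [L2.inner_def, L2.inner_def]
  refine integral_congr_ae ?_
  filter_upwards [coeFn_sep k H η, coeFn_sep (k - l) H η, coeFn_shiftC l u] with z h1 h2 h3
  rw [h1, h2, h3, RCLike.inner_apply, RCLike.inner_apply, sepFun, sepFun]
  simp only [map_mul]
  rw [← circMode_mul_fourier k l]
  ring

section
variable {b : ℝ} [hb : Fact (0 < b)]

lemma coef_shiftC (k l : ℤ) (n : ℕ) (u : L2C) : coef b (k, n) (shiftC l u) = coef b (k - l, n) u := by
  refine ext_inner_left ℂ fun η => ?_
  rw [inner_coef, inner_coef, modeEmb_apply, modeEmb_apply, inner_sep_shiftC]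

end

/-- Multiplication by `(Z e^{-iθ} - conj Z e^{iθ}) / 2i`. -/
def orderMul (Z : ℂ) : L2C →L[ℂ] L2C :=
  (Z / (2 * Complex.I)) • shiftC (-1) - ((starRingEnd ℂ) Z / (2 * Complex.I)) • shiftC 1

lemma orderMul_apply (Z : ℂ) (u : L2C) : orderMul Z u = (Z / (2 * Complex.I)) • shiftC (-1) u
    - ((starRingEnd ℂ) Z / (2 * Complex.I)) • shiftC 1 u := rfl

lemma norm_orderMul_le (Z : ℂ) (u : L2C) : ‖orderMul Z u‖ ≤ ‖Z‖ * ‖u‖ := by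
  rw [orderMul_apply]
  have h1 : ‖Z / (2 * Complex.I)‖ = ‖Z‖ / 2 := by simp
  have h2 : ‖(starRingEnd ℂ) Z / (2 * Complex.I)‖ = ‖Z‖ / 2 := by simp
  refine (norm_sub_le _ _).trans ?_
  rw [norm_smul, norm_smul, h1, h2]
  have := mul_le_mul_of_nonneg_left (norm_shiftC_le (-1) u) (by positivity : 0 ≤ ‖Z‖ / 2)
  have := mul_le_mul_of_nonneg_left (norm_shiftC_le 1 u) (by positivity : 0 ≤ ‖Z‖ / 2)
  linarith

/-- The order function with complex order parameter `Z`. -/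
def orderFun (Z : ℂ) (θ : Circ) : ℝ := ((starRingEnd ℂ) (fourier 1 θ) * Z).im

lemma continuous_orderFun (Z : ℂ) : Continuous (orderFun Z) := by
  unfold orderFun
  exact Complex.continuous_im.comp ((Complex.continuous_conj.comp (fourier 1).continuous).mul
    continuous_const)

lemma abs_orderFun_le (Z : ℂ) (θ : Circ) : |orderFun Z θ| ≤ ‖Z‖ := by
  refine (Complex.abs_im_le_norm _).trans ?_
  rw [norm_mul, RCLike.norm_conj, fourier_apply, Circle.norm_coe, one_mul]

/-- The mean field contains only the modes ±1, so multiplication by it shifts k by one and leaves n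
unchanged. -/
lemma orderFun_eq (Z : ℂ) (θ : Circ) : (orderFun Z θ : ℂ)
    = Z / (2 * Complex.I) * fourier (-1) θ - (starRingEnd ℂ) Z / (2 * Complex.I) * fourier 1 θ := by
  rw [orderFun, Complex.im_eq_sub_conj, map_mul, Complex.conj_conj, fourier_neg]
  field_simp

lemma coeFn_orderMul (Z : ℂ) (u : L2C) :
    orderMul Z u =ᵐ[volume] fun z => (orderFun Z z.1 : ℂ) * u z := by
  rw [orderMul_apply]
  filter_upwards [Lp.coeFn_sub ((Z / (2 * Complex.I)) • shiftC (-1) u)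
    (((starRingEnd ℂ) Z / (2 * Complex.I)) • shiftC 1 u),
    Lp.coeFn_smul (Z / (2 * Complex.I)) (shiftC (-1) u),
    Lp.coeFn_smul ((starRingEnd ℂ) Z / (2 * Complex.I)) (shiftC 1 u),
    coeFn_shiftC (-1) u, coeFn_shiftC 1 u] with z h1 h2 h3 h4 h5
  rw [h1, Pi.sub_apply, h2, h3, Pi.smul_apply, Pi.smul_apply, h4, h5, orderFun_eq]
  simp only [smul_eq_mul]
  ring

/-- The product with the mean field is needed as a real element of L², since only such elements can
be paired with real test functions. -/
lemma exists_orderMul_toC (Z : ℂ) (Y : L2) : ∃ Y' : L2,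
    (Y' =ᵐ[volume] fun z => orderFun Z z.1 * Y z) ∧ toC Y' = orderMul Z (toC Y) := by
  have hm : MemLp (fun z : Phase => orderFun Z z.1 * Y z) 2 := by
    refine MemLp.of_le_mul (c := ‖Z‖) (Lp.memLp Y)
      (((continuous_orderFun Z).comp continuous_fst).aestronglyMeasurable.mul
        (Lp.aestronglyMeasurable Y)) (.of_forall fun z => ?_)
    rw [norm_mul]; gcongr; exact abs_orderFun_le _ _
  refine ⟨hm.toLp _, hm.coeFn_toLp, Lp.ext ?_⟩
  filter_upwards [coeFn_toC (hm.toLp _), hm.coeFn_toLp, coeFn_orderMul Z (toC Y), coeFn_toC Y]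
    with z h1 h2 h3 h4
  rw [h1, h2, h3, h4]; push_cast; rfl

/-! ### The Maxwellian and the order parameter -/

/-- Probability densities of the natural frequency. -/
structure IsFreqDensity (g : ℝ → ℝ) : Prop where
  measurable : Measurable g
  nonneg : ∀ ν, 0 ≤ g ν
  integral_eq_one : ∫ ν, g ν = 1

section Maxwellian
variable {g : ℝ → ℝ}

lemma IsFreqDensity.integrable (hg : IsFreqDensity g) : Integrable g := by
  by_contra h
  have := hg.integral_eq_one
  rw [integral_undef h] at this
  exact zero_ne_one this

lemma IsFreqDensity.memLp_sqrt (hg : IsFreqDensity g) : MemLp (fun ν => Real.sqrt (g ν)) 2 := by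
  rw [memLp_two_iff_integrable_sq hg.measurable.sqrt.aestronglyMeasurable]
  simp_rw [fun ν => Real.sq_sqrt (hg.nonneg ν)]
  exact hg.integrable

/-- `√g` as an element of `L²`. -/
def rootG (hg : IsFreqDensity g) : FreqL2 := realLp _ hg.memLp_sqrt

lemma norm_rootG (hg : IsFreqDensity g) : ‖rootG hg‖ = 1 := by
  have h : ‖rootG hg‖ ^ 2 = 1 := by
    rw [rootG, realLp, norm_toLp_sq, ← hg.integral_eq_one]
    congr 1; ext ν
    rw [RCLike.ofReal_eq_complex_ofReal, Complex.norm_real, Real.norm_eq_abs, sq_abs,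
      Real.sq_sqrt (hg.nonneg ν)]
  exact (pow_eq_one_iff_of_nonneg (norm_nonneg _) two_ne_zero).1 h

variable {m b : ℝ} [hb : Fact (0 < b)]

/-- With σ = m b² the square root of the Maxwellian is the (0,0) mode with profile √g. This is the
reason for the scale b. -/
lemma sqrt_maxwellian (hm : 0 < m) (hg : IsFreqDensity g) (z : Phase) :
    Real.sqrt (maxwellian m (m * b ^ 2) g z) = (Real.sqrt (2 * Real.pi))⁻¹ *
      (hermiteFun b 0 (z.2.1 - z.2.2) * Real.sqrt (g z.2.2)) := by
  have hb0 := hb.out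
  rw [Real.sqrt_eq_iff_mul_self_eq]
  · have h2 : Real.sqrt (m / (2 * Real.pi * (m * b ^ 2))) = (Real.sqrt (2 * Real.pi) * b)⁻¹ := by
      rw [Real.sqrt_eq_iff_mul_self_eq (by positivity) (by positivity)]
      have := Real.mul_self_sqrt (by positivity : (0 : ℝ) ≤ 2 * Real.pi)
      field_simp
      rw [pow_two, this]
    have h1 : (Real.sqrt (2 * Real.pi))⁻¹ * (Real.sqrt (2 * Real.pi))⁻¹ = 1 / (2 * Real.pi) := by
      rw [← mul_inv, Real.mul_self_sqrt (by positivity), one_div]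
    have h3 : hermiteFun b 0 (z.2.1 - z.2.2) * hermiteFun b 0 (z.2.1 - z.2.2)
        = (Real.sqrt (2 * Real.pi) * b)⁻¹ * gaussFactor m (m * b ^ 2) z := by
      simp only [hermiteFun, hermitePoly]
      rw [polyGauss_mul_eq hb0, gaussFactor]
      simp only [mul_one, Polynomial.one_comp, Polynomial.eval_one, one_mul]
      congr 3
      field_simp
    have h4 := Real.mul_self_sqrt (hg.nonneg z.2.2)
    rw [maxwellian, h2]
    symm
    calc _ = ((Real.sqrt (2 * Real.pi))⁻¹ * (Real.sqrt (2 * Real.pi))⁻¹) *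
          (hermiteFun b 0 (z.2.1 - z.2.2) * hermiteFun b 0 (z.2.1 - z.2.2)) *
          (Real.sqrt (g z.2.2) * Real.sqrt (g z.2.2)) := by ring
      _ = _ := by rw [h1, h3, h4]; ring
  · have := hg.nonneg z.2.2
    unfold maxwellian gaussFactor
    positivity
  · have : 0 ≤ hermiteFun b 0 (z.2.1 - z.2.2) := by
      simp only [hermiteFun, hermitePoly, polyGauss, Polynomial.eval_one]; positivity
    positivity

lemma memLp_sqrt_maxwellian (hm : 0 < m) (hg : IsFreqDensity g) :
    MemLp (fun z => Real.sqrt (maxwellian m (m * b ^ 2) g z)) 2 := by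
  have h := memLp_sepTest_cos 0 (memLp_polyGauss hb.out (hermitePoly 0)) hg.memLp_sqrt
  refine h.congr_norm ?_ (.of_forall fun z => ?_)
  · refine (Measurable.sqrt ?_).aestronglyMeasurable
    unfold maxwellian gaussFactor
    have := hg.measurable
    fun_prop
  · rw [sqrt_maxwellian hm hg, sepTest, cosMode, circMode, fourier_zero, mul_one,
      Complex.ofReal_re]
    rfl

variable (b) in
/-- `√M` as an element of `L²`. -/
def sqrtM (hm : 0 < m) (hg : IsFreqDensity g) : L2 := (memLp_sqrt_maxwellian (b := b) hm hg).toLp _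

lemma coeFn_sqrtM (hm : 0 < m) (hg : IsFreqDensity g) :
    sqrtM b hm hg =ᵐ[volume] fun z => Real.sqrt (maxwellian m (m * b ^ 2) g z) := MemLp.coeFn_toLp _

lemma coeFn_modeEmb_rootG (hg : IsFreqDensity g) (k : ℤ) (n : ℕ) :
    modeEmb b (k, n) (rootG hg) =ᵐ[volume] fun z => circMode k z.1 *
      ((hermiteFun b n (z.2.1 - z.2.2) : ℂ) * (Real.sqrt (g z.2.2) : ℂ)) := by
  rw [modeEmb_apply]
  filter_upwards [coeFn_sep k (hermiteLp b n) (rootG hg), ae_velocity (coeFn_hermiteLp (b := b) n),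
    ae_frequency (coeFn_realLp _ hg.memLp_sqrt)] with z h1 h2 h3
  rw [h1, sepFun, h2, rootG, h3]

lemma toC_sqrtM (hm : 0 < m) (hg : IsFreqDensity g) :
    toC (sqrtM b hm hg) = modeEmb b (0, 0) (rootG hg) := by
  apply Lp.ext
  filter_upwards [coeFn_toC (sqrtM b hm hg), coeFn_sqrtM (b := b) hm hg,
    coeFn_modeEmb_rootG (b := b) hg 0 0] with z h1 h2 h3
  rw [h1, h2, h3, sqrt_maxwellian hm hg, circMode]
  simp

variable (b) in
/-- The complex order parameter `∫ e^{iθ} √M u`. -/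
def orderZ (hg : IsFreqDensity g) (u : L2C) : ℂ := inner ℂ (rootG hg) (coef b (-1, 0) u)

lemma orderZ_eq_integral (hm : 0 < m) (hg : IsFreqDensity g) (u : L2) :
    orderZ b hg (toC u) = ∫ z : Phase, fourier 1 z.1 *
      ((Real.sqrt (maxwellian m (m * b ^ 2) g z) * u z : ℝ) : ℂ) := by
  rw [orderZ, inner_coef, L2.inner_def]
  refine integral_congr_ae ?_
  filter_upwards [coeFn_modeEmb_rootG (b := b) hg (-1) 0, coeFn_toC u] with z h1 h2
  rw [h1, h2, RCLike.inner_apply, sqrt_maxwellian hm hg, map_mul, conj_circMode, circMode]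
  simp
  ring

lemma sinC_sub (x y : Circ) : sinC (x - y) = (fourier 1 x * (starRingEnd ℂ) (fourier 1 y)).im := by
  induction x using QuotientAddGroup.induction_on with
  | H x =>
  induction y using QuotientAddGroup.induction_on with
  | H y =>
    have h1 : ∀ x : ℝ, (fourier 1 (x : Circ) : ℂ) = Complex.exp ((x : ℝ) * Complex.I) := by
      intro x
      rw [fourier_coe_apply]
      have : (Real.pi : ℂ) ≠ 0 := by exact_mod_cast Real.pi_pos.ne'
      congr 1; push_cast; field_simp
    have h2 : sinC ((x : Circ) - (y : Circ)) = Real.sin (x - y) := by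
      rw [← AddCircle.coe_sub]; rfl
    have h3 := h1 x
    have h4 := h1 y
    change sinC ((x : Circ) - (y : Circ)) = (fourier 1 (x : Circ) *
      (starRingEnd ℂ) (fourier 1 (y : Circ))).im
    rw [h2, h3, h4, Real.sin_sub]
    simp only [Complex.mul_im, Complex.conj_re, Complex.conj_im, Complex.exp_ofReal_mul_I_re,
      Complex.exp_ofReal_mul_I_im]
    ring

lemma integrable_sqrtM_mul (hm : 0 < m) (hg : IsFreqDensity g) (u : L2) :
    Integrable (fun z => Real.sqrt (maxwellian m (m * b ^ 2) g z) * u z) :=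
  (memLp_sqrt_maxwellian (b := b) hm hg).integrable_mul (Lp.memLp u)

/-- The mean field is the imaginary part of e^{−iθ}Z; thus the whole nonlinearity depends on the
state through one complex number and the state itself. -/
lemma order_eq (hm : 0 < m) (hg : IsFreqDensity g) (u : L2) (θ : Circ) :
    order m (m * b ^ 2) g u θ = orderFun (orderZ b hg (toC u)) θ := by
  have hi : Integrable (fun z : Phase => fourier 1 z.1 *
      ((Real.sqrt (maxwellian m (m * b ^ 2) g z) * u z : ℝ) : ℂ)) := by
    refine ((integrable_sqrtM_mul (b := b) hm hg u).ofReal (𝕜 := ℂ)).bdd_mul (c := 1)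
      ((fourier 1).continuous.comp continuous_fst).aestronglyMeasurable (.of_forall fun z => ?_)
    change ‖(fourier 1 z.1 : ℂ)‖ ≤ 1
    rw [fourier_apply, Circle.norm_coe]
  rw [orderFun, orderZ_eq_integral hm hg, ← integral_const_mul, order]
  have := Complex.imCLM.integral_comp_comm (hi.const_mul ((starRingEnd ℂ) (fourier 1 θ)))
  simp only [Complex.imCLM_apply] at this
  rw [← this]
  congr 1; ext z
  rw [sinC_sub, ← mul_assoc ((starRingEnd ℂ) _), Complex.im_mul_ofReal,
    mul_comm (fourier 1 z.1 : ℂ)]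

lemma norm_orderZ_le (hg : IsFreqDensity g) (u : L2C) : ‖orderZ b hg u‖ ≤ ‖coef b (-1, 0) u‖ := by
  have := norm_inner_le_norm (𝕜 := ℂ) (rootG hg) (coef b (-1, 0) u)
  rwa [norm_rootG, one_mul] at this

end Maxwellian

/-! ### The operator `L₀` on separated functions -/

/-- `L₀` acting on functions of the relative velocity. -/
def opL0v (m b : ℝ) (B : ℝ → ℝ) (v : ℝ) : ℝ :=
  b ^ 2 / m * deriv (deriv B) v + (1 / (2 * m) * B v - 1 / (4 * m * b ^ 2) * (v * (v * B v)))

lemma IsBump.opL0v {B : ℝ → ℝ} (hB : IsBump B) (m b : ℝ) : IsBump (opL0v m b B) := by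
  have h2 : IsBump (fun v => v * (v * B v)) := (hB.mul_left contDiff_id).mul_left contDiff_id
  refine ⟨?_, ?_⟩
  · exact (contDiff_const.mul hB.deriv.deriv.1).add ((contDiff_const.mul hB.1).sub
      (contDiff_const.mul h2.1))
  · exact (hB.deriv.deriv.2.mul_left (f := fun _ => b ^ 2 / m)).add
      ((hB.2.mul_left (f := fun _ => 1 / (2 * m))).sub (h2.2.mul_left (f := fun _ => 1 / (4 * m * b ^ 2))))

/-- The shear turns L₀ into an operator in the relative velocity alone, where conjugation by the
square root of the Gaussian yields the harmonic oscillator. -/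
lemma opL0_sepTest {m b : ℝ} (hm : 0 < m) (hb : 0 < b) (A : Circ → ℝ) {B : ℝ → ℝ} (hB : IsBump B)
    (e : ℝ → ℝ) : opL0 m (m * b ^ 2) (sepTest A B e) = sepTest A (opL0v m b B) e := by
  have hB1 : ∀ v, HasDerivAt B (deriv B v) v := fun v =>
    (hB.1.differentiable (by simp)).differentiableAt.hasDerivAt
  have hB2 : ∀ v, HasDerivAt (deriv B) (deriv (deriv B) v) v := fun v =>
    (hB.deriv.1.differentiable (by simp)).differentiableAt.hasDerivAt
  set c : ℝ := 1 / (2 * b ^ 2) with hc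
  have hG : ∀ z : Phase, gaussFactor m (m * b ^ 2) z
      = Real.exp (-c * (z.2.1 - z.2.2) ^ 2) := fun z => by
    rw [gaussFactor, hc]; congr 2; field_simp
  have hq : ∀ z : Phase, Real.sqrt (gaussFactor m (m * b ^ 2) z)
      = Real.exp (-(c / 2) * (z.2.1 - z.2.2) ^ 2) := fun z => by
    rw [hG, Real.sqrt_eq_iff_mul_self_eq (by positivity) (by positivity), ← Real.exp_add]
    congr 1; ring
  have hE : ∀ a ν w : ℝ, HasDerivAt (fun w => Real.exp (a * (w - ν) ^ 2))
      (Real.exp (a * (w - ν) ^ 2) * (a * (2 * (w - ν)))) w := fun a ν w => by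
    have h := ((((hasDerivAt_id w).sub_const ν).pow 2).const_mul a).exp
    refine h.congr_deriv ?_
    simp
  have hBs : ∀ ν w : ℝ, HasDerivAt (fun w => B (w - ν)) (deriv B (w - ν)) w := fun ν w =>
    (hB1 (w - ν)).comp_sub_const w ν
  have hBs' : ∀ ν w : ℝ, HasDerivAt (fun w => deriv B (w - ν)) (deriv (deriv B) (w - ν)) w :=
    fun ν w => (hB2 (w - ν)).comp_sub_const w ν
  have hinner : ∀ z : Phase, dOmega (fun x => sepTest A B e x /
      Real.sqrt (gaussFactor m (m * b ^ 2) x)) z = A z.1 * e z.2.2 *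
        (Real.exp (c / 2 * (z.2.1 - z.2.2) ^ 2) *
          (deriv B (z.2.1 - z.2.2) + c * (z.2.1 - z.2.2) * B (z.2.1 - z.2.2))) := by
    intro z
    simp only [dOmega, hq]
    have h1 := (((hBs z.2.2 z.2.1).fun_mul (hE (c / 2) z.2.2 z.2.1)).const_mul (A z.1 * e z.2.2))
    have h2 : (fun w => sepTest A B e (z.1, w, z.2.2) / Real.exp (-(c / 2) * (w - z.2.2) ^ 2))
        = fun w => A z.1 * e z.2.2 * (B (w - z.2.2) * Real.exp (c / 2 * (w - z.2.2) ^ 2)) := by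
      ext w
      rw [neg_mul, Real.exp_neg, div_inv_eq_mul, sepTest]; ring
    rw [h2, h1.deriv]; ring
  ext z
  rw [opL0, weightedL0]
  simp only [hinner]
  rw [hq z]
  simp only [dOmega, hG]
  -- The weight and the inverse square root combine to exp(−cv²/2), which the outer factor of L₀
  -- cancels after differentiation.
  have h3 : (fun w => Real.exp (-c * (w - z.2.2) ^ 2) * (A z.1 * e z.2.2 *
        (Real.exp (c / 2 * (w - z.2.2) ^ 2) *
          (deriv B (w - z.2.2) + c * (w - z.2.2) * B (w - z.2.2)))))
      = fun w => A z.1 * e z.2.2 * (Real.exp (-(c / 2) * (w - z.2.2) ^ 2) *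
          (deriv B (w - z.2.2) + c * ((w - z.2.2) * B (w - z.2.2)))) := by
    ext w
    have : Real.exp (-(c / 2) * (w - z.2.2) ^ 2) = Real.exp (-c * (w - z.2.2) ^ 2) *
        Real.exp (c / 2 * (w - z.2.2) ^ 2) := by rw [← Real.exp_add]; congr 1; ring
    rw [this]; ring
  have h4 := (((hE (-(c / 2)) z.2.2 z.2.1).fun_mul ((hBs' z.2.2 z.2.1).fun_add
    ((((hasDerivAt_id z.2.1).sub_const z.2.2).fun_mul (hBs z.2.2 z.2.1)).const_mul c))).const_mul
      (A z.1 * e z.2.2))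
  simp only [id_eq] at h4
  rw [h3, h4.deriv, sepTest, opL0v]
  have h5 : Real.exp (-(c / 2) * (z.2.1 - z.2.2) ^ 2) ≠ 0 := (Real.exp_pos _).ne'
  generalize Real.exp (-(c / 2) * (z.2.1 - z.2.2) ^ 2) = Ex at *
  generalize z.2.1 - z.2.2 = v
  rw [hc]
  field_simp
  ring

end KuramotoSakaguchi
end

/-! ### The equation tested against Fourier–Hermite modes. -/

noncomputable section
namespace KuramotoSakaguchi
open Filter Topology
open scoped BoundedContinuousFunction

/-! ### The equation tested against separated functions -/

lemma MemH.isWeakDeriv {s i j : ℕ} {u : L2} (h : MemH s u) (hij : i + j ≤ s) :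
    IsWeakDeriv i j u (weakDeriv i j u) := by
  have hex := h i j hij
  rw [weakDeriv, dif_pos hex]
  exact hex.choose_spec

lemma MemH.weakDeriv_zero {s : ℕ} {u : L2} (h : MemH s u) : weakDeriv 0 0 u = u :=
  (h.isWeakDeriv (i := 0) (j := 0) (Nat.zero_le _)).coef_zero

lemma ContInH.continuousOn_toC {s i j : ℕ} {T : ℝ} {f : ℝ → L2} (h : ContInH s T f)
    (hij : i + j ≤ s) : ContinuousOn (fun t => toC (weakDeriv i j (f t))) (Icc 0 T) :=
  toC.continuous.comp_continuousOn (h.2 i j hij)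

lemma ContInH.continuousOn_toC_self {s : ℕ} {T : ℝ} {f : ℝ → L2} (h : ContInH s T f) :
    ContinuousOn (fun t => toC (f t)) (Icc 0 T) :=
  (h.continuousOn_toC (i := 0) (j := 0) (Nat.zero_le _)).congr fun t ht => by
    simp only [(h.1 t ht).weakDeriv_zero]

section Equation
variable {m κ b : ℝ} [hb : Fact (0 < b)] {g : ℝ → ℝ}

lemma orderMul_continuousOn {T : ℝ} {Z : ℝ → ℂ} {u : ℝ → L2C} (hZ : ContinuousOn Z (Icc 0 T))
    (hu : ContinuousOn u (Icc 0 T)) : ContinuousOn (fun t => orderMul (Z t) (u t)) (Icc 0 T) := by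
  simp only [orderMul_apply]
  have h1 : ContinuousOn (fun t => (starRingEnd ℂ) (Z t)) (Icc 0 T) :=
    Complex.continuous_conj.comp_continuousOn hZ
  exact ((hZ.div_const _).smul ((shiftC (-1)).continuous.comp_continuousOn hu)).sub
    ((h1.div_const _).smul ((shiftC 1).continuous.comp_continuousOn hu))

lemma continuous_orderZ (hg : IsFreqDensity g) : Continuous (orderZ b hg) := by
  unfold orderZ
  fun_prop

/-- The right-hand side of the equation tested against `circMode k ⊗ x₀ ⊗ e`; here `x₁`, `x₂` stand
for `v x₀`, `L₀ x₀` and `e'` for `ν e`. -/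
def testedRHS (m κ b : ℝ) [Fact (0 < b)] (hg : IsFreqDensity g) (k : ℤ) (u uθ uω : L2C)
    (x₀ x₁ x₂ e e' : FreqL2) : ℂ :=
  -(inner ℂ (sep k x₁ e) uθ + inner ℂ (sep k x₀ e') uθ) + inner ℂ (sep k x₂ e) u
    + (κ / (m * b ^ 2) : ℝ) * inner ℂ (sep k x₁ e) (orderMul (orderZ b hg u) (modeEmb b (0, 0) (rootG hg)))
    + ((κ / (2 * (m * b ^ 2)) : ℝ) * inner ℂ (sep k x₁ e) (orderMul (orderZ b hg u) u)
    - (κ / m : ℝ) * inner ℂ (sep k x₀ e) (orderMul (orderZ b hg u) uω))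

lemma integral_velocity_mul {A : Circ → ℝ} {B e : ℝ → ℝ}
    (hA : ∀ {B e : ℝ → ℝ}, MemLp B 2 → MemLp e 2 → MemLp (sepTest A B e) 2)
    (hB : IsBump B) (he : IsBump e) (w : L2) :
    ∫ z : Phase, z.2.1 * w z * sepTest A B e z = (∫ z, w z * sepTest A (fun v => v * B v) e z)
      + ∫ z, w z * sepTest A B (fun ν => ν * e ν) z := by
  rw [← integral_add]
  -- This is the splitting ω = (ω − ν) + ν: one part acts on the Hermite index, the other on the
  -- frequency profile.
  · congr 1; ext z; simp only [sepTest]; ring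
  · exact (Lp.memLp w).integrable_mul (hA (hB.mul_left contDiff_id).memLp he.memLp)
  · exact (Lp.memLp w).integrable_mul (hA hB.memLp (he.mul_left contDiff_id).memLp)

lemma integral_opL1_opN (hm : 0 < m) (hg : IsFreqDensity g) {A : Circ → ℝ} {B e : ℝ → ℝ}
    (hA : ∀ {B e : ℝ → ℝ}, MemLp B 2 → MemLp e 2 → MemLp (sepTest A B e) 2)
    (hB : IsBump B) (he : IsBump e) (u : L2) {Y₁ Y₂ Y₃ : L2}
    (h1 : Y₁ =ᵐ[volume] fun z => orderFun (orderZ b hg (toC u)) z.1 * sqrtM b hm hg z)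
    (h2 : Y₂ =ᵐ[volume] fun z => orderFun (orderZ b hg (toC u)) z.1 * u z)
    (h3 : Y₃ =ᵐ[volume] fun z => orderFun (orderZ b hg (toC u)) z.1 * weakDeriv 0 1 u z) :
    (∫ z, opL1 m κ (m * b ^ 2) g u z * sepTest A B e z
        = κ / (m * b ^ 2) * ∫ z, Y₁ z * sepTest A (fun v => v * B v) e z) ∧
    ∫ z, opN m κ (m * b ^ 2) g u z * sepTest A B e z
        = κ / (2 * (m * b ^ 2)) * (∫ z, Y₂ z * sepTest A (fun v => v * B v) e z)
          - κ / m * ∫ z, Y₃ z * sepTest A B e z := by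
  constructor
  · rw [← integral_const_mul]
    refine integral_congr_ae ?_
    filter_upwards [h1, coeFn_sqrtM (b := b) hm hg] with z hz hM
    rw [hz, hM, opL1, order_eq hm hg]
    simp only [sepTest]; ring
  · rw [← integral_const_mul, ← integral_const_mul, ← integral_sub]
    · refine integral_congr_ae ?_
      filter_upwards [h2, h3] with z hz hz'
      rw [hz, hz', opN, order_eq hm hg]
      simp only [sepTest]; ring
    · exact ((Lp.memLp Y₂).integrable_mul (hA (hB.mul_left contDiff_id).memLp he.memLp)).const_mul _
    · exact ((Lp.memLp Y₃).integrable_mul (hA hB.memLp he.memLp)).const_mul _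

/-- The equation is tested with the cosine and the sine mode, and the results are combined as cosine
minus i times sine. -/
lemma hasDerivWithinAt_inner_sep (hm : 0 < m) (hg : IsFreqDensity g) {T : ℝ} {f : ℝ → L2}
    (heq : SolvesEq m κ (m * b ^ 2) g T f) (k : ℤ) {B e : ℝ → ℝ} (hB : IsBump B) (he : IsBump e)
    {t : ℝ} (ht : t ∈ Icc 0 T) :
    HasDerivWithinAt (fun τ => inner ℂ (sep k (realLp B hB.memLp) (realLp e he.memLp)) (toC (f τ)))
      (testedRHS m κ b hg k (toC (f t)) (toC (weakDeriv 1 0 (f t))) (toC (weakDeriv 0 1 (f t)))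
        (realLp B hB.memLp) (realLp _ (hB.mul_left contDiff_id).memLp)
        (realLp _ (hB.opL0v m b).memLp) (realLp e he.memLp)
        (realLp _ (he.mul_left contDiff_id).memLp)) (Icc 0 T) t := by
  obtain ⟨Y₁, hY₁, hY₁'⟩ := exists_orderMul_toC (orderZ b hg (toC (f t))) (sqrtM b hm hg)
  obtain ⟨Y₂, hY₂, hY₂'⟩ := exists_orderMul_toC (orderZ b hg (toC (f t))) (f t)
  obtain ⟨Y₃, hY₃, hY₃'⟩ := exists_orderMul_toC (orderZ b hg (toC (f t))) (weakDeriv 0 1 (f t))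
  have hc := heq _ (isTest_sepTest (contDiff_cosMode k) hB he) t ht
  have hs := heq _ (isTest_sepTest (contDiff_sinMode k) hB he) t ht
  have hc' := integral_opL1_opN (κ := κ) hm hg (memLp_sepTest_cos k) hB he (f t) hY₁ hY₂ hY₃
  have hs' := integral_opL1_opN (κ := κ) hm hg (memLp_sepTest_sin k) hB he (f t) hY₁ hY₂ hY₃
  rw [opL0_sepTest hm hb.out _ hB, hc'.1, hc'.2,
    integral_velocity_mul (memLp_sepTest_cos k) hB he] at hc
  rw [opL0_sepTest hm hb.out _ hB, hs'.1, hs'.2,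
    integral_velocity_mul (memLp_sepTest_sin k) hB he] at hs
  have h := hc.ofReal_comp.sub (hs.ofReal_comp.const_mul Complex.I)
  have hfun : (fun τ => inner ℂ (sep k (realLp B hB.memLp) (realLp e he.memLp)) (toC (f τ)))
      = (fun y => ((∫ z, f y z * sepTest (cosMode k) B e z : ℝ) : ℂ)) - fun y => Complex.I *
        ((∫ z, f y z * sepTest (sinMode k) B e z : ℝ) : ℂ) :=
    funext fun τ => inner_sep_toC_eq k hB.memLp he.memLp (f τ)
  rw [hfun]
  refine h.congr_deriv ?_
  simp only [testedRHS, ← toC_sqrtM (b := b) hm hg, ← hY₁', ← hY₂', ← hY₃', inner_sep_toC_eq, id_eq]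
  push_cast
  ring

open Polynomial in
lemma mul_cutPoly (R : ℕ) (p : ℝ[X]) (v : ℝ) : v * cutPoly b R p v = cutPoly b R (C b * (X * p)) v := by
  rw [cutPoly, cutPoly, ← mul_polyGauss hb.out]; ring

open Polynomial in
/-- `L₀` on the level of polynomials. -/
def opL0Poly (m b : ℝ) (p : ℝ[X]) : ℝ[X] := C (b ^ 2 / m) * derivPoly b (derivPoly b p) +
  (C (1 / (2 * m)) * p + C (-(1 / (4 * m * b ^ 2))) * (C b * (X * (C b * (X * p)))))

-- On the polynomial factor L₀ becomes −(1/m)(X d/dx − d²/dx²), that is −(1/m)a*a, whose eigenvalue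
-- on the n-th Hermite polynomial is −n/m.
open Polynomial in
lemma opL0Poly_hermitePoly (hm : 0 < m) (n : ℕ) :
    opL0Poly m b (hermitePoly n) = C (-(n / m : ℝ)) * hermitePoly n := by
  have hb0 : b ≠ 0 := hb.out.ne'
  have h1 : ∀ p : ℝ[X], opL0Poly m b p = C (-(1 / m)) * (X * derivative p - derivative (derivative p)) := by
    intro p
    have e0 : (C (b ^ 2 / m) : ℝ[X]) * C b⁻¹ * C b⁻¹ = C (1 / m) := by
      rw [← C_mul, ← C_mul]; congr 1; field_simp
    have e1 : (C (-(1 / (4 * m * b ^ 2))) : ℝ[X]) * C b * C b = - C (1 / m) * C (1 / 4) := by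
      rw [← C_mul, ← C_mul, ← C_neg, ← C_mul]; congr 1; field_simp
    have e2 : (C (1 / (2 * m)) : ℝ[X]) = C (1 / m) * C (1 / 2) := by
      rw [← C_mul]; congr 1; field_simp
    have e3 : (C (-(1 / m)) : ℝ[X]) = - C (1 / m) := by rw [← C_neg]
    have e4 : (C (1 / 4) : ℝ[X]) = C (1 / 2) * C (1 / 2) := by rw [← C_mul]; norm_num
    have e5 : (C (1 / 2) : ℝ[X]) + C (1 / 2) = 1 := by rw [← C_add]; norm_num
    simp only [opL0Poly, derivPoly, derivative_mul, derivative_sub, derivative_C, derivative_X]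
    calc _ = (C (b ^ 2 / m) : ℝ[X]) * C b⁻¹ * C b⁻¹ * (derivative (derivative p)
            - C (1 / 2) * (p + X * derivative p)
            - C (1 / 2) * (X * (derivative p - C (1 / 2) * (X * p))))
          + (C (1 / (2 * m)) * p + (C (-(1 / (4 * m * b ^ 2))) : ℝ[X]) * C b * C b * (X * (X * p))) := by
          ring
      _ = _ := by
          rw [e0, e1, e2, e3, e4]
          linear_combination (-C (1 / m) * (X * derivative p)) * e5
  rw [h1, derivative_hermitePoly, derivative_mul, derivative_C]
  cases n with
  | zero => simp
  | succ n =>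
    have h2 := hermitePoly_raise n
    have h3 : (C (-((n + 1 : ℕ) / m : ℝ)) : ℝ[X]) = C (-(1 / m)) * (C (Real.sqrt ((n : ℝ) + 1)) *
        C (Real.sqrt ((n : ℝ) + 1))) := by
      rw [← C_mul, ← C_mul, Real.mul_self_sqrt (by positivity)]; congr 1; push_cast; ring
    rw [h3]
    simp only [Nat.add_sub_cancel, Nat.cast_add, Nat.cast_one]
    linear_combination (C (-(1 / m)) * C (Real.sqrt ((n : ℝ) + 1))) * h2

open Polynomial in
lemma tendsto_opL0v_cutPoly (p : ℝ[X]) :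
    Tendsto (fun R => realLp (opL0v m b (cutPoly b R p)) ((isBump_cutPoly b R p).opL0v m b).memLp) atTop
      (𝓝 (polyLp b (opL0Poly m b p))) := by
  have h1 := ((tendsto_deriv_deriv_cutPoly (b := b) p).const_smul ((b ^ 2 / m : ℝ) : ℂ)).add
    (((tendsto_cutPoly (b := b) p).const_smul ((1 / (2 * m) : ℝ) : ℂ)).add
    ((tendsto_cutPoly (b := b) (C b * (X * (C b * (X * p))))).const_smul
      ((-(1 / (4 * m * b ^ 2)) : ℝ) : ℂ)))
  rw [← polyLp_C_mul, ← polyLp_C_mul, ← polyLp_C_mul, ← polyLp_add, ← polyLp_add] at h1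
  refine h1.congr fun R => ?_
  have m1 := (isBump_cutPoly b R p).deriv.deriv.memLp
  have m2 := (isBump_cutPoly b R p).memLp
  have m3 := (isBump_cutPoly b R (C b * (X * (C b * (X * p))))).memLp
  rw [← realLp_const_mul _ m1 (m1.const_mul _), ← realLp_const_mul _ m2 (m2.const_mul _),
    ← realLp_const_mul _ m3 (m3.const_mul _)]
  have m4 : MemLp (fun v => 1 / (2 * m) * cutPoly b R p v + -(1 / (4 * m * b ^ 2)) *
    cutPoly b R (C b * (X * (C b * (X * p)))) v) 2 := (m2.const_mul _).add (m3.const_mul _)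
  rw [← realLp_add _ _ m4, ← realLp_add (m1.const_mul _) m4 ((m1.const_mul _).add m4)]
  congr 1
  ext v
  rw [opL0v, mul_cutPoly, mul_cutPoly]
  ring

/-- Joint continuity in the velocity profiles and in time is what the passage from truncated to full
Hermite functions requires. -/
lemma continuousOn_testedRHS {P : Type*} [TopologicalSpace P] {x₀ x₁ x₂ : P → FreqL2}
    (c0 : Continuous x₀) (c1 : Continuous x₁) (c2 : Continuous x₂)
    (hg : IsFreqDensity g) (k : ℤ) (e e' : FreqL2) {T : ℝ} {u uθ uω : ℝ → L2C}
    (h0 : ContinuousOn u (Icc 0 T)) (h1 : ContinuousOn uθ (Icc 0 T)) (h2 : ContinuousOn uω (Icc 0 T)) :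
    ContinuousOn (Function.uncurry fun (x : P) t =>
      testedRHS m κ b hg k (u t) (uθ t) (uω t) (x₀ x) (x₁ x) (x₂ x) e e') (univ ×ˢ Icc 0 T) := by
  have hs : ∀ {w : ℝ → L2C}, ContinuousOn w (Icc 0 T) →
      ContinuousOn (fun p : P × ℝ => w p.2) (univ ×ˢ Icc 0 T) :=
    fun hw => hw.comp continuousOn_snd fun p hp => hp.2
  have hZ : ContinuousOn (fun t => orderZ b hg (u t)) (Icc 0 T) :=
    (continuous_orderZ hg).comp_continuousOn h0
  have hi : ∀ {w : ℝ → L2C} (y : P → FreqL2) (e : FreqL2), Continuous y →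
      ContinuousOn w (Icc 0 T) → ContinuousOn (fun p : P × ℝ =>
        inner ℂ (sep k (y p.1) e) (w p.2)) (univ ×ˢ Icc 0 T) := fun y e hy hw => by
    have : Continuous fun p : P × ℝ => sepCLM k (y p.1) e := by fun_prop
    exact ContinuousOn.inner (𝕜 := ℂ) this.continuousOn (hs hw)
  simp only [Function.uncurry_def, testedRHS]
  have a1 := hi _ e c1 h1
  have a2 := hi _ e' c0 h1
  have a3 := hi _ e c2 h0
  have a4 := hi _ e c1 (orderMul_continuousOn hZ (continuousOn_const (c := modeEmb b (0, 0) (rootG hg))))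
  have a5 := hi _ e c1 (orderMul_continuousOn hZ h0)
  have a6 := hi _ e c0 (orderMul_continuousOn hZ h2)
  clear hi hs
  fun_prop

lemma hasDerivWithinAt_inner_hermite (hm : 0 < m) (hg : IsFreqDensity g) {s : ℕ} (hs : 1 ≤ s) {T : ℝ}
    {f : ℝ → L2} (hf : ContInH s T f) (heq : SolvesEq m κ (m * b ^ 2) g T f) (k : ℤ) (n : ℕ)
    {e : ℝ → ℝ} (he : IsBump e) {t : ℝ} (ht : t ∈ Icc 0 T) :
    HasDerivWithinAt (fun τ => inner ℂ (realLp e he.memLp) (coef b (k, n) (toC (f τ))))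
      (testedRHS m κ b hg k (toC (f t)) (toC (weakDeriv 1 0 (f t))) (toC (weakDeriv 0 1 (f t)))
        (polyLp b (hermitePoly n)) (polyLp b (Polynomial.C b * (Polynomial.X * hermitePoly n)))
        (polyLp b (Polynomial.C (-(n / m : ℝ)) * hermitePoly n)) (realLp e he.memLp)
        (realLp _ (he.mul_left contDiff_id).memLp)) (Icc 0 T) t := by
  simp_rw [inner_coef, modeEmb_apply, hermiteLp_eq, ← opL0Poly_hermitePoly (b := b) hm n]
  have htend := (tendsto_cutPoly (b := b) (hermitePoly n)).prodMk_nhds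
    ((tendsto_cutPoly (b := b) (Polynomial.C b * (Polynomial.X * hermitePoly n))).prodMk_nhds
      (tendsto_opL0v_cutPoly (m := m) (b := b) (hermitePoly n)))
  have hcont := continuousOn_testedRHS (m := m) (κ := κ) (b := b) (P := FreqL2 × FreqL2 × FreqL2)
    continuous_fst continuous_snd.fst continuous_snd.snd hg k (realLp e he.memLp)
    (realLp _ (he.mul_left contDiff_id).memLp) hf.continuousOn_toC_self
      (hf.continuousOn_toC (i := 1) (j := 0) hs) (hf.continuousOn_toC (i := 0) (j := 1) hs)
  have hΦ : ∀ t ∈ Icc 0 T, Tendsto (fun R => inner ℂ (sep k (realLp (cutPoly b R (hermitePoly n))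
      (isBump_cutPoly b R (hermitePoly n)).memLp) (realLp e he.memLp)) (toC (f t))) atTop
      (𝓝 (inner ℂ (sep k (polyLp b (hermitePoly n)) (realLp e he.memLp)) (toC (f t)))) :=
    fun t _ => tendsto_inner_sep (tendsto_cutPoly (hermitePoly n)) k _ _
  have key := hasDerivWithinAt_Icc_of_tendsto
    (Φ := fun (x : FreqL2 × FreqL2 × FreqL2) τ => inner ℂ (sep k x.1 (realLp e he.memLp)) (toC (f τ)))
    htend hcont hΦ
  refine key ?_ t ht
  · intro R t ht
    have h := hasDerivWithinAt_inner_sep hm hg heq k (isBump_cutPoly b R (hermitePoly n)) he ht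
    -- Multiplying a truncated Hermite function by v gives the truncation of another function of the
    -- same type, so this term lies on the convergent sequence.
    have hv : realLp _ ((isBump_cutPoly b R (hermitePoly n)).mul_left contDiff_id).memLp
        = realLp _ (isBump_cutPoly b R (Polynomial.C b * (Polynomial.X * hermitePoly n))).memLp := by
      congr 1; ext v; exact mul_cutPoly R _ v
    rw [hv] at h
    exact h

end Equation

end KuramotoSakaguchi
end

/-! ### The evolution of the mode coefficients with a frequency cutoff. -/

noncomputable section
namespace KuramotoSakaguchi
open Filter Topology
open scoped BoundedContinuousFunction

/-! ### Frequency cutoffs -/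

/-- A smooth compactly supported function as a bounded continuous function. -/
def bumpBCF {B : ℝ → ℝ} (hB : IsBump B) : ℝ →ᵇ ℂ :=
  BoundedContinuousFunction.ofNormedAddCommGroup (fun v => (B v : ℂ))
    (Complex.continuous_ofReal.comp hB.1.continuous) hB.exists_bound.choose (fun v => by
      rw [Complex.norm_real]; exact hB.exists_bound.choose_spec v)

lemma bumpBCF_apply {B : ℝ → ℝ} (hB : IsBump B) (v : ℝ) : bumpBCF hB v = (B v : ℂ) := rfl

lemma inner_realLp_mulCLM {B e : ℝ → ℝ} (hB : IsBump B) (he : IsBump e) (x : FreqL2) :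
    inner ℂ (realLp e he.memLp) (mulCLM (bumpBCF hB) x)
      = inner ℂ (realLp _ (he.mul_left hB.1).memLp) x := by
  rw [L2.inner_def, L2.inner_def]
  refine integral_congr_ae ?_
  filter_upwards [coeFn_realLp e he.memLp, coeFn_realLp _ (he.mul_left hB.1).memLp,
    coeFn_mulCLM (bumpBCF hB) x] with v h1 h2 h3
  rw [h1, h2, h3, RCLike.inner_apply, RCLike.inner_apply, bumpBCF_apply, Complex.conj_ofReal,
    Complex.conj_ofReal]
  push_cast; ring

/-- Multiplication by the frequency cutoff `ζ_R`. -/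
def zetaOp (R : ℕ) : FreqL2 →L[ℂ] FreqL2 := mulCLM (bumpBCF (isBump_cutoff R))

/-- Multiplication by `ν ζ_R(ν)`. -/
def nuOp (R : ℕ) : FreqL2 →L[ℂ] FreqL2 :=
  mulCLM (bumpBCF ((isBump_cutoff R).mul_left contDiff_id))

lemma norm_zetaOp_le (R : ℕ) (x : FreqL2) : ‖zetaOp R x‖ ≤ ‖x‖ := by
  rw [← one_mul ‖x‖]
  refine norm_mulCLM_le _ x fun v => ?_
  rw [bumpBCF_apply, Complex.norm_real]; exact abs_cutoff_le R v

lemma tendsto_zetaOp (x : FreqL2) : Tendsto (fun R => zetaOp R x) atTop (𝓝 x) := by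
  refine tendsto_mulCLM (c := 1) (fun R v => ?_) (fun v => ?_) x
  · rw [bumpBCF_apply, Complex.norm_real]; exact abs_cutoff_le R v
  · simp only [bumpBCF_apply]
    exact_mod_cast (Complex.continuous_ofReal.tendsto 1).comp (tendsto_cutoff v)

/-- Multiplication by ν is symmetric. Multiplied by ik, this part of transport therefore contributes
nothing to the energy. -/
lemma inner_zetaOp_nuOp (R : ℕ) (x : FreqL2) : (inner ℂ (zetaOp R x) (nuOp R x)).im = 0 := by
  rw [zetaOp, nuOp, inner_mulCLM_mulCLM]
  have : ∀ v, (starRingEnd ℂ) (bumpBCF (isBump_cutoff R) v * x v) *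
      (bumpBCF ((isBump_cutoff R).mul_left contDiff_id) v * x v)
      = ((v * cutoff R v ^ 2 * ‖x v‖ ^ 2 : ℝ) : ℂ) := fun v => by
    rw [bumpBCF_apply, bumpBCF_apply, map_mul, Complex.conj_ofReal]
    have h := Complex.conj_mul' (x v)
    push_cast
    simp only [id_eq]
    linear_combination (v * (cutoff R v : ℂ) ^ 2) * h
  simp_rw [this]
  rw [integral_complex_ofReal, Complex.ofReal_im]

section Equation
variable {m κ b : ℝ} [hb : Fact (0 < b)] {g : ℝ → ℝ}

/-! ### The equation for the coefficients -/

lemma coef_orderMul (Z : ℂ) (k : ℤ) (n : ℕ) (u : L2C) :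
    coef b (k, n) (orderMul Z u) = (Z / (2 * Complex.I)) • coef b (k + 1, n) u
      - ((starRingEnd ℂ) Z / (2 * Complex.I)) • coef b (k - 1, n) u := by
  rw [orderMul_apply, map_sub, map_smul, map_smul, coef_shiftC, coef_shiftC, sub_neg_eq_add]

/-- The coefficients of `(ω - ν) u / b`. -/
def velCoef (b : ℝ) [Fact (0 < b)] (u : L2C) (k : ℤ) (n : ℕ) : FreqL2 :=
  ((Real.sqrt (n + 1) : ℝ) : ℂ) • coef b (k, n + 1) u + ((Real.sqrt n : ℝ) : ℂ) • coef b (k, n - 1) u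

lemma inner_sep_X (k : ℤ) (n : ℕ) (η : FreqL2) (u : L2C) :
    inner ℂ (sep k (polyLp b (Polynomial.C b * (Polynomial.X * hermitePoly n))) η) u =
      inner ℂ η ((b : ℂ) • velCoef b u k n) := by
  rw [polyLp_C_mul, X_mul_hermitePoly, polyLp_add, polyLp_C_mul, polyLp_C_mul, sep_smul_left,
    sep_add_left, sep_smul_left, sep_smul_left, inner_smul_left, inner_add_left, inner_smul_left,
    inner_smul_left, ← hermiteLp_eq, ← hermiteLp_eq, ← modeEmb_apply (b := b) (k, n + 1),
    ← modeEmb_apply (b := b) (k, n - 1), ← inner_coef, ← inner_coef]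
  simp only [velCoef, inner_smul_right, inner_add_right, Complex.conj_ofReal]

lemma inner_sep_polyLp (k : ℤ) (n : ℕ) (η : FreqL2) (u : L2C) :
    inner ℂ (sep k (polyLp b (hermitePoly n)) η) u = inner ℂ η (coef b (k, n) u) := by
  rw [inner_coef, modeEmb_apply, hermiteLp_eq]

/-- The Maxwellian factor `√M` in mode representation, as an element of the complexified space. -/
def rootM (b : ℝ) [Fact (0 < b)] (hg : IsFreqDensity g) : L2C := modeEmb b (0, 0) (rootG hg)

/-- The part of the equation for the `(k, n)` coefficient that does not involve multiplication by `ν`. -/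
def modeRHS (m κ b : ℝ) [Fact (0 < b)] (hg : IsFreqDensity g) (u : L2C) (k : ℤ) (n : ℕ) : FreqL2 :=
  -(((k : ℂ) * Complex.I * b) • velCoef b u k n) - ((n / m : ℝ) : ℂ) • coef b (k, n) u
    + ((κ / (m * b) : ℝ) : ℂ) • ((Real.sqrt n : ℝ) : ℂ) •
      coef b (k, n - 1) (orderMul (orderZ b hg u) (u + rootM b hg))

/-- Here the three interaction terms merge. The nonlinear ones carry v/(2b²) − ∂_ω = a*/b, because
the mean field does not depend on ω, and v√M = b a*√M because a√M = 0. Both together give (κ/(mb))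
a*(S(u + √M)). -/
lemma testedRHS_eq (hm : 0 < m) (hg : IsFreqDensity g) {u w₁ w₂ : L2} (h1 : IsWeakDeriv 1 0 u w₁)
    (h2 : IsWeakDeriv 0 1 u w₂) (h0 : IsWeakDeriv 0 0 u u) (k : ℤ) (n : ℕ) (e e' : FreqL2) :
    testedRHS m κ b hg k (toC u) (toC w₁) (toC w₂)
        (polyLp b (hermitePoly n)) (polyLp b (Polynomial.C b * (Polynomial.X * hermitePoly n)))
        (polyLp b (Polynomial.C (-(n / m : ℝ)) * hermitePoly n)) e e'
      = inner ℂ e (modeRHS m κ b hg (toC u) k n)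
        + inner ℂ e' (-(((k : ℂ) * Complex.I) • coef b (k, n) (toC u))) := by
  have hb0 : (b : ℂ) ≠ 0 := by exact_mod_cast hb.out.ne'
  have hm0 : (m : ℂ) ≠ 0 := by exact_mod_cast hm.ne'
  have hL : inner ℂ (sep k (polyLp b (Polynomial.C (-(n / m : ℝ)) * hermitePoly n)) e) (toC u)
      = inner ℂ e (((-(n / m) : ℝ) : ℂ) • coef b (k, n) (toC u)) := by
    rw [polyLp_C_mul, sep_smul_left, inner_smul_left, Complex.conj_ofReal, inner_sep_polyLp,
      inner_smul_right]
  rw [testedRHS, hL]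
  simp only [inner_sep_X, inner_sep_polyLp, h0.coef_theta h1]
  rw [inner_neg_right]
  simp only [← inner_smul_right]
  rw [neg_add, add_right_comm (-_), add_right_comm (-_ + _), add_right_comm (-_ + _ + _)]
  congr 1
  rw [← inner_neg_right, ← inner_add_right, ← inner_add_right, ← inner_sub_right, ← inner_add_right]
  congr 1
  have hO : ∀ k' n', coef b (k', n') (orderMul (orderZ b hg (toC u)) (toC u + rootM b hg)) =
      coef b (k', n') (orderMul (orderZ b hg (toC u)) (toC u)) +
      coef b (k', n') (orderMul (orderZ b hg (toC u)) (rootM b hg)) := fun k' n' => by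
    rw [map_add, map_add]
  -- √M lives at n = 0 and the mean field does not change n, so only the creation half of v acts on
  -- S√M.
  have hM : coef b (k, n + 1) (orderMul (orderZ b hg (toC u)) (modeEmb b (0, 0) (rootG hg))) = 0 := by
    rw [coef_orderMul, coef_modeEmb, coef_modeEmb, if_neg (by simp), if_neg (by simp)]; simp
  have hω : coef b (k, n) (orderMul (orderZ b hg (toC u)) (toC w₂)) = ((1 / (2 * b) : ℝ) : ℂ) •
      (((Real.sqrt (n + 1) : ℝ) : ℂ) • coef b (k, n + 1) (orderMul (orderZ b hg (toC u)) (toC u))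
        - ((Real.sqrt n : ℝ) : ℂ) • coef b (k, n - 1) (orderMul (orderZ b hg (toC u)) (toC u))) := by
    simp only [coef_orderMul, h0.coef_omega h2]
    module
  rw [hω, modeRHS, hO]
  simp only [velCoef, hM, h0.coef_theta h1, rootM]
  generalize coef b (k, n + 1) (orderMul (orderZ b hg (toC u)) (toC u)) = x1
  generalize coef b (k, n - 1) (orderMul (orderZ b hg (toC u)) (toC u)) = x2
  generalize coef b (k, n - 1) (orderMul (orderZ b hg (toC u)) (modeEmb b (0, 0) (rootG hg))) = x3
  generalize coef b (k, n + 1) (toC u) = x4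
  generalize coef b (k, n - 1) (toC u) = x5
  push_cast
  match_scalars <;> field_simp <;> ring

lemma hasDerivWithinAt_inner_coef (hm : 0 < m) (hg : IsFreqDensity g) {s : ℕ} (hs : 1 ≤ s) {T : ℝ}
    {f : ℝ → L2} (hf : ContInH s T f) (heq : SolvesEq m κ (m * b ^ 2) g T f) (k : ℤ) (n : ℕ)
    {e : ℝ → ℝ} (he : IsBump e) {t : ℝ} (ht : t ∈ Icc 0 T) :
    HasDerivWithinAt (fun τ => inner ℂ (realLp e he.memLp) (coef b (k, n) (toC (f τ))))
      (inner ℂ (realLp e he.memLp) (modeRHS m κ b hg (toC (f t)) k n)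
        + inner ℂ (realLp _ (he.mul_left contDiff_id).memLp)
          (-(((k : ℂ) * Complex.I) • coef b (k, n) (toC (f t))))) (Icc 0 T) t := by
  have hH := hf.1 t ht
  have h00 := hH.isWeakDeriv (i := 0) (j := 0) (Nat.zero_le _)
  rw [hH.weakDeriv_zero] at h00
  rw [← testedRHS_eq hm hg (hH.isWeakDeriv (i := 1) (j := 0) hs) (hH.isWeakDeriv (i := 0) (j := 1) hs)
    h00]
  exact hasDerivWithinAt_inner_hermite hm hg hs hf heq k n he ht

lemma continuousOn_modeRHS (hg : IsFreqDensity g) {T : ℝ} {u : ℝ → L2C}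
    (hu : ContinuousOn u (Icc 0 T)) (k : ℤ) (n : ℕ) :
    ContinuousOn (fun t => modeRHS m κ b hg (u t) k n) (Icc 0 T) := by
  have hc : ∀ i {w : ℝ → L2C}, ContinuousOn w (Icc 0 T) →
      ContinuousOn (fun t => coef b i (w t)) (Icc 0 T) := fun i w hw =>
    (coef b i).continuous.comp_continuousOn hw
  have hZ : ContinuousOn (fun t => orderZ b hg (u t)) (Icc 0 T) :=
    (continuous_orderZ hg).comp_continuousOn hu
  have h1 := hc (k, n + 1) hu
  have h2 := hc (k, n - 1) hu
  have h3 := hc (k, n) hu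
  have h5 : ContinuousOn (fun t => u t + rootM b hg) (Icc 0 T) := hu.fun_add continuousOn_const
  have h4 := hc (k, n - 1) (orderMul_continuousOn hZ h5)
  unfold modeRHS velCoef
  clear hc hZ hu h5
  exact ((((h1.fun_const_smul _).fun_add (h2.fun_const_smul _)).fun_const_smul _).fun_neg.fun_sub
    (h3.fun_const_smul _)).fun_add ((h4.fun_const_smul _).fun_const_smul _)

/-- The equation for the coefficients after a frequency cutoff. -/
theorem hasDerivWithinAt_zetaOp_coef (hm : 0 < m) (hg : IsFreqDensity g) {s : ℕ} (hs : 1 ≤ s) {T : ℝ}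
    {f : ℝ → L2} (hf : ContInH s T f) (heq : SolvesEq m κ (m * b ^ 2) g T f) (R : ℕ) (k : ℤ) (n : ℕ)
    {t : ℝ} (ht : t ∈ Icc 0 T) :
    HasDerivWithinAt (fun τ => zetaOp R (coef b (k, n) (toC (f τ))))
      (zetaOp R (modeRHS m κ b hg (toC (f t)) k n)
        - ((k : ℂ) * Complex.I) • nuOp R (coef b (k, n) (toC (f t)))) (Icc 0 T) t := by
  have hu := hf.continuousOn_toC_self
  have hD : ContinuousOn (fun t => zetaOp R (modeRHS m κ b hg (toC (f t)) k n)
        - ((k : ℂ) * Complex.I) • nuOp R (coef b (k, n) (toC (f t)))) (Icc 0 T) :=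
    ContinuousOn.sub ((zetaOp R).continuous.comp_continuousOn (continuousOn_modeRHS hg hu k n))
      (by fun_prop)
  refine hasDerivWithinAt_Icc_of_eq_integral hD (fun t ht => ?_) t ht
  -- The product of ν with a coefficient need not be square integrable. Moving the cutoff onto the
  -- test function e leaves only admissible test functions, ζ_R e and νζ_R e.
  refine freqL2_ext_bump fun e he => ?_
  have hDi : IntervalIntegrable (fun t => zetaOp R (modeRHS m κ b hg (toC (f t)) k n)
        - ((k : ℂ) * Complex.I) • nuOp R (coef b (k, n) (toC (f t)))) volume 0 t :=
    (hD.mono (by rw [uIcc_of_le ht.1]; exact Icc_subset_Icc_right ht.2)).intervalIntegrable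
  rw [inner_add_right]
  have h1 := (innerSL ℂ (realLp e he.memLp)).intervalIntegral_comp_comm hDi
  simp only [innerSL_apply_apply] at h1
  rw [← h1]
  have key := integral_eq_sub_of_hasDerivWithinAt_Icc (T := T)
    (Φ := fun τ => inner ℂ (realLp e he.memLp) (zetaOp R (coef b (k, n) (toC (f τ)))))
    (D := fun t => inner ℂ (realLp e he.memLp) (zetaOp R (modeRHS m κ b hg (toC (f t)) k n)
        - ((k : ℂ) * Complex.I) • nuOp R (coef b (k, n) (toC (f t)))))
    (ContinuousOn.inner continuousOn_const hD) (fun t ht => ?_) le_rfl ht.1 ht.2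
  · rw [key]; ring
  · have h := hasDerivWithinAt_inner_coef hm hg hs hf heq k n (he.mul_left (isBump_cutoff R).1) ht
    have e1 : ∀ x, inner ℂ (realLp e he.memLp) (zetaOp R x) = _ :=
      fun x => inner_realLp_mulCLM (isBump_cutoff R) he x
    have e2 : ∀ x, inner ℂ (realLp e he.memLp) (nuOp R x) = _ :=
      fun x => inner_realLp_mulCLM ((isBump_cutoff R).mul_left contDiff_id) he x
    simp only [e1, e2, inner_sub_right, inner_smul_right]
    refine h.congr_deriv ?_
    rw [inner_neg_right, inner_smul_right, ← sub_eq_add_neg]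
    congr 4
    ext v
    simp only [id_eq]; ring

end Equation

end KuramotoSakaguchi
end

/-! ### Negative parts: integration by parts in velocity and differentiation along curves in L². -/

noncomputable section
namespace KuramotoSakaguchi
open Filter Topology
open scoped BoundedContinuousFunction

/-! ### Negative parts -/

/-- The negative part of a real number. -/
def negPart (x : ℝ) : ℝ := max (-x) 0

/-- The indicator of the negative half line. -/
def negInd (x : ℝ) : ℝ := if x < 0 then 1 else 0

lemma negPart_nonneg (x : ℝ) : 0 ≤ negPart x := le_max_right _ _

lemma negInd_mul_self (x : ℝ) : negInd x * x = -negPart x := by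
  unfold negInd negPart
  split_ifs with h
  · rw [max_eq_left (by linarith)]; ring
  · rw [max_eq_right (by linarith [not_lt.1 h])]; ring

lemma negInd_nonneg (x : ℝ) : 0 ≤ negInd x := by unfold negInd; split_ifs <;> norm_num

lemma negInd_le_one (x : ℝ) : negInd x ≤ 1 := by unfold negInd; split_ifs <;> norm_num

lemma negInd_sq (x : ℝ) : negInd x ^ 2 = negInd x := by unfold negInd; split_ifs <;> norm_num

lemma continuous_negPart : Continuous negPart := continuous_neg.max continuous_const

lemma abs_negPart_le (x : ℝ) : |negPart x| ≤ |x| := by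
  rw [abs_of_nonneg (negPart_nonneg x)]
  exact max_le (neg_le_abs x) (abs_nonneg x)

lemma measurable_negInd : Measurable negInd :=
  Measurable.ite measurableSet_Iio measurable_const measurable_const

lemma hasDerivAt_negPart_comp {u : ℝ → ℝ} {u' v : ℝ} (hu : HasDerivAt u u' v) (h0 : u v ≠ 0) :
    HasDerivAt (fun v => negPart (u v)) (-(negInd (u v) * u')) v := by
  rcases lt_or_gt_of_ne h0 with h | h
  · have h1 : (fun v => negPart (u v)) =ᶠ[𝓝 v] fun v => -u v := by
      filter_upwards [hu.continuousAt.eventually (Iio_mem_nhds h)] with y hy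
      exact max_eq_left (by linarith [show u y < 0 from hy])
    rw [negInd, if_pos h, one_mul]
    exact hu.fun_neg.congr_of_eventuallyEq h1
  · have h1 : (fun v => negPart (u v)) =ᶠ[𝓝 v] fun _ => 0 := by
      filter_upwards [hu.continuousAt.eventually (Ioi_mem_nhds h)] with y hy
      exact max_eq_right (by linarith [show 0 < u y from hy])
    rw [negInd, if_neg (not_lt.2 h.le), zero_mul, neg_zero]
    exact (hasDerivAt_const v 0).congr_of_eventuallyEq h1

lemma hasDerivAt_sq_negPart (x : ℝ) : HasDerivAt (fun x => negPart x ^ 2 / 2) (-negPart x) x := by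
  rcases lt_trichotomy x 0 with h | h | h
  · have h1 := ((hasDerivAt_negPart_comp (hasDerivAt_id x) h.ne).pow 2).div_const 2
    refine h1.congr_deriv ?_
    simp [negInd, h]
    ring
  · subst h
    rw [show -negPart 0 = (0 : ℝ) by simp [negPart]]
    rw [hasDerivAt_iff_isLittleO_nhds_zero]
    refine Asymptotics.IsBigO.trans_isLittleO (g := fun h : ℝ => h ^ 2) ?_ ?_
    · refine Asymptotics.IsBigO.of_bound 1 (.of_forall fun h => ?_)
      have h2 := abs_negPart_le h
      have h3 : negPart h ^ 2 ≤ h ^ 2 := sq_le_sq.2 h2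
      simp only [zero_add, smul_zero, sub_zero]
      rw [show negPart 0 = (0 : ℝ) by simp [negPart], zero_pow two_ne_zero, zero_div, sub_zero,
        Real.norm_of_nonneg (by positivity), Real.norm_of_nonneg (by positivity)]
      linarith [sq_nonneg (negPart h)]
    · simpa using Asymptotics.isLittleO_pow_id (𝕜 := ℝ) (n := 2) (by norm_num)
  · have h1 := ((hasDerivAt_negPart_comp (hasDerivAt_id x) h.ne').pow 2).div_const 2
    refine h1.congr_deriv ?_
    simp [negInd, h.le, not_lt.2 h.le, negPart]

section Line
open Polynomial
variable {b : ℝ}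

lemma tendsto_polyGauss_mul (hb : 0 < b) (p q : ℝ[X]) :
    Tendsto (fun v => polyGauss b p v * polyGauss b q v) atTop (𝓝 0) ∧
      Tendsto (fun v => polyGauss b p v * polyGauss b q v) atBot (𝓝 0) := by
  have hd := fun v => (hasDerivAt_polyGauss hb p v).fun_mul (hasDerivAt_polyGauss hb q v)
  have hi := (integrable_polyGauss_mul hb (C b⁻¹ * (derivative p - C (1 / 2) * (X * p))) q).fun_add
    (integrable_polyGauss_mul hb p (C b⁻¹ * (derivative q - C (1 / 2) * (X * q))))
  exact ⟨tendsto_zero_of_hasDerivAt_of_integrableOn_Ioi (a := 0) (fun v _ => hd v) hi.integrableOn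
      (integrable_polyGauss_mul hb p q).integrableOn,
    tendsto_zero_of_hasDerivAt_of_integrableOn_Iic (a := 0) (fun v _ => hd v) hi.integrableOn
      (integrable_polyGauss_mul hb p q).integrableOn⟩

lemma integrable_negPart_polyGauss (hb : 0 < b) (p q : ℝ[X]) :
    Integrable (fun v => negPart (polyGauss b p v) * polyGauss b q v) := by
  refine (integrable_polyGauss_mul hb p q).mono ?_ (.of_forall fun v => ?_)
  · exact ((continuous_negPart.comp (continuous_polyGauss b p)).mul
      (continuous_polyGauss b q)).aestronglyMeasurable
  · rw [norm_mul, norm_mul]; gcongr; exact abs_negPart_le _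

lemma integrable_negInd_polyGauss (hb : 0 < b) (p q r : ℝ[X]) :
    Integrable (fun v => negInd (polyGauss b p v) * (polyGauss b q v * polyGauss b r v)) := by
  refine (integrable_polyGauss_mul hb q r).bdd_mul (c := 1) ?_ (.of_forall fun v => ?_)
  · exact (measurable_negInd.comp (continuous_polyGauss b p).measurable).aestronglyMeasurable
  · rw [Real.norm_of_nonneg (negInd_nonneg _)]; exact negInd_le_one _

/-- Integration by parts against a negative part. -/
lemma integral_negPart_polyGauss (hb : 0 < b) (p q : ℝ[X]) :
    ∫ v, (negPart (polyGauss b p v) * polyGauss b (X * q - derivative q) v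
      + negInd (polyGauss b p v) * (polyGauss b q v * polyGauss b (derivative p) v)) = 0 := by
  rcases eq_or_ne p 0 with rfl | hp
  · simp [polyGauss, negPart, negInd]
  set Φ : ℝ → ℝ := fun v => negPart (polyGauss b p v) * polyGauss b q v with hΦ
  set D : ℝ → ℝ := fun v => negPart (polyGauss b p v) * polyGauss b (X * q - derivative q) v
      + negInd (polyGauss b p v) * (polyGauss b q v * polyGauss b (derivative p) v) with hD
  have hDi : Integrable D := (integrable_negPart_polyGauss hb _ _).fun_add
    (integrable_negInd_polyGauss hb _ _ _)
  -- The negative part fails to be differentiable only at zeros of the polynomial. The fundamental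
  -- theorem of calculus tolerates this countable set, and the negative part vanishes there, so no
  -- boundary terms arise.
  have hroots : {v : ℝ | polyGauss b p v = 0}.Countable := by
    have h1 : {v : ℝ | polyGauss b p v = 0} ⊆ (fun v => v / b) ⁻¹' {x | p.IsRoot x} := by
      intro v hv
      have hv' : polyGauss b p v = 0 := hv
      rw [polyGauss, mul_eq_zero] at hv'
      refine hv'.resolve_right ?_
      positivity
    refine Set.Countable.mono h1 (Set.Countable.preimage_of_injOn ?_ ?_)
    · exact (finite_setOfPred_isRoot hp).countable
    · intro x _ y _ hxy
      exact (div_left_inj' hb.ne').1 hxy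
  have hder : ∀ v, polyGauss b p v ≠ 0 → HasDerivAt Φ (-(b⁻¹ * D v)) v := by
    intro v hv
    have h1 := (hasDerivAt_negPart_comp (hasDerivAt_polyGauss hb p v) hv).fun_mul
      (hasDerivAt_polyGauss hb q v)
    refine h1.congr_deriv ?_
    have h2 := negInd_mul_self (polyGauss b p v)
    have h3 : ∀ r : ℝ[X], polyGauss b (C b⁻¹ * (derivative r - C (1 / 2) * (X * r))) v
        = b⁻¹ * (polyGauss b (derivative r) v - 1 / 2 * (v / b * polyGauss b r v)) := fun r => by
      simp only [polyGauss, eval_mul, eval_C, eval_sub, eval_X]; ring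
    have h4 : polyGauss b (X * q - derivative q) v = v / b * polyGauss b q v
        - polyGauss b (derivative q) v := by
      simp only [polyGauss, eval_mul, eval_sub, eval_X]; ring
    simp only [hD]
    rw [h3, h3, h4]
    linear_combination (b⁻¹ * (1 / 2) * (v / b) * polyGauss b q v) * h2
  have hc : Continuous Φ := (continuous_negPart.comp (continuous_polyGauss b p)).mul
    (continuous_polyGauss b q)
  have hlim : ∀ l : Filter ℝ, Tendsto (fun v => polyGauss b p v * polyGauss b q v) l (𝓝 0) →
      Tendsto Φ l (𝓝 0) := fun l hl => by
    refine squeeze_zero_norm (a := fun v => ‖polyGauss b p v * polyGauss b q v‖) (fun v => ?_)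
      (by simpa using hl.norm)
    rw [norm_mul, norm_mul]; gcongr; exact abs_negPart_le _
  have hint : ∀ R : ℝ, 0 ≤ R → ∫ v in (-R)..R, -(b⁻¹ * D v) = Φ R - Φ (-R) := fun R hR =>
    integral_eq_of_hasDerivAt_off_countable_of_le Φ _ (by linarith) hroots hc.continuousOn
      (fun v hv => hder v hv.2) (hDi.const_mul _).neg.intervalIntegrable
  have t1 : Tendsto (fun R : ℝ => ∫ v in (-R)..R, -(b⁻¹ * D v)) atTop (𝓝 (∫ v, -(b⁻¹ * D v))) :=
    intervalIntegral_tendsto_integral (hDi.const_mul _).neg tendsto_neg_atTop_atBot tendsto_id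
  have t2 : Tendsto (fun R : ℝ => Φ R - Φ (-R)) atTop (𝓝 (0 - 0)) :=
    (hlim _ (tendsto_polyGauss_mul hb p q).1).sub
      ((hlim _ (tendsto_polyGauss_mul hb p q).2).comp tendsto_neg_atTop_atBot)
  have t3 : ∫ v, -(b⁻¹ * D v) = 0 - 0 := by
    refine tendsto_nhds_unique (t1.congr' ?_) t2
    filter_upwards [eventually_ge_atTop 0] with R hR
    exact hint R hR
  rw [integral_neg, integral_const_mul] at t3
  have hb' : b⁻¹ ≠ 0 := inv_ne_zero hb.ne'
  have : b⁻¹ * ∫ v, D v = 0 := by linarith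
  exact (mul_eq_zero.1 this).resolve_left hb'

end Line

lemma lipschitzWith_negPart_re : LipschitzWith 1 (fun z : ℂ => ((negPart z.re : ℝ) : ℂ)) := by
  refine LipschitzWith.of_dist_le_mul fun x y => ?_
  rw [dist_eq_norm, dist_eq_norm, ← Complex.ofReal_sub, Complex.norm_real]
  have h1 : |negPart x.re - negPart y.re| ≤ |x.re - y.re| := by
    have := abs_max_sub_max_le_abs (-x.re) (-y.re) 0
    rwa [neg_sub_neg, abs_sub_comm y.re] at this
  calc _ ≤ |x.re - y.re| := h1
    _ = |(x - y).re| := by rw [Complex.sub_re]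
    _ ≤ _ := by simpa using Complex.abs_re_le_norm (x - y)

/-- The negative part of the real part, on `L²`. -/
def negLp (u : L2C) : L2C := lipschitzWith_negPart_re.compLp (by simp [negPart]) u

lemma coeFn_negLp (u : L2C) : negLp u =ᵐ[volume] fun z => ((negPart (u z).re : ℝ) : ℂ) :=
  LipschitzWith.coeFn_compLp _ _ _

lemma continuous_negLp : Continuous negLp :=   lipschitzWith_negPart_re.continuous_compLp (by simp [negPart])

lemma integrable_re_mul_re (u w : L2C) : Integrable (fun z => (u z).re * (w z).re) :=
  (Lp.memLp u).re.integrable_mul (Lp.memLp w).re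

lemma re_inner_negLp (u w : L2C) :
    (inner ℂ (negLp u) w).re = ∫ z, negPart (u z).re * (w z).re := by
  rw [L2.inner_def]
  have h1 := integral_re (L2.integrable_inner (𝕜 := ℂ) (negLp u) w)
  simp only [RCLike.re_to_complex] at h1
  rw [← h1]
  refine integral_congr_ae ?_
  filter_upwards [coeFn_negLp u] with z hz
  rw [hz, RCLike.inner_apply, Complex.conj_ofReal, Complex.re_mul_ofReal, mul_comm]

lemma norm_negLp_sq (u : L2C) : ‖negLp u‖ ^ 2 = ∫ z, negPart (u z).re ^ 2 := by
  have h := re_inner_negLp u (negLp u)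
  rw [inner_self_eq_norm_sq_to_K] at h
  have h2 : ((‖negLp u‖ : ℂ) ^ 2).re = ‖negLp u‖ ^ 2 := by
    rw [← Complex.ofReal_pow, Complex.ofReal_re]
  rw [← h2]
  refine h.trans (integral_congr_ae ?_)
  filter_upwards [coeFn_negLp u] with z hz
  rw [hz, Complex.ofReal_re, pow_two]

/-- The function (x⁻)²/2 has a derivative with Lipschitz constant 1, hence a quadratic Taylor
remainder. A remainder uniform in x gives Fréchet differentiability of the squared norm on L². -/
lemma abs_sq_negPart_sub_le (x h : ℝ) :
    |negPart (x + h) ^ 2 / 2 - negPart x ^ 2 / 2 + negPart x * h| ≤ h ^ 2 / 2 := by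
  unfold negPart
  rw [abs_le]
  rcases le_total (-(x + h)) 0 with h1 | h1 <;> rcases le_total (-x) 0 with h2 | h2 <;>
    simp only [max_eq_right h1, max_eq_left h1, max_eq_right h2, max_eq_left h2] <;>
    constructor <;> nlinarith [sq_nonneg (x + h), sq_nonneg x, sq_nonneg h]

/-- The derivative of half the squared norm of the negative part along a curve. -/
lemma hasDerivWithinAt_norm_negLp_sq {W : ℝ → L2C} {W' : L2C} {s : Set ℝ} {t : ℝ}
    (hW : HasDerivWithinAt W W' s t) :
    HasDerivWithinAt (fun τ => ‖negLp (W τ)‖ ^ 2 / 2) (-(inner ℂ (negLp (W t)) W').re) s t := by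
  set L : L2C →L[ℝ] ℝ := -(Complex.reCLM.comp
    ((innerSL ℂ (negLp (W t))).restrictScalars ℝ)) with hL
  have hLa : ∀ h, L h = -(inner ℂ (negLp (W t)) h).re := fun h => rfl
  have hF : HasFDerivAt (fun u : L2C => ‖negLp u‖ ^ 2 / 2) L (W t) := by
    rw [hasFDerivAt_iff_isLittleO_nhds_zero]
    refine Asymptotics.IsBigO.trans_isLittleO (g := fun h : L2C => ‖h‖ ^ 2) ?_ ?_
    · refine Asymptotics.IsBigO.of_bound (1 / 2) (.of_forall fun h => ?_)
      set u := W t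
      have hn : ‖(‖h‖ ^ 2 : ℝ)‖ = ‖h‖ ^ 2 := Real.norm_of_nonneg (by positivity)
      rw [hLa, norm_negLp_sq, norm_negLp_sq, re_inner_negLp, hn, sub_neg_eq_add]
      have i1 : ∀ u : L2C, Integrable (fun z => negPart (u z).re ^ 2 / 2) := fun u => by
        refine Integrable.div_const ?_ 2
        have := integrable_re_mul_re (negLp u) (negLp u)
        refine this.congr ?_
        filter_upwards [coeFn_negLp u] with z hz
        rw [hz, Complex.ofReal_re, pow_two]
      have i2 : Integrable (fun z => negPart (u z).re * (h z).re) := by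
        refine (integrable_re_mul_re (negLp u) h).congr ?_
        filter_upwards [coeFn_negLp u] with z hz
        rw [hz, Complex.ofReal_re]
      have i12 : Integrable (fun z => negPart ((u + h : L2C) z).re ^ 2 / 2 - negPart (u z).re ^ 2 / 2) :=
        (i1 (u + h)).sub (i1 u)
      rw [← integral_div, ← integral_div, ← integral_sub (i1 _) (i1 _), ← integral_add i12 i2]
      have i3 : Integrable (fun z => ‖h z‖ ^ 2) := (Lp.memLp h).integrable_norm_pow two_ne_zero
      have e3 : ‖h‖ ^ 2 = ∫ z, ‖h z‖ ^ 2 := by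
        have := norm_toLp_sq (Lp.memLp h)
        rwa [Lp.toLp_coeFn] at this
      rw [e3, ← integral_const_mul]
      refine norm_integral_le_of_norm_le (i3.const_mul _) ?_
      filter_upwards [Lp.coeFn_add u h] with z hz
      rw [Real.norm_eq_abs, hz, Pi.add_apply, Complex.add_re]
      refine (abs_sq_negPart_sub_le _ _).trans ?_
      have := Complex.abs_re_le_norm (h z)
      have h5 : (h z).re ^ 2 ≤ ‖h z‖ ^ 2 := by
        rw [← sq_abs]; gcongr
      linarith
    · have := Asymptotics.isLittleO_norm_pow_id (E' := L2C) (n := 2) (by norm_num)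
      exact this
  exact (hF.comp_hasDerivWithinAt t hW).congr_deriv (hLa W')

end KuramotoSakaguchi
end

/-! ### Finite mode sums and the pairing of negative parts with creation and transport. -/

noncomputable section
namespace KuramotoSakaguchi
open Filter Topology
open scoped BoundedContinuousFunction

/-! ### Finite mode sums -/

section Synth
variable {b : ℝ} [hb : Fact (0 < b)] (K : Finset ℤ) (N : ℕ)

variable (b) in
/-- The finite mode sum with coefficients `x`. -/
def synth (x : ℤ → ℕ → FreqL2) : L2C := ∑ i ∈ K ×ˢ Finset.range N, modeEmb b i (x i.1 i.2)

lemma norm_synth_sq (x : ℤ → ℕ → FreqL2) :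
    ‖synth b K N x‖ ^ 2 = ∑ i ∈ K ×ˢ Finset.range N, ‖x i.1 i.2‖ ^ 2 :=
  (orthogonalFamily_modeEmb (b := b)).norm_sum (fun i => x i.1 i.2) _

lemma coef_synth (x : ℤ → ℕ → FreqL2) (i : ℤ × ℕ) : coef b i (synth b K N x)
    = if i ∈ K ×ˢ Finset.range N then x i.1 i.2 else 0 := by
  rw [synth, map_sum]
  simp_rw [coef_modeEmb]
  rw [Finset.sum_ite_eq]

lemma synth_add (x y : ℤ → ℕ → FreqL2) :
    synth b K N (fun k n => x k n + y k n) = synth b K N x + synth b K N y := by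
  simp only [synth, map_add, Finset.sum_add_distrib]

lemma synth_smul (c : ℂ) (x : ℤ → ℕ → FreqL2) :
    synth b K N (fun k n => c • x k n) = c • synth b K N x := by
  simp only [synth, map_smul, Finset.smul_sum]

lemma coeFn_modeEmb (i : ℤ × ℕ) (η : FreqL2) : modeEmb b i η =ᵐ[volume] fun z =>
    circMode i.1 z.1 * ((hermiteFun b i.2 (z.2.1 - z.2.2) : ℂ) * η z.2.2) := by
  rw [modeEmb_apply]
  filter_upwards [coeFn_sep i.1 (hermiteLp b i.2) η, ae_velocity (coeFn_hermiteLp (b := b) i.2)]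
    with z h1 h2
  rw [h1, sepFun, h2]

lemma coeFn_synth (x : ℤ → ℕ → FreqL2) : synth b K N x =ᵐ[volume] fun z =>
    ∑ i ∈ K ×ˢ Finset.range N,
      circMode i.1 z.1 * ((hermiteFun b i.2 (z.2.1 - z.2.2) : ℂ) * x i.1 i.2 z.2.2) := by
  have h : ∀ᵐ z : Phase, ∀ i : ℤ × ℕ, modeEmb b i (x i.1 i.2) z =
      circMode i.1 z.1 * ((hermiteFun b i.2 (z.2.1 - z.2.2) : ℂ) * x i.1 i.2 z.2.2) :=
    ae_all_iff.2 fun i => coeFn_modeEmb i _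
  filter_upwards [h, Lp.coeFn_finsetSum (K ×ˢ Finset.range N) (fun i => modeEmb b i (x i.1 i.2))]
    with z h1 h2
  rw [synth, h2, Finset.sum_apply]
  exact Finset.sum_congr rfl fun i _ => h1 i

open Polynomial in
/-- The polynomial of the velocity profile of a finite mode sum at fixed phase and frequency. -/
def synthPoly (X : ℤ → ℕ → ℂ) (θ : Circ) : ℝ[X] :=
  ∑ k ∈ K, ∑ n ∈ Finset.range N, C ((circMode k θ * X k n).re) * hermitePoly n

lemma polyGauss_sum {ι : Type*} (a : ℝ) (s : Finset ι) (p : ι → Polynomial ℝ) (v : ℝ) :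
    polyGauss a (∑ i ∈ s, p i) v = ∑ i ∈ s, polyGauss a (p i) v := by
  simp only [polyGauss, Polynomial.eval_finsetSum, Finset.sum_mul]

lemma polyGauss_synthPoly (a : ℝ) (X : ℤ → ℕ → ℂ) (θ : Circ) (v : ℝ) :
    polyGauss a (synthPoly K N X θ) v = (∑ i ∈ K ×ˢ Finset.range N,
      circMode i.1 θ * ((hermiteFun a i.2 v : ℂ) * X i.1 i.2)).re := by
  rw [synthPoly, polyGauss_sum, Complex.re_sum, Finset.sum_product]
  refine Finset.sum_congr rfl fun k _ => ?_
  rw [polyGauss_sum]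
  refine Finset.sum_congr rfl fun n _ => ?_
  rw [polyGauss_C_mul, mul_left_comm, Complex.re_ofReal_mul, mul_comm]
  rfl

lemma re_synth (x : ℤ → ℕ → FreqL2) : ∀ᵐ z : Phase, (synth b K N x z).re
    = polyGauss b (synthPoly K N (fun k n => x k n z.2.2) z.1) (z.2.1 - z.2.2) := by
  filter_upwards [coeFn_synth (b := b) K N x] with z hz
  rw [hz, polyGauss_synthPoly]

/-- The action of the creation operator on coefficients. -/
def raiseSeq (y : ℤ → ℕ → FreqL2) (k : ℤ) (n : ℕ) : FreqL2 := ((Real.sqrt n : ℝ) : ℂ) • y k (n - 1)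

/-- The action of the annihilation operator on coefficients. -/
def lowerSeq (x : ℤ → ℕ → FreqL2) (k : ℤ) (n : ℕ) : FreqL2 :=
  ((Real.sqrt (n + 1) : ℝ) : ℂ) • x k (n + 1)

-- At fixed θ and ν the velocity profile of a finite mode sum is a polynomial times a Gaussian, and
-- raising the coefficients applies X − d/dx to it. One more Hermite level is needed to hold the
-- result.
open Polynomial in
lemma synthPoly_raise (Y : ℤ → ℕ → ℂ) (θ : Circ) :
    synthPoly K (N + 1) (fun k n => ((Real.sqrt n : ℝ) : ℂ) * Y k (n - 1)) θ
      = X * synthPoly K N Y θ - derivative (synthPoly K N Y θ) := by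
  simp only [synthPoly, derivative_sum, Finset.mul_sum, ← Finset.sum_sub_distrib]
  refine Finset.sum_congr rfl fun k _ => ?_
  rw [Finset.sum_range_succ']
  simp only [Nat.cast_zero, Real.sqrt_zero, Complex.ofReal_zero, zero_mul, mul_zero, Complex.zero_re,
    C_0, add_zero]
  refine Finset.sum_congr rfl fun n _ => ?_
  rw [derivative_mul, derivative_C, zero_mul, zero_add, mul_left_comm (circMode k θ),
    Complex.re_ofReal_mul, C_mul, Nat.add_sub_cancel, Nat.cast_add, Nat.cast_one]
  linear_combination (-C (circMode k θ * Y k n).re) * hermitePoly_raise n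

-- Lowering the coefficients differentiates the polynomial; the sum on the right has one more level
-- because its n = 0 term is annihilated.
open Polynomial in
lemma synthPoly_lower (Y : ℤ → ℕ → ℂ) (θ : Circ) :
    synthPoly K N (fun k n => ((Real.sqrt (n + 1) : ℝ) : ℂ) * Y k (n + 1)) θ
      = derivative (synthPoly K (N + 1) Y θ) := by
  simp only [synthPoly, derivative_sum]
  refine Finset.sum_congr rfl fun k _ => ?_
  rw [Finset.sum_range_succ']
  simp only [derivative_mul, derivative_C, zero_mul, zero_add, derivative_hermitePoly]
  rw [Nat.cast_zero, Real.sqrt_zero, C_0, zero_mul, mul_zero, add_zero]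
  refine Finset.sum_congr rfl fun n _ => ?_
  rw [mul_left_comm (circMode k θ), Complex.re_ofReal_mul, C_mul, Nat.add_sub_cancel, Nat.cast_add,
    Nat.cast_one]
  ring

lemma re_synth_raise (y : ℤ → ℕ → FreqL2) : ∀ᵐ z : Phase, (synth b K (N + 1) (raiseSeq y) z).re
    = polyGauss b (Polynomial.X * synthPoly K N (fun k n => y k n z.2.2) z.1
      - Polynomial.derivative (synthPoly K N (fun k n => y k n z.2.2) z.1)) (z.2.1 - z.2.2) := by
  have h : ∀ᵐ z : Phase, ∀ i : ℤ × ℕ, raiseSeq y i.1 i.2 z.2.2 =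
      ((Real.sqrt i.2 : ℝ) : ℂ) * y i.1 (i.2 - 1) z.2.2 :=
    ae_all_iff.2 fun i => ae_frequency (Lp.coeFn_smul _ _)
  filter_upwards [re_synth (b := b) K (N + 1) (raiseSeq y), h] with z h1 h2
  rw [h1, ← synthPoly_raise]
  congr 2
  funext k n
  exact h2 (k, n)

lemma re_synth_lower (x : ℤ → ℕ → FreqL2) : ∀ᵐ z : Phase, (synth b K N (lowerSeq x) z).re
    = polyGauss b (Polynomial.derivative (synthPoly K (N + 1) (fun k n => x k n z.2.2) z.1))
      (z.2.1 - z.2.2) := by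
  have h : ∀ᵐ z : Phase, ∀ i : ℤ × ℕ, lowerSeq x i.1 i.2 z.2.2 =
      ((Real.sqrt (i.2 + 1) : ℝ) : ℂ) * x i.1 (i.2 + 1) z.2.2 :=
    ae_all_iff.2 fun i => ae_frequency (Lp.coeFn_smul _ _)
  filter_upwards [re_synth (b := b) K N (lowerSeq x), h] with z h1 h2
  rw [h1, ← synthPoly_lower]
  congr 2
  funext k n
  exact h2 (k, n)

lemma integral_eq_zero_of_velocity {D : Phase → ℝ} (hD : Integrable D)
    (h : ∀ θ ν, ∫ ω : ℝ, D (θ, ω, ν) = 0) : ∫ z, D z = 0 := by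
  rw [show (volume : Measure Phase) = volume.prod volume from rfl] at hD ⊢
  rw [integral_prod _ hD]
  have h2 : ∀ᵐ θ : Circ, ∫ y : ℝ × ℝ, D (θ, y) = 0 := by
    filter_upwards [hD.prod_right_ae] with θ hθ
    rw [show (volume : Measure (ℝ × ℝ)) = volume.prod volume from rfl] at hθ ⊢
    rw [integral_prod_symm _ hθ]
    simp [h]
  rw [integral_congr_ae h2, integral_zero]

lemma integral_eq_zero_of_phase {D : Phase → ℝ} (hD : Integrable D)
    (h : ∀ y : ℝ × ℝ, ∫ θ : Circ, D (θ, y) = 0) : ∫ z, D z = 0 := by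
  rw [show (volume : Measure Phase) = volume.prod volume from rfl] at hD ⊢
  rw [integral_prod_symm _ hD]
  simp [h]

lemma aestronglyMeasurable_negInd (u : L2C) :
    AEStronglyMeasurable (fun z => negInd (u z).re) volume :=
  (measurable_negInd.comp (Complex.measurable_re.comp
    (Lp.stronglyMeasurable u).measurable)).aestronglyMeasurable

lemma integrable_negInd_mul (u v w : L2C) :
    Integrable (fun z => negInd (u z).re * ((v z).re * (w z).re)) := by
  refine (integrable_re_mul_re v w).bdd_mul (c := 1) (aestronglyMeasurable_negInd u)
    (.of_forall fun z => ?_)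
  rw [Real.norm_of_nonneg (negInd_nonneg _)]; exact negInd_le_one _

lemma integrable_negPart_mul (u w : L2C) : Integrable (fun z => negPart (u z).re * (w z).re) := by
  refine (integrable_re_mul_re (negLp u) w).congr ?_
  filter_upwards [coeFn_negLp u] with z hz
  rw [hz, Complex.ofReal_re]

/-- Integration by parts in the velocity against a negative part. -/
lemma re_inner_negLp_raise (x y : ℤ → ℕ → FreqL2) :
    (inner ℂ (negLp (synth b K (N + 1) x)) (synth b K (N + 1) (raiseSeq y))).re
      = -∫ z, negInd (synth b K (N + 1) x z).re *
        ((synth b K N y z).re * (synth b K N (lowerSeq x) z).re) := by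
  rw [re_inner_negLp, eq_neg_iff_add_eq_zero, ← integral_add (integrable_negPart_mul _ _)
    (integrable_negInd_mul _ _ _)]
  set P : Phase → Polynomial ℝ := fun z => synthPoly K (N + 1) (fun k n => x k n z.2.2) z.1 with hP
  set Q : Phase → Polynomial ℝ := fun z => synthPoly K N (fun k n => y k n z.2.2) z.1 with hQ
  set D : Phase → ℝ := fun z => negPart (polyGauss b (P z) (z.2.1 - z.2.2)) *
      polyGauss b (Polynomial.X * Q z - Polynomial.derivative (Q z)) (z.2.1 - z.2.2)
    + negInd (polyGauss b (P z) (z.2.1 - z.2.2)) * (polyGauss b (Q z) (z.2.1 - z.2.2)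
      * polyGauss b (Polynomial.derivative (P z)) (z.2.1 - z.2.2)) with hDdef
  have hae : (fun z => negPart (synth b K (N + 1) x z).re * (synth b K (N + 1) (raiseSeq y) z).re
      + negInd (synth b K (N + 1) x z).re *
        ((synth b K N y z).re * (synth b K N (lowerSeq x) z).re)) =ᵐ[volume] D := by
    filter_upwards [re_synth (b := b) K (N + 1) x, re_synth (b := b) K N y,
      re_synth_raise (b := b) K N y, re_synth_lower (b := b) K N x] with z h1 h2 h3 h4
    rw [h1, h2, h3, h4]
  rw [integral_congr_ae hae]
  refine integral_eq_zero_of_velocity (((integrable_negPart_mul _ _).add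
    (integrable_negInd_mul _ _ _)).congr hae) fun θ ν => ?_
  -- At fixed θ and ν a translation replaces ω − ν by v, where the one-dimensional integration by
  -- parts applies.
  have h := integral_sub_right_eq_self (fun v => negPart (polyGauss b (P (θ, 0, ν)) v) *
      polyGauss b (Polynomial.X * Q (θ, 0, ν) - Polynomial.derivative (Q (θ, 0, ν))) v
    + negInd (polyGauss b (P (θ, 0, ν)) v) * (polyGauss b (Q (θ, 0, ν)) v
      * polyGauss b (Polynomial.derivative (P (θ, 0, ν))) v)) ν (μ := volume)
  rw [integral_negPart_polyGauss hb.out] at h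
  exact h

/-- The integrand is the θ-derivative of −(u⁻)²/2, and u is periodic. -/
lemma integral_negPart_trig (y : ℤ → ℂ) :
    ∫ θ : Circ, negPart (∑ k ∈ K, circMode k θ * y k).re *
      (∑ k ∈ K, (k * Complex.I) * (circMode k θ * y k)).re = 0 := by
  set u : ℝ → ℝ := fun x => (∑ k ∈ K, circMode k (x : Circ) * y k).re with hu
  set u' : ℝ → ℝ := fun x => (∑ k ∈ K, (k * Complex.I) * (circMode k (x : Circ) * y k)).re with hu'
  have hd : ∀ x, HasDerivAt u (u' x) x := by
    intro x
    have h1 : ∀ k : ℤ, HasDerivAt (fun x : ℝ => circMode k (x : Circ) * y k)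
        ((k * Complex.I) * (circMode k (x : Circ) * y k)) x := fun k => by
      simp_rw [circMode_coe]
      have h2 : HasDerivAt (fun x : ℝ => ((k * x : ℝ) : ℂ) * Complex.I) (k * Complex.I) x := by
        have h3 : HasDerivAt (fun x : ℝ => ((k * x : ℝ))) (k * 1 : ℝ) x := (hasDerivAt_id x).const_mul _
        have h4 := h3.ofReal_comp.mul_const Complex.I
        refine h4.congr_deriv ?_
        push_cast; ring
      have h5 := (h2.cexp.const_mul (((Real.sqrt (2 * Real.pi))⁻¹ : ℝ) : ℂ)).mul_const (y k)
      refine h5.congr_deriv ?_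
      ring
    have h6 := HasDerivAt.fun_sum (u := K) (fun k _ => h1 k)
    exact Complex.reCLM.hasFDerivAt.comp_hasDerivAt x h6
  have hc : ∀ k : ℤ, Continuous (fun x : ℝ => circMode k (x : Circ)) := fun k =>
    (continuous_circMode k).comp (AddCircle.continuous_mk' _)
  have hcu' : Continuous u' := by fun_prop
  have hcu : Continuous u := by fun_prop
  have h7 := AddCircle.intervalIntegral_preimage (2 * Real.pi) 0 (fun θ : Circ =>
    negPart (∑ k ∈ K, circMode k θ * y k).re * (∑ k ∈ K, (k * Complex.I) * (circMode k θ * y k)).re)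
  rw [← h7]
  have h8 : ∀ x, HasDerivAt (fun x => -(negPart (u x) ^ 2 / 2)) (negPart (u x) * u' x) x := fun x => by
    have := ((hasDerivAt_sq_negPart (u x)).comp x (hd x)).neg
    refine this.congr_deriv ?_
    ring
  have h9 := intervalIntegral.integral_eq_sub_of_hasDerivAt (a := 0) (b := 0 + 2 * Real.pi)
    (fun x _ => h8 x)
    ((continuous_negPart.comp hcu).mul hcu').continuousOn.intervalIntegrable
  refine h9.trans ?_
  have h10 : u (0 + 2 * Real.pi) = u 0 := by
    simp only [hu, zero_add]
    rw [AddCircle.coe_period]; simp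
  rw [h10, sub_self]

lemma hermiteFun_recurrence (n : ℕ) (v : ℝ) : v * hermiteFun b n v
    = b * (Real.sqrt (n + 1) * hermiteFun b (n + 1) v + Real.sqrt n * hermiteFun b (n - 1) v) := by
  rw [hermiteFun, mul_polyGauss hb.out, polyGauss_C_mul, X_mul_hermitePoly, polyGauss_add,
    polyGauss_C_mul, polyGauss_C_mul]
  rfl

/-- Multiplication by v acts on coefficients by the three-term recurrence. The truncated identity is
exact because the coefficients from index N on vanish, so nothing is lost at the top. -/
lemma sum_velocity (X : ℕ → ℂ) (hX : ∀ n, N ≤ n → X n = 0) (v : ℝ) :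
    ∑ n ∈ Finset.range (N + 1), (hermiteFun b n v : ℂ) *
      (b * (((Real.sqrt (n + 1) : ℝ) : ℂ) * X (n + 1) + ((Real.sqrt n : ℝ) : ℂ) * X (n - 1)))
    = v * ∑ n ∈ Finset.range (N + 1), (hermiteFun b n v : ℂ) * X n := by
  have h1 : ∑ n ∈ Finset.range (N + 1), (hermiteFun b n v : ℂ) * (((Real.sqrt (n + 1) : ℝ) : ℂ) * X (n + 1))
      = ∑ n ∈ Finset.range (N + 1), ((Real.sqrt n : ℝ) : ℂ) * (hermiteFun b (n - 1) v : ℂ) * X n := by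
    rw [Finset.sum_range_succ, hX (N + 1) (by omega), Finset.sum_range_succ' _ N]
    simp only [mul_zero, add_zero, Nat.cast_zero, Real.sqrt_zero, Complex.ofReal_zero, zero_mul]
    refine Finset.sum_congr rfl fun n _ => ?_
    rw [Nat.add_sub_cancel, Nat.cast_add, Nat.cast_one]; ring
  have h2 : ∑ n ∈ Finset.range (N + 1), (hermiteFun b n v : ℂ) * (((Real.sqrt n : ℝ) : ℂ) * X (n - 1))
      = ∑ n ∈ Finset.range (N + 1), ((Real.sqrt (n + 1) : ℝ) : ℂ) * (hermiteFun b (n + 1) v : ℂ) * X n := by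
    rw [Finset.sum_range_succ' _ N, Finset.sum_range_succ _ N, hX N le_rfl]
    simp only [mul_zero, add_zero, Nat.cast_zero, Real.sqrt_zero, Complex.ofReal_zero, zero_mul]
    refine Finset.sum_congr rfl fun n _ => ?_
    rw [Nat.add_sub_cancel, Nat.cast_add, Nat.cast_one]; ring
  have h3 : ∀ n, (v : ℂ) * (hermiteFun b n v : ℂ) = b * (((Real.sqrt (n + 1) : ℝ) : ℂ) *
      (hermiteFun b (n + 1) v : ℂ) + ((Real.sqrt n : ℝ) : ℂ) * (hermiteFun b (n - 1) v : ℂ)) := fun n => by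
    exact_mod_cast congrArg (fun x : ℝ => (x : ℂ)) (hermiteFun_recurrence (b := b) n v)
  calc _ = b * (∑ n ∈ Finset.range (N + 1), (hermiteFun b n v : ℂ) * (((Real.sqrt (n + 1) : ℝ) : ℂ) * X (n + 1))
        + ∑ n ∈ Finset.range (N + 1), (hermiteFun b n v : ℂ) * (((Real.sqrt n : ℝ) : ℂ) * X (n - 1))) := by
        rw [← Finset.sum_add_distrib, Finset.mul_sum]
        exact Finset.sum_congr rfl fun n _ => by ring
    _ = _ := by
        rw [h1, h2, ← Finset.sum_add_distrib, Finset.mul_sum, Finset.mul_sum]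
        refine Finset.sum_congr rfl fun n _ => ?_
        rw [← mul_assoc, h3]; ring

/-- The free transport term does not contribute to the evolution of the negative part. -/
lemma re_inner_negLp_transport (x x' : ℤ → ℕ → FreqL2) (hx : ∀ k n, N ≤ n → x k n = 0)
    (hx' : ∀ k n, x' k n =ᵐ[volume] fun ν => (ν : ℂ) * x k n ν) :
    (inner ℂ (negLp (synth b K (N + 1) x)) (synth b K (N + 1) fun k n =>
      ((k : ℂ) * Complex.I) • (x' k n + (b : ℂ) • (((Real.sqrt (n + 1) : ℝ) : ℂ) • x k (n + 1)
        + ((Real.sqrt n : ℝ) : ℂ) • x k (n - 1))))).re = 0 := by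
  set τ : ℤ → ℕ → FreqL2 := fun k n =>
      ((k : ℂ) * Complex.I) • (x' k n + (b : ℂ) • (((Real.sqrt (n + 1) : ℝ) : ℂ) • x k (n + 1)
        + ((Real.sqrt n : ℝ) : ℂ) • x k (n - 1))) with hτ
  rw [re_inner_negLp]
  set Y : ℝ × ℝ → ℤ → ℂ := fun p k =>
    ∑ n ∈ Finset.range (N + 1), (hermiteFun b n (p.1 - p.2) : ℂ) * x k n p.2 with hY
  have e1 : ∀ᵐ z : Phase, synth b K (N + 1) x z = ∑ k ∈ K, circMode k z.1 * Y z.2 k := by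
    filter_upwards [coeFn_synth (b := b) K (N + 1) x] with z hz
    rw [hz, Finset.sum_product]
    refine Finset.sum_congr rfl fun k _ => ?_
    simp only [hY]
    rw [Finset.mul_sum]
  have h0 : ∀ᵐ z : Phase, ∀ i : ℤ × ℕ, N ≤ i.2 → x i.1 i.2 z.2.2 = 0 := by
    refine ae_all_iff.2 fun i => ?_
    by_cases hi : N ≤ i.2
    · rw [hx i.1 i.2 hi]
      filter_upwards [ae_frequency (Lp.coeFn_zero ℂ 2 (volume : Measure ℝ))] with z hz _
      exact hz
    · exact .of_forall fun z h => absurd h hi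
  have h1 : ∀ᵐ z : Phase, ∀ i : ℤ × ℕ, τ i.1 i.2 z.2.2 = (i.1 * Complex.I) *
      ((z.2.2 : ℂ) * x i.1 i.2 z.2.2 + b * (((Real.sqrt (i.2 + 1) : ℝ) : ℂ) * x i.1 (i.2 + 1) z.2.2
        + ((Real.sqrt i.2 : ℝ) : ℂ) * x i.1 (i.2 - 1) z.2.2)) := by
    refine ae_all_iff.2 fun i => ae_frequency (p := fun ν => τ i.1 i.2 ν = (i.1 * Complex.I) *
      ((ν : ℂ) * x i.1 i.2 ν + b * (((Real.sqrt (i.2 + 1) : ℝ) : ℂ) * x i.1 (i.2 + 1) ν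
        + ((Real.sqrt i.2 : ℝ) : ℂ) * x i.1 (i.2 - 1) ν))) ?_
    simp only [hτ]
    filter_upwards [Lp.coeFn_smul ((i.1 : ℂ) * Complex.I) (x' i.1 i.2 + (b : ℂ) • (((Real.sqrt (i.2 + 1) : ℝ) : ℂ) • x i.1 (i.2 + 1)
        + ((Real.sqrt i.2 : ℝ) : ℂ) • x i.1 (i.2 - 1))), Lp.coeFn_add (x' i.1 i.2) ((b : ℂ) • (((Real.sqrt (i.2 + 1) : ℝ) : ℂ) • x i.1 (i.2 + 1)
        + ((Real.sqrt i.2 : ℝ) : ℂ) • x i.1 (i.2 - 1))), hx' i.1 i.2,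
        Lp.coeFn_smul (b : ℂ) (((Real.sqrt (i.2 + 1) : ℝ) : ℂ) • x i.1 (i.2 + 1)
        + ((Real.sqrt i.2 : ℝ) : ℂ) • x i.1 (i.2 - 1)),
        Lp.coeFn_add (((Real.sqrt (i.2 + 1) : ℝ) : ℂ) • x i.1 (i.2 + 1))
          (((Real.sqrt i.2 : ℝ) : ℂ) • x i.1 (i.2 - 1)),
        Lp.coeFn_smul ((Real.sqrt (i.2 + 1) : ℝ) : ℂ) (x i.1 (i.2 + 1)),
        Lp.coeFn_smul ((Real.sqrt i.2 : ℝ) : ℂ) (x i.1 (i.2 - 1))] with ν a1 a2 a3 a4 a5 a6 a7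
    rw [a1, Pi.smul_apply, a2, Pi.add_apply, a3, a4, Pi.smul_apply, a5, Pi.add_apply, a6, a7]
    rfl
  -- The frequency term and the Hermite ladder recombine pointwise to the factor ω, which is
  -- constant in θ and comes out of the phase integral.
  have e2 : ∀ᵐ z : Phase, synth b K (N + 1) τ z
      = z.2.1 * ∑ k ∈ K, (k * Complex.I) * (circMode k z.1 * Y z.2 k) := by
    filter_upwards [coeFn_synth (b := b) K (N + 1) τ, h0, h1] with z hz hz0 hz1
    rw [hz, Finset.sum_product, Finset.mul_sum]
    refine Finset.sum_congr rfl fun k _ => ?_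
    have hv := sum_velocity (b := b) N (fun n => x k n z.2.2) (fun n hn => hz0 (k, n) hn)
      (z.2.1 - z.2.2)
    simp only [hY]
    simp_rw [fun n => hz1 (k, n)]
    calc _ = (k * Complex.I) * circMode k z.1 * (z.2.2 * (∑ n ∈ Finset.range (N + 1),
          (hermiteFun b n (z.2.1 - z.2.2) : ℂ) * x k n z.2.2) +
          ∑ n ∈ Finset.range (N + 1), (hermiteFun b n (z.2.1 - z.2.2) : ℂ) *
      (b * (((Real.sqrt (n + 1) : ℝ) : ℂ) * x k (n + 1) z.2.2
        + ((Real.sqrt n : ℝ) : ℂ) * x k (n - 1) z.2.2))) := by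
          rw [Finset.mul_sum, ← Finset.sum_add_distrib, Finset.mul_sum]
          exact Finset.sum_congr rfl fun n _ => by ring
      _ = _ := by
          rw [hv]; push_cast; ring
  set D : Phase → ℝ := fun z => negPart (∑ k ∈ K, circMode k z.1 * Y z.2 k).re *
    (z.2.1 * (∑ k ∈ K, (k * Complex.I) * (circMode k z.1 * Y z.2 k)).re) with hD
  have hae : (fun z => negPart (synth b K (N + 1) x z).re * (synth b K (N + 1) τ z).re) =ᵐ[volume] D := by
    filter_upwards [e1, e2] with z h1 h2
    rw [h1, h2, Complex.re_ofReal_mul]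
  rw [integral_congr_ae hae]
  refine integral_eq_zero_of_phase ((integrable_negPart_mul _ _).congr hae) fun p => ?_
  have h3 := integral_negPart_trig K (Y p)
  simp only [hD]
  simp_rw [mul_left_comm _ p.1]
  rw [integral_const_mul, h3, mul_zero]

end Synth

end KuramotoSakaguchi
end

/-! ### Weighted truncations and their commutator with transport. -/

noncomputable section
namespace KuramotoSakaguchi
open Filter Topology
open scoped BoundedContinuousFunction

/-! ### Truncations -/

/-- The truncated set of phase modes. -/
def modeBox (r : ℕ) : Finset ℤ := Finset.Icc (-(r + 1 : ℤ)) (r + 1)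

/-- The truncation order of the velocity modes. -/
def modeCut (r : ℕ) : ℕ := (r + 1) ^ 4

/-- The weights of the truncation in the velocity modes. -/
def modeWeight (r n : ℕ) : ℝ := max 0 (1 - n / modeCut r)

lemma modeCut_pos (r : ℕ) : (0 : ℝ) < modeCut r := by
  unfold modeCut; positivity

lemma modeWeight_nonneg (r n : ℕ) : 0 ≤ modeWeight r n := le_max_left _ _

lemma modeWeight_le_one (r n : ℕ) : modeWeight r n ≤ 1 := by
  refine max_le zero_le_one ?_
  have := modeCut_pos r
  have : (0 : ℝ) ≤ n / modeCut r := by positivity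
  linarith

lemma modeWeight_eq_zero {r n : ℕ} (h : modeCut r ≤ n) : modeWeight r n = 0 := by
  refine max_eq_left ?_
  have h1 := modeCut_pos r
  have h2 : (modeCut r : ℝ) ≤ n := by exact_mod_cast h
  have : 1 ≤ (n : ℝ) / modeCut r := (one_le_div h1).2 h2
  linarith

lemma abs_modeWeight_succ_sub (r n : ℕ) :
    |modeWeight r (n + 1) - modeWeight r n| ≤ (modeCut r : ℝ)⁻¹ := by
  have h := abs_max_sub_max_le_abs (1 - ((n + 1 : ℕ) : ℝ) / modeCut r) (1 - (n : ℝ) / modeCut r) 0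
  have h1 := modeCut_pos r
  have h2 : (1 - ((n + 1 : ℕ) : ℝ) / modeCut r) - (1 - (n : ℝ) / modeCut r) = -(modeCut r : ℝ)⁻¹ := by
    push_cast; field_simp; ring
  rw [h2, abs_neg, abs_of_pos (inv_pos.2 h1)] at h
  unfold modeWeight
  rwa [max_comm 0, max_comm 0]

lemma modeCut_ge (r : ℕ) : r ≤ modeCut r := by
  have h2 := Nat.le_self_pow (show 4 ≠ 0 by norm_num) (r + 1)
  unfold modeCut; omega

lemma tendsto_modeWeight (n : ℕ) : Tendsto (fun r => modeWeight r n) atTop (𝓝 1) := by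
  have h1 : Tendsto (fun r => (modeCut r : ℝ)) atTop atTop :=
    tendsto_natCast_atTop_atTop.comp (tendsto_atTop_mono modeCut_ge tendsto_id)
  have h2 : Tendsto (fun r => max (0 : ℝ) (1 - n / modeCut r)) atTop (𝓝 (max 0 (1 - 0))) :=
    tendsto_const_nhds.max (tendsto_const_nhds.sub (h1.const_div_atTop (n : ℝ)))
  rw [show max (0 : ℝ) (1 - 0) = 1 by norm_num] at h2
  exact h2

lemma eventually_mem_modeBox (k : ℤ) : ∀ᶠ r in atTop, k ∈ modeBox r := by
  filter_upwards [eventually_ge_atTop k.natAbs] with r hr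
  simp only [modeBox, Finset.mem_Icc]
  omega

lemma abs_le_of_mem_modeBox {r : ℕ} {k : ℤ} (h : k ∈ modeBox r) : |(k : ℝ)| ≤ r + 1 := by
  simp only [modeBox, Finset.mem_Icc] at h
  rw [abs_le]
  constructor
  · have : ((-(r + 1 : ℤ) : ℤ) : ℝ) ≤ k := by exact_mod_cast h.1
    push_cast at this; exact this
  · exact_mod_cast h.2

section
variable {b : ℝ} [hb : Fact (0 < b)]

lemma sum_norm_coef_sq_le {ι : Type*} (s : Finset ι) (φ : ι → ℤ × ℕ) (hφ : Set.InjOn φ s) (u : L2C) :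
    ∑ i ∈ s, ‖coef b (φ i) u‖ ^ 2 ≤ ‖u‖ ^ 2 := by
  classical
  rw [← Finset.sum_image (f := fun i => ‖coef b i u‖ ^ 2) hφ]
  exact sum_le_hasSum _ (fun i _ => by positivity) (hasSum_coef u)

lemma norm_coef_le (i : ℤ × ℕ) (u : L2C) : ‖coef b i u‖ ≤ ‖u‖ := by
  have h := sum_norm_coef_sq_le (b := b) {i} id (by simp) u
  simp only [Finset.sum_singleton, id_eq] at h
  exact le_of_sq_le_sq h (norm_nonneg _)

lemma norm_synth_le (K : Finset ℤ) (N : ℕ) (x : ℤ → ℕ → FreqL2) (u : L2C)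
    (h : ∀ k n, ‖x k n‖ ≤ ‖coef b (k, n) u‖) : ‖synth b K N x‖ ≤ ‖u‖ := by
  refine le_of_sq_le_sq ?_ (norm_nonneg _)
  rw [norm_synth_sq]
  refine le_trans (Finset.sum_le_sum fun i _ => ?_)
    (sum_norm_coef_sq_le (b := b) (K ×ˢ Finset.range N) id (by simp) u)
  have := h i.1 i.2
  gcongr
  exact this

/-- By Parseval the squared error is a sum over modes. Each term tends to zero and is bounded by
four times the squared norm of the corresponding coefficient, so dominated convergence for series
applies. -/
lemma tendsto_synth (N : ℕ → ℕ) (hN : ∀ r, r ≤ N r) (x : ℕ → ℤ → ℕ → FreqL2) (u : L2C)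
    (h : ∀ r k n, ‖x r k n‖ ≤ ‖coef b (k, n) u‖)
    (hx : ∀ k n, Tendsto (fun r => x r k n) atTop (𝓝 (coef b (k, n) u))) :
    Tendsto (fun r => synth b (modeBox r) (N r) (x r)) atTop (𝓝 u) := by
  rw [tendsto_iff_norm_sub_tendsto_zero]
  have hsq : Tendsto (fun r => ‖synth b (modeBox r) (N r) (x r) - u‖ ^ 2) atTop (𝓝 0) := by
    have heq : ∀ r, ‖synth b (modeBox r) (N r) (x r) - u‖ ^ 2
        = ∑' i, ‖coef b i (synth b (modeBox r) (N r) (x r)) - coef b i u‖ ^ 2 := fun r => by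
      rw [← (hasSum_coef (b := b) _).tsum_eq]
      simp only [map_sub]
    simp_rw [heq]
    rw [show (0 : ℝ) = ∑' i : ℤ × ℕ, (0 : ℝ) by simp]
    refine tendsto_tsum_of_dominated_convergence (bound := fun i => 4 * ‖coef b i u‖ ^ 2)
      ((hasSum_coef u).summable.mul_left 4) (fun i => ?_) (.of_forall fun r i => ?_)
    · have h1 : Tendsto (fun r => coef b i (synth b (modeBox r) (N r) (x r)) - coef b i u) atTop
          (𝓝 (coef b i u - coef b i u)) := by
        refine Tendsto.sub_const ((hx i.1 i.2).congr' ?_) _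
        filter_upwards [eventually_mem_modeBox i.1, eventually_gt_atTop i.2] with r h1 h2
        rw [coef_synth, if_pos]
        exact Finset.mem_product.2 ⟨h1, Finset.mem_range.2 (h2.trans_le (hN r))⟩
      rw [sub_self] at h1
      simpa using (h1.norm.pow 2)
    · rw [Real.norm_of_nonneg (by positivity)]
      have h1 : ‖coef b i (synth b (modeBox r) (N r) (x r))‖ ≤ ‖coef b i u‖ := by
        rw [coef_synth]
        split_ifs
        · exact h r i.1 i.2
        · simp
      have h2 := (norm_sub_le (coef b i (synth b (modeBox r) (N r) (x r))) (coef b i u)).trans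
        (add_le_add_left h1 _)
      have h3 := norm_nonneg (coef b i (synth b (modeBox r) (N r) (x r)) - coef b i u)
      nlinarith
  have := hsq.sqrt
  simpa using this

lemma hasDerivWithinAt_synth (K : Finset ℤ) (N : ℕ) {x : ℝ → ℤ → ℕ → FreqL2} {x' : ℤ → ℕ → FreqL2}
    {s : Set ℝ} {t : ℝ} (h : ∀ k n, HasDerivWithinAt (fun τ => x τ k n) (x' k n) s t) :
    HasDerivWithinAt (fun τ => synth b K N (x τ)) (synth b K N x') s t := by
  unfold synth
  refine HasDerivWithinAt.fun_sum fun i _ => ?_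
  exact ((modeEmb b i).toContinuousLinearMap.restrictScalars ℝ).hasFDerivAt.comp_hasDerivWithinAt t
    (h i.1 i.2)

lemma continuousOn_synth (K : Finset ℤ) (N : ℕ) {x : ℝ → ℤ → ℕ → FreqL2} {s : Set ℝ}
    (h : ∀ k n, ContinuousOn (fun τ => x τ k n) s) : ContinuousOn (fun τ => synth b K N (x τ)) s := by
  unfold synth
  exact continuousOn_finsetSum _ fun i _ => (modeEmb b i).continuous.comp_continuousOn (h i.1 i.2)

/-! ### Evolution equations in mode form -/

/-- `∂_t v + ω ∂_θ v = -(1/m) a*a v - d v + p + a* q` in mode form, with frequency cutoffs. -/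
structure ModeEq (m b d T : ℝ) [Fact (0 < b)] (v p q : ℝ → L2C) : Prop where
  cont : ContinuousOn v (Icc 0 T)
  cont_p : ContinuousOn p (Icc 0 T)
  cont_q : ContinuousOn q (Icc 0 T)
  deriv : ∀ R k n, ∀ t ∈ Icc 0 T, HasDerivWithinAt (fun τ => zetaOp R (coef b (k, n) (v τ)))
    (zetaOp R (-(((k : ℂ) * Complex.I * b) • velCoef b (v t) k n)
        - ((n / m + d : ℝ) : ℂ) • coef b (k, n) (v t) + coef b (k, n) (p t)
        + ((Real.sqrt n : ℝ) : ℂ) • coef b (k, n - 1) (q t))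
      - ((k : ℂ) * Complex.I) • nuOp R (coef b (k, n) (v t))) (Icc 0 T) t

/-- The commutator of free transport with the truncation. -/
def transportError (b : ℝ) [Fact (0 < b)] (r : ℕ) (h : L2C) (k : ℤ) (n : ℕ) : FreqL2 :=
  ((k : ℂ) * Complex.I * b) • (((Real.sqrt (n + 1) * (modeWeight r (n + 1) - modeWeight r n) : ℝ) : ℂ) •
      zetaOp r (coef b (k, n + 1) h)
    + ((Real.sqrt n * (modeWeight r (n - 1) - modeWeight r n) : ℝ) : ℂ) •
      zetaOp r (coef b (k, n - 1) h))

lemma norm_transportError_le (r : ℕ) (h : L2C) :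
    ‖synth b (modeBox r) (modeCut r + 1) (transportError b r h)‖ ≤ 4 * b / (r + 1) * ‖h‖ := by
  have hb0 := hb.out
  set ρ : ℝ := (r : ℝ) + 1 with hρ
  have hρ1 : 1 ≤ ρ := by rw [hρ]; linarith [show (0 : ℝ) ≤ r by positivity]
  have hN : (modeCut r : ℝ) = ρ ^ 4 := by unfold modeCut; push_cast; rfl
  -- With ρ = r + 1 there are about ρ⁴ velocity levels. The weights have slope ρ⁻⁴ while √n is at
  -- most of order ρ², which leaves ρ⁻².
  have hsq : ∀ n : ℕ, n ≤ modeCut r + 1 → Real.sqrt n * (modeCut r : ℝ)⁻¹ ≤ 2 / ρ ^ 2 := by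
    intro n hn
    have h1 : Real.sqrt n ≤ 2 * ρ ^ 2 := by
      rw [Real.sqrt_le_left (by positivity)]
      have : (n : ℝ) ≤ ρ ^ 4 + 1 := by rw [← hN]; exact_mod_cast hn
      have : 1 ≤ ρ ^ 4 := one_le_pow₀ hρ1
      nlinarith
    rw [hN]
    calc Real.sqrt n * (ρ ^ 4)⁻¹ ≤ 2 * ρ ^ 2 * (ρ ^ 4)⁻¹ := by gcongr
      _ = 2 / ρ ^ 2 := by field_simp
  have hterm : ∀ i ∈ modeBox r ×ˢ Finset.range (modeCut r + 1),
      ‖transportError b r h i.1 i.2‖ ^ 2 ≤ (2 * b / ρ) ^ 2 * 2 * (‖coef b (i.1, i.2 + 1) h‖ ^ 2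
        + (if i.2 = 0 then 0 else ‖coef b (i.1, i.2 - 1) h‖ ^ 2)) := by
    rintro ⟨k, n⟩ hi
    rw [Finset.mem_product, Finset.mem_range] at hi
    have hk := abs_le_of_mem_modeBox hi.1
    have hn : n < modeCut r + 1 := hi.2
    simp only
    set A := ‖coef b (k, n + 1) h‖
    -- At n = 0 the truncated index n − 1 would give a spurious term; its factor √0 vanishes, and
    -- `B` records this.
    set B : ℝ := if n = 0 then 0 else ‖coef b (k, n - 1) h‖ with hB
    have hB2 : (if n = 0 then 0 else ‖coef b (k, n - 1) h‖ ^ 2) = B ^ 2 := by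
      rw [hB]; split_ifs <;> simp
    rw [hB2]
    have hA0 : 0 ≤ A := norm_nonneg _
    have hB0 : 0 ≤ B := by rw [hB]; split_ifs <;> positivity
    have h1 : ‖(((Real.sqrt (n + 1) * (modeWeight r (n + 1) - modeWeight r n) : ℝ) : ℂ) •
      zetaOp r (coef b (k, n + 1) h))‖ ≤ 2 / ρ ^ 2 * A := by
      rw [norm_smul, Complex.norm_real, Real.norm_eq_abs, abs_mul, abs_of_nonneg (Real.sqrt_nonneg _)]
      refine mul_le_mul ?_ (norm_zetaOp_le _ _) (norm_nonneg _) (by positivity)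
      refine le_trans (mul_le_mul_of_nonneg_left (abs_modeWeight_succ_sub r n) (Real.sqrt_nonneg _)) ?_
      have := hsq (n + 1) (by omega)
      push_cast at this; exact this
    have h2 : ‖((Real.sqrt n * (modeWeight r (n - 1) - modeWeight r n) : ℝ) : ℂ) •
      zetaOp r (coef b (k, n - 1) h)‖ ≤ 2 / ρ ^ 2 * B := by
      rcases Nat.eq_zero_or_pos n with h0 | h0
      · subst h0; simp [hB]
      · rw [hB, if_neg h0.ne', norm_smul, Complex.norm_real, Real.norm_eq_abs, abs_mul,
          abs_of_nonneg (Real.sqrt_nonneg _)]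
        refine mul_le_mul ?_ (norm_zetaOp_le _ _) (norm_nonneg _) (by positivity)
        have h3 := abs_modeWeight_succ_sub r (n - 1)
        rw [Nat.sub_add_cancel h0, abs_sub_comm] at h3
        exact le_trans (mul_le_mul_of_nonneg_left h3 (Real.sqrt_nonneg _)) (hsq n (by omega))
    -- The phase index contributes at most ρ, so the commutator is of order ρ · ρ⁻² = 1/ρ. This is
    -- why the velocity cutoff is a high power of the phase cutoff.
    have h3 : ‖transportError b r h k n‖ ≤ 2 * b / ρ * (A + B) := by
      rw [transportError, norm_smul]
      have h4 : ‖(k : ℂ) * Complex.I * b‖ ≤ ρ * b := by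
        rw [norm_mul, norm_mul, Complex.norm_I, mul_one, Complex.norm_real, Real.norm_of_nonneg hb0.le]
        gcongr
        rw [← Complex.ofReal_intCast, Complex.norm_real]
        exact hk
      calc _ ≤ (ρ * b) * (2 / ρ ^ 2 * A + 2 / ρ ^ 2 * B) := by
            refine mul_le_mul h4 ((norm_add_le _ _).trans (add_le_add h1 h2)) (norm_nonneg _) (by positivity)
        _ = _ := by field_simp
    calc _ ≤ (2 * b / ρ * (A + B)) ^ 2 := by gcongr
      _ = (2 * b / ρ) ^ 2 * (A + B) ^ 2 := by ring
      _ ≤ (2 * b / ρ) ^ 2 * (2 * (A ^ 2 + B ^ 2)) := by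
          gcongr; nlinarith [sq_nonneg (A - B)]
      _ = _ := by ring
  have hsum1 : ∑ i ∈ modeBox r ×ˢ Finset.range (modeCut r + 1), ‖coef b (i.1, i.2 + 1) h‖ ^ 2 ≤ ‖h‖ ^ 2 :=
    sum_norm_coef_sq_le (b := b) _ (fun i : ℤ × ℕ => (i.1, i.2 + 1)) (by
      rintro ⟨k, n⟩ _ ⟨l, j⟩ _ hij
      simpa using hij) h
  have hsum2 : ∑ i ∈ modeBox r ×ˢ Finset.range (modeCut r + 1),
      (if i.2 = 0 then 0 else ‖coef b (i.1, i.2 - 1) h‖ ^ 2) ≤ ‖h‖ ^ 2 := by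
    -- Once n = 0 is removed the shift n ↦ n − 1 is injective, and the Bessel inequality applies to
    -- the shifted coefficients.
    have : ∀ i : ℤ × ℕ, (if i.2 = 0 then 0 else ‖coef b (i.1, i.2 - 1) h‖ ^ 2)
        = (if i.2 ≠ 0 then ‖coef b (i.1, i.2 - 1) h‖ ^ 2 else 0) := fun i => by split_ifs <;> simp_all
    simp_rw [this]
    rw [← Finset.sum_filter]
    refine sum_norm_coef_sq_le (b := b) _ (fun i : ℤ × ℕ => (i.1, i.2 - 1)) ?_ h
    rintro ⟨k, n⟩ h1 ⟨l, j⟩ h2 hij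
    simp only [Finset.coe_filter, mem_ofPred_eq] at h1 h2
    simp only [Prod.mk.injEq] at hij ⊢
    omega
  refine le_of_sq_le_sq ?_ (by positivity)
  rw [norm_synth_sq]
  refine (Finset.sum_le_sum hterm).trans ?_
  rw [← Finset.mul_sum, Finset.sum_add_distrib]
  calc _ ≤ (2 * b / ρ) ^ 2 * 2 * (‖h‖ ^ 2 + ‖h‖ ^ 2) := by gcongr
    _ = _ := by ring

end

end KuramotoSakaguchi
end

/-! ### The Grönwall estimate for the negative part of a truncated solution. -/

noncomputable section
namespace KuramotoSakaguchi
open Filter Topology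
open scoped BoundedContinuousFunction

/-! ### Propagation of positivity -/

lemma sub_le_integral_of_hasDerivWithinAt_Icc {T : ℝ} {φ φ' ψ : ℝ → ℝ}
    (h : ∀ t ∈ Icc 0 T, HasDerivWithinAt φ (φ' t) (Icc 0 T) t) {s t : ℝ} (hs : 0 ≤ s) (hst : s ≤ t)
    (ht : t ≤ T) (hψ : IntegrableOn ψ (Icc s t)) (hle : ∀ τ ∈ Icc 0 T, φ' τ ≤ ψ τ) :
    φ t - φ s ≤ ∫ τ in s..t, ψ τ := by
  have hsub : Icc s t ⊆ Icc 0 T := Icc_subset_Icc hs ht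
  refine intervalIntegral.sub_le_integral_of_hasDeriv_right_of_le hst
    (fun x hx => (h x (hsub hx)).continuousWithinAt.mono hsub) (fun x hx => ?_) hψ
    (fun x hx => hle x (hsub (Ioo_subset_Icc_self hx)))
  have hx' : x ∈ Ioo 0 T := ⟨hs.trans_lt hx.1, hx.2.trans_le ht⟩
  exact ((h x (Ioo_subset_Icc_self hx')).hasDerivAt (Icc_mem_nhds hx'.1 hx'.2)).hasDerivWithinAt

/-- With J the primitive of φ, the function e^{−Ct}J(t) is nonincreasing and starts at 0, so J ≤ 0
and the hypothesis forces φ ≤ 0. -/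
lemma eq_zero_of_le_integral {T C : ℝ} {φ : ℝ → ℝ} (hφ : ContinuousOn φ (Icc 0 T))
    (h0 : ∀ t ∈ Icc 0 T, 0 ≤ φ t) (hC : 0 ≤ C)
    (h : ∀ t ∈ Icc 0 T, φ t ≤ C * ∫ τ in (0 : ℝ)..t, φ τ) : ∀ t ∈ Icc 0 T, φ t = 0 := by
  set J : ℝ → ℝ := fun t => ∫ τ in (0 : ℝ)..t, φ τ with hJ
  have hJd : ∀ t ∈ Icc 0 T, HasDerivWithinAt J (φ t) (Icc 0 T) t :=
    hasDerivWithinAt_Icc_of_eq_integral hφ (fun t _ => by simp [hJ])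
  have hd : ∀ t ∈ Icc 0 T, HasDerivWithinAt (fun t => Real.exp (-C * t) * J t)
      (Real.exp (-C * t) * (-C) * J t + Real.exp (-C * t) * φ t) (Icc 0 T) t := fun t ht => by
    have h1 : HasDerivAt (fun t => Real.exp (-C * t)) (Real.exp (-C * t) * (-C)) t := by
      simpa using ((hasDerivAt_id t).const_mul (-C)).exp
    exact h1.hasDerivWithinAt.fun_mul (hJd t ht)
  intro t ht
  have h2 := sub_le_integral_of_hasDerivWithinAt_Icc (ψ := fun _ => 0) hd le_rfl ht.1 ht.2
    (integrableOn_zero) (fun τ hτ => by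
      have := h τ hτ
      have h3 := Real.exp_pos (-C * τ)
      nlinarith)
  have h4 : J 0 = 0 := by simp [hJ]
  rw [h4, mul_zero, sub_zero, intervalIntegral.integral_zero] at h2
  have h5 : J t ≤ 0 := by
    by_contra hcon
    push Not at hcon
    have := mul_pos (Real.exp_pos (-C * t)) hcon
    linarith
  have h6 := h t ht
  have h7 := h0 t ht
  have h8 : C * J t ≤ 0 := mul_nonpos_of_nonneg_of_nonpos hC h5
  linarith

section
variable {m b : ℝ} [hb : Fact (0 < b)]

/-- The dissipation controls the creation term on the negative set. -/
lemma neg_re_inner_negLp_raise_le (hm : 0 < m) (K : Finset ℤ) (N : ℕ) (x y : ℤ → ℕ → FreqL2)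
    {σ : ℝ} (U : L2C) (s : Phase → ℝ) (hs : ∀ z, |s z| ≤ σ)
    (hU : U =ᵐ[volume] fun z => (s z : ℂ) * synth b K (N + 1) x z) :
    -(inner ℂ (negLp (synth b K (N + 1) x)) (synth b K (N + 1) (raiseSeq fun k n =>
        y k n + ((-(1 / m) : ℝ) : ℂ) • lowerSeq x k n))).re
      ≤ m / 2 * (σ ^ 2 * ‖negLp (synth b K (N + 1) x)‖ ^ 2 + ‖synth b K N y - U‖ ^ 2) := by
  rw [re_inner_negLp_raise, neg_neg]
  set W := synth b K (N + 1) x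
  set Y := synth b K N y
  set L := synth b K N (lowerSeq x)
  have hsum : synth b K N (fun k n => y k n + ((-(1 / m) : ℝ) : ℂ) • lowerSeq x k n)
      = Y + ((-(1 / m) : ℝ) : ℂ) • L := by
    rw [synth_add, synth_smul]
  rw [hsum, norm_negLp_sq]
  have e3 : ‖Y - U‖ ^ 2 = ∫ z, ‖(Y - U : L2C) z‖ ^ 2 := by
    have := norm_toLp_sq (Lp.memLp (Y - U))
    rwa [Lp.toLp_coeFn] at this
  have i2 : Integrable (fun z => negPart (W z).re ^ 2) := by
    refine (integrable_negPart_mul W (negLp W)).congr ?_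
    filter_upwards [coeFn_negLp W] with z hz
    rw [hz, Complex.ofReal_re, pow_two]
  have i3 : Integrable (fun z => ‖(Y - U : L2C) z‖ ^ 2) :=
    (Lp.memLp (Y - U)).integrable_norm_pow two_ne_zero
  rw [e3, ← integral_const_mul, ← integral_add (i2.const_mul _) i3, ← integral_const_mul]
  refine integral_mono_ae (integrable_negInd_mul _ _ _) (((i2.const_mul _).fun_add i3).const_mul _) ?_
  filter_upwards [Lp.coeFn_add Y (((-(1 / m) : ℝ) : ℂ) • L), Lp.coeFn_smul ((-(1 / m) : ℝ) : ℂ) L,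
    Lp.coeFn_sub Y U, hU] with z h1 h2 h3 h4
  rw [h1, Pi.add_apply, h2, Pi.smul_apply, smul_eq_mul, Complex.add_re, Complex.re_ofReal_mul, h3,
    Pi.sub_apply, h4]
  have h5 : |(Y z - (s z : ℂ) * W z).re| ≤ ‖Y z - (s z : ℂ) * W z‖ := Complex.abs_re_le_norm _
  rw [Complex.sub_re, Complex.re_ofReal_mul] at h5
  set N' := ‖Y z - (s z : ℂ) * W z‖
  have hN' : 0 ≤ N' := norm_nonneg _
  set Yr := (Y z).re
  set Lr := (L z).re
  set Wr := (W z).re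
  have h6 : (Yr - s z * Wr) ^ 2 ≤ N' ^ 2 := sq_le_sq' (by linarith [abs_le.1 h5]) (abs_le.1 h5).2
  have h7 : (s z) ^ 2 ≤ σ ^ 2 := by rw [← sq_abs (s z)]; gcongr; exact hs z
  -- Completing the square: the diffusion absorbs the velocity derivative of the truncated solution
  -- and leaves a term in the undifferentiated source only.
  have h8 : (Yr + -(1 / m) * Lr) * Lr ≤ m / 4 * Yr ^ 2 := by
    have : m / 4 * Yr ^ 2 - (Yr + -(1 / m) * Lr) * Lr = m / 4 * (Yr - 2 / m * Lr) ^ 2 := by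
      field_simp; ring
    have : 0 ≤ m / 4 * (Yr - 2 / m * Lr) ^ 2 := by positivity
    linarith
  have h9 := negInd_nonneg Wr
  have h10 := negInd_le_one Wr
  have h11 := negInd_mul_self Wr
  -- On the negative set the source is s·W up to the error Y − U, and there W² is the square of the
  -- negative part. This closes the Grönwall inequality.
  have h12 : negInd Wr * Wr ^ 2 = negPart Wr ^ 2 := by
    have : negInd Wr * Wr ^ 2 = (negInd Wr * Wr) ^ 2 := by rw [mul_pow, negInd_sq]
    rw [this, h11, neg_sq]
  calc negInd Wr * ((Yr + -(1 / m) * Lr) * Lr) ≤ negInd Wr * (m / 4 * Yr ^ 2) := by gcongr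
    _ ≤ negInd Wr * (m / 4 * (2 * (s z * Wr) ^ 2 + 2 * N' ^ 2)) := by
        gcongr
        nlinarith [sq_nonneg (Yr - 2 * (s z * Wr))]
    _ = m / 2 * ((s z) ^ 2 * (negInd Wr * Wr ^ 2) + negInd Wr * N' ^ 2) := by ring
    _ ≤ m / 2 * (σ ^ 2 * negPart Wr ^ 2 + 1 * N' ^ 2) := by
        rw [h12]; gcongr
    _ = _ := by ring

lemma coeFn_zetaOp (R : ℕ) (x : FreqL2) : zetaOp R x =ᵐ[volume] fun ν => (cutoff R ν : ℂ) * x ν :=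
  coeFn_mulCLM _ _

lemma coeFn_nuOp (R : ℕ) (x : FreqL2) :
    nuOp R x =ᵐ[volume] fun ν => ((ν * cutoff R ν : ℝ) : ℂ) * x ν :=
  coeFn_mulCLM _ _

variable (b) in
/-- The truncation of a state. -/
def truncate (r : ℕ) (h : L2C) : L2C :=
  synth b (modeBox r) (modeCut r + 1) fun k n => ((modeWeight r n : ℝ) : ℂ) • zetaOp r (coef b (k, n) h)

variable (b) in
/-- The truncation of the argument of the creation operator. -/
def truncateSucc (r : ℕ) (q : L2C) : L2C :=
  synth b (modeBox r) (modeCut r) fun k n => ((modeWeight r (n + 1) : ℝ) : ℂ) • zetaOp r (coef b (k, n) q)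

lemma norm_weight_zetaOp_le (r j : ℕ) (x : FreqL2) :
    ‖((modeWeight r j : ℝ) : ℂ) • zetaOp r x‖ ≤ ‖x‖ := by
  rw [norm_smul, Complex.norm_real, Real.norm_of_nonneg (modeWeight_nonneg _ _)]
  exact (mul_le_of_le_one_left (norm_nonneg _) (modeWeight_le_one _ _)).trans (norm_zetaOp_le _ _)

lemma tendsto_weight_zetaOp (j : ℕ) (x : FreqL2) :
    Tendsto (fun r => ((modeWeight r j : ℝ) : ℂ) • zetaOp r x) atTop (𝓝 x) := by
  have h1 : Tendsto (fun r => ((modeWeight r j : ℝ) : ℂ)) atTop (𝓝 ((1 : ℝ) : ℂ)) :=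
    (Complex.continuous_ofReal.tendsto 1).comp (tendsto_modeWeight j)
  simpa using h1.smul (tendsto_zetaOp x)

lemma norm_truncate_le (r : ℕ) (h : L2C) : ‖truncate b r h‖ ≤ ‖h‖ :=
  norm_synth_le _ _ _ _ fun _ _ => norm_weight_zetaOp_le _ _ _

lemma norm_truncateSucc_le (r : ℕ) (h : L2C) : ‖truncateSucc b r h‖ ≤ ‖h‖ :=
  norm_synth_le _ _ _ _ fun _ _ => norm_weight_zetaOp_le _ _ _

lemma tendsto_truncate (h : L2C) : Tendsto (fun r => truncate b r h) atTop (𝓝 h) :=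
  tendsto_synth _ (fun r => (modeCut_ge r).trans (Nat.le_succ _)) _ _
    (fun _ _ _ => norm_weight_zetaOp_le _ _ _) fun _ n => tendsto_weight_zetaOp n _

lemma tendsto_truncateSucc (h : L2C) : Tendsto (fun r => truncateSucc b r h) atTop (𝓝 h) :=
  tendsto_synth _ modeCut_ge _ _
    (fun _ _ _ => norm_weight_zetaOp_le _ _ _) fun _ n => tendsto_weight_zetaOp (n + 1) _

lemma continuousOn_truncate (r : ℕ) {h : ℝ → L2C} {s : Set ℝ} (hh : ContinuousOn h s) :
    ContinuousOn (fun t => truncate b r (h t)) s :=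
  continuousOn_synth _ _ fun k n => by
    have := (coef b (k, n)).continuous.comp_continuousOn hh
    exact ((zetaOp r).continuous.comp_continuousOn this).fun_const_smul _

lemma continuousOn_truncateSucc (r : ℕ) {h : ℝ → L2C} {s : Set ℝ} (hh : ContinuousOn h s) :
    ContinuousOn (fun t => truncateSucc b r (h t)) s :=
  continuousOn_synth _ _ fun k n => by
    have := (coef b (k, n)).continuous.comp_continuousOn hh
    exact ((zetaOp r).continuous.comp_continuousOn this).fun_const_smul _

/-- The evolution of the negative part of the truncated solution. -/
lemma ModeEq.hasDerivWithinAt_negLp {T : ℝ} {h p q : ℝ → L2C} (heq : ModeEq m b 0 T h p q)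
    (hp : ∀ t, p t = 0) (hm : 0 < m) (r : ℕ) {σ : ℝ} {U : L2C} {s : Phase → ℝ} {t : ℝ}
    (ht : t ∈ Icc 0 T) (hs : ∀ z, |s z| ≤ σ)
    (hU : U =ᵐ[volume] fun z => (s z : ℂ) * truncate b r (h t) z) :
    ∃ D, HasDerivWithinAt (fun τ => ‖negLp (truncate b r (h τ))‖ ^ 2 / 2) D (Icc 0 T) t ∧
      D ≤ m / 2 * (σ ^ 2 * ‖negLp (truncate b r (h t))‖ ^ 2 + ‖truncateSucc b r (q t) - U‖ ^ 2)
        + ‖negLp (truncate b r (h t))‖ ^ 2 / 2 + (4 * b / (r + 1) * ‖h t‖) ^ 2 / 2 := by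
  set x : ℤ → ℕ → FreqL2 := fun k n => ((modeWeight r n : ℝ) : ℂ) • zetaOp r (coef b (k, n) (h t))
    with hx
  set x₁ : ℤ → ℕ → FreqL2 := fun k n => ((modeWeight r n : ℝ) : ℂ) • nuOp r (coef b (k, n) (h t))
    with hx₁
  set y : ℤ → ℕ → FreqL2 := fun k n => ((modeWeight r (n + 1) : ℝ) : ℂ) • zetaOp r (coef b (k, n) (q t))
    with hy
  set τ₀ : ℤ → ℕ → FreqL2 := fun k n =>
      ((k : ℂ) * Complex.I) • (x₁ k n + (b : ℂ) • (((Real.sqrt (n + 1) : ℝ) : ℂ) • x k (n + 1)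
        + ((Real.sqrt n : ℝ) : ℂ) • x k (n - 1))) with hτ₀
  set ra : ℤ → ℕ → FreqL2 := raiseSeq fun k n => y k n + ((-(1 / m) : ℝ) : ℂ) • lowerSeq x k n with hra
  have hWx : truncate b r (h t) = synth b (modeBox r) (modeCut r + 1) x := rfl
  have hW : HasDerivWithinAt (fun τ => truncate b r (h τ))
      (synth b (modeBox r) (modeCut r + 1) fun k n =>
        (ra k n + transportError b r (h t) k n) + (-1 : ℂ) • τ₀ k n) (Icc 0 T) t := by
    refine hasDerivWithinAt_synth _ _ fun k n => ?_
    have h1 := (heq.deriv r k n t ht).const_smul ((modeWeight r n : ℝ) : ℂ)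
    refine h1.congr_deriv ?_
    -- Dissipation and forcing form one raised sequence. The source carries the weight of index n +
    -- 1 so that after raising it has the weight of index n, like every other term of the truncated
    -- equation.
    have hra' : ra k n = ((Real.sqrt n * modeWeight r n : ℝ) : ℂ) • zetaOp r (coef b (k, n - 1) (q t))
        + ((-(n / m) * modeWeight r n : ℝ) : ℂ) • zetaOp r (coef b (k, n) (h t)) := by
      rcases Nat.eq_zero_or_pos n with h0 | h0
      · subst h0; simp [hra, raiseSeq]
      · simp only [hra, raiseSeq, hy, lowerSeq, hx, Nat.sub_add_cancel h0]
        have h2 : Real.sqrt (((n - 1 : ℕ) : ℝ) + 1) = Real.sqrt n := by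
          congr 1; exact_mod_cast Nat.sub_add_cancel h0
        have h3 : ((Real.sqrt n : ℝ) : ℂ) * ((Real.sqrt n : ℝ) : ℂ) = (n : ℂ) := by
          rw [← Complex.ofReal_mul, Real.mul_self_sqrt (by positivity)]; simp
        rw [h2, smul_add, smul_smul, smul_smul, smul_smul, smul_smul]
        push_cast
        congr 2
        linear_combination (-(1 / m : ℂ) * (modeWeight r n : ℂ)) * h3
    rw [hra']
    simp only [hp, hτ₀, transportError, velCoef, hx, hx₁, map_add, map_sub, map_neg, map_smul, map_zero]
    push_cast
    module
  refine ⟨_, hasDerivWithinAt_norm_negLp_sq hW, ?_⟩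
  -- Transport of the truncated state is orthogonal to its negative part exactly, since the weights
  -- vanish at the top level; only the commutator remains.
  have hT := re_inner_negLp_transport (b := b) (modeBox r) (modeCut r) x x₁ (fun k n hn => by
      simp only [hx, modeWeight_eq_zero hn, Complex.ofReal_zero, zero_smul]) (fun k n => by
      simp only [hx, hx₁]
      filter_upwards [Lp.coeFn_smul ((modeWeight r n : ℝ) : ℂ) (nuOp r (coef b (k, n) (h t))),
        Lp.coeFn_smul ((modeWeight r n : ℝ) : ℂ) (zetaOp r (coef b (k, n) (h t))),
        coeFn_zetaOp r (coef b (k, n) (h t)), coeFn_nuOp r (coef b (k, n) (h t))] with ν a1 a2 a3 a4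
      rw [a1, a2, Pi.smul_apply, Pi.smul_apply, a3, a4]
      simp only [smul_eq_mul]; push_cast; ring)
  have hA := neg_re_inner_negLp_raise_le (b := b) hm (modeBox r) (modeCut r) x y U s hs hU
  rw [synth_add, synth_smul, synth_add, inner_add_right, inner_add_right, inner_smul_right]
  simp only [Complex.add_re, neg_mul, one_mul, Complex.neg_re]
  rw [hWx] at *
  rw [show (inner ℂ (negLp (synth b (modeBox r) (modeCut r + 1) x))
    (synth b (modeBox r) (modeCut r + 1) τ₀)).re = 0 from hT]
  have hE : -(inner ℂ (negLp (synth b (modeBox r) (modeCut r + 1) x))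
      (synth b (modeBox r) (modeCut r + 1) (transportError b r (h t)))).re
      ≤ ‖negLp (synth b (modeBox r) (modeCut r + 1) x)‖ ^ 2 / 2
        + (4 * b / (r + 1) * ‖h t‖) ^ 2 / 2 := by
    have h1 := norm_inner_le_norm (𝕜 := ℂ) (negLp (synth b (modeBox r) (modeCut r + 1) x))
      (synth b (modeBox r) (modeCut r + 1) (transportError b r (h t)))
    have h2 := norm_transportError_le (b := b) r (h t)
    have h3 := (neg_le_abs _).trans (Complex.abs_re_le_norm
      (inner ℂ (negLp (synth b (modeBox r) (modeCut r + 1) x))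
      (synth b (modeBox r) (modeCut r + 1) (transportError b r (h t)))))
    have h4 := norm_nonneg (negLp (synth b (modeBox r) (modeCut r + 1) x))
    have h5 := mul_le_mul_of_nonneg_left h2 h4
    nlinarith [sq_nonneg (‖negLp (synth b (modeBox r) (modeCut r + 1) x)‖ - 4 * b / (r + 1) * ‖h t‖)]
  have hY : truncateSucc b r (q t) = synth b (modeBox r) (modeCut r) y := rfl
  rw [hY]
  linarith

end

end KuramotoSakaguchi
end

/-! ### Nonnegativity, conservation of mass, and the bound on the order parameter. -/

noncomputable section
namespace KuramotoSakaguchi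
open Filter Topology
open scoped BoundedContinuousFunction

section
variable {m κ b : ℝ} [hb : Fact (0 < b)] {g : ℝ → ℝ}

lemma coef_rootM (hg : IsFreqDensity g) (k : ℤ) (n : ℕ) :
    coef b (k, n) (rootM b hg) = if k = 0 ∧ n = 0 then rootG hg else 0 := by
  rw [rootM, coef_modeEmb]; simp

variable (m κ b) in
/-- The field `κ/(mb) S[√M u] (u + √M)` on which the creation operator acts. -/
def forcing (hg : IsFreqDensity g) (u : L2C) : L2C :=
  ((κ / (m * b) : ℝ) : ℂ) • orderMul (orderZ b hg u) (u + rootM b hg)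

lemma continuousOn_forcing (hg : IsFreqDensity g) {T : ℝ} {u : ℝ → L2C}
    (hu : ContinuousOn u (Icc 0 T)) : ContinuousOn (fun t => forcing m κ b hg (u t)) (Icc 0 T) :=
  (orderMul_continuousOn ((continuous_orderZ hg).comp_continuousOn hu)
    (hu.fun_add continuousOn_const)).fun_const_smul _

lemma modeEq_perturbation (hm : 0 < m) (hg : IsFreqDensity g) {s : ℕ} (hs : 1 ≤ s) {T : ℝ}
    {f : ℝ → L2} (hf : ContInH s T f) (heq : SolvesEq m κ (m * b ^ 2) g T f) :
    ModeEq m b 0 T (fun t => toC (f t)) (fun _ => 0) fun t => forcing m κ b hg (toC (f t)) where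
  cont := hf.continuousOn_toC_self
  cont_p := continuousOn_const
  cont_q := continuousOn_forcing hg hf.continuousOn_toC_self
  deriv R k n t ht := by
    refine (hasDerivWithinAt_zetaOp_coef hm hg hs hf heq R k n ht).congr_deriv ?_
    rw [modeRHS, forcing, map_zero, add_zero, add_zero, map_smul, smul_comm]

/-- √M has only the (0,0) coefficient. The terms with a factor k or n do not see it, so adding it
leaves the equation unchanged. The forcing is then the mean field times the density itself. -/
lemma modeEq_density (hm : 0 < m) (hg : IsFreqDensity g) {s : ℕ} (hs : 1 ≤ s) {T : ℝ}
    {f : ℝ → L2} (hf : ContInH s T f) (heq : SolvesEq m κ (m * b ^ 2) g T f) :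
    ModeEq m b 0 T (fun t => toC (f t) + rootM b hg) (fun _ => 0)
      fun t => forcing m κ b hg (toC (f t)) where
  cont := hf.continuousOn_toC_self.fun_add continuousOn_const
  cont_p := continuousOn_const
  cont_q := continuousOn_forcing hg hf.continuousOn_toC_self
  deriv R k n t ht := by
    have h := ((modeEq_perturbation hm hg hs hf heq).deriv R k n t ht).add_const
      (zetaOp R (coef b (k, n) (rootM b hg)))
    simp only [map_add] at h ⊢
    refine h.congr_deriv ?_
    have h1 : (k : ℂ) • coef b (k, n) (rootM b hg) = 0 := by
      rw [coef_rootM]; split_ifs with h0 <;> simp [*]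
    have h2 : (k : ℂ) • velCoef b (rootM b hg) k n = 0 := by
      rcases eq_or_ne k 0 with h0 | h0
      · simp [h0]
      · simp [velCoef, coef_rootM, h0]
    have h3 : ((n / m : ℝ) : ℂ) • coef b (k, n) (rootM b hg) = 0 := by
      rw [coef_rootM]; split_ifs with h0 <;> simp [*]
    have h4 : velCoef b (toC (f t) + rootM b hg) k n = velCoef b (toC (f t)) k n
        + velCoef b (rootM b hg) k n := by
      simp only [velCoef, map_add]; module
    have h5 : ((k : ℂ) * Complex.I * b) • velCoef b (rootM b hg) k n = 0 := by
      rw [mul_assoc, mul_comm, mul_smul, h2, smul_zero]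
    have h6 : ((k : ℂ) * Complex.I) • nuOp R (coef b (k, n) (rootM b hg)) = 0 := by
      rw [mul_comm, mul_smul, ← map_smul, h1, map_zero, smul_zero]
    simp only [add_zero] at *
    rw [h4, smul_add, smul_add, smul_add, h3, h5, h6]
    simp only [add_zero]

/-- The density perturbed from equilibrium stays nonnegative. -/
lemma negLp_density_eq_zero (hm : 0 < m) (hg : IsFreqDensity g) {s : ℕ} (hs : 1 ≤ s) {T : ℝ}
    {f : ℝ → L2} (hf : ContInH s T f) (heq : SolvesEq m κ (m * b ^ 2) g T f)
    (h0 : negLp (toC (f 0) + rootM b hg) = 0) {t : ℝ} (ht : t ∈ Icc 0 T) :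
    negLp (toC (f t) + rootM b hg) = 0 := by
  have hb0 := hb.out
  set h : ℝ → L2C := fun t => toC (f t) + rootM b hg with hh
  set Z : ℝ → ℂ := fun t => orderZ b hg (toC (f t)) with hZ
  set ε : ℝ := κ / (m * b) with hε
  have hE := modeEq_density hm hg hs hf heq
  have hhc : ContinuousOn h (Icc 0 T) := hE.cont
  have hZc : ContinuousOn Z (Icc 0 T) := (continuous_orderZ hg).comp_continuousOn hf.continuousOn_toC_self
  obtain ⟨cZ, hcZ⟩ := isCompact_Icc.exists_bound_of_continuousOn hZc
  obtain ⟨ch, hch⟩ := isCompact_Icc.exists_bound_of_continuousOn hhc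
  have hcZ0 : 0 ≤ cZ := (norm_nonneg _).trans (hcZ t ht)
  have hch0 : 0 ≤ ch := (norm_nonneg _).trans (hch t ht)
  -- The mean field is continuous in time, hence bounded on [0,T]. Any finite bound suffices here;
  -- |Z| ≤ 1 is derived from positivity only afterwards.
  set σ : ℝ := |ε| * cZ with hσ
  have hσ0 : 0 ≤ σ := by positivity
  set q : ℝ → L2C := fun t => (ε : ℂ) • orderMul (Z t) (h t) with hq
  set U : ℕ → ℝ → L2C := fun r t => (ε : ℂ) • orderMul (Z t) (truncate b r (h t)) with hU
  set Ψ : ℝ → ℝ := fun t => ‖negLp (h t)‖ ^ 2 / 2 with hΨ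
  set Φ : ℕ → ℝ → ℝ := fun r t => ‖negLp (truncate b r (h t))‖ ^ 2 / 2 with hΦ
  set ψ : ℕ → ℝ → ℝ := fun r t => (m * σ ^ 2 + 1) * Φ r t
    + (m / 2 * ‖truncateSucc b r (q t) - U r t‖ ^ 2 + (4 * b / (r + 1) * ‖h t‖) ^ 2 / 2) with hψ
  have hqc : ContinuousOn q (Icc 0 T) := hE.cont_q
  have hΦc : ∀ r, ContinuousOn (Φ r) (Icc 0 T) := fun r =>
    (((continuous_negLp.comp_continuousOn (continuousOn_truncate r hhc)).norm).pow 2).div_const 2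
  have hΨc : ContinuousOn Ψ (Icc 0 T) :=
    (((continuous_negLp.comp_continuousOn hhc).norm).pow 2).div_const 2
  have hUc : ∀ r, ContinuousOn (U r) (Icc 0 T) := fun r =>
    (orderMul_continuousOn hZc (continuousOn_truncate r hhc)).fun_const_smul _
  have hψc : ∀ r, ContinuousOn (ψ r) (Icc 0 T) := fun r => by
    have h1 := continuousOn_truncateSucc (b := b) r hqc
    have h2 := hΦc r
    have h3 := hUc r
    have h4 := (h1.fun_sub h3).norm
    have h5 := hhc.norm
    simp only [hψ]
    exact (continuousOn_const.mul h2).add ((continuousOn_const.mul (h4.pow 2)).add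
      (((continuousOn_const.mul h5).pow 2).div_const 2))
  have hmulb : ∀ t ∈ Icc 0 T, ∀ u : L2C, ‖(ε : ℂ) • orderMul (Z t) u‖ ≤ σ * ‖u‖ := by
    intro t ht u
    rw [norm_smul, Complex.norm_real, Real.norm_eq_abs, hσ, mul_assoc]
    exact mul_le_mul_of_nonneg_left ((norm_orderMul_le _ _).trans
      (mul_le_mul_of_nonneg_right (hcZ t ht) (norm_nonneg _))) (abs_nonneg _)
  have hstep : ∀ r, ∀ t ∈ Icc 0 T, Φ r t - Φ r 0 ≤ ∫ τ in (0 : ℝ)..t, ψ r τ := by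
    intro r t ht
    have hex : ∀ τ ∈ Icc 0 T, ∃ D, HasDerivWithinAt (Φ r) D (Icc 0 T) τ ∧ D ≤ ψ r τ := by
      intro τ hτ
      obtain ⟨D, hD, hle⟩ := hE.hasDerivWithinAt_negLp (fun _ => rfl) hm r (σ := σ) (U := U r τ)
        (s := fun z => ε * orderFun (Z τ) z.1) hτ (fun z => by
          rw [abs_mul]
          exact mul_le_mul_of_nonneg_left ((abs_orderFun_le _ _).trans (hcZ τ hτ)) (abs_nonneg _)) (by
          filter_upwards [Lp.coeFn_smul (ε : ℂ) (orderMul (Z τ) (truncate b r (h τ))),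
            coeFn_orderMul (Z τ) (truncate b r (h τ))] with z h1 h2
          simp only [hU]
          rw [h1, Pi.smul_apply, h2, smul_eq_mul]
          push_cast; ring)
      refine ⟨D, hD, hle.trans (le_of_eq ?_)⟩
      have e1 : forcing m κ b hg (toC (f τ)) = q τ := rfl
      simp only [hψ, hΦ, e1, hh]; ring
    choose! D hD hle using hex
    exact sub_le_integral_of_hasDerivWithinAt_Icc hD le_rfl ht.1 ht.2
      ((hψc r).mono (Icc_subset_Icc_right ht.2)).integrableOn_Icc hle
  have hnegb : ∀ u : L2C, ‖negLp u‖ ≤ ‖u‖ := fun u => by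
    refine Lp.norm_le_norm_of_ae_le ?_
    filter_upwards [coeFn_negLp u] with z hz
    rw [hz, Complex.norm_real, Real.norm_eq_abs]
    refine le_trans ?_ (Complex.abs_re_le_norm _)
    unfold negPart
    rw [abs_of_nonneg (le_max_right _ _)]
    exact max_le (neg_le_abs _) (abs_nonneg _)
  have hΦlim : ∀ t, Tendsto (fun r => Φ r t) atTop (𝓝 (Ψ t)) := fun t =>
    ((((continuous_negLp.tendsto _).comp (tendsto_truncate (b := b) (h t))).norm).pow 2).div_const 2
  -- Truncating the source and multiplying the truncated state by the mean field differ by a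
  -- quantity that tends to zero, as does the transport commutator.
  have hψlim : ∀ t, Tendsto (fun r => ψ r t) atTop (𝓝 ((m * σ ^ 2 + 1) * Ψ t)) := by
    intro t
    have h1 : Tendsto (fun r => truncateSucc b r (q t) - U r t) atTop (𝓝 (q t - q t)) :=
      (tendsto_truncateSucc _).sub
        ((((orderMul (Z t)).continuous.tendsto _).comp (tendsto_truncate (h t))).const_smul _)
    rw [sub_self] at h1
    have h2 : Tendsto (fun r : ℕ => (4 * b / ((r : ℝ) + 1) * ‖h t‖) ^ 2 / 2) atTop (𝓝 0) := by
      have h3 : Tendsto (fun r : ℕ => 1 / ((r : ℝ) + 1)) atTop (𝓝 0) := tendsto_one_div_add_atTop_nhds_zero_nat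
      have h4 := (((h3.const_mul (4 * b)).mul_const ‖h t‖).pow 2).div_const 2
      simp only [mul_zero, zero_mul, ne_eq, OfNat.ofNat_ne_zero, not_false_eq_true, zero_pow, zero_div] at h4
      refine h4.congr fun r => by ring
    have h5 := ((hΦlim t).const_mul (m * σ ^ 2 + 1)).add (((h1.norm.pow 2).const_mul (m / 2)).add h2)
    simpa using h5
  have hlim : ∀ t ∈ Icc 0 T, Ψ t ≤ (m * σ ^ 2 + 1) * ∫ τ in (0 : ℝ)..t, Ψ τ := by
    intro t ht
    have h1 : Tendsto (fun r => ∫ τ in (0 : ℝ)..t, ψ r τ) atTop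
        (𝓝 (∫ τ in (0 : ℝ)..t, (m * σ ^ 2 + 1) * Ψ τ)) := by
      refine intervalIntegral.tendsto_integral_filter_of_dominated_convergence
        (fun _ => (m * σ ^ 2 + 1) * (ch ^ 2 / 2) + (m / 2 * (σ * ch + σ * ch) ^ 2
          + (4 * b * ch) ^ 2 / 2)) (.of_forall fun r => ?_) (.of_forall fun r => .of_forall fun τ hτ => ?_)
        (by simp) (.of_forall fun τ _ => hψlim τ)
      · rw [uIoc_of_le ht.1]
        exact ((hψc r).mono (Ioc_subset_Icc_self.trans (Icc_subset_Icc_right ht.2))).aestronglyMeasurable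
          measurableSet_Ioc
      · rw [uIoc_of_le ht.1] at hτ
        have hτ' : τ ∈ Icc 0 T := ⟨hτ.1.le, hτ.2.trans ht.2⟩
        have a1 : ‖negLp (truncate b r (h τ))‖ ≤ ch :=
          (hnegb _).trans ((norm_truncate_le _ _).trans (hch τ hτ'))
        have a2 : ‖truncateSucc b r (q τ) - U r τ‖ ≤ σ * ch + σ * ch := by
          refine (norm_sub_le _ _).trans (add_le_add ?_ ?_)
          · exact (norm_truncateSucc_le _ _).trans ((hmulb τ hτ' _).trans
              (mul_le_mul_of_nonneg_left (hch τ hτ') hσ0))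
          · exact (hmulb τ hτ' _).trans
              (mul_le_mul_of_nonneg_left ((norm_truncate_le _ _).trans (hch τ hτ')) hσ0)
        have a3 : 4 * b / ((r : ℝ) + 1) * ‖h τ‖ ≤ 4 * b * ch := by
          refine mul_le_mul (div_le_self (by positivity) ?_) (hch τ hτ') (norm_nonneg _) (by positivity)
          linarith [show (0 : ℝ) ≤ r by positivity]
        have a4 : 0 ≤ ψ r τ := by simp only [hψ, hΦ]; positivity
        rw [Real.norm_of_nonneg a4]
        simp only [hψ, hΦ]
        gcongr
    have h2 := le_of_tendsto_of_tendsto' ((hΦlim t).sub (hΦlim 0)) h1 (fun r => hstep r t ht)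
    rw [intervalIntegral.integral_const_mul] at h2
    have h3 : Ψ 0 = 0 := by simp only [hΨ, hh, h0]; simp
    rwa [h3, sub_zero] at h2
  have hz := eq_zero_of_le_integral hΨc (fun t _ => by simp only [hΨ]; positivity)
    (by positivity) hlim t ht
  simp only [hΨ] at hz
  have : ‖negLp (h t)‖ ^ 2 = 0 := by linarith
  exact norm_eq_zero.1 (pow_eq_zero_iff two_ne_zero |>.1 this)

/-! ### The initial state and conservation of mass -/

lemma maxwellian_eq_zero_iff (hm : 0 < m) (z : Phase) :
    maxwellian m (m * b ^ 2) g z = 0 ↔ g z.2.2 = 0 := by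
  have hb0 := hb.out
  have : 1 / (2 * Real.pi) * Real.sqrt (m / (2 * Real.pi * (m * b ^ 2))) * gaussFactor m (m * b ^ 2) z ≠ 0 := by
    have := Real.exp_pos (-(m / (2 * (m * b ^ 2))) * (z.2.1 - z.2.2) ^ 2)
    unfold gaussFactor
    positivity
  rw [maxwellian, mul_eq_zero, or_iff_right this]

lemma maxwellian_nonneg {σ : ℝ} (hg : IsFreqDensity g) (z : Phase) : 0 ≤ maxwellian m σ g z := by
  have := hg.nonneg z.2.2
  unfold maxwellian gaussFactor
  positivity

lemma coeFn_initial_density (hm : 0 < m) (hg : IsFreqDensity g) {F : Phase → ℝ} {f₀ : L2}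
    (hf : ∀ᵐ z, f₀ z = (F z - maxwellian m (m * b ^ 2) g z) / Real.sqrt (maxwellian m (m * b ^ 2) g z)) :
    (toC f₀ + rootM b hg : L2C) =ᵐ[volume]
      fun z => ((F z / Real.sqrt (maxwellian m (m * b ^ 2) g z) : ℝ) : ℂ) := by
  rw [rootM, ← toC_sqrtM hm hg]
  filter_upwards [hf, Lp.coeFn_add (toC f₀) (toC (sqrtM b hm hg)), coeFn_toC f₀,
    coeFn_toC (sqrtM b hm hg), coeFn_sqrtM (b := b) hm hg] with z h1 h2 h3 h4 h5
  rw [h2, Pi.add_apply, h3, h4, h5, h1, ← Complex.ofReal_add]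
  congr 1
  rw [sub_div, Real.div_sqrt]; ring

lemma negLp_initial_density (hm : 0 < m) (hg : IsFreqDensity g) {F : Phase → ℝ}
    (hF : IsInitialDensity g F) {f₀ : L2}
    (hf : ∀ᵐ z, f₀ z = (F z - maxwellian m (m * b ^ 2) g z) / Real.sqrt (maxwellian m (m * b ^ 2) g z)) :
    negLp (toC f₀ + rootM b hg) = 0 := by
  apply Lp.ext
  filter_upwards [coeFn_negLp (toC f₀ + rootM b hg), coeFn_initial_density hm hg hf, hF.nonneg,
    Lp.coeFn_zero ℂ 2 (volume : Measure Phase)] with z h1 h2 h3 h4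
  rw [h1, h2, h4, Complex.ofReal_re]
  have : 0 ≤ F z / Real.sqrt (maxwellian m (m * b ^ 2) g z) := by positivity
  simp [negPart, this]

lemma integral_phase_eq (G : Phase → ℝ) (hG : Integrable G) :
    ∫ z, G z = ∫ ν : ℝ, ∫ p : Circ × ℝ, G (p.1, p.2, ν) := by
  have h := (volume_preserving_prodAssoc (α₁ := Circ) (β₁ := ℝ) (γ₁ := ℝ))
  rw [← h.integral_comp MeasurableEquiv.prodAssoc.measurableEmbedding]
  have hi : Integrable (fun x : (Circ × ℝ) × ℝ => G (MeasurableEquiv.prodAssoc x)) :=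
    (h.integrable_comp_emb MeasurableEquiv.prodAssoc.measurableEmbedding).2 hG
  exact integral_prod_symm _ hi

lemma coef_initial_density (hm : 0 < m) (hg : IsFreqDensity g) {F : Phase → ℝ}
    (hF : IsInitialDensity g F) {f₀ : L2}
    (hf : ∀ᵐ z, f₀ z = (F z - maxwellian m (m * b ^ 2) g z) / Real.sqrt (maxwellian m (m * b ^ 2) g z)) :
    coef b (0, 0) (toC f₀) = 0 := by
  have hc : coef b (0, 0) (toC f₀ + rootM b hg) = rootG hg := by
    refine freqL2_ext_bump fun e he => ?_
    rw [inner_coef]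
    set G : Phase → ℝ := fun z => e z.2.2 / Real.sqrt (g z.2.2) * F z with hG
    have hae : ∀ᵐ z, inner ℂ (modeEmb b (0, 0) (realLp e he.memLp) z)
        ((toC f₀ + rootM b hg : L2C) z) = ((G z : ℝ) : ℂ) := by
      filter_upwards [coeFn_initial_density hm hg hf, coeFn_sep 0 (hermiteLp b 0) (realLp e he.memLp),
        ae_velocity (coeFn_hermiteLp (b := b) 0), ae_frequency (coeFn_realLp e he.memLp)] with z h1 h2 h3 h4
      rw [h1, modeEmb_apply, h2, sepFun, h3, h4, RCLike.inner_apply, map_mul, conj_circMode, circMode]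
      have hs := sqrt_maxwellian (b := b) hm hg z
      have hz := maxwellian_eq_zero_iff (g := g) (b := b) hm z
      -- Where g vanishes both sides are zero by the convention for division by zero, in agreement
      -- with the initial datum being 0 where M = 0.
      by_cases h0 : g z.2.2 = 0
      · rw [hz.2 h0]; simp [hG, h0]
      · have h5 : Real.sqrt (maxwellian m (m * b ^ 2) g z) ≠ 0 :=
          (Real.sqrt_ne_zero (maxwellian_nonneg hg z)).2 (fun h => h0 (hz.1 h))
        have h6 : Real.sqrt (g z.2.2) ≠ 0 := (Real.sqrt_ne_zero (hg.nonneg _)).2 h0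
        simp only [neg_zero, fourier_zero, mul_one, map_mul, Complex.conj_ofReal, hG]
        rw [← Complex.ofReal_mul, ← Complex.ofReal_mul, ← Complex.ofReal_mul]
        congr 1
        rw [eq_comm, div_mul_eq_mul_div, div_mul_eq_mul_div, div_eq_div_iff h6 h5, hs]
        ring
    have hGi : Integrable G := by
      have := (L2.integrable_inner (𝕜 := ℂ) (modeEmb b (0, 0) (realLp e he.memLp))
        (toC f₀ + rootM b hg)).congr hae
      simpa using this.re
    rw [L2.inner_def, integral_congr_ae hae, integral_complex_ofReal, integral_phase_eq G hGi, realLp, rootG, realLp,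
      inner_toLp, ← integral_complex_ofReal]
    refine integral_congr_ae ?_
    filter_upwards [hF.marginal] with ν hν
    simp only [hG]
    rw [integral_const_mul, hν]
    change ((_ : ℝ) : ℂ) = (starRingEnd ℂ) ((e ν : ℝ) : ℂ) * ((Real.sqrt (g ν) : ℝ) : ℂ)
    rw [Complex.conj_ofReal, ← Complex.ofReal_mul]
    congr 1
    rw [div_mul_eq_mul_div, mul_div_assoc, Real.div_sqrt]
  rw [map_add, coef_rootM, if_pos ⟨rfl, rfl⟩] at hc
  simpa using hc

/-- Conservation of mass at each natural frequency. -/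
lemma coef_zero_zero (hm : 0 < m) (hg : IsFreqDensity g) {s : ℕ} (hs : 1 ≤ s) {T : ℝ}
    {f : ℝ → L2} (hf : ContInH s T f) (heq : SolvesEq m κ (m * b ^ 2) g T f)
    (h0 : coef b (0, 0) (toC (f 0)) = 0) {t : ℝ} (ht : t ∈ Icc 0 T) :
    coef b (0, 0) (toC (f t)) = 0 := by
  have hz : ∀ R, zetaOp R (coef b (0, 0) (toC (f t))) = 0 := by
    intro R
    -- At k = n = 0 every term carries a factor k, n or √n, so the coefficient is constant in time.
    have h := (modeEq_perturbation hm hg hs hf heq).deriv R 0 0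
    simp only [Int.cast_zero, zero_mul, zero_smul, neg_zero, Nat.cast_zero, zero_div, add_zero,
      Complex.ofReal_zero, sub_zero, map_zero, Real.sqrt_zero] at h
    have := integral_eq_sub_of_hasDerivWithinAt_Icc continuousOn_const h le_rfl ht.1 ht.2
    rw [intervalIntegral.integral_zero, h0, map_zero, sub_zero] at this
    exact this.symm
  have := tendsto_zetaOp (coef b (0, 0) (toC (f t)))
  simp only [hz] at this
  exact (tendsto_nhds_unique this tendsto_const_nhds)

/-- A nonnegative density of mass one has an order parameter in the unit disc. -/
lemma norm_orderZ_le_one (hm : 0 < m) (hg : IsFreqDensity g) {u : L2}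
    (hpos : negLp (toC u + rootM b hg) = 0) (hmass : coef b (0, 0) (toC u) = 0) :
    ‖orderZ b hg (toC u)‖ ≤ 1 := by
  set h : L2 := u + sqrtM b hm hg with hh
  have hhC : toC h = toC u + rootM b hg := by rw [hh, map_add, toC_sqrtM, rootM]
  have hZ : orderZ b hg (toC h) = orderZ b hg (toC u) := by
    rw [hhC, orderZ, map_add, coef_rootM, if_neg (by simp), add_zero, orderZ]
  have hmass' : inner ℂ (rootG hg) (coef b (0, 0) (toC h)) = 1 := by
    rw [hhC, map_add, hmass, zero_add, coef_rootM, if_pos ⟨rfl, rfl⟩, inner_self_eq_norm_sq_to_K, norm_rootG]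
    simp
  have hnn : ∀ᵐ z, 0 ≤ h z := by
    rw [← hhC] at hpos
    have h1 := coeFn_negLp (toC h)
    rw [hpos] at h1
    filter_upwards [h1, coeFn_toC h, Lp.coeFn_zero ℂ 2 (volume : Measure Phase)] with z h2 h3 h4
    rw [h4, h3, Complex.ofReal_re, Pi.zero_apply] at h2
    have h5 : negPart (h z) = 0 := by exact_mod_cast h2.symm
    unfold negPart at h5
    have := le_max_left (-(h z)) 0
    linarith
  have hmass2 : ∫ z, Real.sqrt (maxwellian m (m * b ^ 2) g z) * h z = 1 := by
    rw [inner_coef, L2.inner_def] at hmass'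
    have : ∫ z, inner ℂ (modeEmb b (0, 0) (rootG hg) z) (toC h z)
        = ∫ z, ((Real.sqrt (maxwellian m (m * b ^ 2) g z) * h z : ℝ) : ℂ) := by
      refine integral_congr_ae ?_
      filter_upwards [coeFn_modeEmb_rootG (b := b) hg 0 0, coeFn_toC h] with z h1 h2
      rw [h1, h2, RCLike.inner_apply, sqrt_maxwellian hm hg, map_mul, conj_circMode, circMode]
      simp
      ring
    rw [this, integral_complex_ofReal] at hmass'
    exact_mod_cast hmass'
  rw [← hZ, orderZ_eq_integral hm hg]
  -- Positivity enters here: the integral of |√M h| is the integral of √M h, which is the conserved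
  -- mass 1.
  refine (norm_integral_le_integral_norm _).trans (le_of_eq ?_)
  rw [← hmass2]
  refine integral_congr_ae ?_
  filter_upwards [hnn] with z hz
  rw [norm_mul, fourier_apply, Circle.norm_coe, one_mul, Complex.norm_real, Real.norm_of_nonneg (by positivity)]

end

end KuramotoSakaguchi
end

/-! ### Integrated differential inequalities and the energy balance of truncations. -/

noncomputable section
namespace KuramotoSakaguchi
open Filter Topology
open scoped ENNReal

/-! ### Integrated differential inequalities -/

/-- `φ' ≤ ψ` on `[0,T]` in integrated form. -/
structure IntBound (T : ℝ) (φ ψ : ℝ → ℝ) : Prop where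
  integrableOn : IntegrableOn ψ (Icc 0 T)
  le : ∀ s t, 0 ≤ s → s ≤ t → t ≤ T → φ t - φ s ≤ ∫ τ in s..t, ψ τ

section IntBound
variable {T : ℝ} {φ φ' ψ ψ' : ℝ → ℝ}

lemma IntegrableOn.intervalIntegrable_of_Icc (h : IntegrableOn ψ (Icc 0 T)) {s t : ℝ} (hs : 0 ≤ s)
    (hst : s ≤ t) (ht : t ≤ T) : IntervalIntegrable ψ volume s t :=
  (intervalIntegrable_iff_integrableOn_Icc_of_le hst).2 (h.mono_set (Icc_subset_Icc hs ht))

lemma IntBound.add (h : IntBound T φ ψ) (h' : IntBound T φ' ψ') :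
    IntBound T (fun t => φ t + φ' t) fun t => ψ t + ψ' t where
  integrableOn := h.integrableOn.add h'.integrableOn
  le s t hs hst ht := by
    have h1 := h.le s t hs hst ht
    have h2 := h'.le s t hs hst ht
    rw [intervalIntegral.integral_add (IntegrableOn.intervalIntegrable_of_Icc h.integrableOn hs hst ht)
      (IntegrableOn.intervalIntegrable_of_Icc h'.integrableOn hs hst ht)]
    linarith

lemma IntBound.const_mul (h : IntBound T φ ψ) {c : ℝ} (hc : 0 ≤ c) :
    IntBound T (fun t => c * φ t) fun t => c * ψ t where
  integrableOn := h.integrableOn.const_mul c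
  le s t hs hst ht := by
    have h1 := mul_le_mul_of_nonneg_left (h.le s t hs hst ht) hc
    rw [intervalIntegral.integral_const_mul]
    linarith

lemma IntBound.sum {ι : Type*} (F : Finset ι) {φ ψ : ι → ℝ → ℝ} (h : ∀ i ∈ F, IntBound T (φ i) (ψ i)) :
    IntBound T (fun t => ∑ i ∈ F, φ i t) fun t => ∑ i ∈ F, ψ i t := by
  classical
  induction F using Finset.induction_on with
  | empty => simpa using ⟨by simp, by simp⟩
  | insert a F ha ih =>
    simp only [Finset.sum_insert ha]
    exact (h a (Finset.mem_insert_self _ _)).add (ih fun i hi => h i (Finset.mem_insert_of_mem hi))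

lemma IntBound.mono (h : IntBound T φ ψ) (hi : IntegrableOn ψ' (Icc 0 T))
    (hle : ∀ᵐ t, t ∈ Icc 0 T → ψ t ≤ ψ' t) : IntBound T φ ψ' where
  integrableOn := hi
  le s t hs hst ht := by
    refine (h.le s t hs hst ht).trans ?_
    rw [intervalIntegral.integral_of_le hst, intervalIntegral.integral_of_le hst]
    have hsub : Ioc s t ⊆ Icc 0 T := fun x hx => ⟨hs.trans hx.1.le, hx.2.trans ht⟩
    refine setIntegral_mono_on_ae (h.integrableOn.mono_set hsub) (hi.mono_set hsub) measurableSet_Ioc ?_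
    filter_upwards [hle] with τ hτ hm using hτ (hsub hm)

lemma IntBound.congr (h : IntBound T φ ψ) (he : ∀ t ∈ Icc 0 T, φ' t = φ t) : IntBound T φ' ψ where
  integrableOn := h.integrableOn
  le s t hs hst ht := by
    rw [he t ⟨hs.trans hst, ht⟩, he s ⟨hs, hst.trans ht⟩]; exact h.le s t hs hst ht

lemma IntBound.of_hasDerivWithinAt (hψ : ContinuousOn ψ (Icc 0 T))
    (h : ∀ t ∈ Icc 0 T, ∃ D, HasDerivWithinAt φ D (Icc 0 T) t ∧ D ≤ ψ t) : IntBound T φ ψ where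
  integrableOn := hψ.integrableOn_Icc
  le s t hs hst ht := by
    choose! D hD hle using h
    exact sub_le_integral_of_hasDerivWithinAt_Icc hD hs hst ht
      (hψ.integrableOn_Icc.mono_set (Icc_subset_Icc hs ht)) hle

/-- Passage to the limit in integrated differential inequalities. -/
lemma IntBound.of_tendsto {φ ψ : ℕ → ℝ → ℝ} {φ₀ ψ₀ B : ℝ → ℝ} (h : ∀ r, IntBound T (φ r) (ψ r))
    (hφ : ∀ t ∈ Icc 0 T, Tendsto (fun r => φ r t) atTop (𝓝 (φ₀ t)))
    (hB : IntegrableOn B (Icc 0 T)) (hψB : ∀ r, ∀ᵐ t, t ∈ Icc 0 T → |ψ r t| ≤ B t)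
    (hψ : ∀ᵐ t, t ∈ Icc 0 T → Tendsto (fun r => ψ r t) atTop (𝓝 (ψ₀ t))) : IntBound T φ₀ ψ₀ where
  integrableOn := by
    refine hB.mono' ?_ ?_
    · refine aestronglyMeasurable_of_tendsto_ae atTop (fun r => (h r).integrableOn.aestronglyMeasurable) ?_
      rwa [ae_restrict_iff' measurableSet_Icc]
    · rw [ae_restrict_iff' measurableSet_Icc]
      filter_upwards [hψ, ae_all_iff.2 hψB] with t h1 h2 ht
      exact le_of_tendsto (h1 ht).norm (.of_forall fun r => h2 r ht)
  le s t hs hst ht := by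
    have hsub : Ioc s t ⊆ Icc 0 T := fun x hx => ⟨hs.trans hx.1.le, hx.2.trans ht⟩
    have h1 : Tendsto (fun r => ∫ τ in s..t, ψ r τ) atTop (𝓝 (∫ τ in s..t, ψ₀ τ)) := by
      refine intervalIntegral.tendsto_integral_filter_of_dominated_convergence B
        (.of_forall fun r => ?_) (.of_forall fun r => ?_)
        (IntegrableOn.intervalIntegrable_of_Icc hB hs hst ht) ?_
      · rw [uIoc_of_le hst]
        exact ((h r).integrableOn.mono_set hsub).aestronglyMeasurable
      · rw [uIoc_of_le hst]
        filter_upwards [hψB r] with τ hτ hm using hτ (hsub hm)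
      · rw [uIoc_of_le hst]
        filter_upwards [hψ] with τ hτ hm using hτ (hsub hm)
    exact le_of_tendsto_of_tendsto' ((hφ t ⟨hs.trans hst, ht⟩).sub (hφ s ⟨hs, hst.trans ht⟩)) h1
      fun r => (h r).le s t hs hst ht

end IntBound

/-! ### The energy inequality -/

lemma hasDerivWithinAt_norm_sq {E : Type*} [NormedAddCommGroup E] [InnerProductSpace ℂ E]
    {x : ℝ → E} {x' : E} {s : Set ℝ} {t : ℝ} (h : HasDerivWithinAt x x' s t) :
    HasDerivWithinAt (fun τ => ‖x τ‖ ^ 2) (2 * (inner ℂ (x t) x').re) s t := by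
  have h1 := Complex.reCLM.hasFDerivAt.comp_hasDerivWithinAt t (h.inner ℂ h)
  have h2 : (fun τ => ‖x τ‖ ^ 2) = (Complex.reCLM ∘ fun τ => inner ℂ (x τ) (x τ)) := by
    ext τ
    simp only [Function.comp, Complex.reCLM_apply]
    exact (inner_self_eq_norm_sq (𝕜 := ℂ) (x τ)).symm
  rw [h2]
  refine h1.congr_deriv ?_
  rw [Complex.reCLM_apply, Complex.add_re, ← inner_conj_symm x' (x t), Complex.conj_re]
  ring

section
variable {m b : ℝ} [hb : Fact (0 < b)]

/-- Free transport is antisymmetric on the Hermite ladder. -/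
lemma sum_re_inner_transport (x : ℕ → FreqL2) (k : ℝ) (N : ℕ) (hN : x N = 0) :
    ∑ n ∈ Finset.range (N + 1), (inner ℂ (x n) (((k : ℂ) * Complex.I) •
      (((Real.sqrt (n + 1) : ℝ) : ℂ) • x (n + 1) + ((Real.sqrt n : ℝ) : ℂ) • x (n - 1)))).re = 0 := by
  -- `z n` is the flux between the levels n − 1 and n. The sum telescopes, and both ends vanish
  -- because √0 = 0 and x N = 0.
  set z : ℕ → ℝ := fun n => Real.sqrt n * (inner ℂ (x (n - 1)) (x n)).im with hz
  have hterm : ∀ n, (inner ℂ (x n) (((k : ℂ) * Complex.I) •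
      (((Real.sqrt (n + 1) : ℝ) : ℂ) • x (n + 1) + ((Real.sqrt n : ℝ) : ℂ) • x (n - 1)))).re
      = k * (z n - z (n + 1)) := by
    intro n
    rw [inner_smul_right, inner_add_right, inner_smul_right, inner_smul_right,
      ← inner_conj_symm (x n) (x (n - 1))]
    simp only [hz, Nat.add_sub_cancel, Complex.mul_re, Complex.mul_im, Complex.ofReal_re, Complex.ofReal_im,
      Complex.I_re, Complex.I_im, Complex.add_im, Complex.add_re, Complex.conj_im, Complex.conj_re]
    push_cast; ring
  simp only [hterm]
  rw [← Finset.mul_sum, Finset.sum_range_sub', hz]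
  simp [hN]

variable (b) in
/-- The dissipation `‖a u‖² = ∑ n ‖u_{kn}‖²`. -/
def dissip (u : L2C) : ℝ≥0∞ := ∑' i : ℤ × ℕ, ENNReal.ofReal (i.2 * ‖coef b i u‖ ^ 2)

variable (b) in
/-- The dissipation of the truncated state. -/
def dissipTrunc (r : ℕ) (u : L2C) : ℝ := ∑ i ∈ modeBox r ×ˢ Finset.range (modeCut r + 1),
  i.2 * ‖((modeWeight r i.2 : ℝ) : ℂ) • zetaOp r (coef b i u)‖ ^ 2

lemma dissipTrunc_nonneg (r : ℕ) (u : L2C) : 0 ≤ dissipTrunc b r u :=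
  Finset.sum_nonneg fun i _ => by positivity

lemma ofReal_dissipTrunc_le (r : ℕ) (u : L2C) : ENNReal.ofReal (dissipTrunc b r u) ≤ dissip b u := by
  rw [dissipTrunc, ENNReal.ofReal_sum_of_nonneg fun i _ => by positivity]
  refine le_trans (Finset.sum_le_sum fun i _ => ?_) (ENNReal.sum_le_tsum _)
  refine ENNReal.ofReal_le_ofReal ?_
  gcongr
  exact norm_weight_zetaOp_le _ _ _

lemma sum_le_dissip {u : L2C} (hu : dissip b u ≠ ⊤) (F : Finset (ℤ × ℕ)) :
    ∑ i ∈ F, (i.2 : ℝ) * ‖coef b i u‖ ^ 2 ≤ (dissip b u).toReal := by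
  rw [← ENNReal.ofReal_le_iff_le_toReal hu, ENNReal.ofReal_sum_of_nonneg fun i _ => by positivity]
  exact ENNReal.sum_le_tsum _

/-- Lower semicontinuity. Every finite part of the sum is eventually contained in the truncation box
and converges there. -/
lemma dissip_le_liminf (u : L2C) :
    dissip b u ≤ liminf (fun r => ENNReal.ofReal (dissipTrunc b r u)) atTop := by
  rw [dissip, ENNReal.tsum_eq_iSup_sum]
  refine iSup_le fun F => ?_
  have h1 : Tendsto (fun r => ∑ i ∈ F, ENNReal.ofReal
      (i.2 * ‖((modeWeight r i.2 : ℝ) : ℂ) • zetaOp r (coef b i u)‖ ^ 2)) atTop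
      (𝓝 (∑ i ∈ F, ENNReal.ofReal (i.2 * ‖coef b i u‖ ^ 2))) :=
    tendsto_finsetSum _ fun i _ => (ENNReal.continuous_ofReal.tendsto _).comp
      (((tendsto_weight_zetaOp i.2 (coef b i u)).norm.pow 2).const_mul _)
  rw [← h1.liminf_eq]
  refine liminf_le_liminf ?_
  have h2 : ∀ᶠ r in atTop, ∀ i ∈ F, i ∈ modeBox r ×ˢ Finset.range (modeCut r + 1) := by
    rw [Filter.eventually_all_finset]
    intro i _
    filter_upwards [eventually_mem_modeBox i.1, eventually_ge_atTop i.2] with r h3 h4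
    rw [Finset.mem_product, Finset.mem_range]
    exact ⟨h3, lt_of_le_of_lt (h4.trans (modeCut_ge r)) (Nat.lt_succ_self _)⟩
  filter_upwards [h2] with r hr
  rw [dissipTrunc, ENNReal.ofReal_sum_of_nonneg fun i _ => by positivity]
  exact Finset.sum_le_sum_of_subset hr

/-- The truncated dissipation never exceeds the full one, so semicontinuity upgrades to convergence
when the latter is finite. -/
lemma tendsto_dissipTrunc {u : L2C} (hu : dissip b u ≠ ⊤) :
    Tendsto (fun r => dissipTrunc b r u) atTop (𝓝 (dissip b u).toReal) := by
  have h1 : Tendsto (fun r => ENNReal.ofReal (dissipTrunc b r u)) atTop (𝓝 (dissip b u)) :=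
    tendsto_of_le_liminf_of_limsup_le (dissip_le_liminf u)
      (limsup_le_of_le (by isBoundedDefault) (.of_forall fun r => ofReal_dissipTrunc_le r u))
  have h2 := (ENNReal.tendsto_toReal hu).comp h1
  refine h2.congr fun r => ?_
  simp [ENNReal.toReal_ofReal (dissipTrunc_nonneg r u)]

lemma dissipTrunc_le {u : L2C} (hu : dissip b u ≠ ⊤) (r : ℕ) :
    dissipTrunc b r u ≤ (dissip b u).toReal :=
  (ENNReal.ofReal_le_iff_le_toReal hu).1 (ofReal_dissipTrunc_le r u)

lemma continuousOn_dissipTrunc (r : ℕ) {v : ℝ → L2C} {s : Set ℝ} (hv : ContinuousOn v s) :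
    ContinuousOn (fun t => dissipTrunc b r (v t)) s := by
  unfold dissipTrunc
  refine continuousOn_finsetSum _ fun i _ => ?_
  have h1 := (coef b i).continuous.comp_continuousOn hv
  have h2 := (zetaOp r).continuous.comp_continuousOn h1
  exact continuousOn_const.mul ((h2.fun_const_smul _).norm.pow 2)

/-- The energy identity for the truncated solution, up to controlled terms. -/
lemma ModeEq.hasDerivWithinAt_norm_sq {d T : ℝ} {v p q : ℝ → L2C} (heq : ModeEq m b d T v p q)
    (hm : 0 < m) (r : ℕ) {t : ℝ} (ht : t ∈ Icc 0 T) :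
    ∃ G : ℝ, |G| ≤ 1 / m * dissipTrunc b r (v t) + 2 * ‖p t‖ * ‖v t‖ + m * ‖q t‖ ^ 2
        + 8 * b / (r + 1) * ‖v t‖ ^ 2 ∧
      HasDerivWithinAt (fun τ => ‖truncate b r (v τ)‖ ^ 2)
        (-(2 / m) * dissipTrunc b r (v t) - 2 * d * ‖truncate b r (v t)‖ ^ 2 + G) (Icc 0 T) t := by
  have hb0 := hb.out
  set I := modeBox r ×ˢ Finset.range (modeCut r + 1) with hI
  set x : ℤ → ℕ → FreqL2 := fun k n => ((modeWeight r n : ℝ) : ℂ) • zetaOp r (coef b (k, n) (v t))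
    with hx
  set y : ℤ → ℕ → FreqL2 := fun k n => ((modeWeight r n : ℝ) : ℂ) • zetaOp r (coef b (k, n) (p t))
    with hy
  set w : ℤ → ℕ → FreqL2 := fun k n => ((modeWeight r n : ℝ) : ℂ) • zetaOp r (coef b (k, n - 1) (q t))
    with hw
  set Tr : ℤ → ℕ → FreqL2 := fun k n => (((k : ℝ) : ℂ) * Complex.I) •
      (((Real.sqrt (n + 1) : ℝ) : ℂ) • x k (n + 1) + ((Real.sqrt n : ℝ) : ℂ) • x k (n - 1)) with hTr
  have hWx : truncate b r (v t) = synth b (modeBox r) (modeCut r + 1) x := rfl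
  have hWy : truncate b r (p t) = synth b (modeBox r) (modeCut r + 1) y := rfl
  have hderiv : ∀ i ∈ I, HasDerivWithinAt
      (fun τ => ‖((modeWeight r i.2 : ℝ) : ℂ) • zetaOp r (coef b (i.1, i.2) (v τ))‖ ^ 2)
      (-(2 / m) * (i.2 * ‖x i.1 i.2‖ ^ 2) - 2 * d * ‖x i.1 i.2‖ ^ 2 +
        2 * ((inner ℂ (x i.1 i.2) (y i.1 i.2)).re
          + Real.sqrt i.2 * (inner ℂ (x i.1 i.2) (w i.1 i.2)).re
          + (inner ℂ (x i.1 i.2) (transportError b r (v t) i.1 i.2)).re)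
        - 2 * b * (inner ℂ (x i.1 i.2) (Tr i.1 i.2)).re) (Icc 0 T) t := by
    rintro ⟨k, n⟩ _
    simp only
    have h1 := (heq.deriv r k n t ht).fun_const_smul ((modeWeight r n : ℝ) : ℂ)
    refine (KuramotoSakaguchi.hasDerivWithinAt_norm_sq h1).congr_deriv ?_
    have hxx : ((modeWeight r n : ℝ) : ℂ) • zetaOp r (coef b (k, n) (v t)) = x k n := rfl
    have e1 : ((modeWeight r n : ℝ) : ℂ) • (zetaOp r (-(((k : ℂ) * Complex.I * b) • velCoef b (v t) k n)
        - ((n / m + d : ℝ) : ℂ) • coef b (k, n) (v t) + coef b (k, n) (p t)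
        + ((Real.sqrt n : ℝ) : ℂ) • coef b (k, n - 1) (q t))
      - ((k : ℂ) * Complex.I) • nuOp r (coef b (k, n) (v t)))
      = ((-(n / m + d) : ℝ) : ℂ) • x k n + y k n + ((Real.sqrt n : ℝ) : ℂ) • w k n
        + transportError b r (v t) k n + ((-b : ℝ) : ℂ) • Tr k n
        - ((k : ℂ) * Complex.I * (modeWeight r n : ℂ)) • nuOp r (coef b (k, n) (v t)) := by
      simp only [hx, hy, hw, hTr, transportError, velCoef, map_add, map_sub, map_neg, map_smul]
      push_cast
      module
    -- Multiplication by ikν is antisymmetric, even with the cutoff.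
    have e2 : (inner ℂ (x k n) (((k : ℂ) * Complex.I * (modeWeight r n : ℂ)) •
        nuOp r (coef b (k, n) (v t)))).re = 0 := by
      have := inner_zetaOp_nuOp r (coef b (k, n) (v t))
      rw [inner_smul_right, ← hxx, inner_smul_left, Complex.conj_ofReal]
      have hk : (k : ℂ) = ((k : ℝ) : ℂ) := by simp
      rw [hk]
      simp [this]
    have e3 : (inner ℂ (x k n) (x k n)).re = ‖x k n‖ ^ 2 := inner_self_eq_norm_sq (𝕜 := ℂ) _
    rw [hxx, e1]
    simp only [inner_add_right, inner_sub_right, inner_smul_right, Complex.add_re, Complex.sub_re,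
      Complex.re_ofReal_mul]
    rw [inner_smul_right] at e2
    rw [e2, e3]
    field_simp
    ring
  have hD := HasDerivWithinAt.fun_sum hderiv
  have hTsum : ∑ i ∈ I, (inner ℂ (x i.1 i.2) (Tr i.1 i.2)).re = 0 := by
    rw [hI, Finset.sum_product]
    refine Finset.sum_eq_zero fun k _ => sum_re_inner_transport (x k) k (modeCut r) ?_
    simp only [hx, modeWeight_eq_zero le_rfl, Complex.ofReal_zero, zero_smul]
  have hnorm : ∀ τ, ‖truncate b r (v τ)‖ ^ 2 = ∑ i ∈ I,
      ‖((modeWeight r i.2 : ℝ) : ℂ) • zetaOp r (coef b (i.1, i.2) (v τ))‖ ^ 2 := fun τ => by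
    rw [truncate, norm_synth_sq]
  refine ⟨∑ i ∈ I, 2 * ((inner ℂ (x i.1 i.2) (y i.1 i.2)).re
          + Real.sqrt i.2 * (inner ℂ (x i.1 i.2) (w i.1 i.2)).re
          + (inner ℂ (x i.1 i.2) (transportError b r (v t) i.1 i.2)).re), ?_, ?_⟩
  · have cs : ∀ z z' : ℤ → ℕ → FreqL2, ∑ i ∈ I, ‖z i.1 i.2‖ * ‖z' i.1 i.2‖
        ≤ ‖synth b (modeBox r) (modeCut r + 1) z‖ * ‖synth b (modeBox r) (modeCut r + 1) z'‖ := by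
      intro z z'
      have := Finset.sum_mul_sq_le_sq_mul_sq I (fun i => ‖z i.1 i.2‖) (fun i => ‖z' i.1 i.2‖)
      refine le_of_sq_le_sq ?_ (by positivity)
      rw [mul_pow, norm_synth_sq, norm_synth_sq]
      exact this
    have hre : ∀ z z' : FreqL2, |(inner ℂ z z').re| ≤ ‖z‖ * ‖z'‖ := fun z z' =>
      (Complex.abs_re_le_norm _).trans (norm_inner_le_norm _ _)
    -- Young's inequality with these constants spends half of the available dissipation 2/m on the
    -- source under a*, which costs only m‖q‖².
    have hw0 : ∀ i ∈ I, 2 * (Real.sqrt i.2 * (‖x i.1 i.2‖ * ‖w i.1 i.2‖))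
        ≤ 1 / m * (i.2 * ‖x i.1 i.2‖ ^ 2) + m * (if i.2 ≠ 0 then ‖coef b (i.1, i.2 - 1) (q t)‖ ^ 2 else 0) := by
      rintro ⟨k, n⟩ _
      simp only
      split_ifs with h0
      · have h1 : ‖w k n‖ ≤ ‖coef b (k, n - 1) (q t)‖ := norm_weight_zetaOp_le _ _ _
        have h2 : (Real.sqrt n) ^ 2 = n := Real.sq_sqrt (by positivity)
        have h3 := norm_nonneg (w k n)
        have h4 : ‖w k n‖ ^ 2 ≤ ‖coef b (k, n - 1) (q t)‖ ^ 2 := by gcongr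
        have h5 : 1 / m * (n * ‖x k n‖ ^ 2) + m * ‖w k n‖ ^ 2 - 2 * (Real.sqrt n * (‖x k n‖ * ‖w k n‖))
            = 1 / m * (Real.sqrt n * ‖x k n‖ - m * ‖w k n‖) ^ 2 := by
          rw [show (n : ℝ) * ‖x k n‖ ^ 2 = Real.sqrt n ^ 2 * ‖x k n‖ ^ 2 by rw [h2]]; field_simp; ring
        have h6 : 0 ≤ 1 / m * (Real.sqrt n * ‖x k n‖ - m * ‖w k n‖) ^ 2 := by positivity
        nlinarith
      · have h0' : n = 0 := by simpa using h0
        subst h0'; simp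
    have hq : ∑ i ∈ I, (if i.2 ≠ 0 then ‖coef b (i.1, i.2 - 1) (q t)‖ ^ 2 else 0) ≤ ‖q t‖ ^ 2 := by
      rw [← Finset.sum_filter]
      refine sum_norm_coef_sq_le (b := b) _ (fun i : ℤ × ℕ => (i.1, i.2 - 1)) ?_ _
      rintro ⟨k, n⟩ h1 ⟨l, j⟩ h2 hij
      simp only [Finset.coe_filter, mem_ofPred_eq] at h1 h2
      simp only [Prod.mk.injEq] at hij ⊢
      omega
    have h1 := cs x y
    rw [← hWx, ← hWy] at h1
    have h2 := cs x (transportError b r (v t))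
    rw [← hWx] at h2
    have h3 : ‖truncate b r (v t)‖ ≤ ‖v t‖ := norm_truncate_le _ _
    have h4 : ‖truncate b r (p t)‖ ≤ ‖p t‖ := norm_truncate_le _ _
    have h5 := norm_transportError_le (b := b) r (v t)
    have h6 : ‖truncate b r (v t)‖ * ‖truncate b r (p t)‖ ≤ ‖v t‖ * ‖p t‖ := by gcongr
    have h7 : ‖truncate b r (v t)‖ * ‖synth b (modeBox r) (modeCut r + 1) (transportError b r (v t))‖
        ≤ ‖v t‖ * (4 * b / (r + 1) * ‖v t‖) := by gcongr
    calc _ ≤ ∑ i ∈ I, |2 * ((inner ℂ (x i.1 i.2) (y i.1 i.2)).re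
          + Real.sqrt i.2 * (inner ℂ (x i.1 i.2) (w i.1 i.2)).re
          + (inner ℂ (x i.1 i.2) (transportError b r (v t) i.1 i.2)).re)| := Finset.abs_sum_le_sum_abs _ _
      _ ≤ ∑ i ∈ I, (2 * (‖x i.1 i.2‖ * ‖y i.1 i.2‖) + (1 / m * (i.2 * ‖x i.1 i.2‖ ^ 2)
            + m * (if i.2 ≠ 0 then ‖coef b (i.1, i.2 - 1) (q t)‖ ^ 2 else 0))
            + 2 * (‖x i.1 i.2‖ * ‖transportError b r (v t) i.1 i.2‖)) := by
          refine Finset.sum_le_sum fun i hi => ?_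
          have a1 := hre (x i.1 i.2) (y i.1 i.2)
          have a2 := hre (x i.1 i.2) (w i.1 i.2)
          have a3 := hre (x i.1 i.2) (transportError b r (v t) i.1 i.2)
          have a4 := hw0 i hi
          have a5 := mul_le_mul_of_nonneg_left a2 (Real.sqrt_nonneg (i.2 : ℝ))
          rw [← abs_of_nonneg (Real.sqrt_nonneg (i.2 : ℝ)), ← abs_mul, abs_of_nonneg (Real.sqrt_nonneg (i.2 : ℝ))] at a5
          rw [abs_mul, abs_two]
          have a6 := abs_add_three (inner ℂ (x i.1 i.2) (y i.1 i.2)).re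
            (Real.sqrt i.2 * (inner ℂ (x i.1 i.2) (w i.1 i.2)).re)
            (inner ℂ (x i.1 i.2) (transportError b r (v t) i.1 i.2)).re
          linarith
      _ = 2 * ∑ i ∈ I, ‖x i.1 i.2‖ * ‖y i.1 i.2‖ + (1 / m * dissipTrunc b r (v t)
            + m * ∑ i ∈ I, (if i.2 ≠ 0 then ‖coef b (i.1, i.2 - 1) (q t)‖ ^ 2 else 0))
            + 2 * ∑ i ∈ I, ‖x i.1 i.2‖ * ‖transportError b r (v t) i.1 i.2‖ := by
          simp only [Finset.sum_add_distrib, Finset.mul_sum, dissipTrunc]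
          rfl
      _ ≤ 2 * (‖v t‖ * ‖p t‖) + (1 / m * dissipTrunc b r (v t) + m * ‖q t‖ ^ 2)
            + 2 * (‖v t‖ * (4 * b / (r + 1) * ‖v t‖)) := by
          gcongr
          · exact h1.trans h6
          · exact h2.trans h7
      _ = _ := by ring
  · simp only [hnorm]
    refine hD.congr_deriv ?_
    simp only [Finset.sum_add_distrib, Finset.sum_sub_distrib, ← Finset.mul_sum]
    rw [hTsum, dissipTrunc]
    ring

end

end KuramotoSakaguchi
end

/-! ### The energy inequality in the limit of no truncation. -/

noncomputable section
namespace KuramotoSakaguchi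
open Filter Topology
open scoped ENNReal

section
variable {m b : ℝ} [hb : Fact (0 < b)]

lemma aemeasurable_dissip {v : ℝ → L2C} {T : ℝ} (hv : ContinuousOn v (Icc 0 T)) :
    AEMeasurable (fun t => dissip b (v t)) (volume.restrict (Icc 0 T)) := by
  unfold dissip
  refine AEMeasurable.tsum fun i => ENNReal.measurable_ofReal.comp_aemeasurable ?_
  have h1 := (coef b i).continuous.comp_continuousOn hv
  exact (continuousOn_const.mul (h1.norm.pow 2)).aemeasurable measurableSet_Icc

/-- The energy inequality. -/
theorem ModeEq.energy {d T : ℝ} {v p q : ℝ → L2C} (heq : ModeEq m b d T v p q) (hm : 0 < m)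
    (hT : 0 ≤ T) :
    (∀ᵐ t, t ∈ Icc 0 T → dissip b (v t) ≠ ⊤) ∧
    IntegrableOn (fun t => (dissip b (v t)).toReal) (Icc 0 T) ∧
    IntBound T (fun t => ‖v t‖ ^ 2) (fun t => -(1 / m) * (dissip b (v t)).toReal - 2 * d * ‖v t‖ ^ 2
      + (2 * ‖p t‖ * ‖v t‖ + m * ‖q t‖ ^ 2)) ∧
    IntBound T (fun t => -‖v t‖ ^ 2) (fun t => 3 / m * (dissip b (v t)).toReal + 2 * d * ‖v t‖ ^ 2
      + (2 * ‖p t‖ * ‖v t‖ + m * ‖q t‖ ^ 2)) := by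
  have hb0 := hb.out
  have hvn := heq.cont.norm
  have hV : ContinuousOn (fun t => ‖v t‖ ^ 2) (Icc 0 T) := hvn.pow 2
  set K : ℝ → ℝ := fun t => 2 * ‖p t‖ * ‖v t‖ + m * ‖q t‖ ^ 2 with hK
  have hKc : ContinuousOn K (Icc 0 T) :=
    ((continuousOn_const.mul heq.cont_p.norm).mul hvn).add (continuousOn_const.mul (heq.cont_q.norm.pow 2))
  set Ar : ℕ → ℝ → ℝ := fun r t => dissipTrunc b r (v t) with hAr
  have hArc : ∀ r, ContinuousOn (Ar r) (Icc 0 T) := fun r => continuousOn_dissipTrunc r heq.cont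
  have hVrc : ∀ r, ContinuousOn (fun t => ‖truncate b r (v t)‖ ^ 2) (Icc 0 T) := fun r =>
    (continuousOn_truncate r heq.cont).norm.pow 2
  have hLc : ∀ r : ℕ, ContinuousOn (fun t => K t + 8 * b / (r + 1) * ‖v t‖ ^ 2) (Icc 0 T) := fun r =>
    hKc.add (continuousOn_const.mul hV)
  -- The error G is bounded by 1/m times the dissipation on both sides. The coefficient −2/m
  -- therefore becomes at most −1/m here, and in the bound for the negative 2/m becomes at most 3/m.
  have hup : ∀ r, IntBound T (fun t => ‖truncate b r (v t)‖ ^ 2)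
      (fun t => -(1 / m) * Ar r t - 2 * d * ‖truncate b r (v t)‖ ^ 2
        + (K t + 8 * b / (r + 1) * ‖v t‖ ^ 2)) := by
    intro r
    refine IntBound.of_hasDerivWithinAt (((continuousOn_const.mul (hArc r)).sub
      (continuousOn_const.mul (hVrc r))).add (hLc r)) fun t ht => ?_
    obtain ⟨G, hG, hd⟩ := heq.hasDerivWithinAt_norm_sq hm r ht
    refine ⟨_, hd, ?_⟩
    have h1 := (le_abs_self G).trans hG
    have h2 : 2 / m * dissipTrunc b r (v t) = 2 * (1 / m * dissipTrunc b r (v t)) := by ring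
    simp only [hAr, hK]
    linarith
  have hlo : ∀ r, IntBound T (fun t => -‖truncate b r (v t)‖ ^ 2)
      (fun t => 3 / m * Ar r t + 2 * d * ‖truncate b r (v t)‖ ^ 2
        + (K t + 8 * b / (r + 1) * ‖v t‖ ^ 2)) := by
    intro r
    refine IntBound.of_hasDerivWithinAt (((continuousOn_const.mul (hArc r)).add
      (continuousOn_const.mul (hVrc r))).add (hLc r)) fun t ht => ?_
    obtain ⟨G, hG, hd⟩ := heq.hasDerivWithinAt_norm_sq hm r ht
    refine ⟨_, hd.fun_neg, ?_⟩
    have h1 := (neg_le_abs G).trans hG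
    have h2 : 2 / m * dissipTrunc b r (v t) = 2 * (1 / m * dissipTrunc b r (v t)) := by ring
    have h3 : 3 / m * dissipTrunc b r (v t) = 3 * (1 / m * dissipTrunc b r (v t)) := by ring
    simp only [hAr, hK]
    linarith
  set L : ℝ → ℝ := fun t => 2 * |d| * ‖v t‖ ^ 2 + (K t + 8 * b * ‖v t‖ ^ 2) with hL
  have hLcont : ContinuousOn L (Icc 0 T) :=
    (continuousOn_const.mul hV).add (hKc.add (continuousOn_const.mul hV))
  have hKnn : ∀ t, 0 ≤ K t := fun t => by simp only [hK]; positivity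
  have hdle : ∀ r t, |2 * d * ‖truncate b r (v t)‖ ^ 2| ≤ 2 * |d| * ‖v t‖ ^ 2 := by
    intro r t
    rw [abs_mul, abs_mul, abs_two, abs_of_nonneg (by positivity : (0 : ℝ) ≤ ‖truncate b r (v t)‖ ^ 2)]
    gcongr
    exact norm_truncate_le _ _
  have hble : ∀ (r : ℕ) t, 8 * b / ((r : ℝ) + 1) * ‖v t‖ ^ 2 ≤ 8 * b * ‖v t‖ ^ 2 := by
    intro r t
    gcongr
    exact div_le_self (by positivity) (by linarith [show (0 : ℝ) ≤ r by positivity])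
  have hbnn : ∀ (r : ℕ) t, 0 ≤ 8 * b / ((r : ℝ) + 1) * ‖v t‖ ^ 2 := fun r t => by positivity
  set M : ℝ := m * (‖v 0‖ ^ 2 + ∫ τ in (0 : ℝ)..T, L τ) with hM
  have hIcc : ∀ r, ∫ t in Icc 0 T, Ar r t ≤ M := by
    intro r
    have h1 := ((hup r).mono (ψ' := fun t => -(1 / m) * Ar r t + L t)
      ((continuousOn_const.mul (hArc r)).add hLcont).integrableOn_Icc (.of_forall fun t _ => by
        have a1 := (abs_le.1 (hdle r t)).1
        have a2 := hble r t
        simp only [hL]; linarith)).le 0 T le_rfl hT le_rfl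
    have h0 : IntervalIntegrable (fun t => -(1 / m) * Ar r t) volume 0 T :=
      (continuousOn_const.mul (hArc r)).intervalIntegrable_of_Icc hT
    rw [intervalIntegral.integral_add h0 (hLcont.intervalIntegrable_of_Icc hT),
      intervalIntegral.integral_const_mul] at h1
    have h2 : ‖truncate b r (v 0)‖ ^ 2 ≤ ‖v 0‖ ^ 2 := by gcongr; exact norm_truncate_le _ _
    have h3 : 0 ≤ ‖truncate b r (v T)‖ ^ 2 := by positivity
    rw [integral_Icc_eq_integral_Ioc, ← intervalIntegral.integral_of_le hT, hM]
    have h4 : 1 / m * ∫ τ in (0 : ℝ)..T, Ar r τ ≤ ‖v 0‖ ^ 2 + ∫ τ in (0 : ℝ)..T, L τ := by linarith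
    calc ∫ τ in (0 : ℝ)..T, Ar r τ = m * (1 / m * ∫ τ in (0 : ℝ)..T, Ar r τ) := by field_simp
      _ ≤ _ := mul_le_mul_of_nonneg_left h4 hm.le
  -- Fatou's lemma: the truncated dissipations have uniformly bounded time integrals, so the full
  -- dissipation is integrable in time although it is not known to be finite at any given time.
  have hlint : ∫⁻ t in Icc 0 T, dissip b (v t) ≤ ENNReal.ofReal M := by
    calc _ ≤ ∫⁻ t in Icc 0 T, liminf (fun r => ENNReal.ofReal (Ar r t)) atTop :=
          lintegral_mono fun t => dissip_le_liminf (v t)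
      _ ≤ liminf (fun r => ∫⁻ t in Icc 0 T, ENNReal.ofReal (Ar r t)) atTop :=
          lintegral_liminf_le' fun r => ENNReal.measurable_ofReal.comp_aemeasurable
            ((hArc r).aemeasurable measurableSet_Icc)
      _ ≤ _ := by
          refine liminf_le_of_le (by isBoundedDefault) fun c hc => ?_
          obtain ⟨r, hr⟩ := hc.exists
          refine hr.trans ?_
          rw [← ofReal_integral_eq_lintegral_ofReal (hArc r).integrableOn_Icc
            (.of_forall fun t => dissipTrunc_nonneg r (v t))]
          exact ENNReal.ofReal_le_ofReal (hIcc r)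
  have hfin : ∫⁻ t in Icc 0 T, dissip b (v t) ≠ ⊤ := (hlint.trans_lt ENNReal.ofReal_lt_top).ne
  have hmeas := aemeasurable_dissip (b := b) heq.cont
  have hae : ∀ᵐ t, t ∈ Icc 0 T → dissip b (v t) ≠ ⊤ := by
    have := ae_lt_top' hmeas hfin
    rw [ae_restrict_iff' measurableSet_Icc] at this
    filter_upwards [this] with t h1 h2 using (h1 h2).ne
  have hint : IntegrableOn (fun t => (dissip b (v t)).toReal) (Icc 0 T) :=
    integrable_toReal_of_lintegral_ne_top hmeas hfin
  have hVlim : ∀ t, Tendsto (fun r => ‖truncate b r (v t)‖ ^ 2) atTop (𝓝 (‖v t‖ ^ 2)) := fun t =>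
    (tendsto_truncate (v t)).norm.pow 2
  have hLlim : ∀ t, Tendsto (fun r : ℕ => K t + 8 * b / ((r : ℝ) + 1) * ‖v t‖ ^ 2) atTop (𝓝 (K t)) := by
    intro t
    have h3 : Tendsto (fun r : ℕ => 1 / ((r : ℝ) + 1)) atTop (𝓝 0) := tendsto_one_div_add_atTop_nhds_zero_nat
    have h4 := ((h3.const_mul (8 * b)).mul_const (‖v t‖ ^ 2)).const_add (K t)
    rw [mul_zero, zero_mul, add_zero] at h4
    refine h4.congr fun r => by ring
  refine ⟨hae, hint, ?_, ?_⟩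
  · refine IntBound.of_tendsto hup (fun t _ => hVlim t)
      (B := fun t => 1 / m * (dissip b (v t)).toReal + L t)
      ((hint.const_mul _).add hLcont.integrableOn_Icc) (fun r => ?_) ?_
    · filter_upwards [hae] with t h1 ht
      have a1 := dissipTrunc_le (h1 ht) r
      have a2 := dissipTrunc_nonneg (b := b) r (v t)
      have a3 := mul_le_mul_of_nonneg_left a1 (by positivity : 0 ≤ 1 / m)
      have a4 : 0 ≤ 1 / m * dissipTrunc b r (v t) := by positivity
      have a5 := abs_le.1 (hdle r t)
      have a6 := hble r t
      have a7 := hbnn r t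
      have a8 := hKnn t
      have a9 : 0 ≤ L t := by simp only [hL]; positivity
      simp only [hAr, hL] at *
      rw [abs_le]
      constructor <;> linarith
    · filter_upwards [hae] with t h1 ht
      exact (((tendsto_dissipTrunc (h1 ht)).const_mul _).sub ((hVlim t).const_mul _)).add (hLlim t)
  · refine IntBound.of_tendsto hlo (fun t _ => (hVlim t).neg)
      (B := fun t => 3 / m * (dissip b (v t)).toReal + L t)
      ((hint.const_mul _).add hLcont.integrableOn_Icc) (fun r => ?_) ?_
    · filter_upwards [hae] with t h1 ht
      have a1 := dissipTrunc_le (h1 ht) r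
      have a2 := dissipTrunc_nonneg (b := b) r (v t)
      have a3 := mul_le_mul_of_nonneg_left a1 (by positivity : 0 ≤ 3 / m)
      have a4 : 0 ≤ 3 / m * dissipTrunc b r (v t) := by positivity
      have a5 := abs_le.1 (hdle r t)
      have a6 := hble r t
      have a7 := hbnn r t
      have a8 := hKnn t
      simp only [hAr, hL] at *
      rw [abs_le]
      constructor <;> linarith
    · filter_upwards [hae] with t h1 ht
      exact (((tendsto_dissipTrunc (h1 ht)).const_mul _).add ((hVlim t).const_mul _)).add (hLlim t)

end

end KuramotoSakaguchi
end

/-! ### The hypocoercive cross term. -/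

noncomputable section
namespace KuramotoSakaguchi
open Filter Topology
open scoped ENNReal

/-! ### The hypocoercive cross term -/

/-- By this symmetry the two terms with a factor ν cancel when the cross term is differentiated. -/
lemma inner_nuOp_zetaOp (R : ℕ) (x y : FreqL2) :
    inner ℂ (nuOp R x) (zetaOp R y) = inner ℂ (zetaOp R x) (nuOp R y) := by
  rw [zetaOp, nuOp, inner_mulCLM_mulCLM, inner_mulCLM_mulCLM]
  congr 1
  ext v
  rw [bumpBCF_apply, bumpBCF_apply, map_mul, map_mul, Complex.conj_ofReal, Complex.conj_ofReal]
  simp only [id_eq]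
  push_cast
  ring

section
variable {m b : ℝ} [hb : Fact (0 < b)]

lemma summable_coef_layer (n : ℕ) (u : L2C) : Summable fun k : ℤ => ‖coef b (k, n) u‖ ^ 2 :=
  (hasSum_coef u).summable.comp_injective (i := fun k : ℤ => (k, n)) fun _ _ h => by simpa using h

lemma tsum_coef_layer_le (n : ℕ) (u : L2C) : ∑' k : ℤ, ‖coef b (k, n) u‖ ^ 2 ≤ ‖u‖ ^ 2 :=
  (summable_coef_layer n u).tsum_le_of_sum_le fun s =>
    sum_norm_coef_sq_le (b := b) s (fun k : ℤ => (k, n)) (by simp [Set.InjOn]) u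

variable (b) in
/-- The pairing of the first Hermite layer of `u` with the zeroth layer of `w`. -/
def crossTerm (u w : L2C) : ℝ := ∑' k : ℤ, (inner ℂ (coef b (k, 1) u) (coef b (k, 0) w)).re

lemma abs_re_inner_le (x y : FreqL2) : |(inner ℂ x y).re| ≤ (‖x‖ ^ 2 + ‖y‖ ^ 2) / 2 := by
  have h1 := (Complex.abs_re_le_norm _).trans (norm_inner_le_norm (𝕜 := ℂ) x y)
  nlinarith [sq_nonneg (‖x‖ - ‖y‖)]

lemma abs_crossTerm_le (u w : L2C) : |crossTerm b u w| ≤ (‖u‖ ^ 2 + ‖w‖ ^ 2) / 2 := by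
  have hs : Summable fun k : ℤ => (‖coef b (k, 1) u‖ ^ 2 + ‖coef b (k, 0) w‖ ^ 2) / 2 :=
    ((summable_coef_layer 1 u).add (summable_coef_layer 0 w)).div_const 2
  have h1 := tsum_of_norm_bounded (f := fun k : ℤ => (inner ℂ (coef b (k, 1) u) (coef b (k, 0) w)).re)
    hs.hasSum (fun k => abs_re_inner_le (coef b (k, 1) u) (coef b (k, 0) w))
  refine h1.trans ?_
  rw [tsum_div_const, (summable_coef_layer 1 u).tsum_add (summable_coef_layer 0 w)]
  have := tsum_coef_layer_le (b := b) 1 u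
  have := tsum_coef_layer_le (b := b) 0 w
  linarith

variable (b) in
/-- The truncated cross term. -/
def crossTrunc (r : ℕ) (u w : L2C) : ℝ := ∑ k ∈ modeBox r,
  (inner ℂ (zetaOp r (coef b (k, 1) u)) (zetaOp r (coef b (k, 0) w))).re

lemma tendsto_crossTrunc (u w : L2C) :
    Tendsto (fun r => crossTrunc b r u w) atTop (𝓝 (crossTerm b u w)) := by
  have hs : Summable fun k : ℤ => (‖coef b (k, 1) u‖ ^ 2 + ‖coef b (k, 0) w‖ ^ 2) / 2 :=
    ((summable_coef_layer 1 u).add (summable_coef_layer 0 w)).div_const 2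
  have h1 : ∀ r, crossTrunc b r u w = ∑' k : ℤ, (if k ∈ modeBox r then
      (inner ℂ (zetaOp r (coef b (k, 1) u)) (zetaOp r (coef b (k, 0) w))).re else 0) := fun r => by
    rw [tsum_eq_sum (s := modeBox r) (fun k hk => if_neg hk), crossTrunc]
    exact Finset.sum_congr rfl fun k hk => (if_pos hk).symm
  simp only [h1]
  refine tendsto_tsum_of_dominated_convergence hs (fun k => ?_) (.of_forall fun r k => ?_)
  · have h2 : Tendsto (fun r => (inner ℂ (zetaOp r (coef b (k, 1) u)) (zetaOp r (coef b (k, 0) w))).re)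
        atTop (𝓝 (inner ℂ (coef b (k, 1) u) (coef b (k, 0) w)).re) :=
      (Complex.continuous_re.tendsto _).comp ((tendsto_zetaOp _).inner (tendsto_zetaOp _))
    refine h2.congr' ?_
    filter_upwards [eventually_mem_modeBox k] with r hr
    rw [if_pos hr]
  · split_ifs
    · refine (abs_re_inner_le _ _).trans ?_
      have a1 := norm_zetaOp_le r (coef b (k, 1) u)
      have a2 := norm_zetaOp_le r (coef b (k, 0) w)
      gcongr
    · rw [norm_zero]; positivity

/-- Levels n ≥ 1 are dominated by the dissipation, which weights them by n. It turns control of the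
n = 0 layer into control of the whole norm. -/
lemma norm_truncate_sq_le (r : ℕ) (w : L2C) : ‖truncate b r w‖ ^ 2
    ≤ (∑ k ∈ modeBox r, ‖zetaOp r (coef b (k, 0) w)‖ ^ 2) + dissipTrunc b r w := by
  rw [truncate, norm_synth_sq, dissipTrunc, Finset.sum_product, Finset.sum_product, ← Finset.sum_add_distrib]
  refine Finset.sum_le_sum fun k _ => ?_
  rw [Finset.sum_range_succ', Finset.sum_range_succ' _ (modeCut r)]
  simp only [CharP.cast_eq_zero, zero_mul, add_zero]
  rw [add_comm (‖zetaOp r (coef b (k, 0) w)‖ ^ 2)]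
  refine add_le_add (Finset.sum_le_sum fun n _ => ?_) ?_
  · refine le_mul_of_one_le_left (by positivity) ?_
    push_cast; linarith [show (0 : ℝ) ≤ n by positivity]
  · have h1 : ‖((modeWeight r 0 : ℝ) : ℂ) • zetaOp r (coef b (k, 0) w)‖ ≤ ‖zetaOp r (coef b (k, 0) w)‖ := by
      rw [norm_smul, Complex.norm_real, Real.norm_of_nonneg (modeWeight_nonneg _ _)]
      exact mul_le_of_le_one_left (norm_nonneg _) (modeWeight_le_one _ _)
    gcongr

/-- The derivative of the truncated cross term. -/
lemma ModeEq.hasDerivWithinAt_crossTrunc {T : ℝ} {u w q : ℝ → L2C}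
    (heq : ModeEq m b 0 T u (fun _ => 0) q)
    (hw : ∀ t ∈ Icc 0 T, ∀ k n, coef b (k, n) (w t) = ((k : ℂ) * Complex.I) • coef b (k, n) (u t))
    (r : ℕ) {t : ℝ} (ht : t ∈ Icc 0 T) :
    HasDerivWithinAt (fun τ => crossTrunc b r (u τ) (w τ)) (∑ k ∈ modeBox r,
      (-b * ‖zetaOp r (coef b (k, 0) (w t))‖ ^ 2
        - b * Real.sqrt 2 * (inner ℂ (zetaOp r (coef b (k, 2) (w t))) (zetaOp r (coef b (k, 0) (w t)))).re
        + b * ‖zetaOp r (coef b (k, 1) (w t))‖ ^ 2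
        - 1 / m * (inner ℂ (zetaOp r (coef b (k, 1) (u t))) (zetaOp r (coef b (k, 0) (w t)))).re
        + (inner ℂ (zetaOp r (coef b (k, 0) (q t))) (zetaOp r (coef b (k, 0) (w t)))).re)) (Icc 0 T) t := by
  -- Writing w as ik times u makes the cross term a function of the coefficients of u alone, so no
  -- equation for w is needed.
  have hcongr : ∀ τ ∈ Icc 0 T, crossTrunc b r (u τ) (w τ) = ∑ k ∈ modeBox r,
      (inner ℂ (zetaOp r (coef b (k, 1) (u τ)))
        (((k : ℂ) * Complex.I) • zetaOp r (coef b (k, 0) (u τ)))).re := by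
    intro τ hτ
    unfold crossTrunc
    simp only [hw τ hτ, map_smul]
  refine HasDerivWithinAt.congr ?_ hcongr (hcongr t ht)
  refine HasDerivWithinAt.fun_sum fun k _ => ?_
  have h1 := heq.deriv r k 1 t ht
  have h0 := (heq.deriv r k 0 t ht).fun_const_smul ((k : ℂ) * Complex.I)
  have h2 := Complex.reCLM.hasFDerivAt.comp_hasDerivWithinAt t (h1.inner ℂ h0)
  refine h2.congr_deriv ?_
  rw [Complex.reCLM_apply]
  have e : ∀ n, zetaOp r (coef b (k, n) (w t)) = ((k : ℂ) * Complex.I) • zetaOp r (coef b (k, n) (u t)) :=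
    fun n => by rw [hw t ht, map_smul]
  have hk : (starRingEnd ℂ) (k : ℂ) = k := by rw [← Complex.ofReal_intCast, Complex.conj_ofReal]
  have hnorm : ∀ n, ‖zetaOp r (coef b (k, n) (w t))‖ ^ 2 = (k : ℝ) ^ 2 * ‖zetaOp r (coef b (k, n) (u t))‖ ^ 2 := by
    intro n
    rw [e n, norm_smul, norm_mul, Complex.norm_I, mul_one, mul_pow, ← Complex.ofReal_intCast,
      Complex.norm_real, Real.norm_eq_abs, sq_abs]
  rw [hnorm 0, hnorm 1, e 0, e 2]
  set c0 := zetaOp r (coef b (k, 0) (u t))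
  set c1 := zetaOp r (coef b (k, 1) (u t))
  set c2 := zetaOp r (coef b (k, 2) (u t))
  set q0 := zetaOp r (coef b (k, 0) (q t))
  set n0 := nuOp r (coef b (k, 0) (u t))
  set n1 := nuOp r (coef b (k, 1) (u t))
  have hn : inner ℂ n1 c0 = inner ℂ c1 n0 := inner_nuOp_zetaOp r _ _
  have s0 : inner ℂ c0 c0 = ((‖c0‖ ^ 2 : ℝ) : ℂ) := by
    rw [inner_self_eq_norm_sq_to_K]; push_cast; rfl
  have s1 : inner ℂ c1 c1 = ((‖c1‖ ^ 2 : ℝ) : ℂ) := by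
    rw [inner_self_eq_norm_sq_to_K]; push_cast; rfl
  have x1 : zetaOp r (-(((k : ℂ) * Complex.I * b) • velCoef b (u t) k 1)
        - (((1 : ℕ) / m + 0 : ℝ) : ℂ) • coef b (k, 1) (u t) + coef b (k, 1) 0
        + ((Real.sqrt ((1 : ℕ) : ℝ) : ℝ) : ℂ) • coef b (k, 1 - 1) (q t)) - ((k : ℂ) * Complex.I) • n1
      = -(((k : ℂ) * Complex.I * b) • (((Real.sqrt 2 : ℝ) : ℂ) • c2 + c0))
        - ((1 / m : ℝ) : ℂ) • c1 + q0 - ((k : ℂ) * Complex.I) • n1 := by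
    simp only [velCoef, map_add, map_sub, map_neg, map_smul, map_zero, Nat.sub_self, Nat.cast_one,
      Real.sqrt_one, Complex.ofReal_one, one_smul, add_zero]
    norm_num
    rfl
  have x0 : zetaOp r (-(((k : ℂ) * Complex.I * b) • velCoef b (u t) k 0)
        - (((0 : ℕ) / m + 0 : ℝ) : ℂ) • coef b (k, 0) (u t) + coef b (k, 0) 0
        + ((Real.sqrt ((0 : ℕ) : ℝ) : ℝ) : ℂ) • coef b (k, 0 - 1) (q t)) - ((k : ℂ) * Complex.I) • n0
      = -(((k : ℂ) * Complex.I * b) • c1) - ((k : ℂ) * Complex.I) • n0 := by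
    simp only [velCoef, map_add, map_sub, map_neg, map_smul, map_zero, Nat.cast_zero]
    simp
    rfl
  rw [x1, x0]
  simp only [inner_smul_right, inner_smul_left, inner_sub_right, inner_sub_left, inner_add_left,
    inner_neg_left, inner_neg_right, map_mul, Complex.conj_I, Complex.conj_ofReal, hk, s0, s1, hn]
  have hk' : (k : ℂ) = ((k : ℝ) : ℂ) := by simp
  rw [hk']
  simp only [Complex.add_re, Complex.sub_re, Complex.neg_re, Complex.neg_im, Complex.mul_re, Complex.mul_im,
    Complex.ofReal_re, Complex.ofReal_im, Complex.I_re, Complex.I_im, Complex.add_im, Complex.sub_im]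
  ring

/-- The evolution of the cross term produces macroscopic dissipation. -/
theorem ModeEq.cross {T : ℝ} {u w q : ℝ → L2C} (heq : ModeEq m b 0 T u (fun _ => 0) q) (hm : 0 < m)
    (hwc : ContinuousOn w (Icc 0 T))
    (hw : ∀ t ∈ Icc 0 T, ∀ k n, coef b (k, n) (w t) = ((k : ℂ) * Complex.I) • coef b (k, n) (u t))
    (huf : ∀ᵐ t, t ∈ Icc 0 T → dissip b (u t) ≠ ⊤)
    (hui : IntegrableOn (fun t => (dissip b (u t)).toReal) (Icc 0 T))
    (hwf : ∀ᵐ t, t ∈ Icc 0 T → dissip b (w t) ≠ ⊤)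
    (hwi : IntegrableOn (fun t => (dissip b (w t)).toReal) (Icc 0 T)) :
    IntBound T (fun t => crossTerm b (u t) (w t)) (fun t => b * (-(1 / 2) * ‖w t‖ ^ 2
      + 2 * (dissip b (w t)).toReal + 2 / (m * b) ^ 2 * (dissip b (u t)).toReal + 2 / b ^ 2 * ‖q t‖ ^ 2)) ∧
    IntBound T (fun t => -crossTerm b (u t) (w t)) (fun t => b * (4 * ‖w t‖ ^ 2
      + 2 / (m * b) ^ 2 * ‖u t‖ ^ 2 + 2 / b ^ 2 * ‖q t‖ ^ 2)) := by
  have hb0 := hb.out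
  -- The three error terms receive 1/4, 1/8 and 1/8 of b‖w₀‖². Half of the gained −b‖w₀‖² survives.
  have hyoung : ∀ (r : ℕ) (t : ℝ) (k : ℤ),
      |b * Real.sqrt 2 * (inner ℂ (zetaOp r (coef b (k, 2) (w t))) (zetaOp r (coef b (k, 0) (w t)))).re|
      + |1 / m * (inner ℂ (zetaOp r (coef b (k, 1) (u t))) (zetaOp r (coef b (k, 0) (w t)))).re|
      + |(inner ℂ (zetaOp r (coef b (k, 0) (q t))) (zetaOp r (coef b (k, 0) (w t)))).re|
      ≤ b * (1 / 2 * ‖zetaOp r (coef b (k, 0) (w t))‖ ^ 2 + 2 * ‖coef b (k, 2) (w t)‖ ^ 2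
        + 2 / (m * b) ^ 2 * ‖coef b (k, 1) (u t)‖ ^ 2 + 2 / b ^ 2 * ‖coef b (k, 0) (q t)‖ ^ 2) := by
    intro r t k
    have hre : ∀ z z' : FreqL2, |(inner ℂ (zetaOp r z) (zetaOp r z')).re| ≤ ‖z‖ * ‖zetaOp r z'‖ := fun z z' =>
      (Complex.abs_re_le_norm _).trans ((norm_inner_le_norm _ _).trans
        (mul_le_mul_of_nonneg_right (norm_zetaOp_le _ _) (norm_nonneg _)))
    have a1 := hre (coef b (k, 2) (w t)) (coef b (k, 0) (w t))
    have a2 := hre (coef b (k, 1) (u t)) (coef b (k, 0) (w t))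
    have a3 := hre (coef b (k, 0) (q t)) (coef b (k, 0) (w t))
    set Y := ‖zetaOp r (coef b (k, 0) (w t))‖
    set Y2 := ‖coef b (k, 2) (w t)‖
    set C1 := ‖coef b (k, 1) (u t)‖
    set Q := ‖coef b (k, 0) (q t)‖
    rw [abs_mul, abs_mul (1 / m), abs_of_pos (by positivity : 0 < b * Real.sqrt 2),
      abs_of_pos (by positivity : 0 < 1 / m)]
    have b1 : b * Real.sqrt 2 * (Y2 * Y) ≤ b * (1 / 4 * Y ^ 2 + 2 * Y2 ^ 2) := by
      have h2 : Real.sqrt 2 ^ 2 = 2 := Real.sq_sqrt (by norm_num)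
      have : Real.sqrt 2 * (Y2 * Y) ≤ 1 / 4 * Y ^ 2 + 2 * Y2 ^ 2 := by
        nlinarith [sq_nonneg (1 / 2 * Y - Real.sqrt 2 * Y2)]
      calc _ = b * (Real.sqrt 2 * (Y2 * Y)) := by ring
        _ ≤ _ := by gcongr
    have b2 : 1 / m * (C1 * Y) ≤ b * (1 / 8 * Y ^ 2 + 2 / (m * b) ^ 2 * C1 ^ 2) := by
      have : b * (1 / 8 * Y ^ 2 + 2 / (m * b) ^ 2 * C1 ^ 2) - 1 / m * (C1 * Y)
          = b / 8 * (Y - 4 / (m * b) * C1) ^ 2 := by field_simp; ring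
      have : 0 ≤ b / 8 * (Y - 4 / (m * b) * C1) ^ 2 := by positivity
      linarith
    have b3 : Q * Y ≤ b * (1 / 8 * Y ^ 2 + 2 / b ^ 2 * Q ^ 2) := by
      have : b * (1 / 8 * Y ^ 2 + 2 / b ^ 2 * Q ^ 2) - Q * Y
          = b / 8 * (Y - 4 / b * Q) ^ 2 := by field_simp; ring
      have : 0 ≤ b / 8 * (Y - 4 / b * Q) ^ 2 := by positivity
      linarith
    have c1 := mul_le_mul_of_nonneg_left a1 (by positivity : 0 ≤ b * Real.sqrt 2)
    have c2 := mul_le_mul_of_nonneg_left a2 (by positivity : 0 ≤ 1 / m)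
    linarith
  have hlayer : ∀ (r n : ℕ) (v : L2C), ∑ k ∈ modeBox r, ‖coef b (k, n) v‖ ^ 2 ≤ ‖v‖ ^ 2 := fun r n v =>
    sum_norm_coef_sq_le (b := b) _ (fun k : ℤ => (k, n)) (by simp [Set.InjOn]) v
  have hlayerc : ∀ (r n : ℕ) {v : ℝ → L2C}, ContinuousOn v (Icc 0 T) →
      ContinuousOn (fun t => ∑ k ∈ modeBox r, ‖coef b (k, n) (v t)‖ ^ 2) (Icc 0 T) := fun r n v hv =>
    continuousOn_finsetSum _ fun k _ => ((coef b (k, n)).continuous.comp_continuousOn hv).norm.pow 2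
  have hqc := heq.cont_q.norm.pow 2
  constructor
  · set ψ : ℕ → ℝ → ℝ := fun r t => b * (-(1 / 2) * ‖truncate b r (w t)‖ ^ 2
      + 1 / 2 * dissipTrunc b r (w t) + (∑ k ∈ modeBox r, ‖coef b (k, 1) (w t)‖ ^ 2
        + 2 * ∑ k ∈ modeBox r, ‖coef b (k, 2) (w t)‖ ^ 2)
      + 2 / (m * b) ^ 2 * ∑ k ∈ modeBox r, ‖coef b (k, 1) (u t)‖ ^ 2 + 2 / b ^ 2 * ‖q t‖ ^ 2) with hψ
    have hψb : ∀ r, IntBound T (fun t => crossTrunc b r (u t) (w t)) (ψ r) := by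
      intro r
      refine IntBound.of_hasDerivWithinAt ?_ fun t ht => ⟨_, heq.hasDerivWithinAt_crossTrunc hw r ht, ?_⟩
      · have h1 := (continuousOn_truncate (b := b) r hwc).norm.pow 2
        have h2 := continuousOn_dissipTrunc (b := b) r hwc
        have h3 := hlayerc r 1 hwc
        have h4 := hlayerc r 2 hwc
        have h5 := hlayerc r 1 heq.cont
        exact continuousOn_const.mul (((((continuousOn_const.mul h1).add (continuousOn_const.mul h2)).add
          (h3.add (continuousOn_const.mul h4))).add (continuousOn_const.mul h5)).add
          (continuousOn_const.mul hqc))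
      · have h1 : ∀ k ∈ modeBox r, (-b * ‖zetaOp r (coef b (k, 0) (w t))‖ ^ 2
            - b * Real.sqrt 2 * (inner ℂ (zetaOp r (coef b (k, 2) (w t))) (zetaOp r (coef b (k, 0) (w t)))).re
            + b * ‖zetaOp r (coef b (k, 1) (w t))‖ ^ 2
            - 1 / m * (inner ℂ (zetaOp r (coef b (k, 1) (u t))) (zetaOp r (coef b (k, 0) (w t)))).re
            + (inner ℂ (zetaOp r (coef b (k, 0) (q t))) (zetaOp r (coef b (k, 0) (w t)))).re)
            ≤ b * (-(1 / 2) * ‖zetaOp r (coef b (k, 0) (w t))‖ ^ 2 + (‖coef b (k, 1) (w t)‖ ^ 2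
              + 2 * ‖coef b (k, 2) (w t)‖ ^ 2) + 2 / (m * b) ^ 2 * ‖coef b (k, 1) (u t)‖ ^ 2
              + 2 / b ^ 2 * ‖coef b (k, 0) (q t)‖ ^ 2) := by
          intro k _
          have a1 := hyoung r t k
          have a2 := norm_zetaOp_le r (coef b (k, 1) (w t))
          have a3 : b * ‖zetaOp r (coef b (k, 1) (w t))‖ ^ 2 ≤ b * ‖coef b (k, 1) (w t)‖ ^ 2 := by gcongr
          have a4 := neg_abs_le (b * Real.sqrt 2 *
            (inner ℂ (zetaOp r (coef b (k, 2) (w t))) (zetaOp r (coef b (k, 0) (w t)))).re)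
          have a5 := neg_abs_le (1 / m *
            (inner ℂ (zetaOp r (coef b (k, 1) (u t))) (zetaOp r (coef b (k, 0) (w t)))).re)
          have a6 := le_abs_self (inner ℂ (zetaOp r (coef b (k, 0) (q t))) (zetaOp r (coef b (k, 0) (w t)))).re
          linarith
        refine (Finset.sum_le_sum h1).trans ?_
        rw [← Finset.mul_sum]
        simp only [Finset.sum_add_distrib, ← Finset.mul_sum, hψ]
        -- The gain at n = 0 becomes a gain in the full norm at the price of half the dissipation.
        -- With the layers 1 and 2, estimated below, the total stays under 2 times the dissipation
        -- of w.
        have h2 := norm_truncate_sq_le (b := b) r (w t)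
        have h3 := hlayer r 0 (q t)
        gcongr b * ?_
        have h4 : 2 / b ^ 2 * ∑ k ∈ modeBox r, ‖coef b (k, 0) (q t)‖ ^ 2 ≤ 2 / b ^ 2 * ‖q t‖ ^ 2 := by gcongr
        linarith
    have hfin : ∀ r, ∀ᵐ t, t ∈ Icc 0 T → ψ r t ≤ b * (-(1 / 2) * ‖truncate b r (w t)‖ ^ 2
        + 2 * (dissip b (w t)).toReal + 2 / (m * b) ^ 2 * (dissip b (u t)).toReal
        + 2 / b ^ 2 * ‖q t‖ ^ 2) := by
      intro r
      filter_upwards [huf, hwf] with t h1 h2 ht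
      have a1 := dissipTrunc_le (h2 ht) r
      have a2 : ∑ k ∈ modeBox r, ‖coef b (k, 1) (w t)‖ ^ 2 + 2 * ∑ k ∈ modeBox r, ‖coef b (k, 2) (w t)‖ ^ 2
          ≤ (dissip b (w t)).toReal := by
        have := sum_le_dissip (h2 ht) (modeBox r ×ˢ {1, 2})
        rw [Finset.sum_product] at this
        refine le_trans (le_of_eq ?_) this
        rw [Finset.mul_sum, ← Finset.sum_add_distrib]
        refine Finset.sum_congr rfl fun k _ => ?_
        rw [Finset.sum_pair (by norm_num)]
        push_cast; ring
      have a3 : ∑ k ∈ modeBox r, ‖coef b (k, 1) (u t)‖ ^ 2 ≤ (dissip b (u t)).toReal := by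
        have := sum_le_dissip (h1 ht) (modeBox r ×ˢ {1})
        rw [Finset.sum_product] at this
        simpa using this
      have a4 : 2 / (m * b) ^ 2 * ∑ k ∈ modeBox r, ‖coef b (k, 1) (u t)‖ ^ 2
          ≤ 2 / (m * b) ^ 2 * (dissip b (u t)).toReal := by gcongr
      have a5 : 0 ≤ (dissip b (w t)).toReal := ENNReal.toReal_nonneg
      simp only [hψ]
      gcongr b * ?_
      linarith
    have hint : ∀ r, IntegrableOn (fun t => b * (-(1 / 2) * ‖truncate b r (w t)‖ ^ 2
        + 2 * (dissip b (w t)).toReal + 2 / (m * b) ^ 2 * (dissip b (u t)).toReal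
        + 2 / b ^ 2 * ‖q t‖ ^ 2)) (Icc 0 T) := by
      intro r
      have h1 := ((continuousOn_const (c := (-(1 / 2) : ℝ))).mul
        ((continuousOn_truncate (b := b) r hwc).norm.pow 2)).integrableOn_Icc (μ := volume)
      have h2 := ((continuousOn_const (c := (2 / b ^ 2 : ℝ))).mul hqc).integrableOn_Icc (μ := volume)
      exact (((h1.add (hwi.const_mul 2)).add (hui.const_mul _)).add h2).const_mul b
    refine IntBound.of_tendsto (fun r => (hψb r).mono (hint r) (hfin r))
      (fun t _ => tendsto_crossTrunc (u t) (w t)) (B := fun t => b * (1 / 2 * ‖w t‖ ^ 2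
        + 2 * (dissip b (w t)).toReal + 2 / (m * b) ^ 2 * (dissip b (u t)).toReal
        + 2 / b ^ 2 * ‖q t‖ ^ 2)) ?_ (fun r => ?_) ?_
    · have h1 := ((continuousOn_const (c := (1 / 2 : ℝ))).mul (hwc.norm.pow 2)).integrableOn_Icc (μ := volume)
      have h2 := ((continuousOn_const (c := (2 / b ^ 2 : ℝ))).mul hqc).integrableOn_Icc (μ := volume)
      exact (((h1.add (hwi.const_mul 2)).add (hui.const_mul _)).add h2).const_mul b
    · refine .of_forall fun t _ => ?_
      have a1 : ‖truncate b r (w t)‖ ^ 2 ≤ ‖w t‖ ^ 2 := by gcongr; exact norm_truncate_le _ _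
      have a2 : 0 ≤ ‖truncate b r (w t)‖ ^ 2 := by positivity
      have a3 : 0 ≤ 2 * (dissip b (w t)).toReal := by positivity
      have a4 : 0 ≤ 2 / (m * b) ^ 2 * (dissip b (u t)).toReal := by positivity
      have a5 : 0 ≤ 2 / b ^ 2 * ‖q t‖ ^ 2 := by positivity
      rw [abs_mul, abs_of_pos hb0]
      gcongr b * ?_
      rw [abs_le]
      constructor <;> linarith
    · refine .of_forall fun t _ => ?_
      have h1 : Tendsto (fun r => ‖truncate b r (w t)‖ ^ 2) atTop (𝓝 (‖w t‖ ^ 2)) :=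
        (tendsto_truncate (w t)).norm.pow 2
      exact ((((h1.const_mul _).add_const _).add_const _).add_const _).const_mul b
  -- In the opposite direction only an integrable bound is needed, for absolute continuity, so crude
  -- estimates without dissipation suffice.
  · have hc : ContinuousOn (fun t => b * (4 * ‖w t‖ ^ 2
      + 2 / (m * b) ^ 2 * ‖u t‖ ^ 2 + 2 / b ^ 2 * ‖q t‖ ^ 2)) (Icc 0 T) :=
      continuousOn_const.mul (((continuousOn_const.mul (hwc.norm.pow 2)).add
        (continuousOn_const.mul (heq.cont.norm.pow 2))).add (continuousOn_const.mul hqc))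
    refine IntBound.of_tendsto (φ := fun r t => -crossTrunc b r (u t) (w t)) (fun r => ?_)
      (fun t _ => (tendsto_crossTrunc (u t) (w t)).neg) hc.integrableOn_Icc
      (ψ := fun _ t => b * (4 * ‖w t‖ ^ 2
      + 2 / (m * b) ^ 2 * ‖u t‖ ^ 2 + 2 / b ^ 2 * ‖q t‖ ^ 2))
      (fun r => .of_forall fun t _ => le_of_eq (abs_of_nonneg (by positivity)))
      (.of_forall fun t _ => tendsto_const_nhds)
    refine IntBound.of_hasDerivWithinAt hc fun t ht =>
      ⟨_, (heq.hasDerivWithinAt_crossTrunc hw r ht).fun_neg, ?_⟩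
    rw [← Finset.sum_neg_distrib]
    have h1 : ∀ k ∈ modeBox r, -(-b * ‖zetaOp r (coef b (k, 0) (w t))‖ ^ 2
            - b * Real.sqrt 2 * (inner ℂ (zetaOp r (coef b (k, 2) (w t))) (zetaOp r (coef b (k, 0) (w t)))).re
            + b * ‖zetaOp r (coef b (k, 1) (w t))‖ ^ 2
            - 1 / m * (inner ℂ (zetaOp r (coef b (k, 1) (u t))) (zetaOp r (coef b (k, 0) (w t)))).re
            + (inner ℂ (zetaOp r (coef b (k, 0) (q t))) (zetaOp r (coef b (k, 0) (w t)))).re)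
            ≤ b * (2 * ‖coef b (k, 0) (w t)‖ ^ 2
              + 2 * ‖coef b (k, 2) (w t)‖ ^ 2 + 2 / (m * b) ^ 2 * ‖coef b (k, 1) (u t)‖ ^ 2
              + 2 / b ^ 2 * ‖coef b (k, 0) (q t)‖ ^ 2) := by
      intro k _
      have a1 := hyoung r t k
      have a2 := norm_zetaOp_le r (coef b (k, 0) (w t))
      have a3 : b * ‖zetaOp r (coef b (k, 0) (w t))‖ ^ 2 ≤ b * ‖coef b (k, 0) (w t)‖ ^ 2 := by gcongr
      have a4 := le_abs_self (b * Real.sqrt 2 *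
        (inner ℂ (zetaOp r (coef b (k, 2) (w t))) (zetaOp r (coef b (k, 0) (w t)))).re)
      have a5 := le_abs_self (1 / m *
        (inner ℂ (zetaOp r (coef b (k, 1) (u t))) (zetaOp r (coef b (k, 0) (w t)))).re)
      have a6 := neg_abs_le (inner ℂ (zetaOp r (coef b (k, 0) (q t))) (zetaOp r (coef b (k, 0) (w t)))).re
      have a7 : 0 ≤ b * ‖zetaOp r (coef b (k, 1) (w t))‖ ^ 2 := by positivity
      have a8 : 0 ≤ b * ‖coef b (k, 0) (w t)‖ ^ 2 := by positivity
      linarith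
    refine (Finset.sum_le_sum h1).trans ?_
    rw [← Finset.mul_sum]
    simp only [Finset.sum_add_distrib, ← Finset.mul_sum]
    have h2 := hlayer r 0 (w t)
    have h3 := hlayer r 2 (w t)
    have h4 := hlayer r 1 (u t)
    have h5 := hlayer r 0 (q t)
    calc _ ≤ b * (2 * ‖w t‖ ^ 2 + 2 * ‖w t‖ ^ 2 + 2 / (m * b) ^ 2 * ‖u t‖ ^ 2 + 2 / b ^ 2 * ‖q t‖ ^ 2) := by
          gcongr
      _ = _ := by ring

end

end KuramotoSakaguchi
end

/-! ### Commuting derivatives with the equation. -/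

noncomputable section
namespace KuramotoSakaguchi
open Filter Topology

/-! ### Differentiated equations -/

/-- The commutator of ∂_ω = (a − a*)/(2b) with the equation, read off at index n. Transport yields
−∂_θ v, and [a, a*] = 1 yields q/(2b). From [a − a*, a*a] = (a − a*) + 2a* come the damping 1/m and
the term −(1/(mb)) a*v. The symbols s, s0, s1, s2 stand for the square roots of n − 1, n, n + 1, n +
2, and V0 to V4 for the modes n − 2 to n + 2. -/
lemma ladder_identity {M : Type*} [AddCommGroup M] [Module ℂ M] {k b m d n s0 s1 s2 s : ℂ} (hb : b ≠ 0)
    (hm : m ≠ 0) (h0 : s0 ^ 2 = n) (h1 : s1 ^ 2 = n + 1) (V0 V1 V2 V3 V4 N1 N3 P1 P3 Q0 Q2 : M) :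
    (1 / (2 * b)) • (s1 • (-((k * Complex.I * b) • (s2 • V4 + s1 • V2)) - ((n + 1) / m + d) • V3 + P3 + s1 • Q2
        - (k * Complex.I) • N3)
      - s0 • (-((k * Complex.I * b) • (s0 • V2 + s • V0)) - ((n - 1) / m + d) • V1 + P1 + s • Q0
        - (k * Complex.I) • N1))
    = (-((k * Complex.I * b) • (s1 • (1 / (2 * b)) • (s2 • V4 - s1 • V2)
          + s0 • (1 / (2 * b)) • (s0 • V2 - s • V0)))
        - (n / m + (d + 1 / m)) • (1 / (2 * b)) • (s1 • V3 - s0 • V1)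
        + ((1 / (2 * b)) • (s1 • P3 - s0 • P1) - (k * Complex.I) • V2 + (1 / (2 * b)) • Q2)
        + s0 • ((1 / (2 * b)) • (s0 • Q2 - s • Q0) - (1 / (m * b)) • V1))
      - (k * Complex.I) • (1 / (2 * b)) • (s1 • N3 - s0 • N1) := by
  subst h0
  match_scalars <;> field_simp <;> try ring1
  · linear_combination (-2 * k) * h1
  · linear_combination h1

section
variable {m κ b : ℝ} [hb : Fact (0 < b)] {g : ℝ → ℝ}

variable (b) in
/-- `w = ∂_θ v` in mode form. -/
def IsDTheta (w v : L2C) : Prop := ∀ k n, coef b (k, n) w = ((k : ℂ) * Complex.I) • coef b (k, n) v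

variable (b) in
/-- `w = ∂_ω v` in mode form. -/
def IsDOmega (w v : L2C) : Prop := ∀ k n, coef b (k, n) w = ((1 / (2 * b) : ℝ) : ℂ) •
  (((Real.sqrt (n + 1) : ℝ) : ℂ) • coef b (k, n + 1) v - ((Real.sqrt n : ℝ) : ℂ) • coef b (k, n - 1) v)

lemma IsDTheta.add {w w' v v' : L2C} (h : IsDTheta b w v) (h' : IsDTheta b w' v') :
    IsDTheta b (w + w') (v + v') := fun k n => by simp only [map_add, h k n, h' k n, smul_add]

lemma IsDOmega.add {w w' v v' : L2C} (h : IsDOmega b w v) (h' : IsDOmega b w' v') :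
    IsDOmega b (w + w') (v + v') := fun k n => by simp only [map_add, h k n, h' k n]; module

lemma IsDOmega.smul {w v : L2C} (h : IsDOmega b w v) (c : ℂ) : IsDOmega b (c • w) (c • v) := fun k n => by
  simp only [map_smul, h k n]; module

lemma IsDTheta.smul {w v : L2C} (h : IsDTheta b w v) (c : ℂ) : IsDTheta b (c • w) (c • v) := fun k n => by
  simp only [map_smul, h k n]; module

lemma isDTheta_zero : IsDTheta b 0 0 := fun k n => by simp

lemma isDOmega_zero : IsDOmega b 0 0 := fun k n => by simp

lemma IsDOmega.orderMul {w v : L2C} (h : IsDOmega b w v) (Z : ℂ) :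
    IsDOmega b (orderMul Z w) (orderMul Z v) := fun k n => by
  simp only [coef_orderMul, h (k + 1) n, h (k - 1) n]; module

/-- The Leibniz rule for multiplication by the mean field. -/
lemma IsDTheta.orderMul {w v : L2C} (h : IsDTheta b w v) (Z : ℂ) :
    IsDTheta b (orderMul (-Complex.I * Z) v + orderMul Z w) (orderMul Z v) := fun k n => by
  simp only [map_add, coef_orderMul, h (k + 1) n, h (k - 1) n, map_mul, map_neg, Complex.conj_I]
  push_cast
  have hI : Complex.I ^ 2 = -1 := Complex.I_sq
  match_scalars <;> field_simp <;> ring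

/-- In mode form ∂_θ is multiplication by ik, which commutes with every operator in the equation. -/
lemma ModeEq.theta {d T : ℝ} {v p q v' p' q' : ℝ → L2C} (heq : ModeEq m b d T v p q)
    (hv : ContinuousOn v' (Icc 0 T)) (hp : ContinuousOn p' (Icc 0 T)) (hq : ContinuousOn q' (Icc 0 T))
    (hv' : ∀ t ∈ Icc 0 T, IsDTheta b (v' t) (v t)) (hp' : ∀ t ∈ Icc 0 T, IsDTheta b (p' t) (p t))
    (hq' : ∀ t ∈ Icc 0 T, IsDTheta b (q' t) (q t)) : ModeEq m b d T v' p' q' where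
  cont := hv
  cont_p := hp
  cont_q := hq
  deriv R k n t ht := by
    have h1 := (heq.deriv R k n t ht).fun_const_smul ((k : ℂ) * Complex.I)
    have hc : ∀ τ ∈ Icc 0 T, zetaOp R (coef b (k, n) (v' τ))
        = ((k : ℂ) * Complex.I) • zetaOp R (coef b (k, n) (v τ)) := fun τ hτ => by
      rw [hv' τ hτ k n, map_smul]
    refine (h1.congr hc (hc t ht)).congr_deriv ?_
    simp only [velCoef, hv' t ht k, hp' t ht k, hq' t ht k, map_add, map_sub, map_neg, map_smul]
    module

/-- Each velocity derivative raises the damping by 1/m. The new sources are −∂_θ v, q/(2b) and,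
under a*, −v/(mb); none has more velocity derivatives than the equation started from. -/
lemma ModeEq.omega {d T : ℝ} {v p q v' p' q' vθ : ℝ → L2C} (heq : ModeEq m b d T v p q) (hm : 0 < m)
    (hv : ContinuousOn v' (Icc 0 T)) (hp : ContinuousOn p' (Icc 0 T)) (hq : ContinuousOn q' (Icc 0 T))
    (hθ : ContinuousOn vθ (Icc 0 T))
    (hv' : ∀ t ∈ Icc 0 T, IsDOmega b (v' t) (v t)) (hp' : ∀ t ∈ Icc 0 T, IsDOmega b (p' t) (p t))
    (hq' : ∀ t ∈ Icc 0 T, IsDOmega b (q' t) (q t)) (hθ' : ∀ t ∈ Icc 0 T, IsDTheta b (vθ t) (v t)) :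
    ModeEq m b (d + 1 / m) T v' (fun t => p' t - vθ t + ((1 / (2 * b) : ℝ) : ℂ) • q t)
      (fun t => q' t - ((1 / (m * b) : ℝ) : ℂ) • v t) where
  cont := hv
  cont_p := (hp.fun_sub hθ).fun_add (heq.cont_q.fun_const_smul _)
  cont_q := hq.fun_sub (heq.cont.fun_const_smul _)
  deriv R k n t ht := by
    have hb0 := hb.out
    have hbC : (b : ℂ) ≠ 0 := by exact_mod_cast hb0.ne'
    have hmC : (m : ℂ) ≠ 0 := by exact_mod_cast hm.ne'
    have h1 := (((heq.deriv R k (n + 1) t ht).fun_const_smul ((Real.sqrt (n + 1) : ℝ) : ℂ)).fun_sub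
      ((heq.deriv R k (n - 1) t ht).fun_const_smul ((Real.sqrt n : ℝ) : ℂ))).fun_const_smul
        ((1 / (2 * b) : ℝ) : ℂ)
    have hc : ∀ τ ∈ Icc 0 T, zetaOp R (coef b (k, n) (v' τ)) = ((1 / (2 * b) : ℝ) : ℂ) •
        (((Real.sqrt (n + 1) : ℝ) : ℂ) • zetaOp R (coef b (k, n + 1) (v τ))
          - ((Real.sqrt n : ℝ) : ℂ) • zetaOp R (coef b (k, n - 1) (v τ))) := fun τ hτ => by
      rw [hv' τ hτ k n, map_smul, map_sub, map_smul, map_smul]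
    refine (h1.congr hc (hc t ht)).congr_deriv ?_
    have hs : ∀ j : ℕ, ((Real.sqrt j : ℝ) : ℂ) ^ 2 = j := fun j => by
      rw [← Complex.ofReal_pow, Real.sq_sqrt (by positivity)]; simp
    have hs' : ∀ j : ℕ, ((Real.sqrt (j + 1) : ℝ) : ℂ) ^ 2 = j + 1 := fun j => by
      have := hs (j + 1); push_cast at this; exact this
    simp only [velCoef, hv' t ht k, hp' t ht k, hq' t ht k, hθ' t ht k, map_add, map_sub, map_neg, map_smul,
      Nat.add_sub_cancel]
    -- For n = 0 the truncated index n − 1 is not a genuine mode; the identity is applied with s0 =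
    -- s = 0 instead.
    rcases n with _ | n
    · have key := ladder_identity (M := FreqL2) (k := (k : ℂ)) (b := b) (m := m) (d := d) (n := 0) (s0 := 0)
        (s1 := 1) (s2 := ((Real.sqrt 2 : ℝ) : ℂ)) (s := 0) hbC hmC (by simp) (by simp) 0 0
        (zetaOp R (coef b (k, 0) (v t))) (zetaOp R (coef b (k, 1) (v t)))
        (zetaOp R (coef b (k, 2) (v t))) 0 (nuOp R (coef b (k, 1) (v t))) 0
        (zetaOp R (coef b (k, 1) (p t))) 0 (zetaOp R (coef b (k, 0) (q t)))
      have e2 : (1 : ℝ) + 1 = 2 := by norm_num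
      simp only [Nat.cast_zero, Real.sqrt_zero, Complex.ofReal_zero, zero_smul, zero_add, Nat.cast_one,
        Real.sqrt_one, Complex.ofReal_one, one_smul, sub_zero, smul_zero, add_zero, e2] at key ⊢
      push_cast
      simp only [zero_div, zero_add] at key ⊢
      convert key using 2
    · have key := ladder_identity (M := FreqL2) (k := (k : ℂ)) (b := b) (m := m) (d := d) (n := n + 1)
        (s0 := ((Real.sqrt (n + 1) : ℝ) : ℂ)) (s1 := ((Real.sqrt (n + 1 + 1) : ℝ) : ℂ))
        (s2 := ((Real.sqrt (n + 1 + 1 + 1) : ℝ) : ℂ)) (s := ((Real.sqrt n : ℝ) : ℂ)) hbC hmC (hs' n)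
        (by have := hs' (n + 1); push_cast at this; exact this)
        (zetaOp R (coef b (k, n - 1) (v t))) (zetaOp R (coef b (k, n) (v t)))
        (zetaOp R (coef b (k, n + 1) (v t))) (zetaOp R (coef b (k, n + 2) (v t)))
        (zetaOp R (coef b (k, n + 3) (v t))) (nuOp R (coef b (k, n) (v t)))
        (nuOp R (coef b (k, n + 2) (v t))) (zetaOp R (coef b (k, n) (p t)))
        (zetaOp R (coef b (k, n + 2) (p t))) (zetaOp R (coef b (k, n - 1) (q t)))
        (zetaOp R (coef b (k, n + 1) (q t)))
      simp only [Nat.add_sub_cancel]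
      push_cast at key ⊢
      convert key using 2
      congr 1
      simp only [add_sub_cancel_right]

end

end KuramotoSakaguchi
end

/-! ### Derivatives of the forcing, and the equations for all derivatives of a solution. -/

noncomputable section
namespace KuramotoSakaguchi
open Filter Topology

/-! ### Derivatives of the mean-field product -/

/-- `∂_θ^i (S h)`, where `S` is the mean field of order parameter `Z` and `h l = ∂_θ^l h`. -/
def meanField : ℕ → ℂ → (ℕ → L2C) → L2C
  | 0, Z, h => orderMul Z (h 0)
  | i + 1, Z, h => meanField i (-Complex.I * Z) h + meanField i Z fun l => h (l + 1)

/-- Differentiating the mean field replaces Z by −iZ, which has the same modulus; the factor 2^i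
counts the Leibniz terms. -/
lemma norm_meanField_le (i : ℕ) (Z : ℂ) (h : ℕ → L2C) :
    ‖meanField i Z h‖ ≤ 2 ^ i * ‖Z‖ * ∑ l ∈ Finset.range (i + 1), ‖h l‖ := by
  induction i generalizing Z h with
  | zero => simpa [meanField] using norm_orderMul_le Z (h 0)
  | succ i ih =>
    have h1 := ih (-Complex.I * Z) h
    have h2 := ih Z fun l => h (l + 1)
    rw [norm_mul, norm_neg, Complex.norm_I, one_mul] at h1
    have h3 : ∑ l ∈ Finset.range (i + 1), ‖h l‖ ≤ ∑ l ∈ Finset.range (i + 1 + 1), ‖h l‖ := by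
      rw [Finset.sum_range_succ _ (i + 1)]; linarith [norm_nonneg (h (i + 1))]
    have h4 : ∑ l ∈ Finset.range (i + 1), ‖h (l + 1)‖ ≤ ∑ l ∈ Finset.range (i + 1 + 1), ‖h l‖ := by
      rw [Finset.sum_range_succ' _ (i + 1)]; linarith [norm_nonneg (h 0)]
    have h5 : 0 ≤ 2 ^ i * ‖Z‖ := by positivity
    calc _ ≤ _ := norm_add_le _ _
      _ ≤ 2 ^ i * ‖Z‖ * ∑ l ∈ Finset.range (i + 1 + 1), ‖h l‖
          + 2 ^ i * ‖Z‖ * ∑ l ∈ Finset.range (i + 1 + 1), ‖h l‖ :=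
        add_le_add (h1.trans (mul_le_mul_of_nonneg_left h3 h5)) (h2.trans (mul_le_mul_of_nonneg_left h4 h5))
      _ = _ := by ring

lemma continuousOn_meanField (i : ℕ) {T : ℝ} {Z : ℝ → ℂ} {h : ℕ → ℝ → L2C} (hZ : ContinuousOn Z (Icc 0 T))
    (hh : ∀ l ≤ i, ContinuousOn (h l) (Icc 0 T)) :
    ContinuousOn (fun t => meanField i (Z t) fun l => h l t) (Icc 0 T) := by
  induction i generalizing Z h with
  | zero => exact orderMul_continuousOn hZ (hh 0 le_rfl)
  | succ i ih =>
    exact (ih (continuousOn_const.mul hZ) fun l hl => hh l (by omega)).fun_add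
      (ih (h := fun l => h (l + 1)) hZ fun l hl => hh (l + 1) (by omega))

/-- Coefficients of the derivatives of the Gaussian ground state. -/
def groundCoef : ℕ → ℕ → ℝ
  | 0, n => if n = 0 then 1 else 0
  | j + 1, n => Real.sqrt (n + 1) * groundCoef j (n + 1) - Real.sqrt n * groundCoef j (n - 1)

lemma groundCoef_eq_zero {j n : ℕ} (h : j < n) : groundCoef j n = 0 := by
  induction j generalizing n with
  | zero => simp [groundCoef, h.ne']
  | succ j ih => rw [groundCoef, ih (by omega), ih (by omega)]; ring

section
variable {m κ b : ℝ} [hb : Fact (0 < b)] {g : ℝ → ℝ}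

lemma isDTheta_meanField (i : ℕ) (Z : ℂ) {h : ℕ → L2C} (hh : ∀ l ≤ i, IsDTheta b (h (l + 1)) (h l)) :
    IsDTheta b (meanField (i + 1) Z h) (meanField i Z h) := by
  induction i generalizing Z h with
  | zero => exact (hh 0 le_rfl).orderMul Z
  | succ i ih =>
    exact (ih _ fun l hl => hh l (by omega)).add (ih _ fun l hl => hh (l + 1) (by omega))

lemma isDOmega_meanField (i : ℕ) (Z : ℂ) {h h' : ℕ → L2C} (hh : ∀ l ≤ i, IsDOmega b (h' l) (h l)) :
    IsDOmega b (meanField i Z h') (meanField i Z h) := by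
  induction i generalizing Z h h' with
  | zero => exact (hh 0 le_rfl).orderMul Z
  | succ i ih =>
    exact (ih _ fun l hl => hh l (by omega)).add (ih _ fun l hl => hh (l + 1) (by omega))

variable (b) in
/-- `∂_ω^j √M`. -/
def rootMDeriv (hg : IsFreqDensity g) (j : ℕ) : L2C := ∑ n ∈ Finset.range (j + 1),
  modeEmb b (0, n) ((((1 / (2 * b)) ^ j * groundCoef j n : ℝ) : ℂ) • rootG hg)

lemma rootMDeriv_zero (hg : IsFreqDensity g) : rootMDeriv b hg 0 = rootM b hg := by
  simp only [rootMDeriv, groundCoef, rootM, zero_add, Finset.sum_range_one, pow_zero, one_mul, if_true,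
    Complex.ofReal_one]
  exact congrArg _ (one_smul ℂ _)

lemma coef_rootMDeriv (hg : IsFreqDensity g) (j : ℕ) (k : ℤ) (n : ℕ) :
    coef b (k, n) (rootMDeriv b hg j)
      = if k = 0 then (((1 / (2 * b)) ^ j * groundCoef j n : ℝ) : ℂ) • rootG hg else 0 := by
  rw [rootMDeriv, map_sum]
  simp only [coef_modeEmb, Prod.mk.injEq]
  split_ifs with hk
  · simp only [hk, true_and]
    rw [Finset.sum_ite_eq]
    split_ifs with hn
    · rfl
    · rw [Finset.mem_range, not_lt] at hn
      rw [groundCoef_eq_zero (by omega)]; simp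
  · simp [hk]

lemma isDTheta_rootMDeriv (hg : IsFreqDensity g) (j : ℕ) : IsDTheta b 0 (rootMDeriv b hg j) := fun k n => by
  rw [coef_rootMDeriv, map_zero]; split_ifs with h <;> simp [h]

lemma isDOmega_rootMDeriv (hg : IsFreqDensity g) (j : ℕ) :
    IsDOmega b (rootMDeriv b hg (j + 1)) (rootMDeriv b hg j) := fun k n => by
  simp only [coef_rootMDeriv]
  split_ifs with h
  · rw [groundCoef]
    push_cast
    module
  · simp

/-- A bound for `‖∂_ω^j √M‖` when `b ≥ 1`. -/
def rootMBound (j : ℕ) : ℝ := ∑ n ∈ Finset.range (j + 1), |groundCoef j n|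

lemma rootMBound_nonneg (j : ℕ) : 0 ≤ rootMBound j := Finset.sum_nonneg fun _ _ => abs_nonneg _

/-- The condition b ≥ 1 bounds the powers of 1/(2b) by 1, making the estimate independent of the
parameters. -/
lemma norm_rootMDeriv_le (hg : IsFreqDensity g) (hb1 : 1 ≤ b) (j : ℕ) :
    ‖rootMDeriv b hg j‖ ≤ rootMBound j := by
  refine (norm_sum_le _ _).trans (Finset.sum_le_sum fun n _ => ?_)
  rw [LinearIsometry.norm_map, norm_smul, norm_rootG, mul_one, Complex.norm_real, norm_mul, norm_pow,
    Real.norm_eq_abs, Real.norm_eq_abs]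
  refine mul_le_of_le_one_left (abs_nonneg _) (pow_le_one₀ (abs_nonneg _) ?_)
  rw [abs_of_pos (by have := hb.out; positivity), div_le_one (by linarith)]
  linarith

/-! ### The equations for the derivatives of a solution -/

lemma ModeEq.congr {d T : ℝ} {v p q v' p' q' : ℝ → L2C} (heq : ModeEq m b d T v p q)
    (hv : ∀ t ∈ Icc 0 T, v' t = v t) (hp : ∀ t ∈ Icc 0 T, p' t = p t)
    (hq : ∀ t ∈ Icc 0 T, q' t = q t) : ModeEq m b d T v' p' q' where
  cont := heq.cont.congr hv
  cont_p := heq.cont_p.congr hp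
  cont_q := heq.cont_q.congr hq
  deriv R k n t ht := by
    rw [hv t ht, hp t ht, hq t ht]
    exact (heq.deriv R k n t ht).congr (fun τ hτ => by rw [hv τ hτ]) (by rw [hv t ht])

/-- Source terms with index j − 1 or j − 2 are not correct derivatives when the subtraction
truncates, but then their coefficient is zero. This lemma restricts the check to the remaining
cases. -/
lemma IsDOmega.smul_of_ne {w v : L2C} {c : ℂ} (h : c ≠ 0 → IsDOmega b w v) : IsDOmega b (c • w) (c • v) := by
  rcases eq_or_ne c 0 with h0 | h0
  · rw [h0, zero_smul, zero_smul]; exact isDOmega_zero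
  · exact (h h0).smul c

variable (b) in
/-- `∂_θ^l ∂_ω^j (u + √M)`. -/
def densityDeriv (hg : IsFreqDensity g) (u : L2) (l j : ℕ) : L2C :=
  toC (weakDeriv l j u) + if l = 0 then rootMDeriv b hg j else 0

variable (m κ b) in
/-- `∂_θ^i ∂_ω^j` of the forcing field. -/
def forcingDeriv (hg : IsFreqDensity g) (u : L2) (i j : ℕ) : L2C :=
  ((κ / (m * b) : ℝ) : ℂ) • meanField i (orderZ b hg (toC u)) fun l => densityDeriv b hg u l j

variable (m κ b) in
/-- The zeroth-order source in the equation for `∂_θ^i ∂_ω^j u`. -/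
def sourceP (hg : IsFreqDensity g) (u : L2) (i j : ℕ) : L2C :=
  ((-j : ℝ) : ℂ) • toC (weakDeriv (i + 1) (j - 1) u)
    + ((-(j * (j - 1) / (4 * m * b ^ 2)) : ℝ) : ℂ) • toC (weakDeriv i (j - 2) u)
    + ((j / (2 * b) : ℝ) : ℂ) • forcingDeriv m κ b hg u i (j - 1)

variable (m κ b) in
/-- The source under the creation operator in the equation for `∂_θ^i ∂_ω^j u`. -/
def sourceQ (hg : IsFreqDensity g) (u : L2) (i j : ℕ) : L2C :=
  forcingDeriv m κ b hg u i j + ((-(j / (m * b)) : ℝ) : ℂ) • toC (weakDeriv i (j - 1) u)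

lemma MemH.isDTheta {s i j : ℕ} {u : L2} (h : MemH s u) (hij : i + 1 + j ≤ s) :
    IsDTheta b (toC (weakDeriv (i + 1) j u)) (toC (weakDeriv i j u)) := fun k n =>
  (h.isWeakDeriv (by omega)).coef_theta (h.isWeakDeriv hij) k n

lemma MemH.isDOmega {s i j : ℕ} {u : L2} (h : MemH s u) (hij : i + (j + 1) ≤ s) :
    IsDOmega b (toC (weakDeriv i (j + 1) u)) (toC (weakDeriv i j u)) := fun k n =>
  (h.isWeakDeriv (by omega)).coef_omega (h.isWeakDeriv hij) k n

lemma MemH.isDTheta_densityDeriv (hg : IsFreqDensity g) {s i j : ℕ} {u : L2} (h : MemH s u)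
    (hij : i + 1 + j ≤ s) : IsDTheta b (densityDeriv b hg u (i + 1) j) (densityDeriv b hg u i j) := by
  refine (h.isDTheta hij).add ?_
  rw [if_neg (Nat.succ_ne_zero i)]
  split_ifs
  · exact isDTheta_rootMDeriv hg j
  · exact isDTheta_zero

lemma MemH.isDOmega_densityDeriv (hg : IsFreqDensity g) {s i j : ℕ} {u : L2} (h : MemH s u)
    (hij : i + (j + 1) ≤ s) : IsDOmega b (densityDeriv b hg u i (j + 1)) (densityDeriv b hg u i j) := by
  refine (h.isDOmega hij).add ?_
  split_ifs
  · exact isDOmega_rootMDeriv hg j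
  · exact isDOmega_zero

lemma MemH.isDTheta_forcingDeriv (hg : IsFreqDensity g) {s i j : ℕ} {u : L2} (h : MemH s u)
    (hij : i + 1 + j ≤ s) :
    IsDTheta b (forcingDeriv m κ b hg u (i + 1) j) (forcingDeriv m κ b hg u i j) := by
  unfold forcingDeriv
  have h1 := isDTheta_meanField (b := b) i (orderZ b hg (toC u)) (h := fun l => densityDeriv b hg u l j)
    fun l hl => h.isDTheta_densityDeriv hg (by omega)
  exact h1.smul _

lemma MemH.isDOmega_forcingDeriv (hg : IsFreqDensity g) {s i j : ℕ} {u : L2} (h : MemH s u)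
    (hij : i + (j + 1) ≤ s) :
    IsDOmega b (forcingDeriv m κ b hg u i (j + 1)) (forcingDeriv m κ b hg u i j) := by
  unfold forcingDeriv
  have h1 := isDOmega_meanField (b := b) i (orderZ b hg (toC u)) (h := fun l => densityDeriv b hg u l j)
    (h' := fun l => densityDeriv b hg u l (j + 1)) fun l hl => h.isDOmega_densityDeriv hg (by omega)
  exact h1.smul _

lemma ContInH.continuousOn_forcingDeriv (hg : IsFreqDensity g) {s i j : ℕ} {T : ℝ} {f : ℝ → L2}
    (hf : ContInH s T f) (hij : i + j ≤ s) :
    ContinuousOn (fun t => forcingDeriv m κ b hg (f t) i j) (Icc 0 T) := by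
  refine (continuousOn_meanField i ((continuous_orderZ hg).comp_continuousOn hf.continuousOn_toC_self)
    (h := fun l t => densityDeriv b hg (f t) l j) fun l hl => ?_).fun_const_smul _
  exact (hf.continuousOn_toC (by omega)).fun_add continuousOn_const

/-- The equations for the derivatives of a solution. -/
theorem modeEq_deriv (hm : 0 < m) (hg : IsFreqDensity g) {s : ℕ} (hs : 1 ≤ s) {T : ℝ}
    {f : ℝ → L2} (hf : ContInH s T f) (heq : SolvesEq m κ (m * b ^ 2) g T f) (i j : ℕ) (hij : i + j ≤ s) :
    ModeEq m b (j / m) T (fun t => toC (weakDeriv i j (f t))) (fun t => sourceP m κ b hg (f t) i j)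
      fun t => sourceQ m κ b hg (f t) i j := by
  induction j generalizing i with
  | zero =>
    -- Pure phase derivatives come first, by induction on i: they produce no commutators, hence
    -- neither damping nor a source p.
    have h0 : ModeEq m b 0 T (fun t => toC (weakDeriv i 0 (f t))) (fun _ => 0)
        fun t => forcingDeriv m κ b hg (f t) i 0 := by
      induction i with
      | zero =>
        refine (modeEq_perturbation hm hg hs hf heq).congr (fun t ht => ?_) (fun _ _ => rfl) fun t ht => ?_
        · rw [(hf.1 t ht).weakDeriv_zero]
        · simp only [forcingDeriv, meanField, densityDeriv, (hf.1 t ht).weakDeriv_zero, forcing, if_true,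
            rootMDeriv_zero]
      | succ i ih =>
        exact (ih (by omega)).theta (hf.continuousOn_toC hij) continuousOn_const
          (hf.continuousOn_forcingDeriv hg hij) (fun t ht => (hf.1 t ht).isDTheta (by omega))
          (fun _ _ => isDTheta_zero) (fun t ht => (hf.1 t ht).isDTheta_forcingDeriv hg (by omega))
    rw [Nat.cast_zero, zero_div]
    refine h0.congr (fun _ _ => rfl) (fun t _ => ?_) (fun t _ => ?_)
    · simp [sourceP]
    · simp [sourceQ]
  | succ j ih =>
    have hb0 := hb.out
    have h1 := (ih i (by omega)).omega hm (v' := fun t => toC (weakDeriv i (j + 1) (f t)))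
      (vθ := fun t => toC (weakDeriv (i + 1) j (f t)))
      (p' := fun t => ((-j : ℝ) : ℂ) • toC (weakDeriv (i + 1) j (f t))
        + ((-(j * (j - 1) / (4 * m * b ^ 2)) : ℝ) : ℂ) • toC (weakDeriv i (j - 1) (f t))
        + ((j / (2 * b) : ℝ) : ℂ) • forcingDeriv m κ b hg (f t) i j)
      (q' := fun t => forcingDeriv m κ b hg (f t) i (j + 1)
        + ((-(j / (m * b)) : ℝ) : ℂ) • toC (weakDeriv i j (f t)))
      (hf.continuousOn_toC hij)
      ((((hf.continuousOn_toC (by omega)).fun_const_smul _).fun_add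
        ((hf.continuousOn_toC (by omega)).fun_const_smul _)).fun_add
        ((hf.continuousOn_forcingDeriv hg (by omega)).fun_const_smul _))
      ((hf.continuousOn_forcingDeriv hg (by omega)).fun_add
        ((hf.continuousOn_toC (by omega)).fun_const_smul _))
      (hf.continuousOn_toC (by omega))
      (fun t ht => (hf.1 t ht).isDOmega (by omega))
      (fun t ht => by
        refine ((IsDOmega.smul_of_ne fun hc => ?_).add (IsDOmega.smul_of_ne fun hc => ?_)).add
          (IsDOmega.smul_of_ne fun hc => ?_)
        · rcases j with _ | j
          · simp at hc
          · exact (hf.1 t ht).isDOmega (by omega)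
        · rcases j with _ | _ | j
          · simp at hc
          · simp at hc
          · exact (hf.1 t ht).isDOmega (j := j) (by omega)
        · rcases j with _ | j
          · simp at hc
          · exact (hf.1 t ht).isDOmega_forcingDeriv hg (by omega))
      (fun t ht => by
        refine ((hf.1 t ht).isDOmega_forcingDeriv hg (by omega)).add (IsDOmega.smul_of_ne fun hc => ?_)
        rcases j with _ | j
        · simp at hc
        · exact (hf.1 t ht).isDOmega (by omega))
      (fun t ht => (hf.1 t ht).isDTheta (by omega))
    have hd : ((j + 1 : ℕ) : ℝ) / m = j / m + 1 / m := by push_cast; ring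
    rw [hd]
    have hbC : (b : ℂ) ≠ 0 := by exact_mod_cast hb0.ne'
    have hmC : (m : ℂ) ≠ 0 := by exact_mod_cast hm.ne'
    -- The sources add up by j + 1 copies of each first-order commutator and, for the term with two
    -- velocity derivatives fewer, by j(j − 1)/4 + j/2 = (j + 1)j/4.
    refine h1.congr (fun _ _ => rfl) (fun t _ => ?_) (fun t _ => ?_)
    · simp only [sourceP, sourceQ, Nat.add_sub_cancel, show j + 1 - 2 = j - 1 by omega]
      push_cast
      match_scalars <;> field_simp <;> ring
    · simp only [sourceQ, Nat.add_sub_cancel]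
      push_cast
      match_scalars <;> field_simp <;> ring

end

end KuramotoSakaguchi
end

/-! ### Absolute continuity, differential inequality and decay from integrated bounds. -/

noncomputable section
namespace KuramotoSakaguchi
open Filter Topology

/-! ### Consequences of integrated differential inequalities -/

section
variable {T : ℝ} {E ψ ψ' : ℝ → ℝ}

/-- Bounds for E and for −E control each increment of E by that of the primitive of |ψ| + |ψ'|,
which is absolutely continuous. -/
lemma IntBound.absolutelyContinuous (hT : 0 ≤ T) (h : IntBound T E ψ) (h' : IntBound T (fun t => -E t) ψ') :
    AbsolutelyContinuousOnInterval E 0 T := by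
  set Θ : ℝ → ℝ := fun t => |ψ t| + |ψ' t| with hΘ
  have hΘi : IntegrableOn Θ (Icc 0 T) := h.integrableOn.abs.add h'.integrableOn.abs
  have hΘt : IntervalIntegrable Θ volume 0 T :=
    IntegrableOn.intervalIntegrable_of_Icc hΘi le_rfl hT le_rfl
  set G : ℝ → ℝ := fun x => ∫ τ in (0 : ℝ)..x, Θ τ with hG
  have hGac : AbsolutelyContinuousOnInterval G 0 T :=
    hΘt.absolutelyContinuousOnInterval_intervalIntegral (by simp)
  have key : ∀ x ∈ Icc 0 T, ∀ y ∈ Icc 0 T, x ≤ y → dist (E x) (E y) ≤ dist (G x) (G y) := by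
    intro x hx y hy hxy
    have i1 := IntegrableOn.intervalIntegrable_of_Icc hΘi hx.1 hxy hy.2
    have i0 := IntegrableOn.intervalIntegrable_of_Icc hΘi le_rfl hx.1 hx.2
    have e : G y - G x = ∫ τ in x..y, Θ τ := by
      simp only [hG]
      rw [← intervalIntegral.integral_add_adjacent_intervals i0 i1]; ring
    have a1 := h.le x y hx.1 hxy hy.2
    have a2 := h'.le x y hx.1 hxy hy.2
    have b1 : ∫ τ in x..y, ψ τ ≤ ∫ τ in x..y, Θ τ :=
      intervalIntegral.integral_mono_on hxy
        (IntegrableOn.intervalIntegrable_of_Icc h.integrableOn hx.1 hxy hy.2) i1 fun t _ => by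
          have := le_abs_self (ψ t)
          have := abs_nonneg (ψ' t)
          simp only [hΘ]; linarith
    have b2 : ∫ τ in x..y, ψ' τ ≤ ∫ τ in x..y, Θ τ :=
      intervalIntegral.integral_mono_on hxy
        (IntegrableOn.intervalIntegrable_of_Icc h'.integrableOn hx.1 hxy hy.2) i1 fun t _ => by
          have := le_abs_self (ψ' t)
          have := abs_nonneg (ψ t)
          simp only [hΘ]; linarith
    rw [dist_comm, dist_comm (G x), Real.dist_eq, Real.dist_eq]
    refine le_trans ?_ (le_abs_self _)
    rw [e, abs_le]
    constructor <;> linarith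
  have key' : ∀ x ∈ Icc 0 T, ∀ y ∈ Icc 0 T, dist (E x) (E y) ≤ dist (G x) (G y) := by
    intro x hx y hy
    rcases le_total x y with hxy | hxy
    · exact key x hx y hy hxy
    · rw [dist_comm, dist_comm (G x)]; exact key y hy x hx hxy
  refine squeeze_zero' (.of_forall fun _ => Finset.sum_nonneg fun _ _ => dist_nonneg) ?_ hGac
  have hmem : ∀ᶠ I in AbsolutelyContinuousOnInterval.totalLengthFilter ⊓
      𝓟 (AbsolutelyContinuousOnInterval.disjWithin 0 T),
      I ∈ AbsolutelyContinuousOnInterval.disjWithin 0 T := eventually_inf_principal.2 (.of_forall fun _ h => h)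
  filter_upwards [hmem] with I hI
  refine Finset.sum_le_sum fun i hi => ?_
  have := hI.1 i hi
  rw [uIcc_of_le hT] at this
  exact key' _ this.1 _ this.2

/-- The hypothesis says that E + λ∫E is nonincreasing, so its derivative is nonpositive wherever E
is differentiable. -/
lemma IntBound.ae_deriv_le {lam : ℝ} (hc : ContinuousOn E (Icc 0 T))
    (h : IntBound T E fun t => -lam * E t) {t : ℝ} (ht : t ∈ Ioo 0 T) (hd : DifferentiableAt ℝ E t) :
    deriv E t + lam * E t ≤ 0 := by
  have hT : 0 ≤ T := ht.1.le.trans ht.2.le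
  set Φ : ℝ → ℝ := fun x => E x + lam * ∫ τ in (0 : ℝ)..x, E τ with hΦ
  have hci : IntegrableOn E (Icc 0 T) := hc.integrableOn_Icc
  have hanti : AntitoneOn Φ (Icc 0 T) := by
    intro x hx y hy hxy
    have h1 := h.le x y hx.1 hxy hy.2
    rw [intervalIntegral.integral_const_mul] at h1
    have h2 := intervalIntegral.integral_add_adjacent_intervals
      (IntegrableOn.intervalIntegrable_of_Icc hci le_rfl hx.1 hx.2)
      (IntegrableOn.intervalIntegrable_of_Icc hci hx.1 hxy hy.2)
    simp only [hΦ]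
    rw [← h2]
    linarith
  have hJ := hasDerivWithinAt_Icc_of_eq_integral (Φ := fun x => ∫ τ in (0 : ℝ)..x, E τ) hc
    (fun t _ => by simp) t (Ioo_subset_Icc_self ht)
  have hdΦ : HasDerivWithinAt Φ (deriv E t + lam * E t) (Icc 0 T) t :=
    hd.hasDerivAt.hasDerivWithinAt.fun_add (hJ.const_mul lam)
  rw [← hdΦ.derivWithin (uniqueDiffOn_Icc (ht.1.trans ht.2) t (Ioo_subset_Icc_self ht))]
  exact hanti.derivWithin_nonpos

/-- The integrated bound controls the right difference quotients of E by those of −λ∫E, and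
Grönwall's inequality with rate −λ applies. -/
lemma IntBound.exp_decay {lam : ℝ} (hc : ContinuousOn E (Icc 0 T))
    (h : IntBound T E fun t => -lam * E t) {t : ℝ} (ht : t ∈ Icc 0 T) :
    E t ≤ E 0 * Real.exp (-lam * t) := by
  have hg := le_gronwallBound_of_liminf_deriv_right_le (f := E) (f' := fun t => -lam * E t) (δ := E 0)
    (K := -lam) (ε := 0) hc (fun x hx r hr => ?_) le_rfl (fun x _ => by simp) t ht
  · rwa [gronwallBound_ε0, sub_zero] at hg
  · have hx' : x ∈ Icc 0 T := ⟨hx.1, hx.2.le⟩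
    have hci : IntegrableOn E (Icc 0 T) := hc.integrableOn_Icc
    have hJ : HasDerivWithinAt (fun x => ∫ τ in (0 : ℝ)..x, E τ) (E x) (Icc 0 T) x :=
      hasDerivWithinAt_Icc_of_eq_integral (Φ := fun x => ∫ τ in (0 : ℝ)..x, E τ) hc (fun t _ => by simp) x hx'
    have h1 := ((hJ.const_mul (-lam)).mono (Icc_subset_Icc_left hx.1)).mono
      (Ioc_subset_Icc_self (a := x) (b := T))
    rw [hasDerivWithinAt_iff_tendsto_slope' (by simp)] at h1
    have h2 := (nhdsWithin_Ioc_eq_nhdsGT hx.2) ▸ h1.eventually (eventually_lt_nhds hr)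
    have h3 : ∀ᶠ z in 𝓝[>] x, z ∈ Ioc x T := Ioc_mem_nhdsGT hx.2
    refine (h2.and h3).frequently.mono fun z hz => ?_
    refine lt_of_le_of_lt ?_ hz.1
    rw [slope_def_field, div_eq_inv_mul]
    have hz0 : 0 ≤ (z - x)⁻¹ := inv_nonneg.2 (sub_nonneg.2 hz.2.1.le)
    refine mul_le_mul_of_nonneg_left ?_ hz0
    have h4 := h.le x z hx.1 hz.2.1.le hz.2.2
    rw [intervalIntegral.integral_const_mul] at h4
    have h5 := intervalIntegral.integral_add_adjacent_intervals
      (IntegrableOn.intervalIntegrable_of_Icc hci le_rfl hx.1 hx.2.le)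
      (IntegrableOn.intervalIntegrable_of_Icc hci hx.1 hz.2.1.le hz.2.2)
    rw [← h5]
    linarith

end

end KuramotoSakaguchi
end

/-! ### Bounds on the sources by lower levels. -/

noncomputable section
namespace KuramotoSakaguchi
open Filter Topology

/-! ### Bounds on the sources -/

/-- The part of `‖u‖_{H^s}²` with `j` derivatives in velocity. -/
def levelSq (s j : ℕ) (u : L2) : ℝ := ∑ i ∈ Finset.range (s + 1 - j), ‖weakDeriv i j u‖ ^ 2

lemma levelSq_nonneg (s j : ℕ) (u : L2) : 0 ≤ levelSq s j u := Finset.sum_nonneg fun _ _ => by positivity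

lemma hNormSq_eq_sum_levelSq (s : ℕ) (u : L2) :
    hNormSq s u = ∑ j ∈ Finset.range (s + 1), levelSq s j u := by
  unfold hNormSq levelSq
  refine Finset.sum_comm' fun i j => ?_
  simp only [Finset.mem_range]
  omega

lemma norm_sq_le_levelSq {s i j : ℕ} (hij : i + j ≤ s) (u : L2) : ‖weakDeriv i j u‖ ^ 2 ≤ levelSq s j u :=
  Finset.single_le_sum (f := fun i => ‖weakDeriv i j u‖ ^ 2) (fun _ _ => by positivity)
    (Finset.mem_range.2 (by omega))

lemma ContInH.continuousOn_norm_sq {s i j : ℕ} {T : ℝ} {f : ℝ → L2} (hf : ContInH s T f) (hij : i + j ≤ s) :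
    ContinuousOn (fun t => ‖weakDeriv i j (f t)‖ ^ 2) (Icc 0 T) := (hf.2 i j hij).norm.pow 2

lemma ContInH.continuousOn_levelSq {s j : ℕ} {T : ℝ} {f : ℝ → L2} (hf : ContInH s T f) :
    ContinuousOn (fun t => levelSq s j (f t)) (Icc 0 T) :=
  continuousOn_finsetSum _ fun i hi => hf.continuousOn_norm_sq (by rw [Finset.mem_range] at hi; omega)

/-- The constant in the bound for the forcing. -/
def forcingConst (s : ℕ) : ℝ := 2 * 4 ^ s * (s + 1 + ∑ j ∈ Finset.range (s + 1), rootMBound j ^ 2)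

lemma one_le_forcingConst (s : ℕ) : 1 ≤ forcingConst s := by
  have h1 : (0 : ℝ) ≤ ∑ j ∈ Finset.range (s + 1), rootMBound j ^ 2 := Finset.sum_nonneg fun _ _ => by positivity
  have h2 : (1 : ℝ) ≤ 4 ^ s := one_le_pow₀ (by norm_num)
  have h3 : (0 : ℝ) ≤ s := by positivity
  unfold forcingConst
  nlinarith

/-- Collects the source estimates with constants free of b, using b ≥ 1 and j ≤ s. L stands for the
sum of the lower levels; S will be (κ/b)² times the level in question, the only contribution that is
not of lower order. -/
lemma source_arith {m b : ℝ} (hm : 0 < m) (hb1 : 1 ≤ b) {s j C L S P Q v₁ v₂ v₃ F₁ F₂ : ℝ} (hj : 1 ≤ j)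
    (hjs : j ≤ s) (hP0 : 0 ≤ P) (hQ0 : 0 ≤ Q) (v1 : v₁ ^ 2 ≤ L) (v2 : v₂ ^ 2 ≤ L) (v3 : v₃ ^ 2 ≤ L)
    (f1 : F₁ ^ 2 ≤ 1 / m ^ 2 * (C * (2 * L))) (f2 : F₂ ^ 2 ≤ 1 / m ^ 2 * (C * (S + L)))
    (hP : P ≤ j * v₁ + j * (j - 1) / (4 * m * b ^ 2) * v₂ + j / (2 * b) * F₁)
    (hQ : Q ≤ F₂ + j / (m * b) * v₃) :
    m * P ^ 2 + m * Q ^ 2 ≤ 1 / m * ((3 * (s ^ 2 * m ^ 2 + s ^ 4 + s ^ 2 * C) + 2 * C + 2 * s ^ 2) * L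
      + 2 * (C * S)) := by
  have hb0 : 0 < b := by linarith
  have hs0 : 0 ≤ s := by linarith
  have hL0 : 0 ≤ L := (sq_nonneg _).trans v1
  have hj0 : 0 ≤ j - 1 := by linarith
  have c1 : j ^ 2 ≤ s ^ 2 := by gcongr
  have c2 : (j * (j - 1) / (4 * m * b ^ 2)) ^ 2 ≤ s ^ 4 / m ^ 2 := by
    have : j * (j - 1) / (4 * m * b ^ 2) ≤ s ^ 2 / m := by
      have e1 : j * (j - 1) ≤ s ^ 2 := by nlinarith
      have e2 : m ≤ 4 * m * b ^ 2 := by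
        have : 1 ≤ b ^ 2 := one_le_pow₀ hb1
        nlinarith
      exact div_le_div₀ (by positivity) e1 hm e2
    calc _ ≤ (s ^ 2 / m) ^ 2 := by gcongr
      _ = _ := by rw [div_pow]; ring
  have c3 : (j / (2 * b)) ^ 2 ≤ s ^ 2 / 2 := by
    have : j / (2 * b) ≤ s / 2 := div_le_div₀ hs0 hjs (by norm_num) (by linarith)
    calc _ ≤ (s / 2) ^ 2 := by gcongr
      _ = s ^ 2 / 4 := by ring
      _ ≤ _ := by linarith [sq_nonneg s]
  have c4 : (j / (m * b)) ^ 2 ≤ s ^ 2 / m ^ 2 := by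
    have : j / (m * b) ≤ s / m := div_le_div₀ hs0 hjs hm (le_mul_of_one_le_right hm.le hb1)
    calc _ ≤ (s / m) ^ 2 := by gcongr
      _ = _ := by rw [div_pow]
  have hP2 : P ^ 2 ≤ 3 * (s ^ 2 * L + s ^ 4 / m ^ 2 * L + s ^ 2 / 2 * (1 / m ^ 2 * (C * (2 * L)))) := by
    have a1 : ∀ x y z : ℝ, (x + y + z) ^ 2 ≤ 3 * (x ^ 2 + y ^ 2 + z ^ 2) := fun x y z => by
      nlinarith [sq_nonneg (x - y), sq_nonneg (y - z), sq_nonneg (x - z)]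
    refine le_trans (pow_le_pow_left₀ hP0 hP 2) ((a1 _ _ _).trans ?_)
    rw [mul_pow, mul_pow, mul_pow]
    refine mul_le_mul_of_nonneg_left (add_le_add (add_le_add ?_ ?_) ?_) (by norm_num)
    · exact mul_le_mul c1 v1 (sq_nonneg _) (sq_nonneg _)
    · exact mul_le_mul c2 v2 (sq_nonneg _) (by positivity)
    · exact mul_le_mul c3 f1 (sq_nonneg _) (by positivity)
  have hQ2 : Q ^ 2 ≤ 2 * (1 / m ^ 2 * (C * (S + L)) + s ^ 2 / m ^ 2 * L) := by
    have a1 : ∀ x y : ℝ, (x + y) ^ 2 ≤ 2 * (x ^ 2 + y ^ 2) := fun x y => by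
      nlinarith [sq_nonneg (x - y)]
    refine le_trans (pow_le_pow_left₀ hQ0 hQ 2) ((a1 _ _).trans ?_)
    rw [mul_pow]
    refine mul_le_mul_of_nonneg_left (add_le_add f2 ?_) (by norm_num)
    exact mul_le_mul c4 v3 (sq_nonneg _) (by positivity)
  calc _ ≤ m * (3 * (s ^ 2 * L + s ^ 4 / m ^ 2 * L + s ^ 2 / 2 * (1 / m ^ 2 * (C * (2 * L)))))
        + m * (2 * (1 / m ^ 2 * (C * (S + L)) + s ^ 2 / m ^ 2 * L)) :=
        add_le_add (mul_le_mul_of_nonneg_left hP2 hm.le) (mul_le_mul_of_nonneg_left hQ2 hm.le)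
    _ = _ := by
        field_simp
        ring

section
variable {m κ b : ℝ} [hb : Fact (0 < b)] {g : ℝ → ℝ}

lemma MemH.coef_theta_pow {s : ℕ} {u : L2} (h : MemH s u) {i : ℕ} (hi : i ≤ s) (k : ℤ) (n : ℕ) :
    coef b (k, n) (toC (weakDeriv i 0 u)) = ((k : ℂ) * Complex.I) ^ i • coef b (k, n) (toC u) := by
  induction i with
  | zero => rw [h.weakDeriv_zero, pow_zero, one_smul]
  | succ i ih =>
    rw [h.isDTheta (b := b) (i := i) (j := 0) (by omega) k n, ih (by omega), smul_smul, pow_succ']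

lemma MemH.norm_coef_theta_pow {s : ℕ} {u : L2} (h : MemH s u) {i : ℕ} (hi : i ≤ s) (k : ℤ) (n : ℕ) :
    ‖coef b (k, n) (toC (weakDeriv i 0 u))‖ = |(k : ℝ)| ^ i * ‖coef b (k, n) (toC u)‖ := by
  rw [h.coef_theta_pow hi, norm_smul, norm_pow, norm_mul, Complex.norm_I, mul_one, ← Complex.ofReal_intCast,
    Complex.norm_real, Real.norm_eq_abs]

/-- The order parameter sees only k = −1, where |k| = 1, so it is bounded by the corresponding
coefficient of any phase derivative, in particular the top one. -/
lemma MemH.norm_orderZ_sq_le (hg : IsFreqDensity g) {s : ℕ} {u : L2} (h : MemH s u) :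
    ‖orderZ b hg (toC u)‖ ^ 2 ≤ levelSq s 0 u := by
  have h1 : ‖orderZ b hg (toC u)‖ ≤ ‖weakDeriv s 0 u‖ := by
    refine (norm_orderZ_le hg _).trans ?_
    have h2 := h.norm_coef_theta_pow (b := b) le_rfl (-1) 0
    have h3 := norm_coef_le (b := b) (-1, 0) (toC (weakDeriv s 0 u))
    rw [h2, norm_toC] at h3
    simpa using h3
  calc _ ≤ ‖weakDeriv s 0 u‖ ^ 2 := by gcongr
    _ ≤ _ := norm_sq_le_levelSq (by omega) u

/-- Phase derivatives without mass are controlled by the dissipation and the top derivative. -/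
lemma MemH.norm_sq_le_dissip_add {s : ℕ} {u : L2} (h : MemH s u) (hmass : coef b (0, 0) (toC u) = 0)
    {i : ℕ} (hi : i ≤ s) (hfin : dissip b (toC (weakDeriv i 0 u)) ≠ ⊤) :
    ‖weakDeriv i 0 u‖ ^ 2 ≤ (dissip b (toC (weakDeriv i 0 u))).toReal + ‖weakDeriv s 0 u‖ ^ 2 := by
  rw [← norm_toC (weakDeriv i 0 u), ← norm_toC (weakDeriv s 0 u)]
  refine hasSum_le_of_sum_le (hasSum_coef (b := b) (toC (weakDeriv i 0 u))) fun F => ?_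
  have h1 := sum_le_dissip hfin F
  have h2 := sum_norm_coef_sq_le (b := b) F id (by simp) (toC (weakDeriv s 0 u))
  refine le_trans ?_ (add_le_add h1 h2)
  rw [← Finset.sum_add_distrib]
  refine Finset.sum_le_sum ?_
  rintro ⟨k, n⟩ _
  simp only [id_eq]
  -- For n ≥ 1 the dissipation controls the mode. For n = 0 and k ≠ 0 the top derivative does, since
  -- |k| ≥ 1. The mode (0,0) carries no mass.
  rcases Nat.eq_zero_or_pos n with h0 | h0
  · subst h0
    rw [h.norm_coef_theta_pow hi, h.norm_coef_theta_pow le_rfl]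
    rcases eq_or_ne k 0 with hk | hk
    · subst hk; rw [hmass]; simp
    · have hk1 : (1 : ℝ) ≤ |(k : ℝ)| := by exact_mod_cast Int.one_le_abs hk
      have : |(k : ℝ)| ^ i ≤ |(k : ℝ)| ^ s := pow_le_pow_right₀ hk1 hi
      simp only [Nat.cast_zero, zero_mul, zero_add]
      gcongr
  · have h3 : (1 : ℝ) ≤ n := by exact_mod_cast h0
    nlinarith [sq_nonneg ‖coef b (k, n) (toC (weakDeriv i 0 u))‖,
      sq_nonneg ‖coef b (k, n) (toC (weakDeriv s 0 u))‖]

/-- The forcing is quadratic in u, yet its bound is linear: in the part S·u the bound |Z| ≤ 1 is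
used, and in the part S·√M the smallness comes from Z itself through level 0. -/
lemma MemH.norm_forcingDeriv_sq_le (hg : IsFreqDensity g) (hb1 : 1 ≤ b) {s : ℕ} {u : L2} (h : MemH s u)
    (hZ : ‖orderZ b hg (toC u)‖ ≤ 1) {i j : ℕ} (hij : i + j ≤ s) :
    ‖forcingDeriv m κ b hg u i j‖ ^ 2
      ≤ (κ / (m * b)) ^ 2 * (forcingConst s * (levelSq s j u + levelSq s 0 u)) := by
  have hz := h.norm_orderZ_sq_le (b := b) hg
  set z := ‖orderZ b hg (toC u)‖ with hzdef
  have hz0 : 0 ≤ z := norm_nonneg _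
  set V : ℝ := ∑ l ∈ Finset.range (i + 1), ‖weakDeriv l j u‖ with hV
  have hV0 : 0 ≤ V := Finset.sum_nonneg fun _ _ => norm_nonneg _
  have hρ0 := rootMBound_nonneg j
  have hsum : ∑ l ∈ Finset.range (i + 1), ‖densityDeriv b hg u l j‖ ≤ V + rootMBound j := by
    have h1 : ∀ l ∈ Finset.range (i + 1), ‖densityDeriv b hg u l j‖
        ≤ ‖weakDeriv l j u‖ + if l = 0 then rootMBound j else 0 := fun l _ => by
      refine (norm_add_le _ _).trans (add_le_add (norm_toC _).le ?_)
      split_ifs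
      · exact norm_rootMDeriv_le hg hb1 j
      · rw [norm_zero]
    refine (Finset.sum_le_sum h1).trans (le_of_eq ?_)
    rw [Finset.sum_add_distrib, Finset.sum_ite_eq', if_pos (by simp)]
  have h1 : ‖forcingDeriv m κ b hg u i j‖ ≤ |κ / (m * b)| * (2 ^ i * (V + rootMBound j * z)) := by
    rw [forcingDeriv, norm_smul, Complex.norm_real, Real.norm_eq_abs]
    refine mul_le_mul_of_nonneg_left ((norm_meanField_le _ _ _).trans ?_) (abs_nonneg _)
    rw [mul_assoc, ← hzdef]
    -- What remains is (V + ρ)z ≤ V + ρz, where the factor z is dropped from the first term by z ≤ 1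
    -- and kept in the second.
    refine mul_le_mul_of_nonneg_left ((mul_le_mul_of_nonneg_left hsum hz0).trans ?_) (by positivity)
    nlinarith
  have hV2 : V ^ 2 ≤ (s + 1) * levelSq s j u := by
    have h2 := sq_sum_le_card_mul_sum_sq (s := Finset.range (i + 1)) (f := fun l => ‖weakDeriv l j u‖)
    rw [Finset.card_range] at h2
    refine h2.trans ?_
    have h3 : ∑ l ∈ Finset.range (i + 1), ‖weakDeriv l j u‖ ^ 2 ≤ levelSq s j u :=
      Finset.sum_le_sum_of_subset_of_nonneg (Finset.range_subset_range.2 (by omega)) fun _ _ _ => by positivity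
    have h4 : ((i + 1 : ℕ) : ℝ) ≤ s + 1 := by exact_mod_cast (by omega : i + 1 ≤ s + 1)
    exact mul_le_mul h4 h3 (Finset.sum_nonneg fun _ _ => by positivity) (by positivity)
  have hρ : rootMBound j ^ 2 ≤ ∑ j ∈ Finset.range (s + 1), rootMBound j ^ 2 :=
    Finset.single_le_sum (f := fun j => rootMBound j ^ 2) (fun _ _ => by positivity)
      (Finset.mem_range.2 (by omega))
  set R : ℝ := ∑ j ∈ Finset.range (s + 1), rootMBound j ^ 2 with hR
  have hR0 : 0 ≤ R := (sq_nonneg _).trans hρ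
  have h4 : ((2 : ℝ) ^ i) ^ 2 ≤ 4 ^ s := by
    rw [← pow_mul, mul_comm, pow_mul]
    norm_num
    exact pow_le_pow_right₀ (by norm_num) (by omega)
  have hS0 := levelSq_nonneg s 0 u
  have hSj := levelSq_nonneg s j u
  have h5 : (V + rootMBound j * z) ^ 2 ≤ 2 * (s + 1 + R) * (levelSq s j u + levelSq s 0 u) := by
    have a1 : (V + rootMBound j * z) ^ 2 ≤ 2 * V ^ 2 + 2 * (rootMBound j ^ 2 * z ^ 2) := by
      nlinarith [sq_nonneg (V - rootMBound j * z)]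
    have a2 : rootMBound j ^ 2 * z ^ 2 ≤ R * levelSq s 0 u := by gcongr
    have a3 : 0 ≤ R * levelSq s j u := by positivity
    have a4 : 0 ≤ ((s : ℝ) + 1) * levelSq s 0 u := by positivity
    nlinarith
  calc ‖forcingDeriv m κ b hg u i j‖ ^ 2 ≤ (|κ / (m * b)| * (2 ^ i * (V + rootMBound j * z))) ^ 2 := by gcongr
    _ = (κ / (m * b)) ^ 2 * (((2 : ℝ) ^ i) ^ 2 * (V + rootMBound j * z) ^ 2) := by
        rw [mul_pow, sq_abs, mul_pow]
    _ ≤ (κ / (m * b)) ^ 2 * (4 ^ s * (2 * (s + 1 + R) * (levelSq s j u + levelSq s 0 u))) := by gcongr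
    _ = _ := by rw [forcingConst]; ring

/-- The constant in the bound for the lower-order sources. -/
def sourceConst (s : ℕ) (m : ℝ) : ℝ :=
  3 * (s ^ 2 * m ^ 2 + s ^ 4 + s ^ 2 * forcingConst s) + 2 * forcingConst s + 2 * s ^ 2

lemma norm_sourceP_le (hm : 0 < m) (hg : IsFreqDensity g) (u : L2) (i : ℕ) {j : ℕ} (hj : 1 ≤ j) :
    ‖sourceP m κ b hg u i j‖ ≤ j * ‖weakDeriv (i + 1) (j - 1) u‖
      + j * (j - 1) / (4 * m * b ^ 2) * ‖weakDeriv i (j - 2) u‖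
      + j / (2 * b) * ‖forcingDeriv m κ b hg u i (j - 1)‖ := by
  have hb0 := hb.out
  have hj1 : (1 : ℝ) ≤ j := by exact_mod_cast hj
  have e1 : 0 ≤ (j : ℝ) * (j - 1) / (4 * m * b ^ 2) := by
    have : (0 : ℝ) ≤ j - 1 := by linarith
    positivity
  refine (norm_add_le _ _).trans (add_le_add ((norm_add_le _ _).trans (add_le_add ?_ ?_)) ?_)
  · rw [norm_smul, norm_toC, Complex.norm_real, norm_neg, Real.norm_of_nonneg (by positivity)]
  · rw [norm_smul, norm_toC, Complex.norm_real, norm_neg, Real.norm_of_nonneg e1]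
  · rw [norm_smul, Complex.norm_real, Real.norm_of_nonneg (by positivity)]

lemma norm_sourceQ_le (hm : 0 < m) (hg : IsFreqDensity g) (u : L2) (i j : ℕ) :
    ‖sourceQ m κ b hg u i j‖ ≤ ‖forcingDeriv m κ b hg u i j‖
      + j / (m * b) * ‖weakDeriv i (j - 1) u‖ := by
  have hb0 := hb.out
  refine (norm_add_le _ _).trans (add_le_add le_rfl ?_)
  rw [norm_smul, norm_toC, Complex.norm_real, norm_neg, Real.norm_of_nonneg (by positivity)]

/-- Every source at level j involves fewer velocity derivatives, except the forcing of order j,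
which carries the small factor (κ/b)². -/
lemma MemH.norm_sources_sq_le (hm : 0 < m) (hg : IsFreqDensity g) (hb1 : 1 ≤ b)
    (hδ : (κ / b) ^ 2 ≤ 1) {s : ℕ} {u : L2} (h : MemH s u) (hZ : ‖orderZ b hg (toC u)‖ ≤ 1)
    {i j : ℕ} (hj : 1 ≤ j) (hij : i + j ≤ s) :
    m * ‖sourceP m κ b hg u i j‖ ^ 2 + m * ‖sourceQ m κ b hg u i j‖ ^ 2
      ≤ 1 / m * (sourceConst s m * ∑ l ∈ Finset.range j, levelSq s l u
        + 2 * (forcingConst s * ((κ / b) ^ 2 * levelSq s j u))) := by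
  have hb0 := hb.out
  have hF1 := one_le_forcingConst s
  set L := ∑ l ∈ Finset.range j, levelSq s l u with hL
  have hle : ∀ l < j, levelSq s l u ≤ L := fun l hl =>
    Finset.single_le_sum (f := fun l => levelSq s l u) (fun l _ => levelSq_nonneg s l u)
      (Finset.mem_range.2 hl)
  have hL0 : 0 ≤ L := Finset.sum_nonneg fun l _ => levelSq_nonneg s l u
  have hε : (κ / (m * b)) ^ 2 = (κ / b) ^ 2 / m ^ 2 := by field_simp
  have a2 := hle 0 (by omega)
  have a4 := levelSq_nonneg s 0 u
  refine source_arith hm hb1 (by exact_mod_cast hj) (by exact_mod_cast (by omega : j ≤ s)) (norm_nonneg _)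
    (norm_nonneg _) ((norm_sq_le_levelSq (by omega) u).trans (hle (j - 1) (by omega)))
    ((norm_sq_le_levelSq (by omega) u).trans (hle (j - 2) (by omega)))
    ((norm_sq_le_levelSq (by omega) u).trans (hle (j - 1) (by omega))) ?_ ?_
    (norm_sourceP_le hm hg u i hj) (norm_sourceQ_le hm hg u i j)
  · refine (h.norm_forcingDeriv_sq_le hg hb1 hZ (by omega)).trans ?_
    have a1 := hle (j - 1) (by omega)
    have a3 := levelSq_nonneg s (j - 1) u
    rw [hε]
    refine mul_le_mul (div_le_div_of_nonneg_right hδ (by positivity)) ?_ (by positivity) (by positivity)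
    exact mul_le_mul_of_nonneg_left (by linarith) (by linarith)
  · refine (h.norm_forcingDeriv_sq_le hg hb1 hZ hij).trans ?_
    -- For j ≥ 1 level 0 is among the lower levels, so its share of the forcing needs no smallness
    -- beyond κ/b ≤ 1.
    have a5 : (κ / b) ^ 2 * levelSq s 0 u ≤ L := by nlinarith [sq_nonneg (κ / b)]
    rw [hε]
    calc _ = 1 / m ^ 2 * (forcingConst s * ((κ / b) ^ 2 * levelSq s j u + (κ / b) ^ 2 * levelSq s 0 u)) := by ring
      _ ≤ _ := by
        refine mul_le_mul_of_nonneg_left (mul_le_mul_of_nonneg_left ?_ (by linarith)) (by positivity)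
        linarith

end

end KuramotoSakaguchi
end

/-! ### Decay of the single levels and of the phase energy. -/

noncomputable section
namespace KuramotoSakaguchi
open Filter Topology

/-! ### The Lyapunov functional -/

/-- N is the number of derivatives in the level; the smallness of e lets half of the damping absorb
the self-interaction of the level. -/
lemma level_arith {N s C L S e : ℝ} (hN : N ≤ s + 1) (hC : 0 ≤ C) (hL : 0 ≤ L) (hS : 0 ≤ S) (he : 0 ≤ e)
    (hsm : (s + 1) * (2 * e) ≤ 1 / 2) :
    -S + N * (C * L + 2 * (e * S)) ≤ -(1 / 2) * S + (s + 1) * C * L := by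
  have h1 : N * (C * L + 2 * (e * S)) ≤ (s + 1) * (C * L + 2 * (e * S)) :=
    mul_le_mul_of_nonneg_right hN (by positivity)
  have h2 := mul_le_mul_of_nonneg_right hsm hS
  linarith

/-- A is the total dissipation and W the square of the top phase derivative. Together they control
the level S, and the smallness condition on e lets half of this control absorb the mean-field term.
-/
lemma phase_arith {s e S A W : ℝ} (hs : 0 ≤ s) (hS : 0 ≤ S) (hA : 0 ≤ A) (hSle : S ≤ A + (s + 1) * W)
    (hsm : 16 * (s + 1) * (2 * s + 3) * e ≤ 1) :
    -(1 / 2) * A - 1 / 8 * W + (2 * s + 3) * e * S ≤ -(1 / (16 * (s + 1))) * S := by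
  have hs1 : 0 < s + 1 := by linarith
  have h5 : (2 * s + 3) * e * S ≤ 1 / (16 * (s + 1)) * S := by
    refine mul_le_mul_of_nonneg_right ?_ hS
    rw [le_div_iff₀ (by positivity)]
    linarith
  have h6 : 1 / (8 * (s + 1)) * S ≤ 1 / 2 * A + 1 / 8 * W := by
    calc _ ≤ 1 / (8 * (s + 1)) * (A + (s + 1) * W) := mul_le_mul_of_nonneg_left hSle (by positivity)
      _ = 1 / (8 * (s + 1)) * A + 1 / 8 * W := by field_simp
      _ ≤ _ := by
          have : 1 / (8 * (s + 1)) ≤ 1 / 2 := by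
            rw [div_le_div_iff₀ (by positivity) (by norm_num)]
            linarith
          have := mul_le_mul_of_nonneg_right this hA
          linarith
  have h7 : 1 / (8 * (s + 1)) * S = 2 * (1 / (16 * (s + 1)) * S) := by field_simp; ring
  linarith

section
variable {m κ b : ℝ} [hb : Fact (0 < b)] {g : ℝ → ℝ}

/-- A solution with unit mass at each natural frequency and order parameter in the unit disc, at weak
coupling and strong noise. -/
structure IsWeaklyCoupled (m κ b : ℝ) [Fact (0 < b)] (hg : IsFreqDensity g) (s : ℕ) (T : ℝ) (f : ℝ → L2) :
    Prop where
  m_pos : 0 < m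
  one_le_b : 1 ≤ b
  one_le_mb : 1 ≤ m * b
  T_nonneg : 0 ≤ T
  one_le_s : 1 ≤ s
  cont : ContInH s T f
  eqn : SolvesEq m κ (m * b ^ 2) g T f
  mass : ∀ t ∈ Icc 0 T, coef b (0, 0) (toC (f t)) = 0
  order_le : ∀ t ∈ Icc 0 T, ‖orderZ b hg (toC (f t))‖ ≤ 1
  small : 16 * ((s : ℝ) + 1) * (2 * s + 3) * (forcingConst s * (κ / b) ^ 2) ≤ 1

variable (m b) in
/-- The phase part of the Lyapunov functional. -/
def phaseEnergy (s : ℕ) (u : L2) : ℝ :=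
  levelSq s 0 u + 1 / (4 * (m * b)) *
    crossTerm b (toC (weakDeriv (s - 1) 0 u)) (toC (weakDeriv s 0 u))

namespace IsWeaklyCoupled
variable {hg : IsFreqDensity g} {s : ℕ} {T : ℝ} {f : ℝ → L2}

lemma modeEq_phase (h : IsWeaklyCoupled m κ b hg s T f) {i : ℕ} (hi : i ≤ s) :
    ModeEq m b 0 T (fun t => toC (weakDeriv i 0 (f t))) (fun _ => 0)
      fun t => forcingDeriv m κ b hg (f t) i 0 := by
  have h1 := modeEq_deriv h.m_pos hg h.one_le_s h.cont h.eqn i 0 (by omega)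
  rw [Nat.cast_zero, zero_div] at h1
  exact h1.congr (fun _ _ => rfl) (fun t _ => by simp [sourceP]) (fun t _ => by simp [sourceQ])

lemma kappa_div_sq_le (h : IsWeaklyCoupled m κ b hg s T f) : (κ / b) ^ 2 ≤ 1 := by
  have h1 := one_le_forcingConst s
  have h2 := h.small
  have h3 : (0 : ℝ) ≤ s := by positivity
  have h4 : (κ / b) ^ 2 ≤ forcingConst s * (κ / b) ^ 2 := le_mul_of_one_le_left (sq_nonneg _) h1
  have h5 : forcingConst s * (κ / b) ^ 2 ≤ 16 * ((s : ℝ) + 1) * (2 * s + 3) * (forcingConst s * (κ / b) ^ 2) :=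
    le_mul_of_one_le_left (by positivity) (by nlinarith)
  linarith

lemma small_level (h : IsWeaklyCoupled m κ b hg s T f) :
    ((s : ℝ) + 1) * (2 * (forcingConst s * (κ / b) ^ 2)) ≤ 1 / 2 := by
  have h1 := one_le_forcingConst s
  have he0 : 0 ≤ forcingConst s * (κ / b) ^ 2 := by positivity
  have h2 := h.small
  set e := forcingConst s * (κ / b) ^ 2
  have h3 : (0 : ℝ) ≤ s := by positivity
  nlinarith [mul_nonneg h3 he0, mul_nonneg (mul_nonneg h3 h3) he0]

lemma norm_forcingDeriv_phase_sq_le (h : IsWeaklyCoupled m κ b hg s T f) {i : ℕ} (hi : i ≤ s) {t : ℝ}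
    (ht : t ∈ Icc 0 T) : ‖forcingDeriv m κ b hg (f t) i 0‖ ^ 2
      ≤ 1 / m ^ 2 * (2 * (forcingConst s * (κ / b) ^ 2) * levelSq s 0 (f t)) := by
  have hb0 := hb.out
  have hm := h.m_pos
  refine ((h.cont.1 t ht).norm_forcingDeriv_sq_le hg h.one_le_b (h.order_le t ht) (by omega)).trans
    (le_of_eq ?_)
  field_simp
  ring

/-- The velocity derivatives are damped, up to lower levels. -/
lemma intBound_levelSq (h : IsWeaklyCoupled m κ b hg s T f) {j : ℕ} (hj : 1 ≤ j) (hjs : j ≤ s) :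
    IntBound T (fun t => levelSq s j (f t)) (fun t => 1 / m * (-(1 / 2) * levelSq s j (f t)
      + ((s : ℝ) + 1) * sourceConst s m * ∑ l ∈ Finset.range j, levelSq s l (f t))) := by
  have hm := h.m_pos
  have hLc : ContinuousOn (fun t => ∑ l ∈ Finset.range j, levelSq s l (f t)) (Icc 0 T) :=
    continuousOn_finsetSum _ fun l _ => h.cont.continuousOn_levelSq
  have hSc := h.cont.continuousOn_levelSq (j := j)
  set e := forcingConst s * (κ / b) ^ 2 with he
  have hone : ∀ i ∈ Finset.range (s + 1 - j), IntBound T (fun t => ‖weakDeriv i j (f t)‖ ^ 2)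
      (fun t => 1 / m * (-‖weakDeriv i j (f t)‖ ^ 2 + (sourceConst s m * ∑ l ∈ Finset.range j, levelSq s l (f t)
        + 2 * (e * levelSq s j (f t))))) := by
    intro i hi
    rw [Finset.mem_range] at hi
    have hij : i + j ≤ s := by omega
    have hE := ((modeEq_deriv h.m_pos hg h.one_le_s h.cont h.eqn i j hij).energy hm h.T_nonneg).2.2.1
    simp only [norm_toC] at hE
    refine hE.mono ?_ (.of_forall fun t ht => ?_)
    · exact (continuousOn_const.mul ((h.cont.continuousOn_norm_sq hij).neg.add
        ((continuousOn_const.mul hLc).add (continuousOn_const.mul (continuousOn_const.mul hSc))))).integrableOn_Icc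
    · have h1 := (h.cont.1 t ht).norm_sources_sq_le hm hg h.one_le_b h.kappa_div_sq_le (h.order_le t ht) hj hij
      have h2 : 0 ≤ 1 / m * (dissip b (toC (weakDeriv i j (f t)))).toReal := by positivity
      set V := ‖weakDeriv i j (f t)‖
      set P := ‖sourceP m κ b hg (f t) i j‖
      -- The source p is paid for with half of the damping 2j/m, which is possible since j ≥ 1.
      have h3 : 2 * P * V ≤ 1 / m * V ^ 2 + m * P ^ 2 := by
        have : 1 / m * V ^ 2 + m * P ^ 2 - 2 * P * V = 1 / m * (V - m * P) ^ 2 := by field_simp; ring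
        have : 0 ≤ 1 / m * (V - m * P) ^ 2 := by positivity
        linarith
      have h4 : 1 / m * V ^ 2 ≤ j / m * V ^ 2 := by
        have : (1 : ℝ) ≤ j := by exact_mod_cast hj
        gcongr
      rw [mul_add (1 / m), mul_neg]
      have h5 : forcingConst s * ((κ / b) ^ 2 * levelSq s j (f t)) = e * levelSq s j (f t) := by rw [he]; ring
      rw [h5] at h1
      linarith
  refine (IntBound.sum _ hone).mono ?_ (.of_forall fun t ht => ?_)
  · exact (continuousOn_const.mul ((continuousOn_const.mul hSc).add
      (continuousOn_const.mul hLc))).integrableOn_Icc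
  · rw [← Finset.mul_sum]
    refine mul_le_mul_of_nonneg_left ?_ (by positivity)
    rw [Finset.sum_add_distrib, Finset.sum_neg_distrib, Finset.sum_const, Finset.card_range, nsmul_eq_mul]
    have hS0 := levelSq_nonneg s j (f t)
    have hL0 : 0 ≤ ∑ l ∈ Finset.range j, levelSq s l (f t) := Finset.sum_nonneg fun l _ => levelSq_nonneg s l _
    have hF := one_le_forcingConst s
    have hC0 : 0 ≤ sourceConst s m := by unfold sourceConst; positivity
    have he0 : 0 ≤ e := by positivity
    have hN : ((s + 1 - j : ℕ) : ℝ) ≤ s + 1 := by exact_mod_cast (by omega : s + 1 - j ≤ s + 1)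
    exact level_arith hN hC0 hL0 hS0 he0 h.small_level

/-- The phase part of the functional decays by hypocoercivity. -/
lemma intBound_phaseEnergy (h : IsWeaklyCoupled m κ b hg s T f) :
    IntBound T (fun t => phaseEnergy m b s (f t))
      (fun t => -(1 / (16 * ((s : ℝ) + 1)) / m) * levelSq s 0 (f t)) ∧
    ∃ ψ, IntBound T (fun t => -phaseEnergy m b s (f t)) ψ := by
  have hm := h.m_pos
  have hb0 := hb.out
  have hmb := h.one_le_mb
  have hs := h.one_le_s
  set e := forcingConst s * (κ / b) ^ 2 with he
  have hF := one_le_forcingConst s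
  have he0 : 0 ≤ e := by positivity
  have hen : ∀ i ≤ s, _ := fun i hi => (h.modeEq_phase hi).energy hm h.T_nonneg
  simp only [norm_toC, norm_zero, mul_zero, zero_mul, zero_add, sub_zero, add_zero] at hen
  have hw : ∀ t ∈ Icc 0 T, ∀ k n, coef b (k, n) (toC (weakDeriv s 0 (f t)))
      = ((k : ℂ) * Complex.I) • coef b (k, n) (toC (weakDeriv (s - 1) 0 (f t))) := by
    intro t ht k n
    have h1 := (h.cont.1 t ht).isDTheta (b := b) (i := s - 1) (j := 0) (by omega) k n
    rwa [Nat.sub_add_cancel hs] at h1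
  have hcr := (h.modeEq_phase (i := s - 1) (by omega)).cross hm (h.cont.continuousOn_toC (by omega)) hw
    (hen (s - 1) (by omega)).1 (hen (s - 1) (by omega)).2.1 (hen s le_rfl).1 (hen s le_rfl).2.1
  simp only [norm_toC] at hcr
  have hη : 0 ≤ 1 / (4 * (m * b)) := by positivity
  have hS := (IntBound.sum (Finset.range (s + 1)) fun i hi =>
    (hen i (by rw [Finset.mem_range] at hi; omega)).2.2.1).add (hcr.1.const_mul hη)
  have hS' := (IntBound.sum (Finset.range (s + 1)) fun i hi =>
    (hen i (by rw [Finset.mem_range] at hi; omega)).2.2.2).add (hcr.2.const_mul hη)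
  refine ⟨?_, _, hS'.congr fun t _ => ?_⟩
  · refine IntBound.congr (hS.mono ((continuousOn_const.mul h.cont.continuousOn_levelSq).integrableOn_Icc) ?_)
      fun t _ => rfl
    have hfin : ∀ᵐ t, t ∈ Icc 0 T → ∀ i ∈ Finset.range (s + 1),
        dissip b (toC (weakDeriv i 0 (f t))) ≠ ⊤ := by
      have := (Finset.eventually_all (Finset.range (s + 1))
        (p := fun i t => t ∈ Icc 0 T → dissip b (toC (weakDeriv i 0 (f t))) ≠ ⊤) (l := ae volume)).2
        fun i hi => (hen i (by rw [Finset.mem_range] at hi; omega)).1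
      filter_upwards [this] with t ht h1 i hi using ht i hi h1
    filter_upwards [hfin] with t hfin ht
    have hco : ∀ i ∈ Finset.range (s + 1), ‖weakDeriv i 0 (f t)‖ ^ 2
        ≤ (dissip b (toC (weakDeriv i 0 (f t)))).toReal + ‖weakDeriv s 0 (f t)‖ ^ 2 := fun i hi =>
      (h.cont.1 t ht).norm_sq_le_dissip_add (h.mass t ht) (by rw [Finset.mem_range] at hi; omega)
        (hfin ht i hi)
    set A : ℕ → ℝ := fun i => (dissip b (toC (weakDeriv i 0 (f t)))).toReal with hA
    set At := ∑ i ∈ Finset.range (s + 1), A i with hAt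
    set W := ‖weakDeriv s 0 (f t)‖ ^ 2 with hW
    set S := levelSq s 0 (f t) with hSd
    have hA0 : ∀ i, 0 ≤ A i := fun i => ENNReal.toReal_nonneg
    have hW0 : 0 ≤ W := by positivity
    have hS0 : 0 ≤ S := levelSq_nonneg _ _ _
    -- The cross term costs dissipation only at orders s and s − 1, which are distinct since s ≥ 1
    -- and both occur in the total.
    have hAs : A s + A (s - 1) ≤ At := by
      rw [hAt, Finset.sum_range_succ]
      have := Finset.single_le_sum (f := A) (fun i _ => hA0 i)
        (Finset.mem_range.2 (by omega : s - 1 < s))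
      linarith
    have hSle : S ≤ At + ((s : ℝ) + 1) * W := by
      have := Finset.sum_le_sum hco
      rw [Finset.sum_add_distrib, Finset.sum_const, Finset.card_range, nsmul_eq_mul] at this
      push_cast at this
      exact this
    have hq : ∀ i ∈ Finset.range (s + 1), -(1 / m) * A i + m * ‖forcingDeriv m κ b hg (f t) i 0‖ ^ 2
        ≤ -(1 / m) * A i + 1 / m * (2 * e * S) := by
      intro i hi
      have := h.norm_forcingDeriv_phase_sq_le (i := i) (by rw [Finset.mem_range] at hi; omega) ht
      have h2 := mul_le_mul_of_nonneg_left this hm.le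
      have h3 : m * (1 / m ^ 2 * (2 * (forcingConst s * (κ / b) ^ 2) * levelSq s 0 (f t)))
          = 1 / m * (2 * e * S) := by rw [he, hSd]; field_simp
      linarith
    have h1 : ∑ i ∈ Finset.range (s + 1), (-(1 / m) * A i + m * ‖forcingDeriv m κ b hg (f t) i 0‖ ^ 2)
        ≤ -(1 / m) * At + ((s : ℝ) + 1) * (1 / m * (2 * e * S)) := by
      refine (Finset.sum_le_sum hq).trans (le_of_eq ?_)
      rw [Finset.sum_add_distrib, Finset.sum_const, Finset.card_range, nsmul_eq_mul, ← Finset.mul_sum, hAt]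
      push_cast
      rfl
    -- The weight 1/(4mb) turns the factor b of the cross estimate into 1/(4m), so the dissipation
    -- it costs is half of what the energies provide. The condition mb ≥ 1 removes the remaining
    -- parameters.
    have h2 : 1 / (4 * (m * b)) * (b * (-(1 / 2) * W + 2 * A s + 2 / (m * b) ^ 2 * A (s - 1)
        + 2 / b ^ 2 * ‖forcingDeriv m κ b hg (f t) (s - 1) 0‖ ^ 2))
        ≤ 1 / m * (1 / 4 * (-(1 / 2) * W + 2 * At + 4 * e * S)) := by
      have e1 : 1 / (4 * (m * b)) * (b * (-(1 / 2) * W + 2 * A s + 2 / (m * b) ^ 2 * A (s - 1)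
        + 2 / b ^ 2 * ‖forcingDeriv m κ b hg (f t) (s - 1) 0‖ ^ 2))
        = 1 / m * (1 / 4 * (-(1 / 2) * W + 2 * A s + 2 / (m * b) ^ 2 * A (s - 1)
        + 2 / b ^ 2 * ‖forcingDeriv m κ b hg (f t) (s - 1) 0‖ ^ 2)) := by field_simp
      rw [e1]
      have hmb2 : 1 ≤ (m * b) ^ 2 := one_le_pow₀ hmb
      have e2 : 2 / (m * b) ^ 2 * A (s - 1) ≤ 2 * A (s - 1) := by
        refine mul_le_mul_of_nonneg_right (div_le_self (by norm_num) hmb2) (hA0 _)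
      have e3 : 2 / b ^ 2 * ‖forcingDeriv m κ b hg (f t) (s - 1) 0‖ ^ 2 ≤ 4 * e * S := by
        have := h.norm_forcingDeriv_phase_sq_le (i := s - 1) (by omega) ht
        calc _ ≤ 2 / b ^ 2 * (1 / m ^ 2 * (2 * (forcingConst s * (κ / b) ^ 2) * levelSq s 0 (f t))) :=
              mul_le_mul_of_nonneg_left this (by positivity)
          _ = (4 * e * S) / (m * b) ^ 2 := by rw [he, hSd]; field_simp; ring
          _ ≤ _ := div_le_self (by positivity) hmb2
      refine mul_le_mul_of_nonneg_left (mul_le_mul_of_nonneg_left ?_ (by norm_num)) (by positivity)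
      linarith
    refine (add_le_add h1 h2).trans ?_
    have h3 : -(1 / (16 * ((s : ℝ) + 1)) / m) * S = 1 / m * (-(1 / (16 * ((s : ℝ) + 1))) * S) := by ring
    -- The coefficient 2s + 3 adds 2(s + 1) from the s + 1 energies and 1 from the cross term.
    have h4 : -(1 / m) * At + ((s : ℝ) + 1) * (1 / m * (2 * e * S))
        + 1 / m * (1 / 4 * (-(1 / 2) * W + 2 * At + 4 * e * S))
        = 1 / m * (-(1 / 2) * At - 1 / 8 * W + (2 * s + 3) * e * S) := by ring
    rw [h3, h4]
    refine mul_le_mul_of_nonneg_left ?_ (by positivity)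
    exact phase_arith (Nat.cast_nonneg s) hS0 (Finset.sum_nonneg fun i _ => hA0 i) hSle h.small
  · simp only [phaseEnergy, levelSq, Finset.sum_neg_distrib, Nat.sub_zero]
    ring

/-- The bound from below; its form is irrelevant, since it serves only for absolute continuity. -/
lemma exists_intBound_neg_levelSq (h : IsWeaklyCoupled m κ b hg s T f) (j : ℕ) :
    ∃ ψ, IntBound T (fun t => -levelSq s j (f t)) ψ := by
  have h1 := IntBound.sum (T := T) (Finset.range (s + 1 - j)) fun i hi =>
    ((modeEq_deriv h.m_pos hg h.one_le_s h.cont h.eqn i j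
      (by rw [Finset.mem_range] at hi; omega)).energy h.m_pos h.T_nonneg).2.2.2
  simp only [norm_toC] at h1
  refine ⟨_, h1.congr fun t _ => ?_⟩
  rw [levelSq, Finset.sum_neg_distrib]

end IsWeaklyCoupled

end

end KuramotoSakaguchi
end

/-! ### The Lyapunov functional, its decay, and the constants. -/

noncomputable section
namespace KuramotoSakaguchi
open Filter Topology

/-! ### Decay of the Lyapunov functional -/

/-- The rate at which the phase part decays, in units of `1 / m`. -/
def phaseRate (s : ℕ) : ℝ := 1 / (16 * ((s : ℝ) + 1))

lemma phaseRate_pos (s : ℕ) : 0 < phaseRate s := by unfold phaseRate; positivity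

lemma phaseRate_le_half (s : ℕ) : phaseRate s ≤ 1 / 2 := by
  unfold phaseRate
  have : (0 : ℝ) ≤ s := s.cast_nonneg
  exact one_div_le_one_div_of_le (by norm_num) (by linarith)

lemma sourceConst_nonneg (s : ℕ) (m : ℝ) : 0 ≤ sourceConst s m := by
  have := one_le_forcingConst s
  unfold sourceConst
  positivity

/-- The ratio of the weights of consecutive levels in the Lyapunov functional. -/
def levelWeight (s : ℕ) (m : ℝ) : ℝ :=
  min 1 (phaseRate s / (2 * (((s : ℝ) + 1) * sourceConst s m * s + 1)))

lemma levelWeight_pos (s : ℕ) (m : ℝ) : 0 < levelWeight s m := by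
  have := phaseRate_pos s
  have := sourceConst_nonneg s m
  exact lt_min one_pos (by positivity)

lemma levelWeight_le_one (s : ℕ) (m : ℝ) : levelWeight s m ≤ 1 := min_le_left _ _

/-- The ratio α is defined to make this hold: all lower-level sources together cost at most half of
the phase rate. -/
lemma sourceConst_mul_levelWeight_le (s : ℕ) (m : ℝ) :
    ((s : ℝ) + 1) * sourceConst s m * s * levelWeight s m ≤ phaseRate s / 2 := by
  have hγ := phaseRate_pos s
  have hC := sourceConst_nonneg s m
  set A := ((s : ℝ) + 1) * sourceConst s m * s with hA
  have hA0 : 0 ≤ A := by positivity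
  have h1 : levelWeight s m ≤ phaseRate s / (2 * (A + 1)) := min_le_right _ _
  refine (mul_le_mul_of_nonneg_left h1 hA0).trans ?_
  rw [← mul_div_assoc, div_le_div_iff₀ (by positivity) (by norm_num)]
  nlinarith

/-- The weighted square norm that is equivalent to the Lyapunov functional. -/
def weightedSq (α : ℝ) (s : ℕ) (u : L2) : ℝ := ∑ j ∈ Finset.range (s + 1), α ^ j * levelSq s j u

lemma weightedSq_eq (α : ℝ) (s : ℕ) (u : L2) :
    weightedSq α s u = levelSq s 0 u + ∑ j ∈ Finset.range s, α ^ (j + 1) * levelSq s (j + 1) u := by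
  rw [weightedSq, Finset.sum_range_succ', pow_zero, one_mul, add_comm]

lemma weightedSq_nonneg {α : ℝ} (h0 : 0 ≤ α) (s : ℕ) (u : L2) : 0 ≤ weightedSq α s u :=
  Finset.sum_nonneg fun _ _ => mul_nonneg (pow_nonneg h0 _) (levelSq_nonneg _ _ _)

lemma levelSq_zero_le_weightedSq {α : ℝ} (h0 : 0 ≤ α) (s : ℕ) (u : L2) :
    levelSq s 0 u ≤ weightedSq α s u := by
  rw [weightedSq_eq]
  exact le_add_of_nonneg_right
    (Finset.sum_nonneg fun _ _ => mul_nonneg (pow_nonneg h0 _) (levelSq_nonneg _ _ _))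

lemma weightedSq_le_hNormSq {α : ℝ} (h0 : 0 ≤ α) (h1 : α ≤ 1) (s : ℕ) (u : L2) :
    weightedSq α s u ≤ hNormSq s u := by
  rw [hNormSq_eq_sum_levelSq]
  exact Finset.sum_le_sum fun j _ => mul_le_of_le_one_left (levelSq_nonneg _ _ _) (pow_le_one₀ h0 h1)

lemma pow_mul_hNormSq_le_weightedSq {α : ℝ} (h0 : 0 ≤ α) (h1 : α ≤ 1) (s : ℕ) (u : L2) :
    α ^ s * hNormSq s u ≤ weightedSq α s u := by
  rw [hNormSq_eq_sum_levelSq, Finset.mul_sum]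
  exact Finset.sum_le_sum fun j hj => mul_le_mul_of_nonneg_right
    (pow_le_pow_of_le_one h0 h1 (by rw [Finset.mem_range] at hj; omega)) (levelSq_nonneg _ _ _)

/-- A level l ≤ j enters the estimate of level j + 1 with weight α^{j+1} ≤ α·α^l. One factor α is
thus gained over the weight it has in the functional. -/
lemma sum_lower_levels_le {α : ℝ} (h0 : 0 ≤ α) (h1 : α ≤ 1) (s : ℕ) (u : L2) :
    ∑ j ∈ Finset.range s, α ^ (j + 1) * ∑ l ∈ Finset.range (j + 1), levelSq s l u
      ≤ s * (α * weightedSq α s u) := by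
  have key : ∀ j ∈ Finset.range s, α ^ (j + 1) * ∑ l ∈ Finset.range (j + 1), levelSq s l u
      ≤ α * weightedSq α s u := by
    intro j hj
    rw [Finset.mem_range] at hj
    rw [pow_succ', mul_assoc]
    refine mul_le_mul_of_nonneg_left ?_ h0
    rw [Finset.mul_sum, weightedSq]
    calc _ ≤ ∑ l ∈ Finset.range (j + 1), α ^ l * levelSq s l u :=
          Finset.sum_le_sum fun l hl => mul_le_mul_of_nonneg_right
            (pow_le_pow_of_le_one h0 h1 (by rw [Finset.mem_range] at hl; omega)) (levelSq_nonneg _ _ _)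
      _ ≤ _ := Finset.sum_le_sum_of_subset_of_nonneg
          (Finset.range_subset_range.2 (by omega))
          fun _ _ _ => mul_nonneg (pow_nonneg h0 _) (levelSq_nonneg _ _ _)
  refine (Finset.sum_le_sum key).trans (le_of_eq ?_)
  rw [Finset.sum_const, Finset.card_range, nsmul_eq_mul]

section
variable {m κ b : ℝ} [hb : Fact (0 < b)] {g : ℝ → ℝ}

variable (m b) in
/-- The Lyapunov functional. -/
def lyapunov (s : ℕ) (u : L2) : ℝ :=
  phaseEnergy m b s u + ∑ j ∈ Finset.range s, levelWeight s m ^ (j + 1) * levelSq s (j + 1) u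

/-- The two differ by the cross term only, whose weight is at most 1/4 and which is itself bounded
by level 0. -/
lemma abs_lyapunov_sub_le (hmb : 1 ≤ m * b) (s : ℕ) (u : L2) :
    |lyapunov m b s u - weightedSq (levelWeight s m) s u|
      ≤ 1 / 4 * weightedSq (levelWeight s m) s u := by
  have h1 := abs_crossTerm_le (b := b) (toC (weakDeriv (s - 1) 0 u)) (toC (weakDeriv s 0 u))
  rw [norm_toC, norm_toC] at h1
  have h2 := norm_sq_le_levelSq (s := s) (i := s - 1) (j := 0) (by omega) u
  have h3 := norm_sq_le_levelSq (s := s) (i := s) (j := 0) (by omega) u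
  have h4 := levelSq_zero_le_weightedSq (levelWeight_pos s m).le s u
  have h5 : lyapunov m b s u - weightedSq (levelWeight s m) s u
      = 1 / (4 * (m * b)) * crossTerm b (toC (weakDeriv (s - 1) 0 u)) (toC (weakDeriv s 0 u)) := by
    rw [lyapunov, phaseEnergy, weightedSq_eq]
    ring
  have h6 : 1 / (4 * (m * b)) ≤ 1 / 4 := one_div_le_one_div_of_le (by norm_num) (by linarith)
  rw [h5, abs_mul, abs_of_nonneg (by positivity)]
  exact mul_le_mul h6 (by linarith) (abs_nonneg _) (by norm_num)

lemma lyapunov_le (hmb : 1 ≤ m * b) (s : ℕ) (u : L2) :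
    lyapunov m b s u ≤ 2 * weightedSq (levelWeight s m) s u := by
  have := (abs_le.1 (abs_lyapunov_sub_le hmb s u)).2
  have := weightedSq_nonneg (levelWeight_pos s m).le s u
  linarith

lemma le_lyapunov (hmb : 1 ≤ m * b) (s : ℕ) (u : L2) :
    1 / 2 * weightedSq (levelWeight s m) s u ≤ lyapunov m b s u := by
  have := (abs_le.1 (abs_lyapunov_sub_le hmb s u)).1
  have := weightedSq_nonneg (levelWeight_pos s m).le s u
  linarith

namespace IsWeaklyCoupled
variable {hg : IsFreqDensity g} {s : ℕ} {T : ℝ} {f : ℝ → L2}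

/-- In units of 1/m, level 0 decays at rate γ (`phaseRate`) and the higher levels at rate 1/2 ≥ γ.
The sources give back at most γ/2 of the weighted norm G, and −γG/2 is at most −γ/4 times the
functional because the latter is at most 2G. -/
lemma exists_intBound_lyapunov (h : IsWeaklyCoupled m κ b hg s T f) :
    ∃ ψ, IntBound T (fun t => lyapunov m b s (f t)) ψ ∧
      ∀ t ∈ Icc 0 T, ψ t ≤ -(phaseRate s / (4 * m)) * lyapunov m b s (f t) := by
  have hm := h.m_pos
  have hα := levelWeight_pos s m
  refine ⟨_, h.intBound_phaseEnergy.1.add (IntBound.sum (Finset.range s) fun j hj =>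
    (h.intBound_levelSq (j := j + 1) (by omega)
      (by rw [Finset.mem_range] at hj; omega)).const_mul (pow_nonneg hα.le (j + 1))), fun t _ => ?_⟩
  set A := ((s : ℝ) + 1) * sourceConst s m with hA
  set α := levelWeight s m with hαd
  set G := weightedSq α s (f t) with hG
  set B := ∑ j ∈ Finset.range s, α ^ (j + 1) * levelSq s (j + 1) (f t) with hB
  set L := ∑ j ∈ Finset.range s, α ^ (j + 1) * ∑ l ∈ Finset.range (j + 1), levelSq s l (f t) with hL
  have hA0 : 0 ≤ A := mul_nonneg (by positivity) (sourceConst_nonneg s m)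
  have hG0 : 0 ≤ G := weightedSq_nonneg hα.le s (f t)
  have hB0 : 0 ≤ B :=
    Finset.sum_nonneg fun _ _ => mul_nonneg (pow_nonneg hα.le _) (levelSq_nonneg _ _ _)
  have hsum : ∑ j ∈ Finset.range s, α ^ (j + 1) * (1 / m * (-(1 / 2) * levelSq s (j + 1) (f t)
      + A * ∑ l ∈ Finset.range (j + 1), levelSq s l (f t))) = 1 / m * (-(1 / 2) * B + A * L) := by
    rw [hB, hL, Finset.mul_sum, Finset.mul_sum, ← Finset.sum_add_distrib, Finset.mul_sum]
    exact Finset.sum_congr rfl fun j _ => by ring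
  have hGe : G = levelSq s 0 (f t) + B := weightedSq_eq α s (f t)
  have hLl : A * L ≤ phaseRate s / 2 * G := by
    calc A * L ≤ A * (s * (α * G)) :=
          mul_le_mul_of_nonneg_left (sum_lower_levels_le hα.le (levelWeight_le_one s m) s (f t)) hA0
      _ = A * s * α * G := by ring
      _ ≤ _ := mul_le_mul_of_nonneg_right (sourceConst_mul_levelWeight_le s m) hG0
  have hγB := mul_le_mul_of_nonneg_right (phaseRate_le_half s) hB0
  have hE := mul_le_mul_of_nonneg_left (lyapunov_le (b := b) h.one_le_mb s (f t))
    (by have := phaseRate_pos s; positivity : 0 ≤ phaseRate s / 4)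
  rw [← hG] at hE
  change -(phaseRate s / m) * levelSq s 0 (f t) + ∑ j ∈ Finset.range s, α ^ (j + 1) *
    (1 / m * (-(1 / 2) * levelSq s (j + 1) (f t)
      + A * ∑ l ∈ Finset.range (j + 1), levelSq s l (f t))) ≤ _
  rw [hsum]
  have e1 : -(phaseRate s / m) * levelSq s 0 (f t) + 1 / m * (-(1 / 2) * B + A * L)
      = 1 / m * (-phaseRate s * levelSq s 0 (f t) - 1 / 2 * B + A * L) := by ring
  have e2 : -(phaseRate s / (4 * m)) * lyapunov m b s (f t)
      = 1 / m * (-(phaseRate s / 4 * lyapunov m b s (f t))) := by field_simp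
  rw [e1, e2]
  refine mul_le_mul_of_nonneg_left ?_ (by positivity)
  have e3 : phaseRate s * G = phaseRate s * levelSq s 0 (f t) + phaseRate s * B := by rw [hGe, mul_add]
  linarith

lemma absolutelyContinuous_lyapunov (h : IsWeaklyCoupled m κ b hg s T f) :
    AbsolutelyContinuousOnInterval (fun t => lyapunov m b s (f t)) 0 T := by
  obtain ⟨ψ, hψ, -⟩ := h.exists_intBound_lyapunov
  obtain ⟨ψ₀, hψ₀⟩ := h.intBound_phaseEnergy.2
  choose ψ₁ hψ₁ using fun j => h.exists_intBound_neg_levelSq j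
  refine IntBound.absolutelyContinuous h.T_nonneg hψ ((hψ₀.add (IntBound.sum (Finset.range s) fun j _ =>
    (hψ₁ (j + 1)).const_mul (pow_nonneg (levelWeight_pos s m).le (j + 1)))).congr fun t _ => ?_)
  simp only [lyapunov, mul_neg, Finset.sum_neg_distrib]
  ring

lemma continuousOn_lyapunov (h : IsWeaklyCoupled m κ b hg s T f) :
    ContinuousOn (fun t => lyapunov m b s (f t)) (Icc 0 T) := by
  have := h.absolutelyContinuous_lyapunov.continuousOn
  rwa [uIcc_of_le h.T_nonneg] at this

lemma intBound_lyapunov (h : IsWeaklyCoupled m κ b hg s T f) :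
    IntBound T (fun t => lyapunov m b s (f t))
      fun t => -(phaseRate s / (4 * m)) * lyapunov m b s (f t) := by
  obtain ⟨ψ, hψ, hle⟩ := h.exists_intBound_lyapunov
  exact hψ.mono (h.continuousOn_lyapunov.integrableOn_Icc.const_mul _) (Eventually.of_forall hle)

lemma ae_deriv_lyapunov_le (h : IsWeaklyCoupled m κ b hg s T f) :
    ∀ᵐ t : ℝ, t ∈ Icc 0 T → DifferentiableAt ℝ (fun τ => lyapunov m b s (f τ)) t ∧
      deriv (fun τ => lyapunov m b s (f τ)) t + phaseRate s / (4 * m) * lyapunov m b s (f t) ≤ 0 := by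
  filter_upwards [h.absolutelyContinuous_lyapunov.ae_differentiableAt, Measure.ae_ne volume 0,
    Measure.ae_ne volume T] with t hd h0 hT ht
  have hd' := hd (by rwa [uIcc_of_le h.T_nonneg])
  exact ⟨hd', h.intBound_lyapunov.ae_deriv_le h.continuousOn_lyapunov
    ⟨lt_of_le_of_ne ht.1 h0.symm, lt_of_le_of_ne ht.2 hT⟩ hd'⟩

end IsWeaklyCoupled

/-- Under the smallness condition every solution is weakly coupled. -/
lemma IsSolution.isWeaklyCoupled (hm : 0 < m) (hb1 : 1 ≤ b) (hmb : 1 ≤ m * b) (hg : IsFreqDensity g)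
    {s : ℕ} (hs : 1 ≤ s)
    (hsmall : 16 * ((s : ℝ) + 1) * (2 * s + 3) * (forcingConst s * (κ / b) ^ 2) ≤ 1)
    {T : ℝ} (hT : 0 ≤ T) {F : Phase → ℝ} (hF : IsInitialDensity g F) {f : ℝ → L2}
    (hf : IsSolution m κ (m * b ^ 2) g F s T f) : IsWeaklyCoupled m κ b hg s T f := by
  obtain ⟨hcont, heqn, h0⟩ := hf
  have hmass : ∀ t ∈ Icc 0 T, coef b (0, 0) (toC (f t)) = 0 := fun t ht =>
    coef_zero_zero hm hg hs hcont heqn (coef_initial_density hm hg hF h0) ht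
  exact ⟨hm, hb1, hmb, hT, hs, hcont, heqn, hmass, fun t ht => norm_orderZ_le_one hm hg
    (negLp_density_eq_zero hm hg hs hcont heqn (negLp_initial_density hm hg hF h0) ht)
    (hmass t ht), hsmall⟩

end

/-- Through this bound the moment of g in the threshold yields σ ≥ m, that is b ≥ 1. -/
lemma IsFreqDensity.one_le_gNormSq {g : ℝ → ℝ} (hg : IsFreqDensity g)
    (hi : Integrable fun ν => (1 + ν ^ 2) * g ν) : 1 ≤ gNormSq g := by
  refine hg.integral_eq_one.symm.le.trans (integral_mono hg.integrable hi fun ν => ?_)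
  have := mul_nonneg (sq_nonneg ν) (hg.nonneg ν)
  simp only
  linarith

/-- The threshold for the noise strength. -/
def noiseConst (s : ℕ) : ℝ := 16 * ((s : ℝ) + 1) * (2 * s + 3) * forcingConst s

lemma one_le_noiseConst (s : ℕ) : 1 ≤ noiseConst s := by
  have h1 := one_le_forcingConst s
  have h2 : (0 : ℝ) ≤ s := s.cast_nonneg
  have h3 : (1 : ℝ) ≤ 16 * ((s : ℝ) + 1) * (2 * s + 3) := by nlinarith
  exact one_le_mul_of_one_le_of_one_le h3 h1

/-- The equivalence constant of the Lyapunov functional. -/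
def equivConst (s : ℕ) (m : ℝ) : ℝ := 2 / levelWeight s m ^ s + 4 * m / phaseRate s

lemma two_le_equivConst {m : ℝ} (hm : 0 < m) (s : ℕ) : 2 ≤ equivConst s m := by
  have h1 := levelWeight_pos s m
  have h2 := phaseRate_pos s
  have h3 : levelWeight s m ^ s ≤ 1 := pow_le_one₀ h1.le (levelWeight_le_one s m)
  have h4 : 2 ≤ 2 / levelWeight s m ^ s := by
    rw [le_div_iff₀ (by positivity)]
    linarith
  have : 0 ≤ 4 * m / phaseRate s := by positivity
  unfold equivConst
  linarith

/-- The constant is the sum of the one for the equivalence of norms and the one for the dissipation,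
so that it serves in all three inequalities. -/
lemma lyapunov_equiv {m b : ℝ} [Fact (0 < b)] (hm : 0 < m) (hmb : 1 ≤ m * b) (s : ℕ) (u : L2) :
    (equivConst s m)⁻¹ * hNormSq s u ≤ lyapunov m b s u ∧
      lyapunov m b s u ≤ equivConst s m * hNormSq s u ∧
      lyapunov m b s u ≤ equivConst s m * (phaseRate s / (4 * m) * lyapunov m b s u) := by
  have hα := levelWeight_pos s m
  have hα1 := levelWeight_le_one s m
  have hγ := phaseRate_pos s
  have hc2 := two_le_equivConst hm s
  have hG0 := weightedSq_nonneg hα.le s u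
  have hGle := weightedSq_le_hNormSq hα.le hα1 s u
  have hleG := pow_mul_hNormSq_le_weightedSq hα.le hα1 s u
  have hH0 : 0 ≤ hNormSq s u := hG0.trans hGle
  have hE0 : 0 ≤ lyapunov m b s u := le_trans (by positivity) (le_lyapunov hmb s u)
  refine ⟨?_, ?_, ?_⟩
  · refine le_trans ?_ (le_lyapunov hmb s u)
    have h1 : (equivConst s m)⁻¹ ≤ 1 / 2 * levelWeight s m ^ s := by
      have h2 : 1 / 2 * levelWeight s m ^ s = (2 / levelWeight s m ^ s)⁻¹ := by
        rw [inv_div]; ring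
      rw [h2]
      refine inv_anti₀ (by positivity) ?_
      have : 0 ≤ 4 * m / phaseRate s := by positivity
      unfold equivConst
      linarith
    calc _ ≤ 1 / 2 * levelWeight s m ^ s * hNormSq s u := mul_le_mul_of_nonneg_right h1 hH0
      _ = 1 / 2 * (levelWeight s m ^ s * hNormSq s u) := by ring
      _ ≤ _ := mul_le_mul_of_nonneg_left hleG (by norm_num)
  · exact (lyapunov_le hmb s u).trans (mul_le_mul hc2 hGle hG0 (by linarith))
  · rw [← mul_assoc]
    refine le_mul_of_one_le_left hE0 ?_
    have h1 : 4 * m / phaseRate s ≤ equivConst s m := by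
      have : 0 ≤ 2 / levelWeight s m ^ s := by positivity
      unfold equivConst
      linarith
    calc (1 : ℝ) = 4 * m / phaseRate s * (phaseRate s / (4 * m)) := by field_simp
      _ ≤ _ := mul_le_mul_of_nonneg_right h1 (by positivity)

lemma sqrt_le_of_le_exp {c lam t x y : ℝ} (hc : 0 < c)
    (h : c⁻¹ * x ≤ c * y * Real.exp (-lam * t)) :
    Real.sqrt x ≤ c * Real.exp (-(lam / 2) * t) * Real.sqrt y := by
  have h1 : x ≤ (c * Real.exp (-(lam / 2) * t)) ^ 2 * y := by
    have h2 := mul_le_mul_of_nonneg_left h hc.le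
    rw [mul_inv_cancel_left₀ hc.ne'] at h2
    rw [mul_pow, ← Real.exp_nat_mul]
    refine h2.trans (le_of_eq ?_)
    rw [show ((2 : ℕ) : ℝ) * (-(lam / 2) * t) = -lam * t by push_cast; ring]
    ring
  refine (Real.sqrt_le_sqrt h1).trans (le_of_eq ?_)
  rw [Real.sqrt_mul (by positivity), Real.sqrt_sq (by positivity)]

/-- The noise condition in terms of the thermal width `b = √(σ / m)`. -/
lemma noise_conditions {s : ℕ} {m κ σ N : ℝ} (hm : 0 < m) (hN : 1 ≤ N)
    (hσ : σ > noiseConst s * max (max (m * κ ^ 2) κ) (max (1 / m) (m * N))) :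
    0 < Real.sqrt (σ / m) ∧ m * Real.sqrt (σ / m) ^ 2 = σ ∧ 1 ≤ Real.sqrt (σ / m) ∧
      1 ≤ m * Real.sqrt (σ / m) ∧
      16 * ((s : ℝ) + 1) * (2 * s + 3) * (forcingConst s * (κ / Real.sqrt (σ / m)) ^ 2) ≤ 1 := by
  have hC := one_le_noiseConst s
  have hC0 : 0 ≤ noiseConst s := by linarith
  have h1 : noiseConst s * (m * κ ^ 2) ≤ σ := (mul_le_mul_of_nonneg_left
    ((le_max_left _ _).trans (le_max_left _ _)) hC0).trans hσ.le
  have hmono : ∀ {y : ℝ}, 0 ≤ y → y ≤ max (max (m * κ ^ 2) κ) (max (1 / m) (m * N)) → y ≤ σ :=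
    fun hy hle => (le_mul_of_one_le_left hy hC).trans ((mul_le_mul_of_nonneg_left hle hC0).trans hσ.le)
  have h2 : 1 / m ≤ σ := hmono (by positivity) ((le_max_left _ _).trans (le_max_right _ _))
  -- This gives b ≥ 1, while 1/m ≤ σ gives mb ≥ 1.
  have h3 : m ≤ σ := (le_mul_of_one_le_right hm.le hN).trans
    (hmono (by positivity) ((le_max_right _ _).trans (le_max_right _ _)))
  have hσ0 : 0 < σ := hm.trans_le h3
  have hb2 : Real.sqrt (σ / m) ^ 2 = σ / m := Real.sq_sqrt (by positivity)
  have hb0 : 0 < Real.sqrt (σ / m) := Real.sqrt_pos.2 (by positivity)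
  refine ⟨hb0, ?_, ?_, ?_, ?_⟩
  · rw [hb2]; field_simp
  · rw [Real.one_le_sqrt, le_div_iff₀ hm]; linarith
  · refine le_of_sq_le_sq ?_ (by positivity)
    rw [mul_pow, hb2, one_pow]
    rw [div_le_iff₀ hm] at h2
    calc (1 : ℝ) ≤ σ * m := h2
      _ = _ := by field_simp
  -- As (κ/b)² = mκ²/σ, the smallness condition is the bound of mκ² by σ divided by `noiseConst s`.
  · have e : 16 * ((s : ℝ) + 1) * (2 * s + 3) * (forcingConst s * (κ / Real.sqrt (σ / m)) ^ 2)
        = noiseConst s * (m * κ ^ 2) / σ := by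
      rw [div_pow, hb2, noiseConst]
      field_simp
    rw [e, div_le_one hσ0]
    exact h1

end KuramotoSakaguchi
end

/-! ### Assembly of the proposition. -/

theorem proposition5p2 (s : ℕ) (hs : 1 ≤ s) :
    ∃ C : ℝ, 0 < C ∧ ∀ m : ℝ, 0 < m →
      ∃ c K lam : ℝ, 0 < c ∧ 0 < K ∧ 0 < lam ∧
        ∀ (κ σ : ℝ) (g : ℝ → ℝ), 0 ≤ κ →
          Measurable g → (∀ ν, 0 ≤ g ν) → ∫ ν, g ν = 1 →
          MeasureTheory.Integrable (fun ν => (1 + ν ^ 2) * g ν) →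
          σ > C * max (max (m * κ ^ 2) κ) (max (1 / m) (m * gNormSq g)) →
          ∃ E D : L2 → ℝ,
            ∀ (T : ℝ) (F : Phase → ℝ) (f : ℝ → L2), 0 < T →
              IsInitialDensity g F → IsSolution m κ σ g F s T f →
                AbsolutelyContinuousOnInterval (fun t => E (f t)) 0 T ∧
                (∀ᵐ t : ℝ, t ∈ Set.Icc 0 T →
                  DifferentiableAt ℝ (fun τ => E (f τ)) t ∧
                    deriv (fun τ => E (f τ)) t + D (f t) ≤ 0) ∧
                (∀ t ∈ Set.Icc 0 T,
                  c⁻¹ * hNormSq s (f t) ≤ E (f t) ∧ E (f t) ≤ c * hNormSq s (f t) ∧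
                    E (f t) ≤ c * D (f t)) ∧
                ∀ t ∈ Set.Icc 0 T,
                  hNorm s (f t) ≤ K * Real.exp (-lam * t) * hNorm s (f 0) := by
  -- The rate is halved because the norm is the square root of what the functional controls. The
  -- comparison at both ends gives K equal to the equivalence constant.
  refine ⟨noiseConst s, by linarith [one_le_noiseConst s], fun m hm =>
    ⟨equivConst s m, equivConst s m, phaseRate s / (4 * m) / 2, by linarith [two_le_equivConst hm s],
      by linarith [two_le_equivConst hm s], by have := phaseRate_pos s; positivity, ?_⟩⟩
  intro κ σ g _ hgm hg0 hg1 hgi hσ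
  have hg : IsFreqDensity g := ⟨hgm, hg0, hg1⟩
  obtain ⟨hb0, hbσ, hb1, hmb, hsmall⟩ := noise_conditions hm (hg.one_le_gNormSq hgi) hσ
  set b := Real.sqrt (σ / m)
  have : Fact (0 < b) := ⟨hb0⟩
  -- The dissipation functional is simply the multiple of the Lyapunov functional by which it
  -- decays.
  refine ⟨lyapunov m b s, fun u => phaseRate s / (4 * m) * lyapunov m b s u, fun T F f hT hF hf => ?_⟩
  rw [← hbσ] at hf
  have h := hf.isWeaklyCoupled hm hb1 hmb hg hs hsmall hT.le hF
  refine ⟨h.absolutelyContinuous_lyapunov, h.ae_deriv_lyapunov_le,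
    fun t _ => lyapunov_equiv hm hmb s (f t), fun t ht => ?_⟩
  refine sqrt_le_of_le_exp (by linarith [two_le_equivConst hm s]) ?_
  refine (lyapunov_equiv (b := b) hm hmb s (f t)).1.trans
    ((h.intBound_lyapunov.exp_decay h.continuousOn_lyapunov ht).trans ?_)
  exact mul_le_mul_of_nonneg_right (lyapunov_equiv hm hmb s (f 0)).2.1 (Real.exp_nonneg _)
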